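/- **Notation.** Let $\mathbb C_+=\{z\in\mathbb C:\operatorname{Re} z>0\}$, $w_1,w_2\in\mathbb C_+$, $w=(w_1+w_2)/2$. The hyperbolic gamma function $G(z)=G(w_1,w_2;z)$ is the meromorphic function on $\mathbb C$ given for $|\operatorname{Im} z|<\operatorname{Re} w$ by $$G(z)=\exp\Big(i\int_0^\infty\Big(\frac{\sin(2yz)}{2\sinh(w_1y)\sinh(w_2y)}-\frac{z}{w_1w_2y}\Big)\frac{dy}{y}\Big)$$ and continued by $G(z+iw_1/2)=2\cosh(\pi z/w_2)\,G(z-iw_1/2)$. Write $G(a\pm b)=G(a+b)G(a-b)$. For $\gamma=(\gamma_0,\gamma_1,\gamma_2,\gamma_3)\in\mathbb C^4$ let $\hat\gamma$ be given by $$\hat\gamma_0=\tfrac12(\gamma_0+\gamma_1+\gamma_2+\gamma_3),\quad \hat\gamma_1=\tfrac12(\gamma_0+\gamma_1-\gamma_2-\gamma_3),\quad \hat\gamma_2=\tfrac12(\gamma_0-\gamma_1+\gamma_2-\gamma_3),\quad \hat\gamma_3=\tfrac12(\gamma_0-\gamma_1-\gamma_2+\gamma_3),$$ and define $\rho,\sigma,\tau,\upsilon$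 by $\gamma_0=-\rho+\sigma$, $\gamma_1=\rho+\sigma$, $\gamma_2=-\tau-\upsilon$, $\gamma_3=\tau-\upsilon$. For $w_1,w_2>0$ and $|\operatorname{Im} x|<\zeta:=\frac w2-\max(|\operatorname{Re}\rho|,|\operatorname{Re}\sigma|,|\operatorname{Re}\tau|,|\operatorname{Re}\upsilon|)-\frac12|\operatorname{Im}\lambda|$ let $$\psi(\gamma;x,\lambda)=\int_{\mathbb R}H(z+x+iw)\,\overline{F(z)}\,dz,\qquad H(z)=\frac{G(z+\frac\lambda2-\frac{3iw}2\pm i\tau)}{G(z-\frac\lambda2-\frac{iw}2\pm i\rho)},\quad F(z)=\frac{G(z+\frac{\bar\lambda}2-\frac{iw}2\pm i\bar\upsilon)}{G(z-\frac{\bar\lambda}2+\frac{iw}2\pm i\bar\sigma)},$$ and denote by $\psi$ also its meromorphic continuation to $\mathcal O=\{(w_1,w_2,\gamma,x,\lambda)\in\mathbb C_+^2\times\mathbb C^4\times\mathbb C\times\mathbb C\}$. Put $$\Delta(\gamma;x)=\frac{G(x+i\gamma_2)G(x+i\gamma_3)}{G(x-i\gamma_0)G(x-i\gamma_1)},\quad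 N(\gamma)=\prod_{j=1}^3G(i\gamma_0+i\gamma_j+iw),\quad S(\gamma;x,\lambda)=\frac{N(\gamma)\,\psi(\gamma;x,\lambda)}{\sqrt{w_1w_2}\,\Delta(\gamma;x)\,\Delta(\hat\gamma;\lambda)}$$ (principal branch of the square root). Let $$A(w_1,w_2,\gamma;x)=\frac{\prod_{j=0}^3\big(1-e^{2\pi(iw+i\gamma_j+x)/w_2}\big)}{(1-e^{4\pi x/w_2})(1-e^{4\pi(x+iw)/w_2})},$$ $$\mathcal L_\gamma^xf(x)=A(w_1,w_2,\gamma;x)\big(f(x+iw_1)-f(x)\big)+A(w_1,w_2,\gamma;-x)\big(f(x-iw_1)-f(x)\big),$$ let $\widetilde{\mathcal L}_\gamma^x$ be $\mathcal L_\gamma^x$ with $w_1$ and $w_2$ interchanged, and let $$v(\lambda;w_1,w_2,\gamma)=-2e^{\pi iw_1/w_2+2\pi i\hat\gamma_0/w_2}\big(\cosh(2\pi\lambda/w_2)+\cosh(\pi iw_1/w_2+2\pi i\hat\gamma_0/w_2)\big).$$ **Corollary 6.6.** The meromorphic continuation $\psi$ to $\mathcal O$ exists, and $S$ is a meromorphic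 function on $\mathcal O$, not identically zero, which is a simultaneous eigenfunction of the four Askey–Wilson operators $\mathcal L_\gamma^x$, $\widetilde{\mathcal L}_\gamma^x$, $\mathcal L_{\hat\gamma}^\lambda$, $\widetilde{\mathcal L}_{\hat\gamma}^\lambda$: $$\mathcal L_\gamma^xS=v(\lambda;w_1,w_2,\gamma)\,S,\qquad \widetilde{\mathcal L}_\gamma^xS=v(\lambda;w_2,w_1,\gamma)\,S,$$ $$\mathcal L_{\hat\gamma}^\lambda S=v(x;w_1,w_2,\hat\gamma)\,S,\qquad \widetilde{\mathcal L}_{\hat\gamma}^\lambda S=v(x;w_2,w_1,\hat\gamma)\,S,$$ as identities of meromorphic functions on $\mathcal O$; that is, each holds at every point of $\mathcal O$ at which the denominators of the two coefficients of the operator do not vanish and at which, as well as at its two translates that occur in the operator, $S$ is analytic. -/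

import Mathlib

noncomputable section

namespace AskeyWilson

open Complex Topology
open scoped ComplexConjugate

/-! ### The hyperbolic gamma function -/

/-- The arithmetic mean `w = (w₁ + w₂) / 2` of the two periods. -/
def wMean (w₁ w₂ : ℂ) : ℂ := (w₁ + w₂) / 2

/-- The integral `g(w₁, w₂; z)`, convergent for `|Im z| < Re w`. -/
def gInt (w₁ w₂ z : ℂ) : ℂ :=
  ∫ y in Set.Ioi (0 : ℝ),
    (sin (2 * y * z) / (2 * sinh (w₁ * y) * sinh (w₂ * y)) - z / (w₁ * w₂ * y)) / y

/-- The hyperbolic gamma function on the strip `|Im z| < Re w`. -/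
def gammaStrip (w₁ w₂ z : ℂ) : ℂ := exp (I * gInt w₁ w₂ z)

/-- The hyperbolic gamma function `G(w₁, w₂; z)` on the whole plane, `w₁, w₂` in the right
half-plane. The point `z` is moved to `z₀ = z - i n w₁` with `|Im z₀| ≤ Re w₁ / 2`, inside the
strip, and the value is carried back by
`G(z + i w₁ / 2) = 2 cosh (π z / w₂) G(z - i w₁ / 2)`. One of the two products is empty;
at a pole of `G` the value is `0`. -/
def hypG (w₁ w₂ z : ℂ) : ℂ :=
  let n : ℤ := round (z.im / w₁.re)
  let z₀ : ℂ := z - I * n * w₁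
  gammaStrip w₁ w₂ z₀
    * (∏ k ∈ Finset.range n.toNat, 2 * cosh (Real.pi * (z₀ + I * (k + 1 / 2) * w₁) / w₂))
    / (∏ k ∈ Finset.range (-n).toNat, 2 * cosh (Real.pi * (z₀ - I * (k + 1 / 2) * w₁) / w₂))

/-- `G(a ± b) = G(a + b) G(a - b)`. -/
def hypGpm (w₁ w₂ a b : ℂ) : ℂ := hypG w₁ w₂ (a + b) * hypG w₁ w₂ (a - b)

/-! ### Parameters -/

/-- The dual parameters `γ̂`. -/
def dual (γ : Fin 4 → ℂ) : Fin 4 → ℂ :=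
  ![(γ 0 + γ 1 + γ 2 + γ 3) / 2, (γ 0 + γ 1 - γ 2 - γ 3) / 2,
    (γ 0 - γ 1 + γ 2 - γ 3) / 2, (γ 0 - γ 1 - γ 2 + γ 3) / 2]

/-! The parameters `ρ, σ, τ, υ` with `γ₀ = -ρ + σ`, `γ₁ = ρ + σ`, `γ₂ = -τ - υ`,
`γ₃ = τ - υ`. -/

def rho (γ : Fin 4 → ℂ) : ℂ := (γ 1 - γ 0) / 2
def sigma (γ : Fin 4 → ℂ) : ℂ := (γ 0 + γ 1) / 2
def tau (γ : Fin 4 → ℂ) : ℂ := (γ 3 - γ 2) / 2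
def upsilon (γ : Fin 4 → ℂ) : ℂ := -(γ 2 + γ 3) / 2

theorem gamma_eq (γ : Fin 4 → ℂ) :
    γ = ![-rho γ + sigma γ, rho γ + sigma γ, -tau γ - upsilon γ, tau γ - upsilon γ] := by
  funext j
  fin_cases j <;> simp [rho, sigma, tau, upsilon] <;> ring

/-- `ξ = max (|Re ρ|, |Re σ|, |Re τ|, |Re υ|)`. -/
def xi (γ : Fin 4 → ℂ) : ℝ :=
  max (max |(rho γ).re| |(sigma γ).re|) (max |(tau γ).re| |(upsilon γ).re|)

/-- `ζ = w / 2 - ξ - |Im (λ / 2)|`, for positive real periods. -/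
def zeta (w₁ w₂ : ℝ) (γ : Fin 4 → ℂ) (lam : ℂ) : ℝ :=
  (w₁ + w₂) / 2 / 2 - xi γ - |(lam / 2).im|

/-! ### The formal matrix coefficient -/

/-- The joint eigenfunction `H^λ_{τ,ρ}` of the two twisted primitive elements. -/
def H (w₁ w₂ τ ρ lam z : ℂ) : ℂ :=
  hypGpm w₁ w₂ (z + lam / 2 - 3 * I * wMean w₁ w₂ / 2) (I * τ)
    / hypGpm w₁ w₂ (z - lam / 2 - I * wMean w₁ w₂ / 2) (I * ρ)

/-- The joint eigenfunction `F^λ_{υ,σ}` of the adjoints of the two twisted primitive elements. -/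
def F (w₁ w₂ υ σ lam z : ℂ) : ℂ :=
  hypGpm w₁ w₂ (z + conj lam / 2 - I * wMean w₁ w₂ / 2) (I * conj υ)
    / hypGpm w₁ w₂ (z - conj lam / 2 + I * wMean w₁ w₂ / 2) (I * conj σ)

/-- The action of `x̂` in the principal series, translation by `x + i w`. -/
def hatAct (w₁ w₂ x : ℂ) (f : ℂ → ℂ) (z : ℂ) : ℂ := f (z + (x + I * wMean w₁ w₂))

/-- The sesquilinear form `⟨f, g⟩ = ∫_ℝ f(z) conj (g(z)) dz`. -/
def pairing (f g : ℂ → ℂ) : ℂ := ∫ z : ℝ, f z * conj (g z)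

/-- The matrix coefficient `⟨π_λ(x̂) H^λ_{τ,ρ}, F^λ_{υ,σ}⟩`; meaningful for positive real periods
and `|Im x| < ζ`. -/
def matrixCoeff (w₁ w₂ : ℝ) (γ : Fin 4 → ℂ) (x lam : ℂ) : ℂ :=
  pairing (hatAct w₁ w₂ x (H w₁ w₂ (tau γ) (rho γ) lam)) (F w₁ w₂ (upsilon γ) (sigma γ) lam)

/-! ### Meromorphic functions of several variables and the continuation `ψ` -/

/-- `f` is meromorphic on `U`: near each point of `U` it is a quotient of two analytic functions,
the denominator not vanishing identically near the point. The values of `f` on the zero set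
of the local denominators are irrelevant. -/
def IsMeromorphicOn {V : Type*} [NormedAddCommGroup V] [NormedSpace ℂ V]
    (f : V → ℂ) (U : Set V) : Prop :=
  ∀ p ∈ U, ∃ a b : V → ℂ, AnalyticAt ℂ a p ∧ AnalyticAt ℂ b p ∧
    (∃ᶠ q in 𝓝 p, b q ≠ 0) ∧ ∀ᶠ q in 𝓝 p, b q ≠ 0 → f q = a q / b q

/-- The space of all `(w₁, w₂, γ, x, λ)`. -/
abbrev Param : Type := ℂ × ℂ × (Fin 4 → ℂ) × ℂ × ℂ

/-- The domain `𝒪`: both periods have positive real part. -/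
def domain : Set Param := {p | 0 < p.1.re ∧ 0 < p.2.1.re}

/-- A function of `w₁, w₂, γ, x, λ` as a function on the parameter space. -/
def joint (f : ℂ → ℂ → (Fin 4 → ℂ) → ℂ → ℂ → ℂ) (p : Param) : ℂ :=
  f p.1 p.2.1 p.2.2.1 p.2.2.2.1 p.2.2.2.2

/-- `ψ` is a meromorphic continuation of the matrix coefficient to `𝒪`. -/
def IsContinuation (ψ : ℂ → ℂ → (Fin 4 → ℂ) → ℂ → ℂ → ℂ) : Prop :=
  IsMeromorphicOn (joint ψ) domain ∧
    ∀ (w₁ w₂ : ℝ) (γ : Fin 4 → ℂ) (x lam : ℂ), 0 < w₁ → 0 < w₂ →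
      |x.im| < zeta w₁ w₂ γ lam → ψ w₁ w₂ γ x lam = matrixCoeff w₁ w₂ γ x lam

/-! ### The renormalization `S` -/

/-- `Δ(γ; x)`. -/
def Delta (w₁ w₂ : ℂ) (γ : Fin 4 → ℂ) (x : ℂ) : ℂ :=
  hypG w₁ w₂ (x + I * γ 2) * hypG w₁ w₂ (x + I * γ 3)
    / (hypG w₁ w₂ (x - I * γ 0) * hypG w₁ w₂ (x - I * γ 1))

/-- The normalization constant `N(γ)`. -/
def normConst (w₁ w₂ : ℂ) (γ : Fin 4 → ℂ) : ℂ :=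
  hypG w₁ w₂ (I * γ 0 + I * γ 1 + I * wMean w₁ w₂)
    * hypG w₁ w₂ (I * γ 0 + I * γ 2 + I * wMean w₁ w₂)
    * hypG w₁ w₂ (I * γ 0 + I * γ 3 + I * wMean w₁ w₂)

/-- The function `S(γ; x, λ) = N(γ) ψ(γ; x, λ) / (√(w₁ w₂) Δ(γ; x) Δ(γ̂; λ))`
(principal branch of the square root). -/
def S (ψ : ℂ → ℂ → (Fin 4 → ℂ) → ℂ → ℂ → ℂ) (w₁ w₂ : ℂ) (γ : Fin 4 → ℂ) (x lam : ℂ) : ℂ :=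
  normConst w₁ w₂ γ * ψ w₁ w₂ γ x lam
    / ((w₁ * w₂) ^ (1 / 2 : ℂ) * Delta w₁ w₂ γ x * Delta w₁ w₂ (dual γ) lam)

/-! ### The Askey-Wilson operator -/

/-- The denominator of the coefficient `A(w₁, w₂, γ; x)`. -/
def coeffDenom (w₁ w₂ x : ℂ) : ℂ :=
  (1 - exp (4 * Real.pi * x / w₂)) * (1 - exp (4 * Real.pi * (x + I * wMean w₁ w₂) / w₂))

/-- The coefficient `A(w₁, w₂, γ; x)`. -/
def coeffA (w₁ w₂ : ℂ) (γ : Fin 4 → ℂ) (x : ℂ) : ℂ :=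
  (∏ j : Fin 4, (1 - exp (2 * Real.pi * (I * wMean w₁ w₂ + I * γ j + x) / w₂)))
    / coeffDenom w₁ w₂ x

/-- The Askey-Wilson second order difference operator, with step `i w₁`. The operator with the
tilde is obtained by interchanging `w₁` and `w₂`. -/
def awOp (w₁ w₂ : ℂ) (γ : Fin 4 → ℂ) (f : ℂ → ℂ) (x : ℂ) : ℂ :=
  coeffA w₁ w₂ γ x * (f (x + I * w₁) - f x) + coeffA w₁ w₂ γ (-x) * (f (x - I * w₁) - f x)

/-- The eigenvalue `v(w₁, w₂, γ; λ)`. -/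
def eigenvalue (w₁ w₂ : ℂ) (γ : Fin 4 → ℂ) (lam : ℂ) : ℂ :=
  -2 * exp (Real.pi * I * w₁ / w₂ + 2 * Real.pi * I * dual γ 0 / w₂)
    * (cosh (2 * Real.pi * lam / w₂)
      + cosh (Real.pi * I * w₁ / w₂ + 2 * Real.pi * I * dual γ 0 / w₂))

/-! In the next two definitions the operator has periods `(u₁, u₂)`, to be taken as `(w₁, w₂)` or
`(w₂, w₁)`, and the eigenvalue equation is asserted at `(w₁, w₂, γ, x, λ)` provided that the
coefficients of the operator have no vanishing denominator there and that `f` is analytic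
(jointly in all variables) at the three points of the parameter space involved. For `f`
meromorphic on `𝒪` such points form a dense open subset of `𝒪`, so that the assertion for all points
is the identity of meromorphic functions on `𝒪`. -/

/-- The operator with parameters `γ` in the variable `x`, with eigenvalue `v(u₁, u₂, γ; λ)`. -/
def EigenX (f : ℂ → ℂ → (Fin 4 → ℂ) → ℂ → ℂ → ℂ) (u₁ u₂ w₁ w₂ : ℂ) (γ : Fin 4 → ℂ)
    (x lam : ℂ) : Prop :=
  coeffDenom u₁ u₂ x ≠ 0 → coeffDenom u₁ u₂ (-x) ≠ 0 →
  AnalyticAt ℂ (joint f) (w₁, w₂, γ, x, lam) →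
  AnalyticAt ℂ (joint f) (w₁, w₂, γ, x + I * u₁, lam) →
  AnalyticAt ℂ (joint f) (w₁, w₂, γ, x - I * u₁, lam) →
    awOp u₁ u₂ γ (fun y => f w₁ w₂ γ y lam) x = eigenvalue u₁ u₂ γ lam * f w₁ w₂ γ x lam

/-- The operator with parameters `γ̂` in the variable `λ`, with eigenvalue `v(u₁, u₂, γ̂; x)`. -/
def EigenLam (f : ℂ → ℂ → (Fin 4 → ℂ) → ℂ → ℂ → ℂ) (u₁ u₂ w₁ w₂ : ℂ) (γ : Fin 4 → ℂ)
    (x lam : ℂ) : Prop :=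
  coeffDenom u₁ u₂ lam ≠ 0 → coeffDenom u₁ u₂ (-lam) ≠ 0 →
  AnalyticAt ℂ (joint f) (w₁, w₂, γ, x, lam) →
  AnalyticAt ℂ (joint f) (w₁, w₂, γ, x, lam + I * u₁) →
  AnalyticAt ℂ (joint f) (w₁, w₂, γ, x, lam - I * u₁) →
    awOp u₁ u₂ (dual γ) (fun y => f w₁ w₂ γ x y) lam
      = eigenvalue u₁ u₂ (dual γ) x * f w₁ w₂ γ x lam

end AskeyWilson

end

namespace AskeyWilson

open MeasureTheory Filter Topology Metric

/-! ### Holomorphic functions of several variables -/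

section SeveralVariables

variable {E : Type} [NormedAddCommGroup E] [NormedSpace ℂ E]
  {F : Type} [NormedAddCommGroup F] [NormedSpace ℂ F]

/-! For real periods the rules `G(-z) = 1/G(z)` and `conj G(z) = G(-conj z)` turn the matrix
coefficient into `∫ ∏ G(z + a_j) ∏ G(-z + b_j) dz` over the real line, with four factors of each
kind, whose shifts are linear in the parameters and satisfy `∑ (a_j + b_j) = -4iw`
(`matrixCoeff_eq`). Everything about `ψ` is read off from this integral, which makes sense for
complex periods as well.

Two facts about `G` are needed. The difference equation on the strip comes from evaluating `∫
sin(2yz) / sinh(wy) dy` (`exp_neg_lamInt`, `gammaStrip_shift`). The asymptotics state that `G(z)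
exp(iπz²/(2w₁w₂))` varies slowly as `Re z → ∞` (`exists_hypG_ratio`). In the integrand the factors
pair up as quotients `G(z + a_j) / G(z - b_j)`, the Gaussians cancel to a linear exponent, and there
is exponential decay at every rate below `2π Re(1/w₁ + 1/w₂)`, locally uniformly in the parameters
(`exists_decay`).

Continuation: on a bounded piece of the domain only finitely many poles of the integrand matter, one
family starting below the contour and one above. After division by the corresponding linear factors,
the identity `(β - α)/((z - α)(z - β)) = 1/(z - β) - 1/(z - α)` removes poles one at a time until
only one family is left; then the contour can be moved beyond the reach of that family. Hence the
integral times the product of all differences `β - α` is analytic on the piece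
(`DecayingFamily.exists_continuation`), and the resulting quotients glue
(`exists_global_continuation`).

Difference equation: when the periods are real, `w₂ ≥ 16 w₁`, and all arguments have imaginary part
near `-w/2`, the arguments shifted by `±iw₁` stay in the strip. There a suitable combination of the
integrands at `x + iw₁`, `x`, `x - iw₁` equals `T(z + iw₁) - T(z)` up to a constant, where `T` is a
product of gamma functions times a Laurent polynomial with three terms in `exp(2πz/w₂)`. The
coefficients are given by an explicit rational certificate (`exists_certificate`,
`exists_telescoper`). Cauchy's theorem kills the integral of the right side, and division by `Δ`
turns the relation into the Askey–Wilson equation (`coeffA_mul_Delta`, `Moderate.awOp_eq`). The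
equations in `λ` follow because the translation `z ↦ z + (x - λ)/2` exchanges `(γ, x)` with `(γ̂,
λ)` in the integrand (`coeffIntegrand_dual`); the equations with the periods interchanged follow
from the symmetry of `G` in its periods.

Each equation thus holds for real periods near one base point. The two sides are meromorphic on the
convex set `domain`, so the identity theorem, used first in the periods and then along the domain,
gives the equation off an analytic set near every point, and continuity gives it where it is
asserted (`eigen_identity`). That `S` is not identically zero is seen at equal periods, where for
vanishing `γ`, `x`, `λ` the integrand is positive. -/

theorem norm_fderiv_le_of_ball {f : E → F} {x : E} {r M : ℝ} (hr : 0 < r)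
    (hf : DifferentiableOn ℂ f (ball x r)) (hM : ∀ y ∈ ball x r, ‖f y‖ ≤ M) :
    ‖fderiv ℂ f x‖ ≤ M / r := by
  have hM0 : 0 ≤ M := (norm_nonneg _).trans (hM x (mem_ball_self hr))
  refine ContinuousLinearMap.opNorm_le_bound _ (by positivity) fun v => ?_
  by_cases hv : v = 0
  · simp [hv]
  have hv' : 0 < ‖v‖ := norm_pos_iff.2 hv
  -- Cauchy's estimate on the disc of radius `s` in the complex line through `x` with direction `v`.
  -- The closed disc has to stay in the open ball, so `s = r / ‖v‖` is reached only in the limit.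
  have key : ∀ s : ℝ, 0 < s → s < r / ‖v‖ → ‖fderiv ℂ f x v‖ ≤ M / s := by
    intro s hs hs'
    have hsub : ∀ t ∈ closedBall (0 : ℂ) s, x + t • v ∈ ball x r := by
      intro t ht
      rw [mem_closedBall_zero_iff] at ht
      rw [mem_ball_iff_norm, add_sub_cancel_left, norm_smul]
      calc ‖t‖ * ‖v‖ ≤ s * ‖v‖ := by gcongr
        _ < r := by rwa [lt_div_iff₀ hv'] at hs'
    have hd : ∀ t ∈ closedBall (0 : ℂ) s, HasDerivAt (fun t : ℂ => f (x + t • v))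
        (fderiv ℂ f (x + t • v) v) t := by
      intro t ht
      have h1 := (hf.differentiableAt (isOpen_ball.mem_nhds (hsub t ht))).hasFDerivAt
      have h2 : HasDerivAt (fun t : ℂ => x + t • v) v t := by
        simpa using ((hasDerivAt_id t).smul_const v).const_add x
      exact h1.comp_hasDerivAt t h2
    have h3 := Complex.norm_deriv_le_of_forall_mem_sphere_norm_le (c := 0) (R := s) (C := M)
      (f := fun t : ℂ => f (x + t • v)) hs
      (DifferentiableOn.diffContOnCl (by
        rw [closure_ball _ hs.ne']
        exact fun t ht => (hd t ht).differentiableAt.differentiableWithinAt))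
      (fun t ht => hM _ (hsub t (sphere_subset_closedBall ht)))
    rw [(hd 0 (by simp [hs.le])).deriv] at h3
    simpa using h3
  have hlim : Tendsto (fun s : ℝ => M / s) (𝓝[<] (r / ‖v‖)) (𝓝 (M / (r / ‖v‖))) := by
    refine (tendsto_const_nhds.div tendsto_id ?_).mono_left nhdsWithin_le_nhds
    positivity
  have : ‖fderiv ℂ f x v‖ ≤ M / (r / ‖v‖) := by
    refine ge_of_tendsto hlim ?_
    filter_upwards [Ioo_mem_nhdsLT (show 0 < r / ‖v‖ by positivity)] with s hs
    exact key s hs.1 hs.2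
  calc _ ≤ _ := this
    _ = _ := by field_simp


variable [CompleteSpace F] in
-- Cauchy's formula on the complex line `t ↦ x + t v`. Only values of `f` enter the right side, so
-- it can be differentiated once more in `x` under the integral sign.
theorem fderiv_apply_eq_integral {f : E → F} {x v : E} {U : Set E} (hU : IsOpen U)
    (hf : DifferentiableOn ℂ f U) (hv : ∀ t : ℂ, ‖t‖ ≤ 1 → x + t • v ∈ U) :
    fderiv ℂ f x v = (2 * Real.pi * Complex.I : ℂ)⁻¹ • ∫ θ in Set.Ioc 0 (2 * Real.pi),
      deriv (circleMap 0 1) θ • ((circleMap 0 1 θ - 0) ^ (-2 : ℤ) • f (x + circleMap 0 1 θ • v)) := by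
  have hd : ∀ t ∈ closedBall (0 : ℂ) 1, HasDerivAt (fun t : ℂ => f (x + t • v))
      (fderiv ℂ f (x + t • v) v) t := by
    intro t ht
    have h1 := (hf.differentiableAt (hU.mem_nhds (hv t (by simpa using ht)))).hasFDerivAt
    have h2 : HasDerivAt (fun t : ℂ => x + t • v) v t := by
      simpa using ((hasDerivAt_id t).smul_const v).const_add x
    exact h1.comp_hasDerivAt t h2
  have := DifferentiableOn.deriv_eq_smul_circleIntegral (f := fun t : ℂ => f (x + t • v))
    (c := 0) (R := 1) one_pos
    (fun t ht => (hd t ht).differentiableAt.differentiableWithinAt)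
  rw [(hd 0 (by simp)).deriv] at this
  rw [zero_smul, add_zero] at this
  rw [eq_inv_smul_iff₀ Complex.two_pi_I_ne_zero, ← this, circleIntegral,
    intervalIntegral.integral_of_le Real.two_pi_pos.le]
  simp only [one_div, zpow_neg, zpow_ofNat]

variable [FiniteDimensional ℂ E]

/-- Only values of `h` are assumed measurable and bounded. The directional derivatives are almost
everywhere limits of difference quotients, the full derivative is assembled from a basis, and
Cauchy's estimate on a ball of half the radius dominates it. -/
theorem hasFDerivAt_integral {α : Type} [MeasurableSpace α] {μ : Measure α}
    {h : α → E → F} {U : Set E} (hU : IsOpen U)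
    (hmeas : ∀ p ∈ U, AEStronglyMeasurable (fun a => h a p) μ) {p : E} (hp : p ∈ U)
    {r : ℝ} (hr : 0 < r) {bound : α → ℝ} (hbi : Integrable bound μ)
    (hb : ∀ᵐ a ∂μ, DifferentiableOn ℂ (h a) (ball p r) ∧ ∀ q ∈ ball p r, ‖h a q‖ ≤ bound a) :
    Integrable (fun a => fderiv ℂ (h a) p) μ ∧
      HasFDerivAt (fun p => ∫ a, h a p ∂μ) (∫ a, fderiv ℂ (h a) p ∂μ) p := by
  have hnhds : ∀ᶠ q in 𝓝 p, q ∈ U := hU.mem_nhds hp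
  have hd : ∀ᵐ a ∂μ, HasFDerivAt (h a) (fderiv ℂ (h a) p) p := by
    filter_upwards [hb] with a ha
    exact (ha.1.differentiableAt (isOpen_ball.mem_nhds (mem_ball_self hr))).hasFDerivAt
  have hv : ∀ v : E, AEStronglyMeasurable (fun a => fderiv ℂ (h a) p v) μ := by
    intro v
    obtain ⟨N, hN⟩ : ∃ N : ℕ, ∀ n : ℕ, N ≤ n → p + ((n : ℂ) + 1)⁻¹ • v ∈ U := by
      have : Tendsto (fun n : ℕ => p + ((n : ℂ) + 1)⁻¹ • v) atTop (𝓝 p) := by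
        have h1 : Tendsto (fun n : ℕ => ((n : ℂ) + 1)⁻¹) atTop (𝓝 0) := by
          simpa using tendsto_one_div_add_atTop_nhds_zero_nat (𝕜 := ℂ)
        simpa using (h1.smul_const v).const_add p
      exact eventually_atTop.1 (this.eventually hnhds)
    refine aestronglyMeasurable_of_tendsto_ae atTop
      (f := fun (n : ℕ) a => (((n + N : ℕ) : ℂ) + 1) •
        (h a (p + (((n + N : ℕ) : ℂ) + 1)⁻¹ • v) - h a p)) (fun n => ?_) ?_
    · exact ((hmeas _ (hN _ (Nat.le_add_left _ _))).sub (hmeas p hp)).const_smul _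
    · filter_upwards [hd] with a ha
      have h1 : Tendsto (fun n : ℕ => ‖(((n + N : ℕ) : ℂ) + 1)‖) atTop atTop := by
        have : ∀ n : ℕ, ‖(((n + N : ℕ) : ℂ) + 1)‖ = ((n + N : ℕ) : ℝ) + 1 := fun n => by
          rw [← Nat.cast_succ, Complex.norm_natCast]; push_cast; ring
        simp_rw [this]
        exact tendsto_atTop_add_const_right _ _
          (tendsto_natCast_atTop_atTop.comp (tendsto_add_atTop_nat N))
      have := ha.lim v h1
      simpa using this
  have hF' : AEStronglyMeasurable (fun a => fderiv ℂ (h a) p) μ := by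
    let b := Module.finBasis ℂ E
    have hrep : ∀ L : E →L[ℂ] F, L = ∑ i, (ContinuousLinearMap.smulRightL ℂ E F
        (LinearMap.toContinuousLinearMap (b.coord i))) (L (b i)) := by
      intro L
      ext x
      conv_lhs => rw [← b.sum_repr x, map_sum]
      simp
    have : (fun a => fderiv ℂ (h a) p) = fun a => ∑ i, (ContinuousLinearMap.smulRightL ℂ E F
        (LinearMap.toContinuousLinearMap (b.coord i))) (fderiv ℂ (h a) p (b i)) := by
      funext a; exact hrep _
    rw [this]
    refine Finset.aestronglyMeasurable_fun_sum _ fun i _ => ?_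
    exact (ContinuousLinearMap.continuous _).comp_aestronglyMeasurable (hv (b i))
  have hbd : ∀ᵐ a ∂μ, ∀ q ∈ ball p (r / 2), ‖fderiv ℂ (h a) q‖ ≤ bound a / (r / 2) := by
    filter_upwards [hb] with a ha q hq
    have hs : ball q (r / 2) ⊆ ball p r := ball_subset_ball' (by
      have := mem_ball.1 hq; linarith)
    exact norm_fderiv_le_of_ball (half_pos hr) (ha.1.mono hs) fun y hy => ha.2 y (hs hy)
  refine ⟨Integrable.mono' (hbi.div_const (r / 2)) hF'
    (hbd.mono fun a ha => ha p (mem_ball_self (half_pos hr))), ?_⟩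
  refine hasFDerivAt_integral_of_dominated_of_fderiv_le (F := fun q a => h a q)
    (F' := fun q a => fderiv ℂ (h a) q) (ball_mem_nhds p (half_pos hr))
    (hnhds.mono fun q hq => hmeas q hq) ?_ hF' hbd (hbi.div_const _) ?_
  · exact Integrable.mono' hbi (hmeas p hp) (hb.mono fun a ha => ha.2 p (mem_ball_self hr))
  · filter_upwards [hb] with a ha q hq
    have hs : q ∈ ball p r := ball_subset_ball (by linarith) hq
    exact (ha.1.differentiableAt (isOpen_ball.mem_nhds hs)).hasFDerivAt

theorem differentiableOn_integral {α : Type} [MeasurableSpace α] {μ : Measure α}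
    {h : α → E → F} {U : Set E} (hU : IsOpen U)
    (hmeas : ∀ p ∈ U, AEStronglyMeasurable (fun a => h a p) μ)
    (hloc : ∀ p ∈ U, ∃ r > 0, ∃ bound : α → ℝ, Integrable bound μ ∧
      ∀ᵐ a ∂μ, DifferentiableOn ℂ (h a) (ball p r) ∧ ∀ q ∈ ball p r, ‖h a q‖ ≤ bound a) :
    DifferentiableOn ℂ (fun p => ∫ a, h a p ∂μ) U := by
  intro p hp
  obtain ⟨r, hr, bound, hbi, hb⟩ := hloc p hp
  exact (hasFDerivAt_integral hU hmeas hp hr hbi hb).2.differentiableAt.differentiableWithinAt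

variable [CompleteSpace F]

/-- By Cauchy's formula `f'(y) b_i` is a circle integral of values of `f`, to which
`differentiableOn_integral` applies. The basis vector is scaled by a small `s` so that the unit
circle in its direction stays inside `U`. -/
theorem differentiableOn_fderiv {f : E → F} {U : Set E} (hU : IsOpen U)
    (hf : DifferentiableOn ℂ f U) : DifferentiableOn ℂ (fderiv ℂ f) U := by
  have hcont := hf.continuousOn
  let b := Module.finBasis ℂ E
  have hrep : fderiv ℂ f = fun x => ∑ i, (ContinuousLinearMap.smulRightL ℂ E F
      (LinearMap.toContinuousLinearMap (b.coord i))) (fderiv ℂ f x (b i)) := by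
    funext x
    ext y
    conv_lhs => rw [← b.sum_repr y, map_sum]
    simp
  rw [hrep]
  refine DifferentiableOn.fun_sum fun i _ => ?_
  refine (ContinuousLinearMap.differentiable _).comp_differentiableOn ?_
  intro x hx
  obtain ⟨r, hr, hrU⟩ := Metric.isOpen_iff.1 hU x hx
  obtain ⟨r', hr', M, hM⟩ : ∃ r' > 0, ∃ M, ∀ y ∈ ball x r', ‖f y‖ ≤ M := by
    have : ContinuousAt f x := (hcont x hx).continuousAt (hU.mem_nhds hx)
    obtain ⟨r', hr', h⟩ := Metric.eventually_nhds_iff_ball.1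
      (this.norm.eventually (eventually_le_nhds (lt_add_one ‖f x‖)))
    exact ⟨r', hr', _, h⟩
  obtain ⟨s, hs, hsr⟩ : ∃ s : ℝ, 0 < s ∧ s * ‖b i‖ < min r r' / 2 := by
    refine ⟨min r r' / 2 / (‖b i‖ + 1), by positivity, ?_⟩
    rw [div_mul_eq_mul_div, div_lt_iff₀ (by positivity)]
    have : 0 < min r r' / 2 := by positivity
    nlinarith [norm_nonneg (b i)]
  have hm : 0 < min r r' / 2 := by positivity
  have hball : ∀ y ∈ ball x (min r r' / 2), ∀ t : ℂ, ‖t‖ ≤ 1 →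
      y + t • ((s : ℂ) • b i) ∈ ball x (min r r') := by
    intro y hy t ht
    rw [mem_ball_iff_norm] at hy ⊢
    calc ‖y + t • ((s : ℂ) • b i) - x‖ = ‖(y - x) + t • ((s : ℂ) • b i)‖ := by congr 1; abel
      _ ≤ ‖y - x‖ + ‖t • ((s : ℂ) • b i)‖ := norm_add_le _ _
      _ ≤ ‖y - x‖ + 1 * (s * ‖b i‖) := by
        rw [norm_smul, norm_smul, Complex.norm_real, Real.norm_of_nonneg hs.le]; gcongr
      _ < min r r' := by linarith
  have hsubU : ball x (min r r') ⊆ U := (ball_subset_ball (min_le_left _ _)).trans hrU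
  have hscale : ∀ y, fderiv ℂ f y (b i) = (s : ℂ)⁻¹ • fderiv ℂ f y ((s : ℂ) • b i) := by
    intro y
    rw [map_smul, smul_smul, inv_mul_cancel₀ (by exact_mod_cast hs.ne'), one_smul]
  have hcm : ∀ θ, ‖circleMap 0 1 θ‖ = 1 := fun θ => by simp
  have main : DifferentiableOn ℂ (fun y => ∫ θ in Set.Ioc 0 (2 * Real.pi),
      deriv (circleMap 0 1) θ • ((circleMap 0 1 θ - 0) ^ (-2 : ℤ) •
        f (y + circleMap 0 1 θ • ((s : ℂ) • b i)))) (ball x (min r r' / 2)) := by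
    have hM0 : 0 ≤ M := (norm_nonneg _).trans (hM x (mem_ball_self hr'))
    refine differentiableOn_integral isOpen_ball (fun y hy => ?_) (fun y hy => ?_)
    · refine Continuous.aestronglyMeasurable ?_
      have hf' : Continuous fun θ : ℝ => f (y + circleMap 0 1 θ • ((s : ℂ) • b i)) :=
        (hcont.mono hsubU).comp_continuous
          (continuous_const.add ((continuous_circleMap 0 1).smul continuous_const))
          fun θ => hball y hy _ (hcm θ).le
      have h2 : Continuous fun θ => (circleMap 0 1 θ - 0) ^ (-2 : ℤ) := by
        refine ((continuous_circleMap 0 1).sub continuous_const).zpow₀ _ fun θ => Or.inl ?_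
        simp
      have h3 : Continuous (deriv (circleMap 0 1)) := by
        rw [show deriv (circleMap 0 1) = fun θ => circleMap 0 1 θ * Complex.I from
          funext fun θ => deriv_circleMap 0 1 θ]
        exact (continuous_circleMap 0 1).mul continuous_const
      exact h3.smul (h2.smul hf')
    · obtain ⟨ε, hε, hεy⟩ := Metric.isOpen_iff.1 isOpen_ball y hy
      refine ⟨ε, hε, fun _ => M, integrable_const _, Eventually.of_forall fun θ => ⟨?_, ?_⟩⟩
      · refine DifferentiableOn.const_smul (DifferentiableOn.const_smul ?_ _) _
        refine (hf.mono hsubU).comp ?_ fun q hq => hball q (hεy hq) _ (hcm θ).le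
        exact (differentiable_id.add_const _).differentiableOn
      · intro q hq
        have h1 := hM _ (ball_subset_ball (min_le_right _ _) (hball q (hεy hq) _ (hcm θ).le))
        rw [norm_smul, norm_smul, deriv_circleMap, norm_mul, norm_zpow, sub_zero, hcm,
          Complex.norm_I]
        simpa using h1
  have hev : ∀ y ∈ ball x (min r r' / 2), fderiv ℂ f y (b i) = (s : ℂ)⁻¹ •
      ((2 * Real.pi * Complex.I : ℂ)⁻¹ • ∫ θ in Set.Ioc 0 (2 * Real.pi),
      deriv (circleMap 0 1) θ • ((circleMap 0 1 θ - 0) ^ (-2 : ℤ) •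
        f (y + circleMap 0 1 θ • ((s : ℂ) • b i)))) := by
    intro y hy
    rw [hscale, fderiv_apply_eq_integral hU hf fun t ht => hsubU (hball y hy t ht)]
  have hxm : x ∈ ball x (min r r' / 2) := mem_ball_self hm
  have h4 : DifferentiableOn ℂ (fun y => fderiv ℂ f y (b i)) (ball x (min r r' / 2)) :=
    ((main.const_smul _).const_smul _).congr hev
  exact (h4.differentiableAt (isOpen_ball.mem_nhds hxm)).differentiableWithinAt

theorem contDiffOn_of_differentiableOn {U : Set E} (hU : IsOpen U) (n : ℕ) :
    ∀ {F : Type} [NormedAddCommGroup F] [NormedSpace ℂ F] [CompleteSpace F] {f : E → F},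
    DifferentiableOn ℂ f U → ContDiffOn ℂ n f U := by
  induction n with
  | zero => intro F _ _ _ f hf; exact contDiffOn_zero.2 hf.continuousOn
  | succ n ih =>
    intro F _ _ _ f hf
    rw [Nat.cast_succ, contDiffOn_succ_iff_fderiv_of_isOpen hU]
    exact ⟨hf, by simp, ih (differentiableOn_fderiv hU hf)⟩

/-- Each derivative costs a layer of thickness `δ` of the ball and, by Cauchy's estimate, a factor
`1 / δ`. -/
theorem norm_iteratedFDeriv_le_of_ball (n : ℕ) :
    ∀ {F : Type} [NormedAddCommGroup F] [NormedSpace ℂ F] [CompleteSpace F] {f : E → F} {x : E}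
      {R M δ : ℝ}, 0 < δ → DifferentiableOn ℂ f (ball x R) → (∀ y ∈ ball x R, ‖f y‖ ≤ M) →
      ∀ y ∈ ball x (R - n * δ), ‖iteratedFDeriv ℂ n f y‖ ≤ M / δ ^ n := by
  induction n with
  | zero => intro F _ _ _ f x R M δ hδ hf hM y hy; simpa using hM y (by simpa using hy)
  | succ n ih =>
    intro F _ _ _ f x R M δ hδ hf hM y hy
    have hsub : ∀ z ∈ ball x (R - δ), ball z δ ⊆ ball x R := fun z hz => ball_subset_ball' (by
      have := mem_ball.1 hz; linarith)
    have h1 : ∀ z ∈ ball x (R - δ), ‖fderiv ℂ f z‖ ≤ M / δ := fun z hz =>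
      norm_fderiv_le_of_ball hδ (hf.mono (hsub z hz)) fun w hw => hM w (hsub z hz hw)
    rw [← norm_iteratedFDeriv_fderiv]
    have := ih (f := fderiv ℂ f) (x := x) (R := R - δ) (M := M / δ) hδ
      ((differentiableOn_fderiv isOpen_ball hf).mono (ball_subset_ball (by linarith))) h1 y (by
        rw [show R - δ - n * δ = R - (n + 1 : ℕ) * δ by push_cast; ring]; exact hy)
    rwa [div_div, ← pow_succ'] at this

theorem iteratedDeriv_line {f : E → F} {U : Set E} (hU : IsOpen U) (hf : DifferentiableOn ℂ f U)
    (x y : E) (n : ℕ) : ∀ s : ℂ, x + s • y ∈ U →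
      iteratedDeriv n (fun s : ℂ => f (x + s • y)) s
        = iteratedFDeriv ℂ n f (x + s • y) fun _ => y := by
  induction n with
  | zero => intro s _; simp
  | succ n ih =>
    intro s hs
    have hopen : ∀ᶠ t in 𝓝 s, x + t • y ∈ U :=
      (by fun_prop : Continuous fun t : ℂ => x + t • y).continuousAt.eventually (hU.mem_nhds hs)
    rw [iteratedDeriv_succ, Filter.EventuallyEq.deriv_eq (hopen.mono fun t ht => ih t ht)]
    have hc : ContDiffAt ℂ (n + 1 : ℕ) f (x + s • y) :=
      (contDiffOn_of_differentiableOn hU (n + 1) hf).contDiffAt (hU.mem_nhds hs)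
    have h1 : HasFDerivAt (iteratedFDeriv ℂ n f) (fderiv ℂ (iteratedFDeriv ℂ n f) (x + s • y))
        (x + s • y) :=
      (hc.differentiableAt_iteratedFDeriv (by exact_mod_cast Nat.lt_succ_self n)).hasFDerivAt
    have h2 : HasDerivAt (fun t : ℂ => x + t • y) y s := by
      simpa using ((hasDerivAt_id s).smul_const y).const_add x
    have h3 := h1.comp_hasDerivAt s h2
    have h4 := ((ContinuousMultilinearMap.apply ℂ (fun _ : Fin n => E) F
      (fun _ => y)).hasFDerivAt.comp_hasDerivAt s h3).deriv
    rw [iteratedFDeriv_succ_apply_left]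
    exact h4

/-- A complex differentiable function on an open set of a finite-dimensional space is analytic. -/
theorem analyticAt_of_differentiableOn {f : E → F} {U : Set E} (hU : IsOpen U)
    (hf : DifferentiableOn ℂ f U) {x : E} (hx : x ∈ U) : AnalyticAt ℂ f x := by
  obtain ⟨R, hR, M, hRU, hM⟩ : ∃ R > 0, ∃ M, ball x R ⊆ U ∧ ∀ y ∈ ball x R, ‖f y‖ ≤ M := by
    obtain ⟨r, hr, hrU⟩ := Metric.isOpen_iff.1 hU x hx
    have : ContinuousAt f x := (hf.continuousOn x hx).continuousAt (hU.mem_nhds hx)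
    obtain ⟨r', hr', h⟩ := Metric.eventually_nhds_iff_ball.1
      (this.norm.eventually (eventually_le_nhds (lt_add_one ‖f x‖)))
    exact ⟨min r r', lt_min hr hr', _, (ball_subset_ball (min_le_left _ _)).trans hrU,
      fun y hy => h y (ball_subset_ball (min_le_right _ _) hy)⟩
  have hM0 : 0 ≤ M := (norm_nonneg _).trans (hM x (mem_ball_self hR))
  have hfb := hf.mono hRU
  let p : FormalMultilinearSeries ℂ E F := fun n => (n.factorial : ℂ)⁻¹ • iteratedFDeriv ℂ n f x
  -- The Cauchy estimates with `δ = R / (2(n + 1))` give `‖p n‖ ≤ M (2(n + 1)/R)^n / n!`, and `(n +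
  -- 1)^n ≤ e^(n+1) n!`; this radius makes `‖p n‖ r^n` bounded.
  let r : NNReal := ⟨R / (2 * Real.exp 1), by positivity⟩
  have hr0 : 0 < r := by
    rw [← NNReal.coe_pos]; change 0 < R / (2 * Real.exp 1); positivity
  have hbound : ∀ n, ‖p n‖ * (r : ℝ) ^ n ≤ M * Real.exp 1 := by
    intro n
    have h1 : ‖iteratedFDeriv ℂ n f x‖ ≤ M / (R / (2 * (n + 1))) ^ n := by
      refine norm_iteratedFDeriv_le_of_ball n (by positivity) hfb hM x (mem_ball_self ?_)
      have : n * (R / (2 * (n + 1))) = R / 2 * (n / (n + 1)) := by field_simp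
      rw [this]
      have h3 : (n : ℝ) / (n + 1) ≤ 1 := by rw [div_le_one (by positivity)]; linarith
      nlinarith
    have h2 : ((n : ℝ) + 1) ^ n ≤ Real.exp 1 ^ n * Real.exp 1 * n.factorial := by
      have := Real.pow_div_factorial_le_exp (x := (n : ℝ) + 1) (by positivity) n
      rwa [div_le_iff₀ (by positivity), Real.exp_add, Real.exp_one_pow n |>.symm] at this
    have h3 : ‖p n‖ = (n.factorial : ℝ)⁻¹ * ‖iteratedFDeriv ℂ n f x‖ := by
      simp [p, norm_smul]
    have h4 : (r : ℝ) = R / (2 * Real.exp 1) := rfl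
    rw [h3, h4]
    calc (n.factorial : ℝ)⁻¹ * ‖iteratedFDeriv ℂ n f x‖ * (R / (2 * Real.exp 1)) ^ n
        ≤ (n.factorial : ℝ)⁻¹ * (M / (R / (2 * (n + 1))) ^ n) * (R / (2 * Real.exp 1)) ^ n := by
          gcongr
      _ = M * (((n : ℝ) + 1) ^ n / (Real.exp 1 ^ n * n.factorial)) := by
          simp only [div_pow, mul_pow]
          field_simp
      _ ≤ M * Real.exp 1 := by
          gcongr
          rw [div_le_iff₀ (by positivity)]
          linarith
  refine ⟨p, r, ⟨p.le_radius_of_bound _ hbound, by exact_mod_cast hr0, ?_⟩⟩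
  intro y hy
  have hy' : ‖y‖ < R / (2 * Real.exp 1) := by
    rw [Metric.eball_coe, mem_ball_zero_iff] at hy
    exact hy
  have hyR : ‖y‖ < R / 2 := by
    refine hy'.trans_le ?_
    gcongr
    linarith [Real.add_one_le_exp 1]
  have hline : ∀ s ∈ ball (0 : ℂ) 2, x + s • y ∈ ball x R := by
    intro s hs
    rw [mem_ball_zero_iff] at hs
    rw [mem_ball_iff_norm, add_sub_cancel_left, norm_smul]
    nlinarith [norm_nonneg y, norm_nonneg s]
  -- The sum of the series at `x + y` is the one-variable Taylor series of `s ↦ f (x + s y)` at `s =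
  -- 1`.
  have hg : DifferentiableOn ℂ (fun s : ℂ => f (x + s • y)) (ball 0 2) :=
    hfb.comp (by fun_prop) hline
  have := Complex.hasSum_taylorSeries_on_ball hg (z := 1) (by simp)
  simp only [one_smul] at this
  refine (congrArg (HasSum · _) (funext fun n => ?_)).mp this
  rw [iteratedDeriv_line isOpen_ball hfb x y n 0 (by simpa using hR)]
  simp [p]

end SeveralVariables

end AskeyWilson

namespace AskeyWilson

open MeasureTheory Filter Topology Metric

/-! ### Shifting a horizontal contour -/

section Contour

theorem integrable_exp_neg_mul_abs {c : ℝ} (hc : 0 < c) :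
    Integrable fun t : ℝ => Real.exp (-c * |t|) := by
  rw [← integrableOn_univ, ← Set.Iic_union_Ioi (a := (0 : ℝ))]
  refine IntegrableOn.union ?_ ?_
  · refine (integrableOn_exp_mul_Iic hc 0).congr_fun (fun t ht => ?_) measurableSet_Iic
    simp [abs_of_nonpos (Set.mem_Iic.1 ht)]
  · refine (integrableOn_exp_mul_Ioi (neg_lt_zero.2 hc) 0).congr_fun (fun t ht => ?_)
      measurableSet_Ioi
    simp [abs_of_pos (Set.mem_Ioi.1 ht)]

theorem integrable_of_norm_le_exp {g : ℝ → ℂ} (hg : Continuous g) {C c : ℝ} (hc : 0 < c)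
    (h : ∀ t, ‖g t‖ ≤ C * Real.exp (-c * |t|)) : Integrable g := by
  refine Integrable.mono' ?_ hg.aestronglyMeasurable (Eventually.of_forall h)
  exact (integrable_exp_neg_mul_abs hc).const_mul _

/-- Cauchy's theorem for the rectangle with vertices `±R + ia`, `±R + ib`; the exponential bound
kills the vertical sides as `R → ∞`. The bounds `a`, `b` may come in either order. -/
theorem integral_line_eq {F : ℂ → ℂ} {a b C c : ℝ} (hc : 0 < c)
    (hd : ∀ z : ℂ, z.im ∈ Set.uIcc a b → DifferentiableAt ℂ F z)
    (hb : ∀ z : ℂ, z.im ∈ Set.uIcc a b → ‖F z‖ ≤ C * Real.exp (-c * |z.re|)) :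
    ∫ t : ℝ, F (t + a * Complex.I) = ∫ t : ℝ, F (t + b * Complex.I) := by
  have him : ∀ (t s : ℝ), (t + s * Complex.I : ℂ).im = s := fun t s => by simp
  have hre : ∀ (t s : ℝ), (t + s * Complex.I : ℂ).re = t := fun t s => by simp
  have hint : ∀ s ∈ Set.uIcc a b, Integrable fun t : ℝ => F (t + s * Complex.I) := by
    intro s hs
    refine integrable_of_norm_le_exp (C := C) (continuous_iff_continuousAt.2 fun t => ?_) hc
      fun t => ?_
    · exact ContinuousAt.comp (f := fun t : ℝ => (t + s * Complex.I : ℂ))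
        (hd _ (by rwa [him])).continuousAt (by fun_prop)
    · simpa [hre] using hb (t + s * Complex.I) (by rwa [him])
  have hlim : ∀ s ∈ Set.uIcc a b, Tendsto (fun R : ℝ => ∫ t in (-R)..R, F (t + s * Complex.I)) atTop
      (𝓝 (∫ t : ℝ, F (t + s * Complex.I))) := fun s hs =>
    intervalIntegral_tendsto_integral (hint s hs) tendsto_neg_atTop_atBot tendsto_id
  have hvert : ∀ σ : ℝ, (σ = 1 ∨ σ = -1) → Tendsto (fun R : ℝ => ∫ y in a..b, F ((σ * R : ℝ) + y * Complex.I))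
      atTop (𝓝 0) := by
    intro σ hσ
    have h1 : Tendsto (fun R : ℝ => C * Real.exp (-c * R) * |b - a|) atTop (𝓝 0) := by
      have : Tendsto (fun R : ℝ => Real.exp (-c * R)) atTop (𝓝 0) := by
        refine Real.tendsto_exp_atBot.comp ?_
        exact tendsto_id.const_mul_atTop_of_neg (by linarith)
      simpa using (this.const_mul C).mul_const |b - a|
    refine squeeze_zero_norm' ?_ h1
    filter_upwards [eventually_ge_atTop 0] with R hR
    refine intervalIntegral.norm_integral_le_of_norm_le_const fun y hy => ?_
    have := hb ((σ * R : ℝ) + y * Complex.I) (by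
      rw [him]; exact Set.uIoc_subset_uIcc hy)
    rw [hre] at this
    have h2 : |σ * R| = R := by
      rcases hσ with rfl | rfl <;> simp [abs_of_nonneg hR]
    rwa [h2] at this
  have hrect : ∀ R : ℝ, (((∫ t in (-R)..R, F (t + a * Complex.I)) -
      ∫ t in (-R)..R, F (t + b * Complex.I)) +
      Complex.I • ∫ y in a..b, F ((1 * R : ℝ) + y * Complex.I)) -
      Complex.I • ∫ y in a..b, F ((-1 * R : ℝ) + y * Complex.I) = 0 := by
    intro R
    have := Complex.integral_boundary_rect_eq_zero_of_differentiableOn F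
      (⟨-R, a⟩ : ℂ) ⟨R, b⟩ fun z hz => (hd z (by
        rw [Complex.mem_reProdIm] at hz; exact hz.2)).differentiableWithinAt
    simpa using this
  have hl := (((hlim a Set.left_mem_uIcc).sub (hlim b Set.right_mem_uIcc)).add
    ((hvert 1 (Or.inl rfl)).const_smul Complex.I)).sub
      ((hvert (-1) (Or.inr rfl)).const_smul Complex.I)
  simp only [hrect] at hl
  have := tendsto_nhds_unique hl tendsto_const_nhds
  simp only [smul_zero, add_zero, sub_zero] at this
  exact sub_eq_zero.1 this

end Contour

/-! ### Meromorphic functions of several variables -/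

section Meromorphic

variable {V : Type} [NormedAddCommGroup V] [NormedSpace ℂ V]
  {W : Type} [NormedAddCommGroup W] [NormedSpace ℂ W]

theorem exists_analyticOnNhd_ball {f : V → ℂ} {p : V} (hf : AnalyticAt ℂ f p) :
    ∃ r > 0, AnalyticOnNhd ℂ f (ball p r) := by
  obtain ⟨r, hr, h⟩ := Metric.eventually_nhds_iff_ball.1 hf.eventually_analyticAt
  exact ⟨r, hr, h⟩

/-- The identity theorem on a ball. Throughout, `∃ᶠ x in 𝓝 q, f x ≠ 0` expresses that the germ of
`f` at `q` is not zero. -/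
theorem frequently_ne_of_ball {f : V → ℂ} {p q : V} {r : ℝ} (hf : AnalyticOnNhd ℂ f (ball p r))
    (hq : q ∈ ball p r) (h : ∃ᶠ x in 𝓝 q, f x ≠ 0) :
    ∀ q' ∈ ball p r, ∃ᶠ x in 𝓝 q', f x ≠ 0 := by
  intro q' hq' h'
  have h0 : f =ᶠ[𝓝 q'] 0 := h'.mono fun x hx => not_not.1 hx
  have := hf.eqOn_zero_of_preconnected_of_eventuallyEq_zero
    (convex_ball p r).isPreconnected hq' h0
  refine h ?_
  filter_upwards [isOpen_ball.mem_nhds hq] with x hx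
  exact not_not.2 (this hx)

/-- Germs of analytic functions form an integral domain: if `a b` vanished near `p`, then `a` would
vanish near some point where `b ≠ 0`, hence on a whole ball around `p`. -/
theorem frequently_mul_ne {a b : V → ℂ} {p : V} (ha : AnalyticAt ℂ a p) (hb : AnalyticAt ℂ b p)
    (ha' : ∃ᶠ x in 𝓝 p, a x ≠ 0) (hb' : ∃ᶠ x in 𝓝 p, b x ≠ 0) :
    ∃ᶠ x in 𝓝 p, a x * b x ≠ 0 := by
  obtain ⟨r, hr, har⟩ := exists_analyticOnNhd_ball ha
  intro h
  have h0 : ∀ᶠ x in 𝓝 p, ∀ᶠ y in 𝓝 x, a y * b y = 0 :=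
    (h.mono fun x hx => not_not.1 hx).eventually_nhds
  have hbc : ∀ᶠ x in 𝓝 p, ContinuousAt b x := hb.eventually_analyticAt.mono fun x hx => hx.continuousAt
  obtain ⟨q, hq, h1, h2, h3⟩ := (hb'.and_eventually
    (h0.and (hbc.and (isOpen_ball.mem_nhds (mem_ball_self hr))))).exists
  have h4 : ∀ᶠ y in 𝓝 q, a y = 0 := by
    filter_upwards [h1, h2.eventually_ne hq] with y hy hy'
    exact (mul_eq_zero.1 hy).resolve_right hy'
  have := frequently_ne_of_ball har (mem_ball_self hr) ha' q h3
  exact this (h4.mono fun y hy => not_not.2 hy)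

/-- `f` is a quotient of analytic functions near `p`. -/
def MeromAt (f : V → ℂ) (p : V) : Prop :=
  ∃ a b : V → ℂ, AnalyticAt ℂ a p ∧ AnalyticAt ℂ b p ∧
    (∃ᶠ q in 𝓝 p, b q ≠ 0) ∧ ∀ᶠ q in 𝓝 p, b q ≠ 0 → f q = a q / b q

theorem AnalyticAt.meromAt {f : V → ℂ} {p : V} (hf : AnalyticAt ℂ f p) : MeromAt f p :=
  ⟨f, 1, hf, analyticAt_const, by simp, by simp⟩

theorem MeromAt.mul {f g : V → ℂ} {p : V} (hf : MeromAt f p) (hg : MeromAt g p) :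
    MeromAt (fun x => f x * g x) p := by
  obtain ⟨a, b, ha, hb, hb', h⟩ := hf
  obtain ⟨c, d, hc, hd, hd', h'⟩ := hg
  refine ⟨fun x => a x * c x, fun x => b x * d x, ha.mul hc, hb.mul hd,
    frequently_mul_ne hb hd hb' hd', ?_⟩
  filter_upwards [h, h'] with x hx hx' hne
  rw [hx (left_ne_zero_of_mul hne), hx' (right_ne_zero_of_mul hne), div_mul_div_comm]

theorem MeromAt.add {f g : V → ℂ} {p : V} (hf : MeromAt f p) (hg : MeromAt g p) :
    MeromAt (fun x => f x + g x) p := by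
  obtain ⟨a, b, ha, hb, hb', h⟩ := hf
  obtain ⟨c, d, hc, hd, hd', h'⟩ := hg
  refine ⟨fun x => a x * d x + b x * c x, fun x => b x * d x, (ha.mul hd).add (hb.mul hc),
    hb.mul hd, frequently_mul_ne hb hd hb' hd', ?_⟩
  filter_upwards [h, h'] with x hx hx' hne
  have h1 := left_ne_zero_of_mul hne
  have h2 := right_ne_zero_of_mul hne
  rw [hx h1, hx' h2, div_add_div _ _ h1 h2]

/-- Since `0⁻¹ = 0`, no nonvanishing hypothesis is needed: if the numerator is the zero germ, the
inverse is `0` off the zeros of `b`. Otherwise the fraction is `b² / (a b)` rather than `b / a`,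
because `f = a / b` is known only where `b ≠ 0`. -/
theorem MeromAt.inv {f : V → ℂ} {p : V} (hf : MeromAt f p) : MeromAt (fun x => (f x)⁻¹) p := by
  obtain ⟨a, b, ha, hb, hb', h⟩ := hf
  by_cases ha' : ∃ᶠ q in 𝓝 p, a q ≠ 0
  · refine ⟨fun x => b x * b x, fun x => a x * b x, hb.mul hb, ha.mul hb,
      frequently_mul_ne ha hb ha' hb', ?_⟩
    filter_upwards [h] with x hx hne
    have h1 := left_ne_zero_of_mul hne
    have h2 := right_ne_zero_of_mul hne
    rw [hx h2]
    field_simp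
  · refine ⟨0, b, analyticAt_const, hb, hb', ?_⟩
    have h0 : ∀ᶠ q in 𝓝 p, a q = 0 := (not_frequently.1 ha').mono fun x hx => not_not.1 hx
    filter_upwards [h, h0] with x hx hx0 hne
    simp [hx hne, hx0]

theorem MeromAt.div {f g : V → ℂ} {p : V} (hf : MeromAt f p) (hg : MeromAt g p) :
    MeromAt (fun x => f x / g x) p := by
  simpa only [div_eq_mul_inv] using hf.mul hg.inv

theorem MeromAt.sub {f g : V → ℂ} {p : V} (hf : MeromAt f p) (hg : MeromAt g p) :
    MeromAt (fun x => f x - g x) p := by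
  have : MeromAt (fun x => (-1 : ℂ) * g x) p := (AnalyticAt.meromAt analyticAt_const).mul hg
  simpa only [sub_eq_add_neg, neg_one_mul] using hf.add this

theorem MeromAt.prod {ι : Type} (s : Finset ι) {f : ι → V → ℂ} {p : V}
    (hf : ∀ i ∈ s, MeromAt (f i) p) : MeromAt (fun x => ∏ i ∈ s, f i x) p := by
  classical
  induction s using Finset.induction_on with
  | empty => simpa using AnalyticAt.meromAt (analyticAt_const (v := (1 : ℂ)))
  | insert i s hi ih =>
    simp only [Finset.prod_insert hi]
    exact (hf i (by simp)).mul (ih fun j hj => hf j (by simp [hj]))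

theorem MeromAt.congr {f g : V → ℂ} {p : V} (hf : MeromAt f p) (h : ∀ᶠ x in 𝓝 p, f x = g x) :
    MeromAt g p := by
  obtain ⟨a, b, ha, hb, hb', h'⟩ := hf
  refine ⟨a, b, ha, hb, hb', ?_⟩
  filter_upwards [h, h'] with x hx hx' hne
  rw [← hx, hx' hne]

/-- The hypothesis on `map φ (𝓝 p)` prevents the denominator from becoming the zero germ after
composition. -/
theorem MeromAt.comp {f : W → ℂ} {φ : V → W} {p : V} (hf : MeromAt f (φ p))
    (hφ : AnalyticAt ℂ φ p) (hmap : map φ (𝓝 p) = 𝓝 (φ p)) : MeromAt (fun x => f (φ x)) p := by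
  obtain ⟨a, b, ha, hb, hb', h⟩ := hf
  refine ⟨fun x => a (φ x), fun x => b (φ x), ha.comp hφ, hb.comp hφ, ?_, ?_⟩
  · rw [← hmap, frequently_map] at hb'; exact hb'
  · rw [← hmap, eventually_map] at h; exact h

/-- `f` vanishes near `p` off a proper analytic subset. -/
def VanishesAt (f : V → ℂ) (p : V) : Prop :=
  ∃ c : V → ℂ, AnalyticAt ℂ c p ∧ (∃ᶠ q in 𝓝 p, c q ≠ 0) ∧ ∀ᶠ q in 𝓝 p, c q ≠ 0 → f q = 0

theorem VanishesAt.eq_zero {f : V → ℂ} {p : V} (h : VanishesAt f p) (hf : ContinuousAt f p) :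
    f p = 0 := by
  obtain ⟨c, -, hc, h⟩ := h
  by_contra hne
  obtain ⟨q, h1, h2, h3⟩ := (hc.and_eventually (h.and (hf.eventually_ne hne))).exists
  exact h3 (h2 h1)

theorem isOpen_vanishesAt (f : V → ℂ) : IsOpen {p | VanishesAt f p} := by
  rw [isOpen_iff_mem_nhds]
  rintro p ⟨c, hc, hc', h⟩
  obtain ⟨r, hr, hcr⟩ := exists_analyticOnNhd_ball hc
  filter_upwards [isOpen_ball.mem_nhds (mem_ball_self hr), h.eventually_nhds] with q hq hq'
  exact ⟨c, hcr q hq, frequently_ne_of_ball hcr (mem_ball_self hr) hc' q hq, hq'⟩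

/-- The set of points in question is open; it is also closed in `U`. At a limit point `p` write `f =
a / b`: if `a b` were not the zero germ at `p`, it would not be one at any nearby point either,
which contradicts the vanishing of `f` near such a point off an analytic set. -/
theorem VanishesAt.of_preconnected {f : V → ℂ} {U : Set V} (hU : IsPreconnected U)
    (hf : ∀ p ∈ U, MeromAt f p) {p₀ : V} (hp₀ : p₀ ∈ U) (h₀ : VanishesAt f p₀) :
    ∀ p ∈ U, VanishesAt f p := by
  refine hU.subset_of_closure_inter_subset (u := {p | VanishesAt f p}) (isOpen_vanishesAt f)
    ⟨p₀, hp₀, h₀⟩ ?_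
  intro p hp
  have hpc : p ∈ closure {p | VanishesAt f p} := hp.1
  have hpU := hp.2
  obtain ⟨a, b, ha, hb, hb', h⟩ := hf p hpU
  refine ⟨b, hb, hb', ?_⟩
  have hab := ha.mul hb
  obtain ⟨r, hr, hbr⟩ := exists_analyticOnNhd_ball hab
  have hev := h.eventually_nhds.and (isOpen_ball.mem_nhds (mem_ball_self hr))
  rw [mem_closure_iff_frequently] at hpc
  obtain ⟨q, ⟨c, hc, hc', hq⟩, hq1, hq2⟩ := (hpc.and_eventually hev).exists
  by_contra hcon
  have hfreq : ∃ᶠ x in 𝓝 p, a x * b x ≠ 0 := by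
    intro h0
    refine hcon ?_
    filter_upwards [h0, h] with x hx hx' hne
    rw [hx' hne, (mul_eq_zero.1 (not_not.1 hx)).resolve_right hne, zero_div]
  have h1 := frequently_ne_of_ball hbr (mem_ball_self hr) hfreq q hq2
  have h2 := frequently_mul_ne (hbr q hq2) hc h1 hc'
  obtain ⟨x, hx, hx1, hx2⟩ := (h2.and_eventually (hq.and hq1)).exists
  have h3 : a x * b x ≠ 0 := left_ne_zero_of_mul hx
  have h4 := hx1 (right_ne_zero_of_mul hx)
  rw [hx2 (right_ne_zero_of_mul h3)] at h4
  exact (div_ne_zero (left_ne_zero_of_mul h3) (right_ne_zero_of_mul h3)) h4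

/-! ### Functions vanishing at real values of one or two of the variables -/

/-- The identity theorem in the first coordinate alone, as the real numbers accumulate at `a`. The
predicate `P` on the other coordinates allows the argument to be repeated for a second variable. -/
theorem eventually_eq_zero_of_real {f : ℂ × V → ℂ} {a : ℝ} {v : V} {P : V → Prop}
    (hf : AnalyticAt ℂ f (a, v)) (h : ∀ᶠ q in 𝓝 ((a : ℂ), v), q.1.im = 0 → P q.2 → f q = 0) :
    ∀ᶠ q in 𝓝 ((a : ℂ), v), P q.2 → f q = 0 := by
  obtain ⟨r, hr, hfr⟩ := exists_analyticOnNhd_ball hf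
  obtain ⟨s, hs, hfs⟩ := Metric.eventually_nhds_iff_ball.1 h
  filter_upwards [isOpen_ball.mem_nhds (mem_ball_self (lt_min hr hs))] with q hq hP
  have hq2 : dist q.2 v < min r s := (le_max_right _ _).trans_lt hq
  have hq1 : dist q.1 a < min r s := (le_max_left _ _).trans_lt hq
  have han : AnalyticOnNhd ℂ (fun t : ℂ => f (t, q.2)) (ball (a : ℂ) r) := by
    intro t ht
    refine AnalyticAt.fun_comp (f := fun t : ℂ => (t, q.2)) (hfr (t, q.2) ?_)
      (analyticAt_id.prod analyticAt_const)
    exact max_lt ht (hq2.trans_le (min_le_left _ _))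
  have hzero : ∃ᶠ t in 𝓝[≠] (a : ℂ), f (t, q.2) = 0 := by
    have hseq : Tendsto (fun x : ℝ => (x : ℂ)) (𝓝[>] a) (𝓝[≠] (a : ℂ)) := by
      refine tendsto_nhdsWithin_iff.2 ⟨?_, ?_⟩
      · exact (Complex.continuous_ofReal.tendsto a).mono_left nhdsWithin_le_nhds
      · filter_upwards [self_mem_nhdsWithin] with x hx
        simpa using (ne_of_gt hx)
    refine hseq.frequently (Eventually.frequently ?_)
    have : ∀ᶠ x : ℝ in 𝓝[>] a, dist (x : ℂ) a < s :=
      (((Complex.continuous_ofReal.tendsto a).mono_left nhdsWithin_le_nhds).eventually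
        (ball_mem_nhds _ hs))
    filter_upwards [this] with x hx
    exact hfs (x, q.2) (max_lt hx (hq2.trans_le (min_le_right _ _))) (by simp) hP
  have := han.eqOn_zero_of_preconnected_of_frequently_eq_zero
    (convex_ball _ _).isPreconnected (mem_ball_self hr) hzero
  exact this (x := q.1) (hq1.trans_le (min_le_left _ _))

theorem eventually_eq_zero_of_real₂ {f : ℂ × ℂ × V → ℂ} {a b : ℝ} {v : V}
    (hf : AnalyticAt ℂ f (a, b, v))
    (h : ∀ᶠ q in 𝓝 ((a : ℂ), (b : ℂ), v), q.1.im = 0 → q.2.1.im = 0 → f q = 0) :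
    ∀ᶠ q in 𝓝 ((a : ℂ), (b : ℂ), v), f q = 0 := by
  have h1 := eventually_eq_zero_of_real (P := fun q : ℂ × V => q.1.im = 0) hf h
  -- Exchanging the first two coordinates lets the same lemma remove the second reality condition.
  let e : ℂ × ℂ × V → ℂ × ℂ × V := fun q => (q.2.1, q.1, q.2.2)
  have he : Continuous e := by fun_prop
  have hf' : AnalyticAt ℂ (fun q => f (e q)) ((b : ℂ), (a : ℂ), v) :=
    AnalyticAt.comp (g := f) hf ((analyticAt_fst.fun_comp analyticAt_snd).prod
      (analyticAt_fst.prod (analyticAt_snd.fun_comp analyticAt_snd)))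
  have h2 : ∀ᶠ q in 𝓝 ((b : ℂ), (a : ℂ), v), q.1.im = 0 → True → f (e q) = 0 := by
    have := (he.tendsto ((b : ℂ), (a : ℂ), v)).eventually h1
    filter_upwards [this] with q hq h _
    exact hq h
  have h3 := eventually_eq_zero_of_real (P := fun _ => True) hf' h2
  have := (he.tendsto ((a : ℂ), (b : ℂ), v)).eventually h3
  filter_upwards [this] with q hq
  exact hq trivial

/-- The function shown to vanish identically is `c d` and not the numerator `c`, about which nothing
is known where `d = 0`. -/
theorem VanishesAt.of_real {f : ℂ × ℂ × V → ℂ} {a b : ℝ} {v : V} (hf : MeromAt f (a, b, v))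
    (h : ∀ᶠ q in 𝓝 ((a : ℂ), (b : ℂ), v), q.1.im = 0 → q.2.1.im = 0 → f q = 0) :
    VanishesAt f (a, b, v) := by
  obtain ⟨c, d, hc, hd, hd', h'⟩ := hf
  refine ⟨d, hd, hd', ?_⟩
  have h1 : ∀ᶠ q in 𝓝 ((a : ℂ), (b : ℂ), v), c q * d q = 0 := by
    refine eventually_eq_zero_of_real₂ (hc.mul hd) ?_
    filter_upwards [h, h'] with q hq hq' h1 h2
    by_cases hdq : d q = 0
    · simp [hdq]
    · have := hq h1 h2
      rw [hq' hdq, div_eq_zero_iff] at this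
      rw [this.resolve_right hdq, zero_mul]
  filter_upwards [h1, h'] with q hq hq' hne
  rw [hq' hne, (mul_eq_zero.1 hq).resolve_right hne, zero_div]

/-! ### Gluing local analytic extensions -/

/-- The value at `p` is taken from the local extension chosen at `p`. Two local extensions agree at
a common point `q`, being both the limit of `f` along the set `A`, which accumulates there. -/
theorem exists_analytic_extension {f : V → ℂ} {Ω A : Set V}
    (hA : ∀ p ∈ Ω, p ∈ closure A)
    (h : ∀ p ∈ Ω, ∃ φ : V → ℂ, AnalyticAt ℂ φ p ∧ ∀ᶠ q in 𝓝 p, q ∈ A → f q = φ q)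
    (hΩ : IsOpen Ω) :
    ∃ g : V → ℂ, AnalyticOnNhd ℂ g Ω ∧ ∀ p ∈ Ω, p ∈ A → g p = f p := by
  classical
  choose! φ hφ hφA using h
  refine ⟨fun p => φ p p, fun p hp => ?_, fun p hp hpA => ?_⟩
  · refine (hφ p hp).congr ?_
    filter_upwards [(hφ p hp).eventually_analyticAt, (hφA p hp).eventually_nhds,
      hΩ.mem_nhds hp] with q h1 h2 hq
    have hne : (𝓝[A] q).NeBot := mem_closure_iff_nhdsWithin_neBot.1 (hA q hq)
    have h3 : φ p =ᶠ[𝓝[A] q] φ q := by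
      filter_upwards [nhdsWithin_le_nhds h2, nhdsWithin_le_nhds (hφA q hq),
        self_mem_nhdsWithin] with x hx hx' hxA
      rw [← hx hxA, hx' hxA]
    exact tendsto_nhds_unique_of_eventuallyEq
      (h1.continuousAt.mono_left nhdsWithin_le_nhds)
      ((hφ q hq).continuousAt.mono_left nhdsWithin_le_nhds) h3
  · exact ((hφA p hp).self_of_nhds hpA).symm

end Meromorphic

end AskeyWilson

namespace AskeyWilson

open MeasureTheory Filter Topology Metric
open Complex (I)

/-! ### Entire functions attached to `sinh` and `cos` -/

section Elementary

theorem exists_entire_quotient {f : ℂ → ℂ} (hf : Differentiable ℂ f) (h0 : f 0 = 0) :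
    ∃ g : ℂ → ℂ, Differentiable ℂ g ∧ ∀ u, f u = u * g u := by
  refine ⟨dslope f 0, ?_, fun u => ?_⟩
  · rw [← differentiableOn_univ, Complex.differentiableOn_dslope univ_mem, differentiableOn_univ]
    exact hf
  · have := sub_smul_dslope f 0 u
    rw [h0, sub_zero, sub_zero, smul_eq_mul] at this
    exact this.symm

/-- For even `f` the quotient `f(u) / u` is odd, so by continuity it vanishes at `0` and can be
divided by `u` again. -/
theorem exists_entire_quotient_sq {f : ℂ → ℂ} (hf : Differentiable ℂ f) (h0 : f 0 = 0)
    (heven : ∀ u, f (-u) = f u) :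
    ∃ g : ℂ → ℂ, Differentiable ℂ g ∧ ∀ u, f u = u ^ 2 * g u := by
  obtain ⟨g, hg, hfg⟩ := exists_entire_quotient hf h0
  have hodd : ∀ u, u ≠ 0 → g u + g (-u) = 0 := by
    intro u hu
    have h1 := heven u
    rw [hfg u, hfg (-u)] at h1
    have : u * (g u + g (-u)) = 0 := by linear_combination -h1
    exact (mul_eq_zero.1 this).resolve_left hu
  have hg0 : g 0 = 0 := by
    have hc : Continuous fun u => g u + g (-u) := hg.continuous.add (hg.continuous.comp continuous_neg)
    have h1 : Tendsto (fun u => g u + g (-u)) (𝓝[≠] 0) (𝓝 (g 0 + g (-0))) :=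
      (hc.tendsto 0).mono_left nhdsWithin_le_nhds
    have h2 : Tendsto (fun u => g u + g (-u)) (𝓝[≠] 0) (𝓝 0) := by
      refine tendsto_const_nhds.congr' ?_
      filter_upwards [self_mem_nhdsWithin] with u hu
      exact (hodd u hu).symm
    have := tendsto_nhds_unique h1 h2
    rw [neg_zero, ← two_mul] at this
    simpa using this
  obtain ⟨k, hk, hgk⟩ := exists_entire_quotient hg hg0
  exact ⟨k, hk, fun u => by rw [hfg, hgk]; ring⟩

/-- `sinh u / u` is even with value `1` at `0`. This factorization turns the cancellation of the
singular terms at `y = 0` in the integrals below into an algebraic identity. -/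
theorem exists_sinh_aux : ∃ g : ℂ → ℂ, Differentiable ℂ g ∧
    ∀ u, Complex.sinh u = u * (1 + u ^ 2 * g u) := by
  obtain ⟨s, hs, hs'⟩ := exists_entire_quotient Complex.differentiable_sinh Complex.sinh_zero
  have hs0 : s 0 = 1 := by
    have h1 : HasDerivAt Complex.sinh (Complex.cosh 0) 0 := Complex.hasDerivAt_sinh 0
    have h2 : HasDerivAt (fun u => u * s u) (1 * s 0 + 0 * deriv s 0) 0 :=
      (hasDerivAt_id (0 : ℂ)).mul (hs 0).hasDerivAt
    have h3 : (fun u => u * s u) = Complex.sinh := funext fun u => (hs' u).symm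
    rw [h3] at h2
    have := h2.unique h1
    simpa using this
  have hev : ∀ u, s (-u) = s u := by
    intro u
    by_cases hu : u = 0
    · simp [hu]
    have := Complex.sinh_neg u
    rw [hs', hs' u] at this
    exact mul_left_cancel₀ hu (by linear_combination -this)
  obtain ⟨g, hg, hg'⟩ := exists_entire_quotient_sq (f := fun u => s u - 1) (hs.sub_const 1)
    (by simp [hs0]) (fun u => by simp [hev])
  refine ⟨g, hg, fun u => ?_⟩
  rw [hs', ← hg']
  ring

/-- The entire function with `sinh u = u (1 + u² shAux u)`. -/
noncomputable def shAux : ℂ → ℂ := exists_sinh_aux.choose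

theorem differentiable_shAux : Differentiable ℂ shAux := exists_sinh_aux.choose_spec.1

theorem sinh_eq_shAux (u : ℂ) : Complex.sinh u = u * (1 + u ^ 2 * shAux u) :=
  exists_sinh_aux.choose_spec.2 u

theorem sin_eq_shAux (u : ℂ) : Complex.sin u = u * (1 - u ^ 2 * shAux (u * I)) := by
  have h1 := Complex.sinh_mul_I u
  rw [sinh_eq_shAux, mul_pow, Complex.I_sq] at h1
  have : Complex.sin u * I = u * (1 - u ^ 2 * shAux (u * I)) * I := by
    rw [← h1]; ring
  exact mul_right_cancel₀ Complex.I_ne_zero this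

theorem exists_cosh_aux : ∃ g : ℂ → ℂ, Differentiable ℂ g ∧
    ∀ u, Complex.cosh u = 1 + u ^ 2 * g u := by
  obtain ⟨g, hg, hg'⟩ := exists_entire_quotient_sq (f := fun u => Complex.cosh u - 1)
    (Complex.differentiable_cosh.sub_const 1) (by simp) (fun u => by simp)
  exact ⟨g, hg, fun u => by rw [← hg']; ring⟩

/-- The entire function with `cosh u = 1 + u² chAux u`. -/
noncomputable def chAux : ℂ → ℂ := exists_cosh_aux.choose

theorem differentiable_chAux : Differentiable ℂ chAux := exists_cosh_aux.choose_spec.1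

theorem cosh_eq_chAux (u : ℂ) : Complex.cosh u = 1 + u ^ 2 * chAux u :=
  exists_cosh_aux.choose_spec.2 u

theorem sinh_re_le_norm_sinh (v : ℂ) : Real.sinh v.re ≤ ‖Complex.sinh v‖ := by
  have h : Complex.sinh v = (Complex.exp v - Complex.exp (-v)) / 2 := rfl
  rw [h, norm_div, Real.sinh_eq]
  have h1 := norm_sub_norm_le (Complex.exp v) (Complex.exp (-v))
  rw [Complex.norm_exp, Complex.norm_exp] at h1
  simp only [Complex.neg_re, Complex.norm_ofNat] at h1 ⊢
  gcongr

theorem sinh_ne_zero_of_re_ne {v : ℂ} (h : v.re ≠ 0) : Complex.sinh v ≠ 0 := by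
  intro h0
  rcases lt_or_gt_of_ne h with h1 | h1
  · have := sinh_re_le_norm_sinh (-v)
    rw [Complex.sinh_neg, h0] at this
    have h2 : 0 < Real.sinh (-v).re := Real.sinh_pos_iff.2 (by simpa using h1)
    simp at this h2
    linarith
  · have := sinh_re_le_norm_sinh v
    rw [h0, norm_zero] at this
    have h2 : 0 < Real.sinh v.re := Real.sinh_pos_iff.2 h1
    linarith

theorem sinh_mul_ne_zero {w : ℂ} (hw : 0 < w.re) {y : ℝ} (hy : y ≠ 0) :
    Complex.sinh (w * y) ≠ 0 :=
  sinh_ne_zero_of_re_ne (by simpa using ⟨hw.ne', hy⟩)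

theorem one_add_shAux_ne_zero {w : ℂ} (hw : 0 < w.re) (y : ℝ) :
    1 + (w * y) ^ 2 * shAux (w * y) ≠ 0 := by
  by_cases hy : y = 0
  · simp [hy]
  · have := sinh_mul_ne_zero hw hy
    rw [sinh_eq_shAux] at this
    exact right_ne_zero_of_mul this

/-- For `y ≥ 1` the function `sinh (w y)` grows at least as a multiple of `exp (a y)`, `a ≤ Re w`. -/
theorem norm_inv_sinh_le {a : ℝ} (ha : 0 < a) {w : ℂ} (hw : a ≤ w.re) {y : ℝ} (hy : 1 ≤ y) :
    ‖(Complex.sinh (w * y))⁻¹‖ ≤ (Real.sinh a)⁻¹ * Real.exp a * Real.exp (-a * y) := by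
  have h1 : Real.sinh (a * y) ≤ ‖Complex.sinh (w * y)‖ := by
    refine le_trans ?_ (sinh_re_le_norm_sinh _)
    rw [Real.sinh_le_sinh]
    simp
    nlinarith
  have h2 : Real.sinh a * Real.exp (a * (y - 1)) ≤ Real.sinh (a * y) := by
    rw [Real.sinh_eq, Real.sinh_eq]
    have e1 : Real.exp a * Real.exp (a * (y - 1)) = Real.exp (a * y) := by
      rw [← Real.exp_add]; ring_nf
    have e2 : Real.exp (-(a * y)) ≤ Real.exp (-a) * Real.exp (a * (y - 1)) := by
      rw [← Real.exp_add]
      apply Real.exp_le_exp.2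
      nlinarith
    nlinarith
  have hs : 0 < Real.sinh a := Real.sinh_pos_iff.2 ha
  rw [norm_inv]
  calc ‖Complex.sinh (w * y)‖⁻¹ ≤ (Real.sinh a * Real.exp (a * (y - 1)))⁻¹ := by
        gcongr
        exact h2.trans h1
    _ = (Real.sinh a)⁻¹ * Real.exp a * Real.exp (-a * y) := by
        rw [mul_inv, ← Real.exp_neg, mul_assoc, ← Real.exp_add]
        ring_nf

theorem norm_sin_le_exp (v : ℂ) : ‖Complex.sin v‖ ≤ Real.exp |v.im| := by
  have h : Complex.sin v = (Complex.exp (-v * I) - Complex.exp (v * I)) * I / 2 := rfl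
  rw [h, norm_div, norm_mul, Complex.norm_I, mul_one, Complex.norm_ofNat]
  have h1 := norm_sub_le (Complex.exp (-v * I)) (Complex.exp (v * I))
  rw [Complex.norm_exp, Complex.norm_exp] at h1
  simp only [Complex.mul_re, Complex.neg_re, Complex.I_re, Complex.neg_im, Complex.I_im] at h1
  have h2 : Real.exp (-v.re * 0 - -v.im * 1) ≤ Real.exp |v.im| :=
    Real.exp_le_exp.2 (by simpa using le_abs_self v.im)
  have h3 : Real.exp (v.re * 0 - v.im * 1) ≤ Real.exp |v.im| :=
    Real.exp_le_exp.2 (by simpa using neg_le_abs v.im)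
  linarith

theorem norm_cos_le_exp (v : ℂ) : ‖Complex.cos v‖ ≤ Real.exp |v.im| := by
  have h : Complex.cos v = (Complex.exp (v * I) + Complex.exp (-v * I)) / 2 := rfl
  rw [h, norm_div, Complex.norm_ofNat]
  have h1 := norm_add_le (Complex.exp (v * I)) (Complex.exp (-v * I))
  rw [Complex.norm_exp, Complex.norm_exp] at h1
  simp only [Complex.mul_re, Complex.neg_re, Complex.I_re, Complex.neg_im, Complex.I_im] at h1
  have h2 : Real.exp (-v.re * 0 - -v.im * 1) ≤ Real.exp |v.im| :=
    Real.exp_le_exp.2 (by simpa using le_abs_self v.im)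
  have h3 : Real.exp (v.re * 0 - v.im * 1) ≤ Real.exp |v.im| :=
    Real.exp_le_exp.2 (by simpa using neg_le_abs v.im)
  linarith

end Elementary

/-! ### Integrals over the half-line depending on parameters -/

section HalfLine

theorem eventually_bounded_of_isCompact {X Y : Type} [TopologicalSpace X] [TopologicalSpace Y]
    {f : X × Y → ℂ} {x : X} {K : Set Y} (hK : IsCompact K)
    (hf : ∀ y ∈ K, ContinuousAt f (x, y)) :
    ∃ C, ∀ᶠ x' in 𝓝 x, ∀ y ∈ K, ‖f (x', y)‖ ≤ C := by
  have hc : ContinuousOn (fun y => f (x, y)) K := fun y hy =>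
    (ContinuousAt.comp (f := fun y => (x, y)) (hf y hy) (by fun_prop)).continuousWithinAt
  obtain ⟨C, hC⟩ := hK.exists_bound_of_continuousOn hc
  refine ⟨C + 1, hK.eventually_forall_of_forall_eventually fun y hy => ?_⟩
  have h1 : ‖f (x, y)‖ < C + 1 := (hC y hy).trans_lt (lt_add_one C)
  exact ((hf y hy).norm.eventually (gt_mem_nhds h1)).mono fun z hz => hz.le

/-- The dominating functions used on the half-line. -/
noncomputable def tailBound (A δ B : ℝ) (y : ℝ) : ℝ := A * Real.exp (-δ * y) + B * (1 + y ^ 2)⁻¹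

theorem integrableOn_tailBound {A δ B : ℝ} (hδ : 0 < δ) :
    IntegrableOn (tailBound A δ B) (Set.Ioi 0) :=
  ((integrableOn_exp_mul_Ioi (neg_lt_zero.2 hδ) 0).const_mul A).add
    (integrable_inv_one_add_sq.integrableOn.const_mul B)

variable {E : Type} [NormedAddCommGroup E] [NormedSpace ℂ E] [FiniteDimensional ℂ E]

theorem hasFDerivAt_integral_Ioi {h : ℝ → E → ℂ} {U : Set E} (hU : IsOpen U)
    (hcont : ∀ p ∈ U, ContinuousOn (fun y => h y p) (Set.Ioi 0))
    (hdiff : ∀ y > 0, DifferentiableOn ℂ (h y) U) {p : E} (hp : p ∈ U)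
    (hb : ∃ A δ B, 0 < δ ∧ ∀ᶠ q in 𝓝 p, ∀ y > 0, ‖h y q‖ ≤ tailBound A δ B y) :
    IntegrableOn (fun y => h y p) (Set.Ioi 0) ∧
    IntegrableOn (fun y => fderiv ℂ (h y) p) (Set.Ioi 0) ∧
      HasFDerivAt (fun p => ∫ y in Set.Ioi 0, h y p)
        (∫ y in Set.Ioi 0, fderiv ℂ (h y) p) p := by
  obtain ⟨A, δ, B, hδ, hb⟩ := hb
  obtain ⟨r, hr, hr'⟩ := Metric.eventually_nhds_iff_ball.1 (hb.and (hU.mem_nhds hp))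
  have hm : ∀ q ∈ U, AEStronglyMeasurable (fun y => h y q) (volume.restrict (Set.Ioi 0)) :=
    fun q hq => (hcont q hq).aestronglyMeasurable measurableSet_Ioi
  refine ⟨Integrable.mono' (integrableOn_tailBound (A := A) (B := B) hδ) (hm p hp) ?_,
    hasFDerivAt_integral hU hm hp hr (integrableOn_tailBound (A := A) (B := B) hδ) ?_⟩
  · filter_upwards [ae_restrict_mem measurableSet_Ioi] with y hy
    exact (hr' p (mem_ball_self hr)).1 y hy
  · filter_upwards [ae_restrict_mem measurableSet_Ioi] with y hy
    exact ⟨(hdiff y hy).mono fun q hq => (hr' q hq).2, fun q hq => (hr' q hq).1 y hy⟩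

theorem hasDerivAt_integral_Ioi {h : ℝ → ℂ → ℂ} {U : Set ℂ} (hU : IsOpen U)
    (hcont : ∀ p ∈ U, ContinuousOn (fun y => h y p) (Set.Ioi 0))
    {h' : ℝ → ℂ → ℂ} (hdiff : ∀ y > 0, ∀ q ∈ U, HasDerivAt (h y) (h' y q) q) {p : ℂ} (hp : p ∈ U)
    (hb : ∃ A δ B, 0 < δ ∧ ∀ᶠ q in 𝓝 p, ∀ y > 0, ‖h y q‖ ≤ tailBound A δ B y) :
    IntegrableOn (fun y => h' y p) (Set.Ioi 0) ∧
      HasDerivAt (fun p => ∫ y in Set.Ioi 0, h y p) (∫ y in Set.Ioi 0, h' y p) p := by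
  obtain ⟨-, h1, h2⟩ := hasFDerivAt_integral_Ioi hU hcont
    (fun y hy q hq => (hdiff y hy q hq).differentiableAt.differentiableWithinAt) hp hb
  have h3 : ∀ y > 0, fderiv ℂ (h y) p 1 = h' y p := fun y hy => by
    rw [fderiv_apply_one_eq_deriv, (hdiff y hy p hp).deriv]
  have h4 := h1.apply_continuousLinearMap (1 : ℂ)
  refine ⟨(integrableOn_congr_fun (fun y hy => h3 y hy) measurableSet_Ioi).1 h4, ?_⟩
  have h5 := h2.hasDerivAt
  rw [ContinuousLinearMap.integral_apply h1] at h5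
  rwa [setIntegral_congr_fun measurableSet_Ioi fun y hy => h3 y hy] at h5

end HalfLine

end AskeyWilson

namespace AskeyWilson

open MeasureTheory Filter Topology Metric
open Complex (I)

/-! ### Analyticity of the integral defining the hyperbolic gamma function -/

section GInt

/-- The integrand of `gInt`. -/
noncomputable def gIntegrand (y : ℝ) (q : ℂ × ℂ × ℂ) : ℂ :=
  (Complex.sin (2 * y * q.2.2) / (2 * Complex.sinh (q.1 * y) * Complex.sinh (q.2.1 * y))
    - q.2.2 / (q.1 * q.2.1 * y)) / y

theorem gInt_eq (w₁ w₂ z : ℂ) : gInt w₁ w₂ z = ∫ y in Set.Ioi (0 : ℝ), gIntegrand y (w₁, w₂, z) :=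
  rfl

/-- The integrand of `gInt` with its singularity at `y = 0` removed. -/
noncomputable def gRegular (x : (ℂ × ℂ × ℂ) × ℝ) : ℂ :=
  x.1.2.2 / (x.1.1 * x.1.2.1) *
    (-4 * x.1.2.2 ^ 2 * shAux (2 * x.2 * x.1.2.2 * I) - x.1.1 ^ 2 * shAux (x.1.1 * x.2)
      - x.1.2.1 ^ 2 * shAux (x.1.2.1 * x.2)
      - x.1.1 ^ 2 * x.1.2.1 ^ 2 * x.2 ^ 2 * shAux (x.1.1 * x.2) * shAux (x.1.2.1 * x.2)) /
    ((1 + (x.1.1 * x.2) ^ 2 * shAux (x.1.1 * x.2)) *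
      (1 + (x.1.2.1 * x.2) ^ 2 * shAux (x.1.2.1 * x.2)))

theorem ne_zero_of_re_pos {w : ℂ} (h : 0 < w.re) : w ≠ 0 := by
  rintro rfl; simp at h

/-- The algebra behind the removal of the singularity. The values of `shAux` are free variables, and
`P`, `Q` stay atoms until the denominators are cleared, so that only their nonvanishing is used. -/
theorem gRegular_aux {w₁ w₂ y z a b c P Q : ℂ} (h₁ : w₁ ≠ 0) (h₂ : w₂ ≠ 0) (hy : y ≠ 0)
    (hP : P ≠ 0) (hQ : Q ≠ 0) (eP : P = 1 + (w₁ * y) ^ 2 * a) (eQ : Q = 1 + (w₂ * y) ^ 2 * b) :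
    (2 * y * z * (1 - (2 * y * z) ^ 2 * c) / (2 * (w₁ * y * P) * (w₂ * y * Q))
      - z / (w₁ * w₂ * y)) / y =
    z / (w₁ * w₂) * (-4 * z ^ 2 * c - w₁ ^ 2 * a - w₂ ^ 2 * b - w₁ ^ 2 * w₂ ^ 2 * y ^ 2 * a * b) /
      (P * Q) := by
  field_simp
  rw [eP, eQ]
  ring

theorem gIntegrand_eq_gRegular {q : ℂ × ℂ × ℂ} (h₁ : 0 < q.1.re) (h₂ : 0 < q.2.1.re) {y : ℝ}
    (hy : y ≠ 0) : gIntegrand y q = gRegular (q, y) := by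
  obtain ⟨w₁, w₂, z⟩ := q
  simp only at h₁ h₂
  have e1 := one_add_shAux_ne_zero h₁ y
  have e2 := one_add_shAux_ne_zero h₂ y
  have e3 := ne_zero_of_re_pos h₁
  have e4 := ne_zero_of_re_pos h₂
  have e5 : (y : ℂ) ≠ 0 := by exact_mod_cast hy
  simp only [gIntegrand, gRegular]
  rw [sin_eq_shAux, sinh_eq_shAux (w₁ * y), sinh_eq_shAux (w₂ * y)]
  exact gRegular_aux e3 e4 e5 e1 e2 rfl rfl

theorem continuousAt_gRegular {q : ℂ × ℂ × ℂ} (h₁ : 0 < q.1.re) (h₂ : 0 < q.2.1.re) (y : ℝ) :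
    ContinuousAt gRegular (q, y) := by
  have hsh : Continuous shAux := differentiable_shAux.continuous
  have e1 := one_add_shAux_ne_zero h₁ y
  have e2 := one_add_shAux_ne_zero h₂ y
  have e3 := ne_zero_of_re_pos h₁
  have e4 := ne_zero_of_re_pos h₂
  unfold gRegular
  refine ContinuousAt.div ?_ (by fun_prop) (mul_ne_zero e1 e2)
  refine ContinuousAt.mul (ContinuousAt.div (by fun_prop) (by fun_prop) (mul_ne_zero e3 e4)) ?_
  fun_prop

/-- The domain of `gInt`. -/
def stripDomain : Set (ℂ × ℂ × ℂ) :=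
  {q | 0 < q.1.re ∧ 0 < q.2.1.re ∧ |q.2.2.im| < (wMean q.1 q.2.1).re}

theorem wMean_re (w₁ w₂ : ℂ) : (wMean w₁ w₂).re = (w₁.re + w₂.re) / 2 := by
  simp [wMean]

theorem isOpen_stripDomain : IsOpen stripDomain := by
  have h1 : Continuous fun q : ℂ × ℂ × ℂ => q.1.re := by fun_prop
  have h2 : Continuous fun q : ℂ × ℂ × ℂ => q.2.1.re := by fun_prop
  have h3 : Continuous fun q : ℂ × ℂ × ℂ => |q.2.2.im| := by fun_prop
  have h4 : Continuous fun q : ℂ × ℂ × ℂ => (wMean q.1 q.2.1).re := by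
    unfold wMean
    fun_prop
  exact (isOpen_lt continuous_const h1).inter
    ((isOpen_lt continuous_const h2).inter (isOpen_lt h3 h4))

theorem inv_sq_le {y : ℝ} (hy : 1 ≤ y) : (y ^ 2)⁻¹ ≤ 2 * (1 + y ^ 2)⁻¹ := by
  rw [inv_eq_one_div, inv_eq_one_div, mul_one_div, div_le_div_iff₀ (by positivity) (by positivity)]
  nlinarith

/-- On `0 < y ≤ 1` the regularized integrand is bounded by compactness. For `y ≥ 1` the sine term is
of order `exp((2|Im z| - Re w₁ - Re w₂) y)` and the rational term of order `1 / y²`. -/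
theorem eventually_norm_gIntegrand_le {q : ℂ × ℂ × ℂ} (hq : q ∈ stripDomain) :
    ∃ A δ B, 0 < δ ∧ ∀ᶠ x in 𝓝 q, ∀ y > 0, ‖gIntegrand y x‖ ≤ tailBound A δ B y := by
  obtain ⟨h₁, h₂, h₃⟩ := hq
  rw [wMean_re] at h₃
  -- `η` is the room for moving each period and `z`, and also the decay rate that remains; it is
  -- spent five times, so a sixth of the gap is enough.
  obtain ⟨η, hη, hη1, hη2, hη3⟩ : ∃ η > 0, η < q.1.re ∧ η < q.2.1.re ∧
      2 * (|q.2.2.im| + η) + η < (q.1.re - η) + (q.2.1.re - η) := by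
    have hg : 0 < (q.1.re + q.2.1.re) - 2 * |q.2.2.im| := by linarith
    refine ⟨min (min (q.1.re / 2) (q.2.1.re / 2)) (((q.1.re + q.2.1.re) - 2 * |q.2.2.im|) / 6),
      by positivity, ?_, ?_, ?_⟩
    · refine ((min_le_left _ _).trans (min_le_left _ _)).trans_lt (by linarith)
    · refine ((min_le_left _ _).trans (min_le_right _ _)).trans_lt (by linarith)
    · have := min_le_right (min (q.1.re / 2) (q.2.1.re / 2))
        (((q.1.re + q.2.1.re) - 2 * |q.2.2.im|) / 6)
      linarith
  set a₁ := q.1.re - η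
  set a₂ := q.2.1.re - η
  set b := |q.2.2.im| + η
  have ha₁ : 0 < a₁ := by simp only [a₁]; linarith
  have ha₂ : 0 < a₂ := by simp only [a₂]; linarith
  obtain ⟨C, hC⟩ := eventually_bounded_of_isCompact (f := gRegular) (x := q)
    (isCompact_Icc (a := (0 : ℝ)) (b := 1)) fun y _ => continuousAt_gRegular h₁ h₂ y
  set D := (Real.sinh a₁)⁻¹ * Real.exp a₁ with hD
  set D' := (Real.sinh a₂)⁻¹ * Real.exp a₂ with hD'
  have hs1 : 0 < Real.sinh a₁ := Real.sinh_pos_iff.2 ha₁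
  have hs2 : 0 < Real.sinh a₂ := Real.sinh_pos_iff.2 ha₂
  have hD0 : 0 ≤ D := by positivity
  have hD0' : 0 ≤ D' := by positivity
  set M := ‖q.2.2‖ + 1
  have e1 : ∀ᶠ x : ℂ × ℂ × ℂ in 𝓝 q, a₁ < x.1.re :=
    (by fun_prop : Continuous fun x : ℂ × ℂ × ℂ => x.1.re).continuousAt.eventually_const_lt
      (by simp only [a₁]; linarith)
  have e2 : ∀ᶠ x : ℂ × ℂ × ℂ in 𝓝 q, a₂ < x.2.1.re :=
    (by fun_prop : Continuous fun x : ℂ × ℂ × ℂ => x.2.1.re).continuousAt.eventually_const_lt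
      (by simp only [a₂]; linarith)
  have e3 : ∀ᶠ x : ℂ × ℂ × ℂ in 𝓝 q, |x.2.2.im| < b :=
    (by fun_prop : Continuous fun x : ℂ × ℂ × ℂ => |x.2.2.im|).continuousAt.eventually_lt_const
      (by simp only [b]; linarith)
  have e4 : ∀ᶠ x : ℂ × ℂ × ℂ in 𝓝 q, ‖x.2.2‖ < M :=
    (by fun_prop : Continuous fun x : ℂ × ℂ × ℂ => ‖x.2.2‖).continuousAt.eventually_lt_const
      (by simp only [M]; linarith)
  refine ⟨D * D', η, 2 * |C| + 2 * (M / (a₁ * a₂)), hη, ?_⟩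
  filter_upwards [hC, e1, e2, e3, e4] with x hxC hx1 hx2 hx3 hx4 y hy
  have hx1' : 0 < x.1.re := ha₁.trans hx1
  have hx2' : 0 < x.2.1.re := ha₂.trans hx2
  have hM : 0 < M := by positivity
  rcases le_total y 1 with hy1 | hy1
  · rw [gIntegrand_eq_gRegular hx1' hx2' hy.ne']
    have h5 := hxC y ⟨le_of_lt hy, hy1⟩
    have h6 : (1 : ℝ) / 2 ≤ (1 + y ^ 2)⁻¹ := by
      rw [inv_eq_one_div]
      exact one_div_le_one_div_of_le (by positivity) (by nlinarith)
    have h7 : 0 ≤ D * D' * Real.exp (-η * y) := by positivity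
    have h8 : 0 ≤ 2 * (M / (a₁ * a₂)) * (1 + y ^ 2)⁻¹ := by positivity
    have h9 : |C| ≤ 2 * |C| * (1 + y ^ 2)⁻¹ := by nlinarith [abs_nonneg C]
    unfold tailBound
    rw [add_mul]
    linarith [le_abs_self C]
  · have hy0 : 0 < y := hy
    have i1 := norm_inv_sinh_le ha₁ hx1.le hy1
    have i2 := norm_inv_sinh_le ha₂ hx2.le hy1
    have i3 : ‖Complex.sin (2 * y * x.2.2)‖ ≤ Real.exp (2 * b * y) := by
      refine (norm_sin_le_exp _).trans (Real.exp_le_exp.2 ?_)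
      have : (2 * (y : ℂ) * x.2.2).im = 2 * y * x.2.2.im := by
        rw [show (2 * (y : ℂ) * x.2.2) = ((2 * y : ℝ) : ℂ) * x.2.2 by push_cast; ring,
          Complex.im_ofReal_mul]
      rw [this, abs_mul, abs_of_pos (by positivity)]
      nlinarith
    have hT1 : ‖Complex.sin (2 * y * x.2.2) /
        (2 * Complex.sinh (x.1 * y) * Complex.sinh (x.2.1 * y)) / y‖
        ≤ D * D' * Real.exp (-η * y) := by
      have : Complex.sin (2 * y * x.2.2) /
        (2 * Complex.sinh (x.1 * y) * Complex.sinh (x.2.1 * y)) / y =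
        Complex.sin (2 * y * x.2.2) * (Complex.sinh (x.1 * y))⁻¹ * (Complex.sinh (x.2.1 * y))⁻¹ *
          (2 * y : ℂ)⁻¹ := by
        simp only [div_eq_mul_inv, mul_inv]; ring
      rw [this, norm_mul, norm_mul, norm_mul]
      have h2y : ‖(2 * (y : ℂ))⁻¹‖ ≤ 1 := by
        rw [norm_inv, norm_mul, Complex.norm_ofNat, Complex.norm_real, Real.norm_of_nonneg hy0.le]
        exact inv_le_one_of_one_le₀ (by linarith)
      calc _ ≤ Real.exp (2 * b * y) * (D * Real.exp (-a₁ * y)) * (D' * Real.exp (-a₂ * y)) * 1 := by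
            gcongr
        _ = D * D' * Real.exp (2 * b * y + -a₁ * y + -a₂ * y) := by
            rw [Real.exp_add, Real.exp_add]; ring
        _ ≤ D * D' * Real.exp (-η * y) := by
            gcongr
            nlinarith
    have hT2 : ‖x.2.2 / (x.1 * x.2.1 * y) / y‖ ≤ 2 * (M / (a₁ * a₂)) * (1 + y ^ 2)⁻¹ := by
      have n1 : a₁ ≤ ‖x.1‖ := hx1.le.trans (Complex.re_le_norm _)
      have n2 : a₂ ≤ ‖x.2.1‖ := hx2.le.trans (Complex.re_le_norm _)
      rw [norm_div, norm_div, norm_mul, norm_mul, Complex.norm_real, Real.norm_of_nonneg hy0.le]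
      calc ‖x.2.2‖ / (‖x.1‖ * ‖x.2.1‖ * y) / y ≤ M / (a₁ * a₂ * y) / y := by gcongr
        _ = M / (a₁ * a₂) * (y ^ 2)⁻¹ := by field_simp
        _ ≤ M / (a₁ * a₂) * (2 * (1 + y ^ 2)⁻¹) := by
            gcongr
            exact inv_sq_le hy1
        _ = _ := by ring
    have hC0 : 0 ≤ 2 * |C| * (1 + y ^ 2)⁻¹ := by positivity
    unfold gIntegrand tailBound
    rw [sub_div]
    refine (norm_sub_le _ _).trans ?_
    rw [add_mul]
    linarith

theorem continuousOn_gIntegrand {q : ℂ × ℂ × ℂ} (h₁ : 0 < q.1.re) (h₂ : 0 < q.2.1.re) :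
    ContinuousOn (fun y => gIntegrand y q) (Set.Ioi 0) := by
  have : ContinuousOn (fun y : ℝ => gRegular (q, y)) (Set.Ioi 0) := fun y _ =>
    (ContinuousAt.comp (f := fun y : ℝ => (q, y)) (continuousAt_gRegular h₁ h₂ y)
      (by fun_prop)).continuousWithinAt
  exact this.congr fun y hy => gIntegrand_eq_gRegular h₁ h₂ (ne_of_gt hy)

theorem differentiableAt_gIntegrand {q : ℂ × ℂ × ℂ} (h₁ : 0 < q.1.re) (h₂ : 0 < q.2.1.re) {y : ℝ}
    (hy : 0 < y) : DifferentiableAt ℂ (gIntegrand y) q := by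
  have e1 := sinh_mul_ne_zero h₁ hy.ne'
  have e2 := sinh_mul_ne_zero h₂ hy.ne'
  have e3 := ne_zero_of_re_pos h₁
  have e4 := ne_zero_of_re_pos h₂
  have e5 : (y : ℂ) ≠ 0 := by exact_mod_cast hy.ne'
  unfold gIntegrand
  have d0 : DifferentiableAt ℂ (fun q : ℂ × ℂ × ℂ => Complex.sin (2 * y * q.2.2)) q :=
    DifferentiableAt.csin (by fun_prop)
  have d1 : DifferentiableAt ℂ (fun q : ℂ × ℂ × ℂ => Complex.sinh (q.1 * y)) q :=
    DifferentiableAt.csinh (by fun_prop)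
  have d2 : DifferentiableAt ℂ (fun q : ℂ × ℂ × ℂ => Complex.sinh (q.2.1 * y)) q :=
    DifferentiableAt.csinh (by fun_prop)
  have d3 : DifferentiableAt ℂ (fun q : ℂ × ℂ × ℂ => q.1 * q.2.1 * (y : ℂ)) q := by fun_prop
  have d4 : DifferentiableAt ℂ (fun q : ℂ × ℂ × ℂ => q.2.2) q := by fun_prop
  have d5 : DifferentiableAt ℂ (fun q : ℂ × ℂ × ℂ =>
      (2 * Complex.sinh (q.1 * y) * Complex.sinh (q.2.1 * y))⁻¹) q :=
    ((d1.const_mul 2).fun_mul d2).fun_inv (mul_ne_zero (mul_ne_zero two_ne_zero e1) e2)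
  have d6 : DifferentiableAt ℂ (fun q : ℂ × ℂ × ℂ => (q.1 * q.2.1 * (y : ℂ))⁻¹) q :=
    d3.fun_inv (mul_ne_zero (mul_ne_zero e3 e4) e5)
  simp only [div_eq_mul_inv]
  exact ((d0.fun_mul d5).fun_sub (d4.fun_mul d6)).mul_const _

theorem integrableOn_gIntegrand {q : ℂ × ℂ × ℂ} (hq : q ∈ stripDomain) :
    IntegrableOn (fun y => gIntegrand y q) (Set.Ioi 0) :=
  (hasFDerivAt_integral_Ioi isOpen_stripDomain (fun _ hp => continuousOn_gIntegrand hp.1 hp.2.1)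
    (fun _ hy _ hp => (differentiableAt_gIntegrand hp.1 hp.2.1 hy).differentiableWithinAt) hq
    (eventually_norm_gIntegrand_le hq)).1

theorem differentiableOn_gInt :
    DifferentiableOn ℂ (fun q : ℂ × ℂ × ℂ => gInt q.1 q.2.1 q.2.2) stripDomain := fun _ hq =>
  (hasFDerivAt_integral_Ioi isOpen_stripDomain (fun _ hp => continuousOn_gIntegrand hp.1 hp.2.1)
    (fun _ hy _ hp => (differentiableAt_gIntegrand hp.1 hp.2.1 hy).differentiableWithinAt) hq
    (eventually_norm_gIntegrand_le hq)).2.2.differentiableAt.differentiableWithinAt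

theorem differentiableOn_gammaStrip :
    DifferentiableOn ℂ (fun q : ℂ × ℂ × ℂ => gammaStrip q.1 q.2.1 q.2.2) stripDomain :=
  Complex.differentiable_exp.comp_differentiableOn (differentiableOn_gInt.const_mul I)

theorem analyticAt_gammaStrip {q : ℂ × ℂ × ℂ} (hq : q ∈ stripDomain) :
    AnalyticAt ℂ (fun q : ℂ × ℂ × ℂ => gammaStrip q.1 q.2.1 q.2.2) q :=
  analyticAt_of_differentiableOn isOpen_stripDomain differentiableOn_gammaStrip hq

theorem gInt_comm (w₁ w₂ z : ℂ) : gInt w₁ w₂ z = gInt w₂ w₁ z := by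
  unfold gInt
  congr 1
  funext y
  rw [mul_comm w₁ w₂, mul_right_comm 2 (Complex.sinh _) (Complex.sinh _)]

theorem gInt_neg (w₁ w₂ z : ℂ) : gInt w₁ w₂ (-z) = -gInt w₁ w₂ z := by
  unfold gInt
  rw [← integral_neg]
  congr 1
  funext y
  rw [mul_neg, Complex.sin_neg]
  ring

theorem gInt_conj (w₁ w₂ : ℝ) (z : ℂ) :
    gInt w₁ w₂ (starRingEnd ℂ z) = starRingEnd ℂ (gInt w₁ w₂ z) := by
  unfold gInt
  rw [← integral_conj]
  congr 1
  funext y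
  simp [← Complex.sin_conj, ← Complex.sinh_conj, map_ofNat]

theorem gammaStrip_comm (w₁ w₂ z : ℂ) : gammaStrip w₁ w₂ z = gammaStrip w₂ w₁ z := by
  rw [gammaStrip, gInt_comm, gammaStrip]

theorem gammaStrip_neg (w₁ w₂ z : ℂ) : gammaStrip w₁ w₂ (-z) = (gammaStrip w₁ w₂ z)⁻¹ := by
  rw [gammaStrip, gInt_neg, mul_neg, Complex.exp_neg, gammaStrip]

theorem gammaStrip_ne_zero (w₁ w₂ z : ℂ) : gammaStrip w₁ w₂ z ≠ 0 := Complex.exp_ne_zero _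

/-- For real periods `gInt` commutes with conjugation, while the factor `i` in the exponent changes
sign. -/
theorem gammaStrip_conj (w₁ w₂ : ℝ) (z : ℂ) :
    starRingEnd ℂ (gammaStrip w₁ w₂ z) = (gammaStrip w₁ w₂ (starRingEnd ℂ z))⁻¹ := by
  rw [gammaStrip, gammaStrip, ← Complex.exp_conj, ← Complex.exp_neg, gInt_conj]
  simp

end GInt

end AskeyWilson

namespace AskeyWilson

open MeasureTheory Filter Topology Metric
open Complex (I)

/-! ### The difference equation of the hyperbolic gamma function on the strip -/

section Difference

theorem mem_stripDomain {w₁ w₂ z : ℂ} (h₁ : 0 < w₁.re) (h₂ : 0 < w₂.re)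
    (h : |z.im| < (w₁.re + w₂.re) / 2) : ((w₁, w₂, z) : ℂ × ℂ × ℂ) ∈ stripDomain :=
  ⟨h₁, h₂, by rwa [wMean_re]⟩

theorem hasDerivAt_gInt {w₁ w₂ z : ℂ} (hq : ((w₁, w₂, z) : ℂ × ℂ × ℂ) ∈ stripDomain) :
    IntegrableOn (fun y : ℝ => Complex.cos (2 * y * z) /
      (Complex.sinh (w₁ * y) * Complex.sinh (w₂ * y)) - 1 / (w₁ * w₂ * y ^ 2)) (Set.Ioi 0) ∧
    HasDerivAt (gInt w₁ w₂) (∫ y in Set.Ioi (0 : ℝ), (Complex.cos (2 * y * z) /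
      (Complex.sinh (w₁ * y) * Complex.sinh (w₂ * y)) - 1 / (w₁ * w₂ * y ^ 2))) z := by
  have hc : Continuous fun z : ℂ => ((w₁, w₂, z) : ℂ × ℂ × ℂ) := by fun_prop
  obtain ⟨A, δ, B, hδ, hb⟩ := eventually_norm_gIntegrand_le hq
  refine hasDerivAt_integral_Ioi (U := (fun z : ℂ => ((w₁, w₂, z) : ℂ × ℂ × ℂ)) ⁻¹' stripDomain)
    (h := fun y z => gIntegrand y (w₁, w₂, z))
    (h' := fun y z => Complex.cos (2 * y * z) /
      (Complex.sinh (w₁ * y) * Complex.sinh (w₂ * y)) - 1 / (w₁ * w₂ * y ^ 2))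
    (isOpen_stripDomain.preimage hc) (fun p hp => continuousOn_gIntegrand hp.1 hp.2.1) ?_ hq
    ⟨A, δ, B, hδ, (hc.tendsto z).eventually hb⟩
  intro y hy x hx
  have e1 := sinh_mul_ne_zero hx.1 hy.ne'
  have e2 := sinh_mul_ne_zero hx.2.1 hy.ne'
  have e3 := ne_zero_of_re_pos hx.1
  have e4 := ne_zero_of_re_pos hx.2.1
  have e5 : (y : ℂ) ≠ 0 := by exact_mod_cast hy.ne'
  simp only at e1 e2 e3 e4
  have d1 : HasDerivAt (fun x : ℂ => Complex.sin (2 * y * x)) (Complex.cos (2 * y * x) * (2 * y)) x := by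
    have := ((hasDerivAt_id' x).const_mul (2 * (y : ℂ))).csin
    rwa [mul_one] at this
  have d2 := ((d1.div_const (2 * Complex.sinh (w₁ * y) * Complex.sinh (w₂ * y))).fun_sub
    ((hasDerivAt_id' x).div_const (w₁ * w₂ * y))).div_const (y : ℂ)
  refine d2.congr_deriv ?_
  generalize Complex.cos (2 * y * x) = c
  generalize Complex.sinh (w₁ * y) = s₁ at e1 ⊢
  generalize Complex.sinh (w₂ * y) = s₂ at e2 ⊢
  field_simp

/-- The integral `∫ (cos (2 y z) / sinh (w y) - 1 / (w y)) dy / y`. -/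
noncomputable def lamInt (w z : ℂ) : ℂ :=
  ∫ y in Set.Ioi (0 : ℝ), (Complex.cos (2 * y * z) / Complex.sinh (w * y) - 1 / (w * y)) / y

/-- By the addition theorem the two shifted sines differ by `2i cos(2yz) sinh(w₁y)`; the factor
`sinh(w₁y)` cancels, so the right side depends on `w₂` only. -/
theorem gIntegrand_sub {w₁ w₂ : ℂ} (h₁ : 0 < w₁.re) (z : ℂ) {y : ℝ}
    (hy : 0 < y) :
    gIntegrand y (w₁, w₂, z + I * w₁ / 2) - gIntegrand y (w₁, w₂, z - I * w₁ / 2) =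
      I * ((Complex.cos (2 * y * z) / Complex.sinh (w₂ * y) - 1 / (w₂ * y)) / y) := by
  have e1 := sinh_mul_ne_zero h₁ hy.ne'
  have e3 := ne_zero_of_re_pos h₁
  have e5 : (y : ℂ) ≠ 0 := by exact_mod_cast hy.ne'
  have s1 : Complex.sin (2 * y * (z + I * w₁ / 2)) =
      Complex.sin (2 * y * z) * Complex.cosh (w₁ * y) +
        Complex.cos (2 * y * z) * (Complex.sinh (w₁ * y) * I) := by
    rw [← Complex.cos_mul_I, ← Complex.sin_mul_I, ← Complex.sin_add]
    congr 1; ring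
  have s2 : Complex.sin (2 * y * (z - I * w₁ / 2)) =
      Complex.sin (2 * y * z) * Complex.cosh (w₁ * y) -
        Complex.cos (2 * y * z) * (Complex.sinh (w₁ * y) * I) := by
    rw [← Complex.cos_mul_I, ← Complex.sin_mul_I, ← Complex.sin_sub]
    congr 1; ring
  simp only [gIntegrand]
  rw [s1, s2, ← sub_div, sub_sub_sub_comm, ← sub_div, ← sub_div]
  have n1 : (Complex.sin (2 * y * z) * Complex.cosh (w₁ * y) +
      Complex.cos (2 * y * z) * (Complex.sinh (w₁ * y) * I) -
      (Complex.sin (2 * y * z) * Complex.cosh (w₁ * y) -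
      Complex.cos (2 * y * z) * (Complex.sinh (w₁ * y) * I))) /
      (2 * Complex.sinh (w₁ * y) * Complex.sinh (w₂ * y)) =
      I * (Complex.cos (2 * y * z) / Complex.sinh (w₂ * y)) := by
    rw [show ∀ a b : ℂ, a + b - (a - b) = 2 * b from fun a b => by ring]
    rw [show 2 * (Complex.cos (2 * y * z) * (Complex.sinh (w₁ * y) * I)) =
      (2 * Complex.sinh (w₁ * y)) * (I * Complex.cos (2 * y * z)) by ring,
      mul_div_mul_left _ _ (mul_ne_zero two_ne_zero e1), mul_div_assoc]
  have n2 : (z + I * w₁ / 2 - (z - I * w₁ / 2)) / (w₁ * w₂ * y) = I * (1 / (w₂ * y)) := by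
    rw [show z + I * w₁ / 2 - (z - I * w₁ / 2) = w₁ * I by ring, mul_assoc,
      mul_div_mul_left _ _ e3, mul_one_div]
  rw [n1, n2]
  ring

theorem im_add_I_mul_half (z w : ℂ) : (z + I * w / 2).im = z.im + w.re / 2 := by
  simp

theorem im_sub_I_mul_half (z w : ℂ) : (z - I * w / 2).im = z.im - w.re / 2 := by
  simp

theorem shift_mem_stripDomain {w₁ w₂ z : ℂ} (h₁ : 0 < w₁.re) (h₂ : 0 < w₂.re)
    (h : |z.im| < w₂.re / 2) :
    ((w₁, w₂, z + I * w₁ / 2) : ℂ × ℂ × ℂ) ∈ stripDomain ∧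
      ((w₁, w₂, z - I * w₁ / 2) : ℂ × ℂ × ℂ) ∈ stripDomain := by
  rw [abs_lt] at h
  constructor <;> refine mem_stripDomain h₁ h₂ ?_
  · rw [im_add_I_mul_half, abs_lt]; constructor <;> linarith
  · rw [im_sub_I_mul_half, abs_lt]; constructor <;> linarith

theorem gInt_shift {w₁ w₂ z : ℂ} (h₁ : 0 < w₁.re) (h₂ : 0 < w₂.re) (h : |z.im| < w₂.re / 2) :
    gInt w₁ w₂ (z + I * w₁ / 2) - gInt w₁ w₂ (z - I * w₁ / 2) = I * lamInt w₂ z := by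
  obtain ⟨m1, m2⟩ := shift_mem_stripDomain h₁ h₂ h
  rw [gInt_eq, gInt_eq, ← integral_sub (integrableOn_gIntegrand m1) (integrableOn_gIntegrand m2),
    lamInt, ← integral_const_mul]
  exact setIntegral_congr_fun measurableSet_Ioi fun y hy => gIntegrand_sub h₁ z hy

theorem integrableOn_lamInt {w z : ℂ} (hw : 0 < w.re) (h : |z.im| < w.re / 2) :
    IntegrableOn (fun y : ℝ =>
      (Complex.cos (2 * y * z) / Complex.sinh (w * y) - 1 / (w * y)) / y) (Set.Ioi 0) := by
  obtain ⟨m1, m2⟩ := shift_mem_stripDomain hw hw h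
  have h1 := ((integrableOn_gIntegrand m1).sub (integrableOn_gIntegrand m2)).const_mul (-I)
  refine (integrableOn_congr_fun (fun y hy => ?_) measurableSet_Ioi).1 h1
  simp only [Pi.sub_apply]
  rw [gIntegrand_sub hw z hy, ← mul_assoc]
  simp

/-- The shift relation with both periods equal to `w`. It lets `lamInt` inherit analyticity and its
derivative from `gInt`, without new estimates. -/
theorem lamInt_eq {w z : ℂ} (hw : 0 < w.re) (h : |z.im| < w.re / 2) :
    lamInt w z = -I * (gInt w w (z + I * w / 2) - gInt w w (z - I * w / 2)) := by
  rw [gInt_shift hw hw h, ← mul_assoc]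
  simp

/-- The domain of `lamInt`. -/
def lamDomain : Set (ℂ × ℂ) := {q | 0 < q.1.re ∧ |q.2.im| < q.1.re / 2}

theorem isOpen_lamDomain : IsOpen lamDomain := by
  have h1 : Continuous fun q : ℂ × ℂ => q.1.re := by fun_prop
  have h2 : Continuous fun q : ℂ × ℂ => |q.2.im| := by fun_prop
  exact (isOpen_lt continuous_const h1).inter (isOpen_lt h2 (h1.div_const 2))

theorem convex_lamDomain : Convex ℝ lamDomain := by
  rintro p ⟨hp, hp'⟩ q ⟨hq, hq'⟩ a b ha hb hab
  refine ⟨?_, ?_⟩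
  · simp only [Prod.fst_add, Prod.smul_fst, Complex.add_re, Complex.real_smul,
      Complex.re_ofReal_mul]
    rcases ha.eq_or_lt with rfl | ha'
    · rw [zero_add] at hab; subst hab; simpa using hq
    · nlinarith
  · simp only [Prod.fst_add, Prod.smul_fst, Prod.snd_add, Prod.smul_snd, Complex.add_re,
      Complex.add_im, Complex.real_smul, Complex.re_ofReal_mul, Complex.im_ofReal_mul]
    rw [abs_lt] at hp' hq' ⊢
    rcases ha.eq_or_lt with rfl | ha'
    · rw [zero_add] at hab; subst hab; constructor <;> linarith
    · constructor <;> nlinarith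

theorem differentiableOn_lamInt :
    DifferentiableOn ℂ (fun q : ℂ × ℂ => lamInt q.1 q.2) lamDomain := by
  have h1 : DifferentiableOn ℂ (fun q : ℂ × ℂ => gInt q.1 q.1 (q.2 + I * q.1 / 2)) lamDomain :=
    differentiableOn_gInt.comp (g := fun q : ℂ × ℂ × ℂ => gInt q.1 q.2.1 q.2.2)
      (f := fun q : ℂ × ℂ => (q.1, q.1, q.2 + I * q.1 / 2)) (by fun_prop)
      fun q hq => (shift_mem_stripDomain hq.1 hq.1 hq.2).1
  have h2 : DifferentiableOn ℂ (fun q : ℂ × ℂ => gInt q.1 q.1 (q.2 - I * q.1 / 2)) lamDomain :=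
    differentiableOn_gInt.comp (g := fun q : ℂ × ℂ × ℂ => gInt q.1 q.2.1 q.2.2)
      (f := fun q : ℂ × ℂ => (q.1, q.1, q.2 - I * q.1 / 2)) (by fun_prop)
      fun q hq => (shift_mem_stripDomain hq.1 hq.1 hq.2).2
  exact ((h1.sub h2).const_mul (-I)).congr fun q hq => lamInt_eq hq.1 hq.2

/-- In the difference of the two derivatives of `gInt` the terms `1 / (w² y²)` cancel, and the
addition theorem for the cosine cancels one of the two factors `sinh(wy)`. -/
theorem hasDerivAt_lamInt {w z : ℂ} (hw : 0 < w.re) (h : |z.im| < w.re / 2) :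
    IntegrableOn (fun y : ℝ => Complex.sin (2 * y * z) / Complex.sinh (w * y)) (Set.Ioi 0) ∧
    HasDerivAt (lamInt w) (-2 * ∫ y in Set.Ioi (0 : ℝ),
      Complex.sin (2 * y * z) / Complex.sinh (w * y)) z := by
  obtain ⟨m1, m2⟩ := shift_mem_stripDomain hw hw h
  obtain ⟨i1, d1⟩ := hasDerivAt_gInt m1
  obtain ⟨i2, d2⟩ := hasDerivAt_gInt m2
  have key : ∀ y ∈ Set.Ioi (0 : ℝ),
      (Complex.cos (2 * y * (z + I * w / 2)) / (Complex.sinh (w * y) * Complex.sinh (w * y))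
        - 1 / (w * w * y ^ 2)) -
      (Complex.cos (2 * y * (z - I * w / 2)) / (Complex.sinh (w * y) * Complex.sinh (w * y))
        - 1 / (w * w * y ^ 2)) = (-2 * I) * (Complex.sin (2 * y * z) / Complex.sinh (w * y)) := by
    intro y hy
    have e1 := sinh_mul_ne_zero hw (ne_of_gt hy)
    have s1 : Complex.cos (2 * y * (z + I * w / 2)) =
        Complex.cos (2 * y * z) * Complex.cosh (w * y) -
          Complex.sin (2 * y * z) * (Complex.sinh (w * y) * I) := by
      rw [← Complex.cos_mul_I, ← Complex.sin_mul_I, ← Complex.cos_add]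
      congr 1; ring
    have s2 : Complex.cos (2 * y * (z - I * w / 2)) =
        Complex.cos (2 * y * z) * Complex.cosh (w * y) +
          Complex.sin (2 * y * z) * (Complex.sinh (w * y) * I) := by
      rw [← Complex.cos_mul_I, ← Complex.sin_mul_I, ← Complex.cos_sub]
      congr 1; ring
    rw [s1, s2]
    generalize Complex.sinh (w * y) = S at e1 ⊢
    have e6 : S * S * S⁻¹ = S := by rw [mul_assoc, mul_inv_cancel₀ e1, mul_one]
    rw [sub_sub_sub_cancel_right, ← sub_div, div_eq_iff (mul_ne_zero e1 e1), div_eq_mul_inv]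
    linear_combination (2 * I * Complex.sin (2 * y * z)) * e6
  have i3 : IntegrableOn (fun y : ℝ => (-2 * I) * (Complex.sin (2 * y * z) / Complex.sinh (w * y)))
      (Set.Ioi 0) := (integrableOn_congr_fun key measurableSet_Ioi).1 (i1.sub i2)
  have i4 : IntegrableOn (fun y : ℝ => Complex.sin (2 * y * z) / Complex.sinh (w * y))
      (Set.Ioi 0) := by
    have hne : (-2 * I : ℂ) ≠ 0 := by simp
    refine (integrableOn_congr_fun (fun y _ => ?_) measurableSet_Ioi).1 (i3.const_mul (-2 * I)⁻¹)
    rw [← mul_assoc, inv_mul_cancel₀ hne, one_mul]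
  refine ⟨i4, ?_⟩
  have hev : ∀ᶠ x in 𝓝 z, lamInt w x = -I * (gInt w w (x + I * w / 2) - gInt w w (x - I * w / 2)) := by
    have : ∀ᶠ x : ℂ in 𝓝 z, |x.im| < w.re / 2 :=
      (by fun_prop : Continuous fun x : ℂ => |x.im|).continuousAt.eventually_lt_const h
    filter_upwards [this] with x hx
    exact lamInt_eq hw hx
  refine HasDerivAt.congr_of_eventuallyEq ?_ hev
  have d3 := ((d1.comp_add_const z (I * w / 2)).sub (d2.comp_sub_const z (I * w / 2))).const_mul (-I)
  rw [← integral_sub i1 i2, setIntegral_congr_fun measurableSet_Ioi key, integral_const_mul] at d3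
  refine d3.congr_deriv ?_
  rw [← mul_assoc]
  congr 1
  linear_combination (2 : ℂ) * Complex.I_mul_I

end Difference

/-! ### The integral of `sin (2 y x) / sinh y` -/

section SinOverSinh

/-- Take the Mittag-Leffler series of the cotangent at `u = ix` and at `2u`. As `cotTerm _ n` has
its poles at `±(n + 1)`, the terms of odd index at `2u` are half the terms at `u`; the terms of even
index therefore sum to a difference of two cotangents, which is a multiple of the hyperbolic
tangent. -/
theorem hasSum_tanh {x : ℝ} (hx : x ≠ 0) :
    HasSum (fun n : ℕ => (4 * x : ℂ) / ((2 * n + 1) ^ 2 + 4 * x ^ 2))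
      (Real.pi / 2 * Complex.tanh (Real.pi * x)) := by
  have hmem : ∀ c : ℝ, c ≠ 0 → (c : ℂ) * I ∈ Complex.integerComplement := by
    intro c hc
    rintro ⟨n, hn⟩
    have := congrArg Complex.im hn
    simp at this
    exact hc this.symm
  set u : ℂ := x * I with hu
  have hu1 : u ∈ Complex.integerComplement := hmem x hx
  have hu2 : 2 * u ∈ Complex.integerComplement := by
    have := hmem (2 * x) (by simpa using hx)
    convert this using 1
    rw [hu]; push_cast; ring
  have s1 := (summable_cotTerm hu1).hasSum
  rw [show (∑' n, cotTerm u n) = _ from (cot_series_rep' hu1).symm] at s1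
  have s2 := (summable_cotTerm hu2).hasSum
  rw [show (∑' n, cotTerm (2 * u) n) = _ from (cot_series_rep' hu2).symm] at s2
  have hden : ∀ n : ℕ, (u - (n + 1)) ≠ 0 ∧ (u + (n + 1)) ≠ 0 := by
    intro n
    constructor <;> intro h <;> have := congrArg Complex.im h <;> simp [hu] at this <;> exact hx this
  have hden2 : ∀ n : ℕ, (2 * u - (n + 1)) ≠ 0 ∧ (2 * u + (n + 1)) ≠ 0 := by
    intro n
    constructor <;> intro h <;> have := congrArg Complex.im h <;> simp [hu] at this <;> exact hx this
  have odd : ∀ m : ℕ, cotTerm (2 * u) (2 * m + 1) = cotTerm u m / 2 := by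
    intro m
    obtain ⟨a, b⟩ := hden m
    simp only [cotTerm]
    have a' : 2 * u - (((2 * m + 1 : ℕ) : ℂ) + 1) = 2 * (u - (m + 1)) := by push_cast; ring
    have b' : 2 * u + (((2 * m + 1 : ℕ) : ℂ) + 1) = 2 * (u + (m + 1)) := by push_cast; ring
    rw [a', b']
    field_simp
  have even : ∀ m : ℕ, cotTerm (2 * u) (2 * m) = -I * ((4 * x : ℂ) / ((2 * m + 1) ^ 2 + 4 * x ^ 2)) := by
    intro m
    obtain ⟨a, b⟩ := hden2 (2 * m)
    simp only [cotTerm]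
    push_cast at a b ⊢
    have hne : ((2 * (m : ℂ) + 1) ^ 2 + 4 * x ^ 2) ≠ 0 := by
      have : 0 < (2 * (m : ℝ) + 1) ^ 2 + 4 * x ^ 2 := by positivity
      exact_mod_cast this.ne'
    have hprod : (2 * u - (2 * m + 1)) * (2 * u + (2 * m + 1)) = -((2 * (m : ℂ) + 1) ^ 2 + 4 * x ^ 2) := by
      rw [hu]; linear_combination (4 * (x : ℂ) ^ 2) * Complex.I_sq
    rw [div_add_div _ _ a b, hprod, hu]
    field_simp
    ring
  have hsummable : Summable fun m : ℕ => cotTerm (2 * u) (2 * m) :=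
    s2.summable.comp_injective (mul_right_injective₀ two_ne_zero)
  have s3 := hsummable.hasSum.even_add_odd (f := fun n => cotTerm (2 * u) n)
    (by simpa only [odd] using s1.div_const 2)
  have s4 := s3.unique s2
  have s5 := hsummable.hasSum
  have hval : (∑' m : ℕ, cotTerm (2 * u) (2 * m)) = -I * (Real.pi / 2 * Complex.tanh (Real.pi * x)) := by
    rw [eq_sub_of_add_eq s4]
    have hs : Complex.sinh (Real.pi * x) ≠ 0 := sinh_ne_zero_of_re_ne (by simpa using hx)
    have hch : Complex.cosh (Real.pi * x) ≠ 0 := by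
      have : 0 < Real.cosh (Real.pi * x) := Real.cosh_pos _
      exact_mod_cast this.ne'
    have hune : u ≠ 0 := by rw [hu]; simpa using hx
    have c1 : Complex.cot (Real.pi * u) = -I * Complex.cosh (Real.pi * x) / Complex.sinh (Real.pi * x) := by
      rw [Complex.cot, hu, ← mul_assoc, Complex.cos_mul_I, Complex.sin_mul_I]
      field_simp
      rw [Complex.I_sq]; ring
    have c2 : Complex.cot (Real.pi * (2 * u)) = -I * (Complex.cosh (Real.pi * x) ^ 2 +
        Complex.sinh (Real.pi * x) ^ 2) / (2 * Complex.sinh (Real.pi * x) * Complex.cosh (Real.pi * x)) := by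
      rw [Complex.cot, hu, show (Real.pi : ℂ) * (2 * (x * I)) = (2 * (Real.pi * x)) * I by ring,
        Complex.cos_mul_I, Complex.sin_mul_I, Complex.cosh_two_mul, Complex.sinh_two_mul]
      field_simp
      rw [Complex.I_sq]; ring
    rw [c1, c2, Complex.tanh_eq_sinh_div_cosh]
    field_simp
    ring
  rw [hval] at s5
  simp only [even] at s5
  have := s5.mul_left I
  simp only [← mul_assoc] at this
  simpa [← mul_assoc] using this

theorem integral_sin_mul_exp {m : ℝ} (hm : 0 < m) (x : ℝ) :
    IntegrableOn (fun y : ℝ => Complex.sin (2 * y * x) * (2 * Complex.exp (-m * y))) (Set.Ioi 0) ∧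
    ∫ y in Set.Ioi (0 : ℝ), Complex.sin (2 * y * x) * (2 * Complex.exp (-m * y)) =
      (4 * x : ℂ) / (m ^ 2 + 4 * x ^ 2) := by
  have r1 : (-(m : ℂ) - 2 * x * I).re < 0 := by simpa using hm
  have r2 : (-(m : ℂ) + 2 * x * I).re < 0 := by simpa using hm
  have i1 := integrableOn_exp_mul_complex_Ioi r1 0
  have i2 := integrableOn_exp_mul_complex_Ioi r2 0
  have key : (fun y : ℝ => Complex.sin (2 * y * x) * (2 * Complex.exp (-m * y))) =
      fun y : ℝ => I * (Complex.exp ((-(m : ℂ) - 2 * x * I) * y) -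
        Complex.exp ((-(m : ℂ) + 2 * x * I) * y)) := by
    funext y
    have e1 : Complex.exp ((-(m : ℂ) - 2 * x * I) * y) = Complex.exp (-(2 * y * x) * I) * Complex.exp (-m * y) := by
      rw [← Complex.exp_add]; ring_nf
    have e2 : Complex.exp ((-(m : ℂ) + 2 * x * I) * y) = Complex.exp ((2 * y * x) * I) * Complex.exp (-m * y) := by
      rw [← Complex.exp_add]; ring_nf
    rw [e1, e2, Complex.sin]
    ring
  rw [key]
  refine ⟨(i1.sub i2).const_mul I, ?_⟩
  rw [integral_const_mul, integral_sub i1 i2, integral_exp_mul_complex_Ioi r1,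
    integral_exp_mul_complex_Ioi r2]
  have n1 : (-(m : ℂ) - 2 * x * I) ≠ 0 := fun h => by rw [h] at r1; simp at r1
  have n2 : (-(m : ℂ) + 2 * x * I) ≠ 0 := fun h => by rw [h] at r2; simp at r2
  have n3 : (m : ℂ) ^ 2 + 4 * x ^ 2 ≠ 0 := by
    have : 0 < m ^ 2 + 4 * x ^ 2 := by positivity
    exact_mod_cast this.ne'
  have hp : (-(m : ℂ) - 2 * x * I) * (-(m : ℂ) + 2 * x * I) = m ^ 2 + 4 * x ^ 2 := by
    linear_combination -(4 * (x : ℂ) ^ 2) * Complex.I_sq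
  simp only [Complex.ofReal_zero, mul_zero, Complex.exp_zero]
  rw [div_sub_div _ _ n1 n2, hp, mul_div_assoc']
  congr 1
  linear_combination -(4 * (x : ℂ)) * Complex.I_sq

theorem hasSum_inv_sinh {y : ℝ} (hy : 0 < y) :
    HasSum (fun n : ℕ => 2 * Complex.exp (-((2 * n + 1 : ℝ) : ℂ) * y)) (Complex.sinh y)⁻¹ := by
  have h1 : ‖Complex.exp (-2 * y)‖ < 1 := by
    rw [Complex.norm_exp]
    simp [hy]
  have h2 := (hasSum_geometric_of_norm_lt_one h1).mul_left (2 * Complex.exp (-y))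
  have hs : Complex.sinh y ≠ 0 := sinh_ne_zero_of_re_ne (by simpa using hy.ne')
  have hf : (fun n : ℕ => 2 * Complex.exp (-((2 * n + 1 : ℝ) : ℂ) * y)) =
      fun n : ℕ => 2 * Complex.exp (-y) * Complex.exp (-2 * y) ^ n := by
    funext n
    rw [← Complex.exp_nat_mul, mul_assoc, ← Complex.exp_add]
    congr 2
    push_cast
    ring
  have hv : (Complex.sinh y)⁻¹ = 2 * Complex.exp (-y) * (1 - Complex.exp (-2 * y))⁻¹ := by
    have hne : 1 - Complex.exp (-2 * y) ≠ 0 := fun h => by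
      rw [sub_eq_zero] at h
      rw [← h] at h1
      simp at h1
    rw [← div_eq_mul_inv, inv_eq_one_div, div_eq_div_iff hs hne, Complex.sinh]
    have : Complex.exp (-2 * y) = Complex.exp (-y) * Complex.exp (-y) := by
      rw [← Complex.exp_add]; ring_nf
    have h3 : Complex.exp (-y) * Complex.exp y = 1 := by rw [← Complex.exp_add]; simp
    rw [this]
    linear_combination -h3
  rw [hf, hv]
  exact h2

/-- Expand `1 / sinh y = 2 ∑ exp(-(2n + 1)y)` and integrate termwise. The bound `|sin(2yx)| ≤ 2y|x|`
gives `L¹` norms of order `1 / n²`, which justifies the interchange. -/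
theorem integral_sin_div_sinh (x : ℝ) :
    ∫ y in Set.Ioi (0 : ℝ), Complex.sin (2 * y * x) / Complex.sinh y =
      Real.pi / 2 * Complex.tanh (Real.pi * x) := by
  by_cases hx : x = 0
  · simp [hx]
  set F : ℕ → ℝ → ℂ := fun n y =>
    Complex.sin (2 * y * x) * (2 * Complex.exp (-((2 * n + 1 : ℝ) : ℂ) * y)) with hF
  have hm : ∀ n : ℕ, (0 : ℝ) < 2 * n + 1 := fun n => by positivity
  have hnorm : ∀ n, ∫ y in Set.Ioi (0 : ℝ), ‖F n y‖ ≤ 4 * |x| * (1 / ((n : ℝ) + 1) ^ 2) := by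
    intro n
    have hg := Real.integral_rpow_mul_exp_neg_mul_Ioi (a := 2) (r := 2 * n + 1) two_pos (hm n)
    have hgi : IntegrableOn (fun y : ℝ => y ^ (2 - 1 : ℝ) * Real.exp (-((2 * n + 1) * y))) (Set.Ioi 0) := by
      refine (integrableOn_rpow_mul_exp_neg_mul_rpow (s := 2 - 1) (p := 1) (b := 2 * n + 1)
        (by norm_num) one_pos (hm n)).congr_fun (fun y _ => ?_) measurableSet_Ioi
      simp only [Real.rpow_one, neg_mul]
    calc ∫ y in Set.Ioi (0 : ℝ), ‖F n y‖
        ≤ ∫ y in Set.Ioi (0 : ℝ), 4 * |x| * (y ^ (2 - 1 : ℝ) * Real.exp (-((2 * n + 1) * y))) := by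
          refine setIntegral_mono_on (integral_sin_mul_exp (hm n) x).1.norm (hgi.const_mul _)
            measurableSet_Ioi fun y hy => ?_
          have hy' : 0 < y := hy
          rw [hF]
          simp only [norm_mul, Complex.norm_ofNat, Complex.norm_exp]
          have h1 : ‖Complex.sin (2 * y * x)‖ ≤ 2 * y * |x| := by
            have : (Complex.sin (2 * y * x)) = ((Real.sin (2 * y * x) : ℝ) : ℂ) := by push_cast; rfl
            rw [this, Complex.norm_real]
            refine (Real.abs_sin_le_abs).trans ?_
            rw [abs_mul, abs_of_pos (by positivity)]
          have h2 : (-((2 * n + 1 : ℝ) : ℂ) * y).re = -((2 * n + 1) * y) := by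
            rw [← Complex.ofReal_neg, ← Complex.ofReal_mul, Complex.ofReal_re]; ring
          rw [h2, show (2 - 1 : ℝ) = 1 by norm_num, Real.rpow_one]
          calc _ ≤ 2 * y * |x| * (2 * Real.exp (-((2 * n + 1) * y))) := by gcongr
            _ = _ := by ring
      _ = 4 * |x| * (1 / (2 * n + 1)) ^ 2 := by
          rw [integral_const_mul, hg, Real.Gamma_two, mul_one]
          norm_cast
      _ ≤ _ := by
          rw [one_div_pow]
          gcongr
          linarith
  have hsum : Summable fun n => ∫ y in Set.Ioi (0 : ℝ), ‖F n y‖ := by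
    refine Summable.of_nonneg_of_le (fun n => integral_nonneg fun y => norm_nonneg _) hnorm ?_
    refine Summable.mul_left _ ?_
    have := (summable_nat_add_iff 1).2 (Real.summable_one_div_nat_pow.2 (one_lt_two))
    simpa using this
  have h1 : HasSum (fun n => ∫ y in Set.Ioi (0 : ℝ), F n y)
      (∫ y in Set.Ioi (0 : ℝ), ∑' n, F n y) := hasSum_integral_of_summable_integral_norm
    (fun n => (integral_sin_mul_exp (hm n) x).1) hsum
  have h2 : ∀ n : ℕ, ∫ y in Set.Ioi (0 : ℝ), F n y = (4 * x : ℂ) / ((2 * n + 1) ^ 2 + 4 * x ^ 2) := by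
    intro n
    refine (integral_sin_mul_exp (hm n) x).2.trans ?_
    push_cast
    rfl
  simp only [h2] at h1
  rw [← h1.unique (hasSum_tanh hx)]
  refine setIntegral_congr_fun measurableSet_Ioi fun y hy => ?_
  change _ = ∑' n : ℕ, Complex.sin (2 * y * x) * (2 * Complex.exp (-((2 * n + 1 : ℝ) : ℂ) * y))
  rw [((hasSum_inv_sinh hy).mul_left (Complex.sin (2 * y * x))).tsum_eq, div_eq_mul_inv]

end SinOverSinh

end AskeyWilson

namespace AskeyWilson

open MeasureTheory Filter Topology Metric
open Complex (I)

/-! ### The shift factor of the hyperbolic gamma function. -/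

section ShiftFactor

theorem cosh_ofReal_ne_zero (x : ℝ) : Complex.cosh x ≠ 0 := by
  have : 0 < Real.cosh x := Real.cosh_pos _
  exact_mod_cast this.ne'

/-- Both sides have logarithmic derivative `π tanh(πx)`, so their quotient is constant. The constant
`exp(-lamInt 1 0)` is determined later. -/
theorem exp_neg_lamInt_real (x : ℝ) :
    Complex.exp (-lamInt 1 x) = Complex.exp (-lamInt 1 0) * Complex.cosh (Real.pi * x) := by
  have hd : ∀ x : ℝ, HasDerivAt (fun x : ℝ => lamInt 1 x)
      (-(Real.pi * Complex.tanh (Real.pi * x))) x := by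
    intro x
    have h := (hasDerivAt_lamInt (w := 1) (z := x) (by simp) (by simp)).2
    have h' := h.comp_ofReal
    refine h'.congr_deriv ?_
    simp only [one_mul]
    rw [integral_sin_div_sinh]
    ring
  have hc : ∀ x : ℝ, HasDerivAt (fun x : ℝ => Complex.cosh (Real.pi * x))
      (Complex.sinh (Real.pi * x) * Real.pi) x := by
    intro x
    have h := ((hasDerivAt_id' (x : ℂ)).const_mul (Real.pi : ℂ)).ccosh
    have h' := h.comp_ofReal
    exact h'.congr_deriv (by simp)
  have hq : ∀ x : ℝ, HasDerivAt
      (fun x : ℝ => Complex.exp (-lamInt 1 x) / Complex.cosh (Real.pi * x)) 0 x := by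
    intro x
    have hne : Complex.cosh (Real.pi * x) ≠ 0 := by
      have := cosh_ofReal_ne_zero (Real.pi * x)
      rwa [Complex.ofReal_mul] at this
    refine (((hd x).neg.cexp).fun_div (hc x) hne).congr_deriv ?_
    rw [Complex.tanh_eq_sinh_div_cosh]
    field_simp
    simp
  have := is_const_of_deriv_eq_zero (fun x => (hq x).differentiableAt) (fun x => (hq x).deriv) x 0
  have hne : Complex.cosh (Real.pi * x) ≠ 0 := by
    have := cosh_ofReal_ne_zero (Real.pi * x)
    rwa [Complex.ofReal_mul] at this
  simp only [Complex.ofReal_zero, mul_zero, Complex.cosh_zero, div_one] at this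
  rwa [div_eq_iff hne] at this

theorem lamInt_scale {w : ℝ} (hw : 0 < w) (z : ℂ) : lamInt w z = lamInt 1 (z / w) := by
  have hw' : (w : ℂ) ≠ 0 := by exact_mod_cast hw.ne'
  have h := MeasureTheory.integral_comp_mul_left_Ioi (fun y : ℝ =>
    (Complex.cos (2 * y * (z / w)) / Complex.sinh (1 * y) - 1 / (1 * y)) / y) 0 hw
  rw [mul_zero] at h
  have h2 := congrArg (fun u : ℂ => w • u) h
  simp only [smul_smul, mul_inv_cancel₀ hw.ne', one_smul] at h2
  rw [lamInt, lamInt, ← h2, ← integral_smul]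
  refine setIntegral_congr_fun measurableSet_Ioi fun y hy => ?_
  have hy' : (y : ℂ) ≠ 0 := by exact_mod_cast (ne_of_gt hy)
  simp only [Complex.ofReal_mul, one_mul, Complex.real_smul]
  rw [show 2 * ((w : ℂ) * y) * (z / w) = 2 * y * z by field_simp]
  field_simp

/-- For real `w` and `z` the equation reduces to `w = 1` by scaling the integration variable; both
sides are analytic on the convex set `lamDomain`. -/
theorem exp_neg_lamInt_aux {q : ℂ × ℂ} (hq : q ∈ lamDomain) : Complex.exp (-lamInt q.1 q.2) =
    Complex.exp (-lamInt 1 0) * Complex.cosh (Real.pi * q.2 / q.1) := by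
  -- The one-point factor supplies the third coordinate that `eventually_eq_zero_of_real₂` expects.
  set f : ℂ × ℂ × PUnit.{1} → ℂ := fun q => Complex.exp (-lamInt q.1 q.2.1) -
    Complex.exp (-lamInt 1 0) * Complex.cosh (Real.pi * q.2.1 / q.1) with hf
  let e : ℂ × ℂ × PUnit.{1} →ₗ[ℝ] ℂ × ℂ :=
    (LinearMap.fst ℝ ℂ (ℂ × PUnit)).prod ((LinearMap.fst ℝ ℂ PUnit).comp (LinearMap.snd ℝ ℂ (ℂ × PUnit)))
  have hconv : Convex ℝ (e ⁻¹' lamDomain) := convex_lamDomain.linear_preimage e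
  have hopen : IsOpen (e ⁻¹' lamDomain) :=
    isOpen_lamDomain.preimage (continuous_fst.prodMk (continuous_fst.comp continuous_snd))
  have hdiff : DifferentiableOn ℂ f (e ⁻¹' lamDomain) := by
    have h1 : DifferentiableOn ℂ (fun q : ℂ × ℂ × PUnit.{1} => lamInt q.1 q.2.1) (e ⁻¹' lamDomain) :=
      differentiableOn_lamInt.comp (g := fun q : ℂ × ℂ => lamInt q.1 q.2)
        (f := fun q : ℂ × ℂ × PUnit.{1} => (q.1, q.2.1)) (by fun_prop) fun q hq => hq
    refine h1.neg.cexp.sub (DifferentiableOn.const_mul (DifferentiableOn.ccosh ?_) _)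
    refine fun x hx => DifferentiableAt.differentiableWithinAt ?_
    have hx0 : x.1 ≠ 0 := ne_zero_of_re_pos hx.1
    have : DifferentiableAt ℂ (fun q : ℂ × ℂ × PUnit.{1} => Real.pi * q.2.1 * (q.1)⁻¹) x :=
      (by fun_prop : DifferentiableAt ℂ (fun q : ℂ × ℂ × PUnit.{1} => Real.pi * q.2.1) x).mul
        (DifferentiableAt.inv (by fun_prop) hx0)
    simpa only [div_eq_mul_inv] using this
  have han : AnalyticOnNhd ℂ f (e ⁻¹' lamDomain) :=
    fun x hx => analyticAt_of_differentiableOn hopen hdiff hx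
  have hmem : (((1 : ℝ) : ℂ), ((0 : ℝ) : ℂ), PUnit.unit) ∈ e ⁻¹' lamDomain := by
    refine ⟨?_, ?_⟩ <;> simp [e]
  have hev : ∀ᶠ q in 𝓝 (((1 : ℝ) : ℂ), ((0 : ℝ) : ℂ), PUnit.unit), f q = 0 := by
    refine eventually_eq_zero_of_real₂ (han _ hmem) ?_
    filter_upwards [hopen.mem_nhds hmem] with q hq h1 h2
    obtain ⟨w, z, u⟩ := q
    obtain ⟨w, rfl⟩ : ∃ r : ℝ, (r : ℂ) = w := ⟨w.re, Complex.ext (by simp) (by simpa using h1.symm)⟩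
    obtain ⟨z, rfl⟩ : ∃ r : ℝ, (r : ℂ) = z := ⟨z.re, Complex.ext (by simp) (by simpa using h2.symm)⟩
    have hw : 0 < w := by simpa [e] using hq.1
    simp only [hf]
    rw [lamInt_scale hw, ← Complex.ofReal_div, exp_neg_lamInt_real]
    push_cast
    rw [mul_div_assoc, sub_self]
  have := han.eqOn_zero_of_preconnected_of_eventuallyEq_zero hconv.isPreconnected hmem hev
    (x := (q.1, q.2, PUnit.unit)) hq
  simpa only [hf, Pi.zero_apply, sub_eq_zero] using this

/-- The integrands agree pointwise, by `sinh y = 2 sinh(y/2) cosh(y/2)`. This relation fixes the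
multiplicative constant left open above. -/
theorem lamInt_duplication :
    lamInt ((1 / 2 : ℝ) : ℂ) 0 = lamInt 1 (I / 4) + lamInt 1 (-(I / 4)) := by
  have i1 := integrableOn_lamInt (w := 1) (z := I / 4) (by simp) (by simp; norm_num [abs_of_pos])
  have i2 := integrableOn_lamInt (w := 1) (z := -(I / 4)) (by simp) (by simp; norm_num [abs_of_pos])
  rw [lamInt, lamInt, lamInt, ← integral_add i1 i2]
  refine setIntegral_congr_fun measurableSet_Ioi fun y hy => ?_
  have hy' : (y : ℂ) ≠ 0 := by exact_mod_cast (ne_of_gt hy)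
  have h1 : Complex.cos (2 * y * (I / 4)) = Complex.cosh (y / 2) := by
    rw [← Complex.cos_mul_I]; congr 1; ring
  have h2 : Complex.cos (2 * y * -(I / 4)) = Complex.cosh (y / 2) := by
    rw [← Complex.cos_mul_I, ← Complex.cos_neg]; congr 1; ring
  have h3 : Complex.sinh y = 2 * Complex.sinh (y / 2) * Complex.cosh (y / 2) := by
    rw [← Complex.sinh_two_mul]; congr 1; ring
  have h4 : Complex.sinh (y / 2 : ℂ) ≠ 0 := sinh_ne_zero_of_re_ne (by simpa using (ne_of_gt hy))
  have h5 : Complex.cosh (y / 2 : ℂ) ≠ 0 := by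
    have := cosh_ofReal_ne_zero (y / 2)
    rwa [Complex.ofReal_div] at this
  simp only [mul_zero, Complex.cos_zero, one_mul]
  rw [h1, h2, h3, show (((1 / 2 : ℝ) : ℂ) * y) = y / 2 by push_cast; ring]
  generalize Complex.sinh (y / 2 : ℂ) = S at *
  generalize Complex.cosh (y / 2 : ℂ) = T at *
  field_simp
  ring

theorem exp_neg_lamInt {w z : ℂ} (hw : 0 < w.re) (h : |z.im| < w.re / 2) :
    Complex.exp (-lamInt w z) = 2 * Complex.cosh (Real.pi * z / w) := by
  -- With `c = exp(-lamInt 1 0)` the duplication relation reads `c = (c cos(π/4))² = c²/2`, and `c ≠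
  -- 0`.
  have key : Complex.exp (-lamInt 1 0) = 2 := by
    have h0 := exp_neg_lamInt_aux (q := (((1 / 2 : ℝ) : ℂ), 0)) ⟨by simp, by simp⟩
    have h1 := exp_neg_lamInt_aux (q := (1, I / 4)) ⟨by simp, by simp; norm_num [abs_of_pos]⟩
    have h2 := exp_neg_lamInt_aux (q := (1, -(I / 4))) ⟨by simp, by simp; norm_num [abs_of_pos]⟩
    simp only at h0 h1 h2
    rw [lamInt_duplication, neg_add, Complex.exp_add, h1, h2] at h0
    have e1 : Complex.cosh (Real.pi * (I / 4) / 1) = Complex.cos (Real.pi / 4) := by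
      rw [← Complex.cosh_mul_I]; congr 1; ring
    have e2 : Complex.cosh (Real.pi * -(I / 4) / 1) = Complex.cos (Real.pi / 4) := by
      rw [← Complex.cosh_mul_I, ← Complex.cosh_neg]; congr 1; ring
    have e3 : Complex.cos (Real.pi / 4) * Complex.cos (Real.pi / 4) = 1 / 2 := by
      have : (Complex.cos (Real.pi / 4)) = ((Real.cos (Real.pi / 4) : ℝ) : ℂ) := by push_cast; rfl
      rw [this, Real.cos_pi_div_four, ← Complex.ofReal_mul]
      have : √2 / 2 * (√2 / 2) = 1 / 2 := by
        rw [div_mul_div_comm, Real.mul_self_sqrt two_pos.le]; norm_num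
      rw [this]; simp
    rw [e1, e2, mul_zero, zero_div, Complex.cosh_zero] at h0
    have hne := Complex.exp_ne_zero (-lamInt 1 0)
    apply mul_left_cancel₀ hne
    linear_combination 2 * h0 - 2 * Complex.exp (-lamInt 1 0) ^ 2 * e3
  rw [exp_neg_lamInt_aux (q := (w, z)) ⟨hw, h⟩, key]

theorem two_cosh_ne_zero {w z : ℂ} (hw : 0 < w.re) (h : |z.im| < w.re / 2) :
    2 * Complex.cosh (Real.pi * z / w) ≠ 0 := by
  rw [← exp_neg_lamInt hw h]
  exact Complex.exp_ne_zero _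

theorem gammaStrip_shift {w₁ w₂ z : ℂ} (h₁ : 0 < w₁.re) (h₂ : 0 < w₂.re) (h : |z.im| < w₂.re / 2) :
    gammaStrip w₁ w₂ (z + I * w₁ / 2) =
      2 * Complex.cosh (Real.pi * z / w₂) * gammaStrip w₁ w₂ (z - I * w₁ / 2) := by
  rw [← exp_neg_lamInt h₂ h, gammaStrip, gammaStrip, ← Complex.exp_add]
  congr 1
  have := gInt_shift h₁ h₂ h
  linear_combination I * this + lamInt w₂ z * Complex.I_sq

theorem hasDerivAt_lamInt_tanh {w z : ℂ} (hw : 0 < w.re) (h : |z.im| < w.re / 2) :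
    HasDerivAt (lamInt w) (-(Real.pi / w * Complex.tanh (Real.pi * z / w))) z := by
  obtain ⟨-, hd⟩ := hasDerivAt_lamInt hw h
  have h1 := hd.neg.cexp
  have h2 : HasDerivAt (fun z : ℂ => 2 * Complex.cosh (Real.pi * z / w))
      (2 * (Complex.sinh (Real.pi * z / w) * (Real.pi / w))) z := by
    refine ((((hasDerivAt_id' z).const_mul (Real.pi : ℂ)).div_const w).ccosh.const_mul 2).congr_deriv ?_
    rw [mul_one]
  have hev : (fun z => Complex.exp (-lamInt w z)) =ᶠ[𝓝 z] fun z => 2 * Complex.cosh (Real.pi * z / w) := by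
    have : ∀ᶠ x : ℂ in 𝓝 z, |x.im| < w.re / 2 :=
      (by fun_prop : Continuous fun x : ℂ => |x.im|).continuousAt.eventually_lt_const h
    filter_upwards [this] with x hx
    exact exp_neg_lamInt hw hx
  have h3 := (h2.congr_of_eventuallyEq hev).unique h1
  have hne := two_cosh_ne_zero hw h
  have hne' : Complex.cosh (Real.pi * z / w) ≠ 0 := right_ne_zero_of_mul hne
  refine hd.congr_deriv ?_
  simp only [Pi.neg_apply] at h3
  rw [exp_neg_lamInt hw h] at h3
  generalize (-2 * ∫ y in Set.Ioi (0 : ℝ), Complex.sin (2 * y * z) / Complex.sinh (w * y)) = J at *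
  rw [Complex.tanh_eq_sinh_div_cosh]
  generalize Complex.cosh (Real.pi * z / w) = T at *
  generalize Complex.sinh (Real.pi * z / w) = T' at *
  have : J = -(T' * (Real.pi / w)) / T := by
    rw [eq_div_iff hne']
    linear_combination (1 / 2) * h3
  rw [this]
  ring

theorem integral_sin_div_sinh_eq {w z : ℂ} (hw : 0 < w.re) (h : |z.im| < w.re / 2) :
    ∫ y in Set.Ioi (0 : ℝ), Complex.sin (2 * y * z) / Complex.sinh (w * y) =
      Real.pi / (2 * w) * Complex.tanh (Real.pi * z / w) := by
  have := (hasDerivAt_lamInt hw h).2.unique (hasDerivAt_lamInt_tanh hw h)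
  linear_combination (-1 / 2) * this

end ShiftFactor

end AskeyWilson

namespace AskeyWilson

open MeasureTheory Filter Topology Metric
open Complex (I)

/-! ### Asymptotics of the hyperbolic gamma function on the strip -/

section Asymptotics

/-- Difference of the hyperbolic kernels with periods `w₁, w₂` and with the comparison period. -/
noncomputable def sinhRem (κ : ℝ) (w : ℂ × ℂ) (y : ℝ) : ℂ :=
  w.1 * w.2 / (Complex.sinh (w.1 * y) * Complex.sinh (w.2 * y)) -
    κ ^ 2 * Complex.cosh (κ * y) / Complex.sinh (κ * y) ^ 2

/-- `sinhRem` with its singularity at `y = 0` removed. -/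
noncomputable def sinhRemRegular (κ : ℝ) (x : (ℂ × ℂ) × ℝ) : ℂ :=
  (2 * κ ^ 2 * shAux (κ * x.2) + κ ^ 4 * x.2 ^ 2 * shAux (κ * x.2) ^ 2 - κ ^ 2 * chAux (κ * x.2) -
    (1 + κ ^ 2 * x.2 ^ 2 * chAux (κ * x.2)) *
      (x.1.1 ^ 2 * shAux (x.1.1 * x.2) + x.1.2 ^ 2 * shAux (x.1.2 * x.2) +
        x.1.1 ^ 2 * x.1.2 ^ 2 * x.2 ^ 2 * shAux (x.1.1 * x.2) * shAux (x.1.2 * x.2))) /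
    ((1 + (x.1.1 * x.2) ^ 2 * shAux (x.1.1 * x.2)) *
      (1 + (x.1.2 * x.2) ^ 2 * shAux (x.1.2 * x.2)) *
      (1 + (κ * x.2) ^ 2 * shAux (κ * x.2)) ^ 2)

theorem sinhRem_aux {w₁ w₂ y k a b c d P Q D : ℂ} (h₁ : w₁ ≠ 0) (h₂ : w₂ ≠ 0) (hy : y ≠ 0)
    (hk : k ≠ 0) (hP : P ≠ 0) (hQ : Q ≠ 0) (hD : D ≠ 0) (eP : P = 1 + (w₁ * y) ^ 2 * a)
    (eQ : Q = 1 + (w₂ * y) ^ 2 * b) (eD : D = 1 + (k * y) ^ 2 * d) :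
    w₁ * w₂ / ((w₁ * y * P) * (w₂ * y * Q)) - k ^ 2 * (1 + (k * y) ^ 2 * c) / (k * y * D) ^ 2 =
    (2 * k ^ 2 * d + k ^ 4 * y ^ 2 * d ^ 2 - k ^ 2 * c - (1 + k ^ 2 * y ^ 2 * c) *
      (w₁ ^ 2 * a + w₂ ^ 2 * b + w₁ ^ 2 * w₂ ^ 2 * y ^ 2 * a * b)) / (P * Q * D ^ 2) := by
  field_simp
  rw [eP, eQ, eD]
  ring

theorem sinhRem_eq_regular {κ : ℝ} (hκ : 0 < κ) {w : ℂ × ℂ} (h₁ : 0 < w.1.re) (h₂ : 0 < w.2.re)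
    {y : ℝ} (hy : y ≠ 0) : sinhRem κ w y = sinhRemRegular κ (w, y) := by
  obtain ⟨w₁, w₂⟩ := w
  simp only at h₁ h₂
  have hκ' : 0 < (κ : ℂ).re := by simpa using hκ
  simp only [sinhRem, sinhRemRegular]
  rw [sinh_eq_shAux (w₁ * y), sinh_eq_shAux (w₂ * y), sinh_eq_shAux (κ * y), cosh_eq_chAux (κ * y)]
  exact sinhRem_aux (ne_zero_of_re_pos h₁) (ne_zero_of_re_pos h₂) (by exact_mod_cast hy)
    (ne_zero_of_re_pos hκ') (one_add_shAux_ne_zero h₁ y) (one_add_shAux_ne_zero h₂ y)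
    (one_add_shAux_ne_zero hκ' y) rfl rfl rfl

theorem continuousAt_sinhRemRegular {κ : ℝ} (hκ : 0 < κ) {w : ℂ × ℂ} (h₁ : 0 < w.1.re)
    (h₂ : 0 < w.2.re) (y : ℝ) : ContinuousAt (sinhRemRegular κ) (w, y) := by
  have hsh : Continuous shAux := differentiable_shAux.continuous
  have hch : Continuous chAux := differentiable_chAux.continuous
  have hκ' : 0 < (κ : ℂ).re := by simpa using hκ
  unfold sinhRemRegular
  refine ContinuousAt.div (by fun_prop) (by fun_prop) ?_
  exact mul_ne_zero (mul_ne_zero (one_add_shAux_ne_zero h₁ y) (one_add_shAux_ne_zero h₂ y))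
    (pow_ne_zero _ (one_add_shAux_ne_zero hκ' y))

theorem norm_cos_two_mul_le {z : ℂ} {b y : ℝ} (hz : |z.im| ≤ b) (hy : 0 < y) :
    ‖Complex.cos (2 * y * z)‖ ≤ Real.exp (2 * b * y) := by
  refine (norm_cos_le_exp _).trans (Real.exp_le_exp.2 ?_)
  have : (2 * (y : ℂ) * z).im = 2 * y * z.im := by
    rw [show (2 * (y : ℂ) * z) = ((2 * y : ℝ) : ℂ) * z by push_cast; ring,
      Complex.im_ofReal_mul]
  rw [this, abs_mul, abs_of_pos (by positivity)]
  nlinarith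

set_option maxHeartbeats 800000 in
-- Both kernels are `1 / y²` up to a bounded term at `y = 0`, so the difference is bounded there.
-- For large `y` they decay at the rates `Re w₁ + Re w₂` and `κ`, each above the growth rate `2b` of
-- the cosine.
theorem eventually_norm_cos_mul_sinhRem_le {w : ℂ × ℂ} (h₁ : 0 < w.1.re) (h₂ : 0 < w.2.re)
    {b κ : ℝ} (hb : 0 ≤ b) (hbw : 2 * b < w.1.re + w.2.re) (hbκ : 2 * b < κ) :
    ∃ A δ B, 0 < δ ∧ ∀ᶠ x in 𝓝 w, ∀ z : ℂ, |z.im| ≤ b → ∀ y : ℝ, 0 < y →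
      ‖Complex.cos (2 * y * z) * sinhRem κ x y‖ ≤ tailBound A δ B y := by
  have hκ : 0 < κ := by linarith
  obtain ⟨η, hη, hη1, hη2, hη3, hη4⟩ : ∃ η > 0, η < w.1.re ∧ η < w.2.re ∧
      2 * b + η < (w.1.re - η) + (w.2.re - η) ∧ 2 * b + η < κ := by
    refine ⟨min (min (w.1.re / 2) (w.2.re / 2)) (min ((w.1.re + w.2.re - 2 * b) / 6) ((κ - 2 * b) / 2)),
      ?_, ?_, ?_, ?_, ?_⟩
    · refine lt_min (lt_min (by linarith) (by linarith)) (lt_min (by linarith) (by linarith))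
    · exact ((min_le_left _ _).trans (min_le_left _ _)).trans_lt (by linarith)
    · exact ((min_le_left _ _).trans (min_le_right _ _)).trans_lt (by linarith)
    · have := (min_le_right (min (w.1.re / 2) (w.2.re / 2))
        (min ((w.1.re + w.2.re - 2 * b) / 6) ((κ - 2 * b) / 2))).trans (min_le_left _ _)
      linarith
    · have := (min_le_right (min (w.1.re / 2) (w.2.re / 2))
        (min ((w.1.re + w.2.re - 2 * b) / 6) ((κ - 2 * b) / 2))).trans (min_le_right _ _)
      linarith
  set a₁ := w.1.re - η
  set a₂ := w.2.re - η
  have ha₁ : 0 < a₁ := by simp only [a₁]; linarith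
  have ha₂ : 0 < a₂ := by simp only [a₂]; linarith
  obtain ⟨C, hC⟩ := eventually_bounded_of_isCompact (f := sinhRemRegular κ) (x := w)
    (isCompact_Icc (a := (0 : ℝ)) (b := 1)) fun y _ => continuousAt_sinhRemRegular hκ h₁ h₂ y
  set D := (Real.sinh a₁)⁻¹ * Real.exp a₁ with hD
  set D' := (Real.sinh a₂)⁻¹ * Real.exp a₂ with hD'
  set D'' := (Real.sinh κ)⁻¹ * Real.exp κ with hD''
  have hs1 : 0 < Real.sinh a₁ := Real.sinh_pos_iff.2 ha₁
  have hs2 : 0 < Real.sinh a₂ := Real.sinh_pos_iff.2 ha₂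
  have hs3 : 0 < Real.sinh κ := Real.sinh_pos_iff.2 hκ
  have hD0 : 0 ≤ D := by positivity
  have hD0' : 0 ≤ D' := by positivity
  have hD0'' : 0 ≤ D'' := by positivity
  set M := ‖w.1 * w.2‖ + 1
  have hM : 0 ≤ M := by positivity
  have e1 : ∀ᶠ x : ℂ × ℂ in 𝓝 w, a₁ < x.1.re :=
    (by fun_prop : Continuous fun x : ℂ × ℂ => x.1.re).continuousAt.eventually_const_lt
      (by simp only [a₁]; linarith)
  have e2 : ∀ᶠ x : ℂ × ℂ in 𝓝 w, a₂ < x.2.re :=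
    (by fun_prop : Continuous fun x : ℂ × ℂ => x.2.re).continuousAt.eventually_const_lt
      (by simp only [a₂]; linarith)
  have e3 : ∀ᶠ x : ℂ × ℂ in 𝓝 w, ‖x.1 * x.2‖ < M :=
    (by fun_prop : Continuous fun x : ℂ × ℂ => ‖x.1 * x.2‖).continuousAt.eventually_lt_const
      (by simp only [M]; linarith)
  refine ⟨M * D * D' + κ ^ 2 * D'' ^ 2, η, 2 * (Real.exp (2 * b) * |C|), hη, ?_⟩
  filter_upwards [hC, e1, e2, e3] with x hxC hx1 hx2 hx3 z hz y hy
  have hx1' : 0 < x.1.re := ha₁.trans hx1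
  have hx2' : 0 < x.2.re := ha₂.trans hx2
  have hcos := norm_cos_two_mul_le hz hy
  have hA : 0 ≤ (M * D * D' + κ ^ 2 * D'' ^ 2) * Real.exp (-η * y) := by positivity
  have hB : 0 ≤ 2 * (Real.exp (2 * b) * |C|) * (1 + y ^ 2)⁻¹ := by positivity
  unfold tailBound
  rcases le_total y 1 with hy1 | hy1
  · rw [sinhRem_eq_regular hκ hx1' hx2' hy.ne', norm_mul]
    have h5 := (hxC y ⟨le_of_lt hy, hy1⟩).trans (le_abs_self C)
    have h6 : (1 : ℝ) / 2 ≤ (1 + y ^ 2)⁻¹ := by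
      rw [inv_eq_one_div]
      exact one_div_le_one_div_of_le (by positivity) (by nlinarith)
    have h7 : Real.exp (2 * b * y) ≤ Real.exp (2 * b) := Real.exp_le_exp.2 (by nlinarith)
    have h8 : ‖Complex.cos (2 * y * z)‖ * ‖sinhRemRegular κ (x, y)‖ ≤ Real.exp (2 * b) * |C| := by
      gcongr
      exact hcos.trans h7
    have h9 : 0 ≤ Real.exp (2 * b) * |C| := by positivity
    nlinarith
  · have hy0 : 0 < y := hy
    have i1 := norm_inv_sinh_le ha₁ hx1.le hy1
    have i2 := norm_inv_sinh_le ha₂ hx2.le hy1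
    have i3 := norm_inv_sinh_le hκ (w := κ) (by simp) hy1
    have i4 : ‖Complex.cosh (κ * y)‖ ≤ Real.exp (κ * y) := by
      rw [← Complex.ofReal_mul, ← Complex.ofReal_cosh, Complex.norm_real,
        Real.norm_of_nonneg (Real.cosh_pos _).le, Real.cosh_eq]
      have : Real.exp (-(κ * y)) ≤ Real.exp (κ * y) := Real.exp_le_exp.2 (by nlinarith)
      linarith
    have hT1 : ‖x.1 * x.2 / (Complex.sinh (x.1 * y) * Complex.sinh (x.2 * y))‖ ≤
        M * D * D' * Real.exp (-(a₁ + a₂) * y) := by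
      rw [div_eq_mul_inv, mul_inv, norm_mul, norm_mul (Complex.sinh (x.1 * y))⁻¹]
      calc _ ≤ M * ((D * Real.exp (-a₁ * y)) * (D' * Real.exp (-a₂ * y))) :=
            mul_le_mul hx3.le (mul_le_mul i1 i2 (norm_nonneg _) (by positivity)) (by positivity) hM
        _ = M * D * D' * Real.exp (-a₁ * y + -a₂ * y) := by rw [Real.exp_add]; ring
        _ = _ := by ring_nf
    have hT2 : ‖κ ^ 2 * Complex.cosh (κ * y) / Complex.sinh (κ * y) ^ 2‖ ≤
        κ ^ 2 * D'' ^ 2 * Real.exp (-κ * y) := by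
      rw [div_eq_mul_inv, ← inv_pow, norm_mul, norm_mul, norm_pow, norm_pow, Complex.norm_real,
        Real.norm_of_nonneg hκ.le]
      calc _ ≤ κ ^ 2 * Real.exp (κ * y) * (D'' * Real.exp (-κ * y)) ^ 2 := by
            gcongr
        _ = κ ^ 2 * D'' ^ 2 * Real.exp (κ * y + -κ * y + -κ * y) := by
            rw [Real.exp_add, Real.exp_add]; ring
        _ = _ := by ring_nf
    have hE1 : Real.exp (2 * b * y) * Real.exp (-(a₁ + a₂) * y) ≤ Real.exp (-η * y) := by
      rw [← Real.exp_add]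
      exact Real.exp_le_exp.2 (by nlinarith)
    have hE2 : Real.exp (2 * b * y) * Real.exp (-κ * y) ≤ Real.exp (-η * y) := by
      rw [← Real.exp_add]
      exact Real.exp_le_exp.2 (by nlinarith)
    rw [norm_mul, sinhRem]
    calc _ ≤ Real.exp (2 * b * y) * (M * D * D' * Real.exp (-(a₁ + a₂) * y) +
          κ ^ 2 * D'' ^ 2 * Real.exp (-κ * y)) := by
          gcongr
          exact (norm_sub_le _ _).trans (add_le_add hT1 hT2)
      _ = M * D * D' * (Real.exp (2 * b * y) * Real.exp (-(a₁ + a₂) * y)) +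
          κ ^ 2 * D'' ^ 2 * (Real.exp (2 * b * y) * Real.exp (-κ * y)) := by ring
      _ ≤ M * D * D' * Real.exp (-η * y) + κ ^ 2 * D'' ^ 2 * Real.exp (-η * y) := by gcongr
      _ = (M * D * D' + κ ^ 2 * D'' ^ 2) * Real.exp (-η * y) := by ring
      _ ≤ _ := by linarith

theorem continuousOn_cos_mul_sinhRem {κ : ℝ} (hκ : 0 < κ) {w : ℂ × ℂ} (h₁ : 0 < w.1.re)
    (h₂ : 0 < w.2.re) (z : ℂ) :
    ContinuousOn (fun y : ℝ => Complex.cos (2 * y * z) * sinhRem κ w y) (Set.Ioi 0) := by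
  intro y hy
  have hy' : y ≠ 0 := ne_of_gt hy
  have hκ' : 0 < (κ : ℂ).re := by simpa using hκ
  have e1 := sinh_mul_ne_zero h₁ hy'
  have e2 := sinh_mul_ne_zero h₂ hy'
  have e3 := sinh_mul_ne_zero hκ' hy'
  refine ContinuousAt.continuousWithinAt ?_
  unfold sinhRem
  refine ContinuousAt.mul (by fun_prop) (ContinuousAt.sub ?_ ?_)
  · exact ContinuousAt.div (by fun_prop) (by fun_prop) (mul_ne_zero e1 e2)
  · exact ContinuousAt.div (by fun_prop) (by fun_prop) (pow_ne_zero 2 e3)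

/-- The antiderivative entering the integration by parts. -/
theorem tendsto_boundary_term {κ : ℝ} (hκ : 0 < κ) {z : ℂ} (h : |z.im| < κ / 2) :
    ContinuousWithinAt (fun y : ℝ => 1 / (y : ℂ) - κ * Complex.cos (2 * y * z) / Complex.sinh (κ * y))
      (Set.Ici 0) 0 ∧
    Tendsto (fun y : ℝ => 1 / (y : ℂ) - κ * Complex.cos (2 * y * z) / Complex.sinh (κ * y))
      atTop (𝓝 0) := by
  have hκ' : 0 < (κ : ℂ).re := by simpa using hκ
  constructor
  · have hsh : Continuous shAux := differentiable_shAux.continuous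
    have hch : Continuous chAux := differentiable_chAux.continuous
    have heq : (fun y : ℝ => 1 / (y : ℂ) - κ * Complex.cos (2 * y * z) / Complex.sinh (κ * y)) =
        fun y : ℝ => y * (κ ^ 2 * shAux (κ * y) + 4 * z ^ 2 * chAux (2 * y * z * I)) /
          (1 + (κ * y) ^ 2 * shAux (κ * y)) := by
      funext y
      by_cases hy : y = 0
      · simp [hy]
      have hy' : (y : ℂ) ≠ 0 := by exact_mod_cast hy
      have hD := one_add_shAux_ne_zero hκ' y
      have hc : Complex.cos (2 * y * z) = 1 - (2 * y * z) ^ 2 * chAux (2 * y * z * I) := by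
        rw [← Complex.cosh_mul_I, cosh_eq_chAux, mul_pow, Complex.I_sq]; ring
      have hκ0 := ne_zero_of_re_pos hκ'
      rw [hc, sinh_eq_shAux]
      generalize hD' : 1 + ((κ : ℂ) * y) ^ 2 * shAux (κ * y) = D at *
      have : (κ : ℂ) ^ 2 * shAux (κ * y) = (D - 1) / y ^ 2 := by
        rw [← hD']; field_simp; ring
      rw [this]
      field_simp
      ring
    rw [heq]
    refine ContinuousAt.continuousWithinAt (ContinuousAt.div (by fun_prop) (by fun_prop) ?_)
    simp
  · have h1 : Tendsto (fun y : ℝ => 1 / (y : ℂ)) atTop (𝓝 0) := by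
      have : Tendsto (fun y : ℝ => ((y⁻¹ : ℝ) : ℂ)) atTop (𝓝 ((0 : ℝ) : ℂ)) :=
        (Complex.continuous_ofReal.tendsto 0).comp tendsto_inv_atTop_zero
      simpa using this
    have h2 : Tendsto (fun y : ℝ => κ * Complex.cos (2 * y * z) / Complex.sinh (κ * y)) atTop (𝓝 0) := by
      have hlim : Tendsto (fun y : ℝ => κ * ((Real.sinh κ)⁻¹ * Real.exp κ) *
          Real.exp (-((κ - 2 * |z.im|) * y))) atTop (𝓝 0) := by
        have : Tendsto (fun y : ℝ => (κ - 2 * |z.im|) * y) atTop atTop :=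
          tendsto_id.const_mul_atTop (by linarith)
        simpa using (Real.tendsto_exp_neg_atTop_nhds_zero.comp this).const_mul
          (κ * ((Real.sinh κ)⁻¹ * Real.exp κ))
      refine squeeze_zero_norm' ?_ hlim
      filter_upwards [eventually_ge_atTop 1] with y hy
      have i3 := norm_inv_sinh_le hκ (w := κ) (by simp) hy
      have i4 := norm_cos_two_mul_le (z := z) le_rfl (zero_lt_one.trans_le hy)
      rw [div_eq_mul_inv, norm_mul, norm_mul, Complex.norm_real, Real.norm_of_nonneg hκ.le]
      have hs3 : 0 < Real.sinh κ := Real.sinh_pos_iff.2 hκ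
      calc _ ≤ κ * Real.exp (2 * |z.im| * y) *
            ((Real.sinh κ)⁻¹ * Real.exp κ * Real.exp (-κ * y)) := by gcongr
        _ = κ * ((Real.sinh κ)⁻¹ * Real.exp κ) * Real.exp (2 * |z.im| * y + -κ * y) := by
            rw [Real.exp_add]; ring
        _ = _ := by ring_nf
    simpa using h1.sub h2

/-- Integration by parts: the boundary function has the integrand plus `2zκ sin(2yz) / sinh(κy)` as
derivative, and the integral of the latter is known. The boundary function tends to `0` at both
ends; at `y = 0` its value is also `0`, through division by zero, so continuity there holds as
stated. -/
theorem integral_cosh_div_sinh_sq {κ : ℝ} (hκ : 0 < κ) {z : ℂ} (h : |z.im| < κ / 2)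
    (hi : IntegrableOn (fun y : ℝ => Complex.cos (2 * y * z) *
      (κ ^ 2 * Complex.cosh (κ * y) / Complex.sinh (κ * y) ^ 2) - 1 / (y : ℂ) ^ 2) (Set.Ioi 0)) :
    ∫ y in Set.Ioi (0 : ℝ), (Complex.cos (2 * y * z) *
      (κ ^ 2 * Complex.cosh (κ * y) / Complex.sinh (κ * y) ^ 2) - 1 / (y : ℂ) ^ 2) =
      -(Real.pi * z * Complex.tanh (Real.pi * z / κ)) := by
  have hκ' : 0 < (κ : ℂ).re := by simpa using hκ
  have hz : |z.im| < (κ : ℂ).re / 2 := by simpa using h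
  have hs := (hasDerivAt_lamInt hκ' hz).1
  obtain ⟨h0, hlim⟩ := tendsto_boundary_term hκ h
  have hder : ∀ y ∈ Set.Ioi (0 : ℝ), HasDerivAt
      (fun y : ℝ => 1 / (y : ℂ) - κ * Complex.cos (2 * y * z) / Complex.sinh (κ * y))
      ((Complex.cos (2 * y * z) * (κ ^ 2 * Complex.cosh (κ * y) / Complex.sinh (κ * y) ^ 2)
        - 1 / (y : ℂ) ^ 2) + 2 * z * κ * (Complex.sin (2 * y * z) / Complex.sinh (κ * y))) y := by
    intro y hy
    have hy' : (y : ℂ) ≠ 0 := by exact_mod_cast (ne_of_gt hy)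
    have hsn := sinh_mul_ne_zero hκ' (ne_of_gt hy)
    have d1 : HasDerivAt (fun u : ℂ => 1 / u) (-1 / (y : ℂ) ^ 2) y := by
      have := hasDerivAt_inv hy'
      simp only [one_div]
      exact this.congr_deriv (by rw [neg_div, one_div])
    have d2 : HasDerivAt (fun u : ℂ => (κ : ℂ) * Complex.cos (2 * u * z))
        (κ * (-Complex.sin (2 * y * z) * (2 * z))) y := by
      have := ((((hasDerivAt_id' (y : ℂ)).const_mul (2 : ℂ)).mul_const z).ccos).const_mul (κ : ℂ)
      rwa [mul_one] at this
    have d3 : HasDerivAt (fun u : ℂ => Complex.sinh (κ * u)) (Complex.cosh (κ * y) * κ) y := by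
      have := ((hasDerivAt_id' (y : ℂ)).const_mul (κ : ℂ)).csinh
      rwa [mul_one] at this
    have d4 := (d1.fun_sub (d2.fun_div d3 hsn)).comp_ofReal
    refine d4.congr_deriv ?_
    generalize Complex.sinh (κ * y) = S at *
    generalize Complex.cosh (κ * y) = T at *
    field_simp
    ring
  have := integral_Ioi_of_hasDerivAt_of_tendsto h0 hder (hi.add (hs.const_mul _)) hlim
  rw [integral_add hi (hs.const_mul _), integral_const_mul, integral_sin_div_sinh_eq hκ' hz] at this
  have hκ0 := ne_zero_of_re_pos hκ'
  simp only [Complex.ofReal_zero, div_zero, mul_zero, Complex.sinh_zero, sub_zero] at this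
  rw [eq_neg_of_add_eq_zero_left this]
  field_simp

/-- The quantity estimated is `∫ cos(2yz) sinhRem(y) dy`, because the kernel with the single period
`κ` integrates exactly to a hyperbolic tangent. The estimate depends on `z` only through `|Im z| ≤
b`, hence is uniform as `Re z → ∞`. -/
theorem eventually_norm_deriv_gInt_le {w : ℂ × ℂ} (h₁ : 0 < w.1.re) (h₂ : 0 < w.2.re)
    {b κ : ℝ} (hb : 0 ≤ b) (hbw : 2 * b < w.1.re + w.2.re) (hbκ : 2 * b < κ) :
    ∃ K, ∀ᶠ x in 𝓝 w, ∀ z : ℂ, |z.im| ≤ b → ∃ g',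
      HasDerivAt (gInt x.1 x.2) g' z ∧
        ‖x.1 * x.2 * g' + Real.pi * z * Complex.tanh (Real.pi * z / κ)‖ ≤ K := by
  have hκ : 0 < κ := by linarith
  have hκ' : 0 < (κ : ℂ).re := by simpa using hκ
  obtain ⟨A, δ, B, hδ, hev⟩ := eventually_norm_cos_mul_sinhRem_le h₁ h₂ hb hbw hbκ
  obtain ⟨A', δ', B', hδ', hev'⟩ := eventually_norm_cos_mul_sinhRem_le (w := ((κ : ℂ), (κ : ℂ)))
    hκ' hκ' hb (by simp; linarith) hbκ
  refine ⟨∫ y in Set.Ioi 0, tailBound A δ B y, ?_⟩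
  have e1 : ∀ᶠ x : ℂ × ℂ in 𝓝 w, 0 < x.1.re :=
    (by fun_prop : Continuous fun x : ℂ × ℂ => x.1.re).continuousAt.eventually_const_lt h₁
  have e2 : ∀ᶠ x : ℂ × ℂ in 𝓝 w, 0 < x.2.re :=
    (by fun_prop : Continuous fun x : ℂ × ℂ => x.2.re).continuousAt.eventually_const_lt h₂
  have e3 : ∀ᶠ x : ℂ × ℂ in 𝓝 w, 2 * b < x.1.re + x.2.re :=
    (by fun_prop : Continuous fun x : ℂ × ℂ => x.1.re + x.2.re).continuousAt.eventually_const_lt hbw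
  filter_upwards [hev, e1, e2, e3] with x hx hx1 hx2 hx3 z hz
  obtain ⟨i1, hd⟩ := hasDerivAt_gInt (mem_stripDomain hx1 hx2 (z := z) (by linarith))
  refine ⟨_, hd, ?_⟩
  have int : IntegrableOn (fun y : ℝ => Complex.cos (2 * y * z) * sinhRem κ x y) (Set.Ioi 0) := by
    refine Integrable.mono' (integrableOn_tailBound (A := A) (B := B) hδ)
      ((continuousOn_cos_mul_sinhRem hκ hx1 hx2 z).aestronglyMeasurable measurableSet_Ioi) ?_
    filter_upwards [ae_restrict_mem measurableSet_Ioi] with y hy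
    exact hx z hz y hy
  have key : ∀ y ∈ Set.Ioi (0 : ℝ), x.1 * x.2 * (Complex.cos (2 * y * z) /
      (Complex.sinh (x.1 * y) * Complex.sinh (x.2 * y)) - 1 / (x.1 * x.2 * y ^ 2)) -
      Complex.cos (2 * y * z) * sinhRem κ x y = Complex.cos (2 * y * z) *
      (κ ^ 2 * Complex.cosh (κ * y) / Complex.sinh (κ * y) ^ 2) - 1 / (y : ℂ) ^ 2 := by
    intro y hy
    have n1 := ne_zero_of_re_pos hx1
    have n2 := ne_zero_of_re_pos hx2
    have hy' : (y : ℂ) ≠ 0 := by exact_mod_cast (ne_of_gt hy)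
    have : x.1 * x.2 * (1 / (x.1 * x.2 * y ^ 2)) = 1 / (y : ℂ) ^ 2 := by field_simp
    rw [mul_sub, this, sinhRem]
    ring
  have i2 := i1.const_mul (x.1 * x.2)
  have hi := (integrableOn_congr_fun key measurableSet_Ioi).1 (i2.sub int)
  have hval := integral_cosh_div_sinh_sq hκ (z := z) (by linarith) hi
  rw [← setIntegral_congr_fun measurableSet_Ioi key, integral_sub i2 int, integral_const_mul] at hval
  rw [sub_eq_iff_eq_add] at hval
  rw [hval, add_assoc, add_comm, add_assoc, add_neg_cancel, add_zero]
  refine norm_integral_le_of_norm_le (integrableOn_tailBound hδ) ?_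
  filter_upwards [ae_restrict_mem measurableSet_Ioi] with y hy
  exact hx z hz y hy

theorem norm_tanh_sub_one_le {u : ℂ} (h : 0 < u.re) :
    ‖Complex.tanh u - 1‖ * (1 - Real.exp (-2 * u.re)) ≤ 2 * Real.exp (-2 * u.re) := by
  have hn : ‖Complex.exp (-2 * u)‖ = Real.exp (-2 * u.re) := by
    rw [Complex.norm_exp]; simp
  have hlt : Real.exp (-2 * u.re) < 1 := by
    rw [Real.exp_lt_one_iff]; linarith
  have h1 : 1 - Real.exp (-2 * u.re) ≤ ‖1 + Complex.exp (-2 * u)‖ := by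
    rw [← hn]
    have := norm_sub_le (1 + Complex.exp (-2 * u)) (Complex.exp (-2 * u))
    rw [add_sub_cancel_right, norm_one] at this
    linarith
  have hne : 1 + Complex.exp (-2 * u) ≠ 0 := by
    intro h0
    rw [h0, norm_zero] at h1
    linarith
  have e1 : Complex.exp u * Complex.exp (-u) = 1 := by rw [← Complex.exp_add]; simp
  have e2 : Complex.exp (-2 * u) = Complex.exp (-u) * Complex.exp (-u) := by
    rw [← Complex.exp_add]; ring_nf
  have hch : Complex.exp u + Complex.exp (-u) ≠ 0 := by
    have : Complex.exp u + Complex.exp (-u) = Complex.exp u * (1 + Complex.exp (-2 * u)) := by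
      rw [e2]; linear_combination -Complex.exp (-u) * e1
    rw [this]
    exact mul_ne_zero (Complex.exp_ne_zero _) hne
  have h2 : Complex.tanh u - 1 = -2 * Complex.exp (-2 * u) / (1 + Complex.exp (-2 * u)) := by
    rw [Complex.tanh_eq_sinh_div_cosh, Complex.sinh, Complex.cosh, div_div_div_cancel_right₀ two_ne_zero,
      div_sub_one hch, div_eq_div_iff hch hne, e2]
    linear_combination 2 * Complex.exp (-u) * e1
  rw [h2, norm_div, norm_mul, hn]
  simp only [norm_neg, Complex.norm_ofNat]
  calc _ ≤ 2 * Real.exp (-2 * u.re) / ‖1 + Complex.exp (-2 * u)‖ * ‖1 + Complex.exp (-2 * u)‖ := by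
        gcongr
    _ = _ := div_mul_cancel₀ _ (norm_ne_zero_iff.2 hne)

end Asymptotics

end AskeyWilson

namespace AskeyWilson

open MeasureTheory Filter Topology Metric
open Complex (I)

/-! ### Slow variation of the gamma function against a Gaussian. -/

section Ratio

theorem mul_norm_tanh_sub_one_le {b κ : ℝ} (hb : 0 ≤ b) (hκ : 0 < κ) :
    ∃ K, ∀ z : ℂ, 1 ≤ z.re → |z.im| ≤ b → ‖z‖ * ‖Complex.tanh (Real.pi * z / κ) - 1‖ ≤ K := by
  set c := 2 * Real.pi / κ with hc
  have hc0 : 0 < c := by positivity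
  have hlt : Real.exp (-c) < 1 := by rw [Real.exp_lt_one_iff]; linarith
  refine ⟨(1 / c + b) * 2 / (1 - Real.exp (-c)), fun z hz hz' => ?_⟩
  have hre : -2 * (Real.pi * z / κ : ℂ).re = -(c * z.re) := by
    rw [show (Real.pi * z / κ : ℂ) = ((Real.pi / κ : ℝ) : ℂ) * z by push_cast; ring,
      Complex.re_ofReal_mul, hc]
    ring
  have hpos : 0 < (Real.pi * z / κ : ℂ).re := by nlinarith
  have h1 := norm_tanh_sub_one_le hpos
  rw [hre] at h1
  have h2 : Real.exp (-(c * z.re)) ≤ Real.exp (-c) := Real.exp_le_exp.2 (by nlinarith)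
  have h3 : ‖Complex.tanh (Real.pi * z / κ) - 1‖ * (1 - Real.exp (-c)) ≤ 2 * Real.exp (-(c * z.re)) := by
    refine le_trans ?_ h1
    gcongr
  rw [le_div_iff₀ (by linarith)]
  have h4 : ‖z‖ ≤ z.re + b := by
    have := Complex.norm_le_abs_re_add_abs_im z
    rw [abs_of_pos (by linarith)] at this
    linarith
  have h5 : (z.re + b) * Real.exp (-(c * z.re)) ≤ 1 / c + b := by
    have e1 : c * z.re ≤ Real.exp (c * z.re) := by linarith [Real.add_one_le_exp (c * z.re)]
    have e2 : Real.exp (c * z.re) * Real.exp (-(c * z.re)) = 1 := by rw [← Real.exp_add]; simp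
    have e3 : z.re * Real.exp (-(c * z.re)) ≤ 1 / c := by
      rw [le_div_iff₀ hc0, ← e2]
      nlinarith [Real.exp_pos (-(c * z.re))]
    have e4 : Real.exp (-(c * z.re)) ≤ 1 := by rw [Real.exp_le_one_iff]; nlinarith
    nlinarith
  calc ‖z‖ * ‖Complex.tanh (Real.pi * z / κ) - 1‖ * (1 - Real.exp (-c))
      = ‖z‖ * (‖Complex.tanh (Real.pi * z / κ) - 1‖ * (1 - Real.exp (-c))) := by ring
    _ ≤ (z.re + b) * (2 * Real.exp (-(c * z.re))) := by
        gcongr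
    _ = (z.re + b) * Real.exp (-(c * z.re)) * 2 := by ring
    _ ≤ _ := by gcongr

/-- The Gaussian factor compensating the growth of the hyperbolic gamma function. -/
noncomputable def gauss (w₁ w₂ z : ℂ) : ℂ := Complex.exp (I * Real.pi * z ^ 2 / (2 * w₁ * w₂))

/-- For `Re z ≥ 1` the logarithmic derivative of `G` is `-iπz/(w₁w₂)` up to a bounded term, and that
of `gauss` is `iπz/(w₁w₂)`. The product thus has bounded logarithmic derivative on a convex
half-strip, and the mean value inequality applies. -/
theorem exists_strip_ratio {w : ℂ × ℂ} (h₁ : 0 < w.1.re) (h₂ : 0 < w.2.re)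
    {b : ℝ} (hb : 0 ≤ b) (hbw : 2 * b < w.1.re + w.2.re) :
    ∃ K, ∀ᶠ x in 𝓝 w, ∀ z z' : ℂ, 1 ≤ z.re → |z.im| ≤ b → 1 ≤ z'.re → |z'.im| ≤ b →
      ‖gammaStrip x.1 x.2 z * gauss x.1 x.2 z‖ ≤
        Real.exp (K * ‖z - z'‖) * ‖gammaStrip x.1 x.2 z' * gauss x.1 x.2 z'‖ := by
  -- Any comparison period above `2b` would serve.
  set κ := 2 * b + 1 with hκ
  have hκ0 : 0 < κ := by positivity
  obtain ⟨K, hK⟩ := eventually_norm_deriv_gInt_le h₁ h₂ hb hbw (κ := κ) (by linarith)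
  obtain ⟨K', hK'⟩ := mul_norm_tanh_sub_one_le hb hκ0
  have n1 := ne_zero_of_re_pos h₁
  have n2 := ne_zero_of_re_pos h₂
  set M := ‖(w.1 * w.2)⁻¹‖ + 1
  have e1 : ∀ᶠ x : ℂ × ℂ in 𝓝 w, ‖(x.1 * x.2)⁻¹‖ < M := by
    have : ContinuousAt (fun x : ℂ × ℂ => ‖(x.1 * x.2)⁻¹‖) w :=
      
      (ContinuousAt.inv₀ (f := fun x : ℂ × ℂ => x.1 * x.2) (by fun_prop) (mul_ne_zero n1 n2)).norm
    exact this.eventually_lt_const (lt_add_one _)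
  have e2 : ∀ᶠ x : ℂ × ℂ in 𝓝 w, 0 < x.1.re :=
    (by fun_prop : Continuous fun x : ℂ × ℂ => x.1.re).continuousAt.eventually_const_lt h₁
  have e3 : ∀ᶠ x : ℂ × ℂ in 𝓝 w, 0 < x.2.re :=
    (by fun_prop : Continuous fun x : ℂ × ℂ => x.2.re).continuousAt.eventually_const_lt h₂
  refine ⟨(K + Real.pi * K') * M, ?_⟩
  filter_upwards [hK, e1, e2, e3] with x hx hx1 hx2 hx3 z z' hz1 hz2 hz1' hz2'
  have m1 := ne_zero_of_re_pos hx2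
  have m2 := ne_zero_of_re_pos hx3
  set Φ : ℂ → ℂ := fun z => I * gInt x.1 x.2 z + I * Real.pi * z ^ 2 / (2 * x.1 * x.2) with hΦ
  have hΦe : ∀ z, gammaStrip x.1 x.2 z * gauss x.1 x.2 z = Complex.exp (Φ z) := by
    intro z
    rw [hΦ, gammaStrip, gauss, ← Complex.exp_add]
  set s : Set ℂ := {z | 1 ≤ z.re ∧ |z.im| ≤ b} with hs
  have hconv : Convex ℝ s := by
    have c1 : Convex ℝ {z : ℂ | 1 ≤ z.re} := convex_halfSpace_re_ge 1
    have c2 : Convex ℝ {z : ℂ | z.im ≤ b} := convex_halfSpace_im_le b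
    have c3 : Convex ℝ {z : ℂ | -b ≤ z.im} := convex_halfSpace_im_ge (-b)
    have : s = {z : ℂ | 1 ≤ z.re} ∩ ({z : ℂ | -b ≤ z.im} ∩ {z : ℂ | z.im ≤ b}) := by
      ext z; simp [hs, abs_le]
    rw [this]
    exact c1.inter (c3.inter c2)
  have hder : ∀ z ∈ s, ∃ d, HasDerivAt Φ d z ∧ ‖d‖ ≤ (K + Real.pi * K') * M := by
    intro z hz
    obtain ⟨g', hg, hg'⟩ := hx z hz.2
    refine ⟨I * g' + I * Real.pi * (2 * z) / (2 * x.1 * x.2), ?_, ?_⟩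
    · have := (hg.const_mul I).fun_add ((((hasDerivAt_id' z).fun_pow 2).const_mul (I * Real.pi)).div_const
        (2 * x.1 * x.2))
      exact this.congr_deriv (by simp)
    · have : I * g' + I * Real.pi * (2 * z) / (2 * x.1 * x.2) =
          I * ((x.1 * x.2)⁻¹ * ((x.1 * x.2 * g' + Real.pi * z * Complex.tanh (Real.pi * z / κ)) -
            Real.pi * (z * (Complex.tanh (Real.pi * z / κ) - 1)))) := by
        field_simp
        ring
      rw [this, norm_mul, Complex.norm_I, one_mul, norm_mul, mul_comm]
      have hn : ‖Real.pi * (z * (Complex.tanh (Real.pi * z / κ) - 1))‖ ≤ Real.pi * K' := by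
        rw [norm_mul, norm_mul, Complex.norm_real, Real.norm_of_nonneg Real.pi_pos.le]
        gcongr
        exact hK' z hz.1 hz.2
      have := (norm_sub_le (x.1 * x.2 * g' + Real.pi * z * Complex.tanh (Real.pi * z / κ))
        (Real.pi * (z * (Complex.tanh (Real.pi * z / κ) - 1)))).trans (add_le_add hg' hn)
      gcongr
      exact (norm_nonneg _).trans this
  choose! d hd hd' using hder
  have hmv := hconv.norm_image_sub_le_of_norm_hasDerivWithin_le (f := Φ) (f' := d)
    (fun z hz => (hd z hz).hasDerivWithinAt) hd' (x := z') (y := z) ⟨hz1', hz2'⟩ ⟨hz1, hz2⟩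
  rw [hΦe, hΦe, Complex.norm_exp, Complex.norm_exp, ← Real.exp_add]
  refine Real.exp_le_exp.2 ?_
  have := (Complex.re_le_norm (Φ z - Φ z')).trans hmv
  rw [Complex.sub_re] at this
  linarith

theorem gauss_add (w₁ w₂ z : ℂ) (h₁ : w₁ ≠ 0) (h₂ : w₂ ≠ 0) :
    gauss w₁ w₂ (z + I * w₁) = gauss w₁ w₂ z * Complex.exp (-(Real.pi * (z + I * w₁ / 2) / w₂)) := by
  rw [gauss, gauss, ← Complex.exp_add]
  congr 1
  field_simp
  linear_combination (2 * z * w₁ + w₁ ^ 2 * I + w₁ * I * w₁ * 0) * Complex.I_sq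

theorem gauss_sub (w₁ w₂ z : ℂ) (h₁ : w₁ ≠ 0) (h₂ : w₂ ≠ 0) :
    gauss w₁ w₂ (z - I * w₁) = gauss w₁ w₂ z * Complex.exp (Real.pi * (z - I * w₁ / 2) / w₂) := by
  rw [gauss, gauss, ← Complex.exp_add]
  congr 1
  field_simp
  linear_combination (-2 * z * w₁ + w₁ ^ 2 * I) * Complex.I_sq

theorem two_cosh_mul_exp_neg (v : ℂ) :
    2 * Complex.cosh v * Complex.exp (-v) = 1 + Complex.exp (-2 * v) := by
  have e1 : Complex.exp v * Complex.exp (-v) = 1 := by rw [← Complex.exp_add]; simp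
  have e2 : Complex.exp (-2 * v) = Complex.exp (-v) * Complex.exp (-v) := by
    rw [← Complex.exp_add]; ring_nf
  rw [Complex.cosh, e2]
  linear_combination e1

/-- Moving the Gaussian by one period produces `exp(-v)`, which absorbs the growth of `2 cosh v`.
What remains is `1 + exp(-2v)`, bounded above and below as soon as `Re v ≥ 1`. -/
theorem prod_cosh_mul_gauss {w₁ w₂ : ℂ} (h₁ : w₁ ≠ 0) (h₂ : w₂ ≠ 0) (z : ℂ) (n : ℕ) :
    (∏ k ∈ Finset.range n, 2 * Complex.cosh (Real.pi * (z + I * (k + 1 / 2) * w₁) / w₂)) *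
      gauss w₁ w₂ (z + I * n * w₁) = gauss w₁ w₂ z *
      ∏ k ∈ Finset.range n, (1 + Complex.exp (-2 * (Real.pi * (z + I * (k + 1 / 2) * w₁) / w₂))) := by
  induction n with
  | zero => simp
  | succ n ih =>
    rw [Finset.prod_range_succ, Finset.prod_range_succ, ← two_cosh_mul_exp_neg,
      ← mul_assoc (gauss w₁ w₂ z), ← ih,
      show z + I * ((n + 1 : ℕ) : ℂ) * w₁ = (z + I * n * w₁) + I * w₁ by push_cast; ring,
      gauss_add _ _ _ h₁ h₂,
      show z + I * n * w₁ + I * w₁ / 2 = z + I * (n + 1 / 2) * w₁ by ring]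
    ring

theorem gauss_div_prod_cosh {w₁ w₂ : ℂ} (h₁ : w₁ ≠ 0) (h₂ : w₂ ≠ 0) (z : ℂ) (n : ℕ) :
    gauss w₁ w₂ (z - I * n * w₁) /
      (∏ k ∈ Finset.range n, 2 * Complex.cosh (Real.pi * (z - I * (k + 1 / 2) * w₁) / w₂)) =
    gauss w₁ w₂ z /
      ∏ k ∈ Finset.range n, (1 + Complex.exp (-2 * (Real.pi * (z - I * (k + 1 / 2) * w₁) / w₂))) := by
  induction n with
  | zero => simp
  | succ n ih =>
    rw [Finset.prod_range_succ, Finset.prod_range_succ, ← two_cosh_mul_exp_neg,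
      ← div_div (gauss w₁ w₂ z), ← ih,
      show z - I * ((n + 1 : ℕ) : ℂ) * w₁ = (z - I * n * w₁) - I * w₁ by push_cast; ring,
      gauss_sub _ _ _ h₁ h₂,
      show z - I * n * w₁ - I * w₁ / 2 = z - I * (n + 1 / 2) * w₁ by ring, Complex.exp_neg]
    have := Complex.exp_ne_zero (Real.pi * (z - I * (n + 1 / 2) * w₁) / w₂)
    simp only [div_eq_mul_inv, mul_inv, inv_inv]
    ring

theorem norm_one_add_exp_bounds {v : ℂ} (hv : 1 ≤ v.re) :
    1 / 2 ≤ ‖1 + Complex.exp (-2 * v)‖ ∧ ‖1 + Complex.exp (-2 * v)‖ ≤ 2 := by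
  have hn : ‖Complex.exp (-2 * v)‖ ≤ 1 / 2 := by
    rw [Complex.norm_exp]
    have : (-2 * v).re ≤ -1 := by simp; linarith
    refine (Real.exp_le_exp.2 this).trans ?_
    rw [Real.exp_neg, one_div]
    gcongr
    linarith [Real.add_one_le_exp (1 : ℝ)]
  have h1 := norm_add_le 1 (Complex.exp (-2 * v))
  have h2 := norm_sub_le (1 + Complex.exp (-2 * v)) (Complex.exp (-2 * v))
  rw [add_sub_cancel_right] at h2
  rw [norm_one] at h1 h2
  constructor <;> linarith

theorem norm_prod_bounds {n N : ℕ} (hn : n ≤ N) {f : ℕ → ℂ}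
    (hf : ∀ k < n, 1 / 2 ≤ ‖f k‖ ∧ ‖f k‖ ≤ 2) :
    (1 / 2) ^ N ≤ ‖∏ k ∈ Finset.range n, f k‖ ∧ ‖∏ k ∈ Finset.range n, f k‖ ≤ 2 ^ N := by
  rw [norm_prod]
  constructor
  · calc ((1 : ℝ) / 2) ^ N ≤ (1 / 2) ^ n := pow_le_pow_of_le_one (by norm_num) (by norm_num) hn
      _ = ∏ k ∈ Finset.range n, (1 / 2 : ℝ) := by simp
      _ ≤ _ := Finset.prod_le_prod (fun _ _ => by norm_num) fun k hk => (hf k (Finset.mem_range.1 hk)).1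
  · calc ∏ k ∈ Finset.range n, ‖f k‖ ≤ ∏ k ∈ Finset.range n, (2 : ℝ) :=
        Finset.prod_le_prod (fun _ _ => norm_nonneg _) fun k hk => (hf k (Finset.mem_range.1 hk)).2
      _ = 2 ^ n := by simp
      _ ≤ 2 ^ N := pow_le_pow_right₀ (by norm_num) hn

/-- `Re(y/w) = (Re y Re w + Im y Im w) / |w|²`, where `Re w ≥ ε` makes the first term dominate once
`Re y` is large. -/
theorem one_le_re_pi_mul_div {y w : ℂ} {ε R C : ℝ} (hε : 0 < ε) (hw : ε ≤ w.re) (hR : ‖w‖ ≤ R)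
    (hC : |y.im| ≤ C) (hy : (R ^ 2 + C * R) / ε ≤ y.re) : 1 ≤ (Real.pi * y / w).re := by
  have hR0 : 0 ≤ R := (norm_nonneg _).trans hR
  have hC0 : 0 ≤ C := (abs_nonneg _).trans hC
  have hw0 : 0 < w.re := hε.trans_le hw
  rw [mul_div_assoc, Complex.re_ofReal_mul]
  have hns : 0 < Complex.normSq w := Complex.normSq_pos.2 (ne_zero_of_re_pos hw0)
  have h1 : 1 ≤ (y / w).re := by
    rw [Complex.div_re, ← add_div, le_div_iff₀ hns, one_mul, Complex.normSq_eq_norm_sq]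
    rw [div_le_iff₀ hε] at hy
    have hyre : 0 ≤ y.re := by
      by_contra hneg
      push Not at hneg
      nlinarith [mul_nonneg hC0 hR0, sq_nonneg R]
    have h2 : ‖w‖ ^ 2 ≤ R ^ 2 := by gcongr
    have h3 : |y.im * w.im| ≤ C * R := by
      rw [abs_mul]
      gcongr
      exact (Complex.abs_im_le_norm w).trans hR
    have h4 : y.re * ε ≤ y.re * w.re := by gcongr
    have h5 := neg_abs_le (y.im * w.im)
    linarith
  have := Real.pi_gt_three
  nlinarith

/-- Off the real direction the hyperbolic gamma function times the Gaussian factor is comparable to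
its value in the strip. -/
theorem exists_hypG_comparable {w : ℂ × ℂ} (h₁ : 0 < w.1.re) (h₂ : 0 < w.2.re) {T : ℝ} (hT : 0 ≤ T) :
    ∃ (X R : ℝ) (N : ℕ), ∀ᶠ x in 𝓝 w, ∀ z : ℂ, X ≤ z.re → |z.im| ≤ T → ∃ z₀ : ℂ,
      1 ≤ z₀.re ∧ |z₀.im| ≤ x.1.re / 2 ∧ ‖z - z₀‖ ≤ R ∧
      ‖hypG x.1 x.2 z * gauss x.1 x.2 z‖ ≤ 2 ^ N * ‖gammaStrip x.1 x.2 z₀ * gauss x.1 x.2 z₀‖ ∧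
      ‖gammaStrip x.1 x.2 z₀ * gauss x.1 x.2 z₀‖ ≤ 2 ^ N * ‖hypG x.1 x.2 z * gauss x.1 x.2 z‖ := by
  set ε := min (w.1.re / 2) (w.2.re / 2) with hε
  have hε0 : 0 < ε := lt_min (by linarith) (by linarith)
  set R := max (‖w.1‖ + 1) (‖w.2‖ + 1) with hR
  have hR0 : 0 < R := lt_max_of_lt_left (by positivity)
  set N := ⌈T / ε⌉₊ + 1 with hN
  set C := T + (2 * N + 1) * R with hC
  have e1 : ∀ᶠ x : ℂ × ℂ in 𝓝 w, ε < x.1.re :=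
    (by fun_prop : Continuous fun x : ℂ × ℂ => x.1.re).continuousAt.eventually_const_lt
      ((min_le_left _ _).trans_lt (by linarith))
  have e2 : ∀ᶠ x : ℂ × ℂ in 𝓝 w, ε < x.2.re :=
    (by fun_prop : Continuous fun x : ℂ × ℂ => x.2.re).continuousAt.eventually_const_lt
      ((min_le_right _ _).trans_lt (by linarith))
  have e3 : ∀ᶠ x : ℂ × ℂ in 𝓝 w, ‖x.1‖ < R :=
    (by fun_prop : Continuous fun x : ℂ × ℂ => ‖x.1‖).continuousAt.eventually_lt_const
      ((lt_add_one _).trans_le (le_max_left _ _))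
  have e4 : ∀ᶠ x : ℂ × ℂ in 𝓝 w, ‖x.2‖ < R :=
    (by fun_prop : Continuous fun x : ℂ × ℂ => ‖x.2‖).continuousAt.eventually_lt_const
      ((lt_add_one _).trans_le (le_max_right _ _))
  -- `N` bounds the number of periods by which `z` is moved. The first entry of the maximum gives
  -- every `cosh` argument real part at least `1`, the second gives `Re z₀ ≥ 1`. The exponent is `N
  -- + N` because numerator and denominator products contribute `2 ^ N` each.
  refine ⟨max ((R ^ 2 + C * R) / ε + (2 * N + 1) * R) (1 + N * R), N * R, N + N, ?_⟩
  filter_upwards [e1, e2, e3, e4] with x hx1 hx2 hx3 hx4 z hz hzT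
  have p1 : 0 < x.1.re := hε0.trans hx1
  have p2 : 0 < x.2.re := hε0.trans hx2
  have n1 := ne_zero_of_re_pos p1
  have n2 := ne_zero_of_re_pos p2
  set n := round (z.im / x.1.re) with hn
  have hround : |z.im / x.1.re - n| ≤ 1 / 2 := abs_sub_round _
  have him : |z.im - n * x.1.re| ≤ x.1.re / 2 := by
    have : z.im - n * x.1.re = (z.im / x.1.re - n) * x.1.re := by field_simp
    rw [this, abs_mul, abs_of_pos p1]
    nlinarith
  have hnN : |(n : ℝ)| ≤ N := by
    have h1 : |z.im / x.1.re| ≤ T / ε := by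
      rw [abs_div, abs_of_pos p1]
      gcongr
    have h2 : |(n : ℝ)| ≤ |z.im / x.1.re| + 1 / 2 := by
      rw [abs_le] at hround ⊢
      have := le_abs_self (z.im / x.1.re)
      have := neg_abs_le (z.im / x.1.re)
      constructor <;> linarith
    have h3 := Nat.le_ceil (T / ε)
    rw [hN]; push_cast
    linarith
  have hre : ∀ c : ℝ, |c| ≤ 2 * N + 1 → ‖I * c * x.1‖ ≤ (2 * N + 1) * R := by
    intro c hc
    rw [norm_mul, norm_mul, Complex.norm_I, one_mul, Complex.norm_real, Real.norm_eq_abs]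
    gcongr
  have hv : ∀ c : ℝ, |c| ≤ 2 * N + 1 → 1 ≤ (Real.pi * (z + I * c * x.1) / x.2).re := by
    intro c hc
    have h1 := hre c hc
    refine one_le_re_pi_mul_div hε0 hx2.le hx4.le (C := C) ?_ ?_
    · rw [Complex.add_im]
      refine (abs_add_le _ _).trans (add_le_add hzT ((Complex.abs_im_le_norm _).trans h1))
    · rw [Complex.add_re]
      have h2 := (abs_le.1 ((Complex.abs_re_le_norm (I * c * x.1)).trans h1)).1
      have h3 := (le_max_left _ _).trans hz
      linarith
  have hnat1 : (n.toNat : ℝ) ≤ N := by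
    have : ((n.toNat : ℤ) : ℝ) ≤ |(n : ℝ)| := by
      rcases le_total 0 n with h | h
      · rw [Int.toNat_of_nonneg h]; exact le_abs_self _
      · rw [Int.toNat_of_nonpos h]; simp
    exact_mod_cast this.trans hnN
  have hnat2 : ((-n).toNat : ℝ) ≤ N := by
    have : (((-n).toNat : ℤ) : ℝ) ≤ |(n : ℝ)| := by
      rcases le_total 0 (-n) with h | h
      · rw [Int.toNat_of_nonneg h, ← abs_neg]; push_cast; exact le_abs_self _
      · rw [Int.toNat_of_nonpos h]; simp
    exact_mod_cast this.trans hnN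
  set z₀ : ℂ := z - I * n * x.1 with hz₀
  set P := ∏ k ∈ Finset.range n.toNat,
    (1 + Complex.exp (-2 * (Real.pi * (z₀ + I * (k + 1 / 2) * x.1) / x.2))) with hP
  set Q := ∏ k ∈ Finset.range (-n).toNat,
    (1 + Complex.exp (-2 * (Real.pi * (z₀ - I * (k + 1 / 2) * x.1) / x.2))) with hQ
  have bP : (1 / 2) ^ N ≤ ‖P‖ ∧ ‖P‖ ≤ 2 ^ N := by
    refine norm_prod_bounds (by exact_mod_cast hnat1) fun k hk => norm_one_add_exp_bounds ?_
    have := hv (-n + (k + 1 / 2)) ?_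
    · convert this using 4
      rw [hz₀]; push_cast; ring
    · have hk' : (k : ℝ) + 1 ≤ n.toNat := by exact_mod_cast hk
      rw [abs_le] at hnN ⊢
      constructor <;> linarith [hnN.1, hnN.2, (Nat.cast_nonneg k : (0 : ℝ) ≤ k)]
  have bQ : (1 / 2) ^ N ≤ ‖Q‖ ∧ ‖Q‖ ≤ 2 ^ N := by
    refine norm_prod_bounds (by exact_mod_cast hnat2) fun k hk => norm_one_add_exp_bounds ?_
    have := hv (-n - (k + 1 / 2)) ?_
    · convert this using 4
      rw [hz₀]; push_cast; ring
    · have hk' : (k : ℝ) + 1 ≤ (-n).toNat := by exact_mod_cast hk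
      rw [abs_le] at hnN ⊢
      constructor <;> linarith [hnN.1, hnN.2, (Nat.cast_nonneg k : (0 : ℝ) ≤ k)]
  have hformula : hypG x.1 x.2 z * gauss x.1 x.2 z =
      gammaStrip x.1 x.2 z₀ * gauss x.1 x.2 z₀ * P / Q := by
    have hz : z = z₀ + I * n * x.1 := by rw [hz₀]; ring
    have hdef : hypG x.1 x.2 z = gammaStrip x.1 x.2 z₀
      * (∏ k ∈ Finset.range n.toNat, 2 * Complex.cosh (Real.pi * (z₀ + I * (k + 1 / 2) * x.1) / x.2))
      / (∏ k ∈ Finset.range (-n).toNat, 2 * Complex.cosh (Real.pi * (z₀ - I * (k + 1 / 2) * x.1) / x.2)) :=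
      rfl
    rw [hdef]
    rcases le_total 0 n with h | h
    · have hq : (-n).toNat = 0 := Int.toNat_of_nonpos (by omega)
      have hcast : (n : ℂ) = (n.toNat : ℂ) := by exact_mod_cast (Int.toNat_of_nonneg h).symm
      rw [hQ, hq, Finset.prod_range_zero, Finset.prod_range_zero, div_one, div_one]
      conv_lhs => rw [hz, hcast, mul_assoc, prod_cosh_mul_gauss n1 n2]
      rw [hP]; ring
    · have hq : n.toNat = 0 := Int.toNat_of_nonpos (by omega)
      have hcast : (n : ℂ) = -((-n).toNat : ℂ) := by
        have : ((-n).toNat : ℂ) = ((-n : ℤ) : ℂ) := by exact_mod_cast (Int.toNat_of_nonneg (by omega : 0 ≤ -n))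
        rw [this]; push_cast; ring
      rw [hP, hq, Finset.prod_range_zero, Finset.prod_range_zero, mul_one, mul_one]
      conv_lhs => rw [hz, hcast, show z₀ + I * -((-n).toNat : ℂ) * x.1 = z₀ - I * ((-n).toNat : ℂ) * x.1 by ring,
        div_mul_eq_mul_div, mul_div_assoc, gauss_div_prod_cosh n1 n2]
      rw [hQ]; ring
  have hzz : ‖z - z₀‖ ≤ N * R := by
    rw [hz₀, sub_sub_cancel, norm_mul, norm_mul, Complex.norm_I, one_mul]
    gcongr
    have : ‖(n : ℂ)‖ = |(n : ℝ)| := by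
      rw [← Complex.ofReal_intCast, Complex.norm_real, Real.norm_eq_abs]
    rw [this]; exact hnN
  refine ⟨z₀, ?_, ?_, hzz, ?_, ?_⟩
  · have h2 := (abs_le.1 ((Complex.abs_re_le_norm (z - z₀)).trans hzz)).2
    rw [Complex.sub_re] at h2
    have h3 := (le_max_right _ _).trans hz
    linarith
  · have : z₀.im = z.im - n * x.1.re := by
      rw [hz₀, Complex.sub_im, mul_assoc, Complex.I_mul_im, ← Complex.ofReal_intCast,
        Complex.re_ofReal_mul]
    rw [this]; exact him
  · rw [hformula, norm_div, norm_mul (gammaStrip x.1 x.2 z₀ * gauss x.1 x.2 z₀) P, pow_add, div_le_iff₀ (lt_of_lt_of_le (by positivity) bQ.1)]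
    have h12 : (2 : ℝ) ^ N * (1 / 2) ^ N = 1 := by rw [← mul_pow]; norm_num
    set m := ‖gammaStrip x.1 x.2 z₀ * gauss x.1 x.2 z₀‖
    calc m * ‖P‖ ≤ m * 2 ^ N * (2 ^ N * (1 / 2) ^ N) := by
          rw [h12, mul_one]; gcongr; exact bP.2
      _ ≤ m * 2 ^ N * (2 ^ N * ‖Q‖) := by gcongr; exact bQ.1
      _ = _ := by ring
  · rw [hformula, norm_div, norm_mul (gammaStrip x.1 x.2 z₀ * gauss x.1 x.2 z₀) P, pow_add, mul_div_assoc', le_div_iff₀ (lt_of_lt_of_le (by positivity) bQ.1)]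
    have h12 : (2 : ℝ) ^ N * (1 / 2) ^ N = 1 := by rw [← mul_pow]; norm_num
    set m := ‖gammaStrip x.1 x.2 z₀ * gauss x.1 x.2 z₀‖
    calc m * ‖Q‖ ≤ m * 2 ^ N * (2 ^ N * (1 / 2) ^ N) := by
          rw [h12, mul_one]; gcongr; exact bQ.2
      _ ≤ m * 2 ^ N * (2 ^ N * ‖P‖) := by gcongr; exact bP.1
      _ = _ := by ring

/-- The hyperbolic gamma function times the Gaussian factor varies slowly as `Re z → ∞`. -/
theorem exists_hypG_ratio {w : ℂ × ℂ} (h₁ : 0 < w.1.re) (h₂ : 0 < w.2.re) {T : ℝ} (hT : 0 ≤ T) :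
    ∃ X K : ℝ, 0 ≤ K ∧ ∀ᶠ x in 𝓝 w, ∀ z z' : ℂ, X ≤ z.re → |z.im| ≤ T → X ≤ z'.re → |z'.im| ≤ T →
      ‖z - z'‖ ≤ T → hypG x.1 x.2 z' ≠ 0 ∧
      ‖hypG x.1 x.2 z * gauss x.1 x.2 z‖ ≤ K * ‖hypG x.1 x.2 z' * gauss x.1 x.2 z'‖ := by
  obtain ⟨X, R, N, hev⟩ := exists_hypG_comparable h₁ h₂ hT
  obtain ⟨K, hK⟩ := exists_strip_ratio h₁ h₂ (b := w.1.re / 2 + w.2.re / 4) (by positivity) (by linarith)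
  have e1 : ∀ᶠ x : ℂ × ℂ in 𝓝 w, x.1.re / 2 < w.1.re / 2 + w.2.re / 4 :=
    (by fun_prop : Continuous fun x : ℂ × ℂ => x.1.re / 2).continuousAt.eventually_lt_const
      (by linarith)
  refine ⟨X, 2 ^ N * (Real.exp (|K| * (T + R + R)) * 2 ^ N), by positivity, ?_⟩
  filter_upwards [hev, hK, e1] with x hx hx1 hx2 z z' hz hzT hz' hzT' hzz
  obtain ⟨z₀, a1, a2, a3, a4, a5⟩ := hx z hz hzT
  obtain ⟨z₁, b1, b2, b3, b4, b5⟩ := hx z' hz' hzT'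
  have hmain := hx1 z₀ z₁ a1 (a2.trans hx2.le) b1 (b2.trans hx2.le)
  have hd : ‖z₀ - z₁‖ ≤ T + R + R := by
    have : z₀ - z₁ = -(z - z₀) + (z - z') + (z' - z₁) := by ring
    rw [this]
    refine (norm_add_le _ _).trans ?_
    refine (add_le_add_left (norm_add_le _ _) _).trans ?_
    rw [norm_neg]
    linarith
  refine ⟨fun h0 => ?_, ?_⟩
  · rw [h0, zero_mul, norm_zero, mul_zero] at b5
    have : 0 < ‖gammaStrip x.1 x.2 z₁ * gauss x.1 x.2 z₁‖ :=
      norm_pos_iff.2 (mul_ne_zero (gammaStrip_ne_zero _ _ _) (Complex.exp_ne_zero _))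
    linarith
  · calc _ ≤ _ := a4
      _ ≤ 2 ^ N * (Real.exp (K * ‖z₀ - z₁‖) * ‖gammaStrip x.1 x.2 z₁ * gauss x.1 x.2 z₁‖) := by gcongr
      _ ≤ 2 ^ N * (Real.exp (|K| * (T + R + R)) * (2 ^ N * ‖hypG x.1 x.2 z' * gauss x.1 x.2 z'‖)) := by
          gcongr
          exact le_abs_self K
      _ = _ := by ring

end Ratio

end AskeyWilson

namespace AskeyWilson

open MeasureTheory Filter Topology Metric
open Complex (I)

/-! ### The hyperbolic gamma function on the whole plane -/

section HypG

/-- The expression for the hyperbolic gamma function on the strip `|Im z - n Re w₁| < Re w`. -/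
noncomputable def hypGForm (n : ℤ) (w₁ w₂ z : ℂ) : ℂ :=
  gammaStrip w₁ w₂ (z - I * n * w₁)
    * (∏ k ∈ Finset.range n.toNat,
        2 * Complex.cosh (Real.pi * (z - I * n * w₁ + I * (k + 1 / 2) * w₁) / w₂))
    / (∏ k ∈ Finset.range (-n).toNat,
        2 * Complex.cosh (Real.pi * (z - I * n * w₁ - I * (k + 1 / 2) * w₁) / w₂))

theorem hypG_eq_form_round (w₁ w₂ z : ℂ) :
    hypG w₁ w₂ z = hypGForm (round (z.im / w₁.re)) w₁ w₂ z := rfl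

/-- On the overlap of two consecutive strips the difference equation on the strip trades one shift
of the argument for one factor `2 cosh`. For negative `n` that factor is cancelled against the
denominator, so it has to be nonzero. -/
theorem hypGForm_succ {w₁ w₂ z : ℂ} (h₁ : 0 < w₁.re) (h₂ : 0 < w₂.re) {n : ℤ}
    (hn : |z.im - n * w₁.re| < (w₁.re + w₂.re) / 2)
    (hn' : |z.im - (n + 1) * w₁.re| < (w₁.re + w₂.re) / 2) :
    hypGForm n w₁ w₂ z = hypGForm (n + 1) w₁ w₂ z := by
  set y : ℂ := z - I * n * w₁ - I * w₁ / 2 with hy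
  have hyim : |y.im| < w₂.re / 2 := by
    have : y.im = z.im - n * w₁.re - w₁.re / 2 := by
      rw [hy, im_sub_I_mul_half, Complex.sub_im, mul_assoc, Complex.I_mul_im, ← Complex.ofReal_intCast,
        Complex.re_ofReal_mul]
    rw [this, abs_lt]
    rw [abs_lt] at hn hn'
    constructor <;> linarith [hn.1, hn.2, hn'.1, hn'.2]
  have hshift := gammaStrip_shift h₁ h₂ hyim
  have hne := two_cosh_ne_zero h₂ hyim
  have e1 : z - I * n * w₁ = y + I * w₁ / 2 := by rw [hy]; ring
  have e2 : z - I * ((n + 1 : ℤ) : ℂ) * w₁ = y - I * w₁ / 2 := by rw [hy]; push_cast; ring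
  rw [hypGForm, hypGForm, e1, e2, hshift]
  rcases le_or_gt 0 n with h | h
  · have q1 : (-n).toNat = 0 := Int.toNat_of_nonpos (by omega)
    have q2 : (-(n + 1)).toNat = 0 := Int.toNat_of_nonpos (by omega)
    have q3 : (n + 1).toNat = n.toNat + 1 := Int.toNat_add_nat h 1
    simp only [q1, q2, q3, Finset.prod_range_zero, div_one, Finset.prod_range_succ' _ n.toNat]
    have f1 : ∀ k : ℕ, y - I * w₁ / 2 + I * (((k + 1 : ℕ) : ℂ) + 1 / 2) * w₁ =
        y + I * w₁ / 2 + I * (k + 1 / 2) * w₁ := fun k => by push_cast; ring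
    have f2 : y - I * w₁ / 2 + I * (((0 : ℕ) : ℂ) + 1 / 2) * w₁ = y := by push_cast; ring
    simp only [f1, f2]
    ring
  · obtain ⟨m, rfl⟩ : ∃ m : ℕ, n = -((m : ℤ) + 1) := ⟨(-n - 1).toNat, by omega⟩
    have q1 : (-((m : ℤ) + 1)).toNat = 0 := Int.toNat_of_nonpos (by omega)
    have q2 : (-((m : ℤ) + 1) + 1).toNat = 0 := Int.toNat_of_nonpos (by omega)
    have q3 : (-(-((m : ℤ) + 1))).toNat = m + 1 := by omega
    have q4 : (-(-((m : ℤ) + 1) + 1)).toNat = m := by omega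
    simp only [q1, q2, q3, q4, Finset.prod_range_zero, mul_one, Finset.prod_range_succ' _ m]
    have f1 : ∀ k : ℕ, y + I * w₁ / 2 - I * (((k + 1 : ℕ) : ℂ) + 1 / 2) * w₁ =
        y - I * w₁ / 2 - I * (k + 1 / 2) * w₁ := fun k => by push_cast; ring
    have f2 : y + I * w₁ / 2 - I * (((0 : ℕ) : ℂ) + 1 / 2) * w₁ = y := by push_cast; ring
    simp only [f1, f2]
    rw [mul_comm (2 * Complex.cosh (Real.pi * y / w₂)), mul_div_mul_right _ _ hne]

theorem hypGForm_add_nat {w₁ w₂ z : ℂ} (h₁ : 0 < w₁.re) (h₂ : 0 < w₂.re) {n : ℤ} (k : ℕ)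
    (hn : |z.im - n * w₁.re| < (w₁.re + w₂.re) / 2)
    (hn' : |z.im - (n + k) * w₁.re| < (w₁.re + w₂.re) / 2) :
    hypGForm n w₁ w₂ z = hypGForm (n + k) w₁ w₂ z := by
  induction k with
  | zero => simp
  | succ k ih =>
    rw [abs_lt] at hn
    push_cast at hn'
    rw [abs_lt] at hn'
    have hk : (0 : ℝ) ≤ k * w₁.re := by positivity
    have hmid : |z.im - (n + k) * w₁.re| < (w₁.re + w₂.re) / 2 := by
      rw [abs_lt]
      constructor <;> linarith [hn.1, hn.2, hn'.1, hn'.2]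
    rw [ih hmid]
    have := hypGForm_succ h₁ h₂ (n := n + k) (z := z) (by push_cast; exact hmid)
      (by push_cast; rw [abs_lt]; constructor <;> linarith [hn'.1, hn'.2])
    rw [this]
    push_cast
    rw [add_assoc]

theorem abs_im_sub_round_le {w z : ℂ} (hw : 0 < w.re) :
    |z.im - round (z.im / w.re) * w.re| ≤ w.re / 2 := by
  have hround := abs_sub_round (z.im / w.re)
  have : z.im - round (z.im / w.re) * w.re = (z.im / w.re - round (z.im / w.re)) * w.re := by
    field_simp
  rw [this, abs_mul, abs_of_pos hw]
  nlinarith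

/-- The rounding in the definition of `hypG` is immaterial: every strip containing `z` gives the
same value. Hence near any point `hypG` is one fixed expression, although the rounding jumps. -/
theorem hypG_eq_form {w₁ w₂ z : ℂ} (h₁ : 0 < w₁.re) (h₂ : 0 < w₂.re) {n : ℤ}
    (hn : |z.im - n * w₁.re| < (w₁.re + w₂.re) / 2) : hypG w₁ w₂ z = hypGForm n w₁ w₂ z := by
  rw [hypG_eq_form_round]
  set m := round (z.im / w₁.re) with hm
  have hm' : |z.im - m * w₁.re| < (w₁.re + w₂.re) / 2 :=
    (abs_im_sub_round_le h₁).trans_lt (by linarith)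
  rcases le_total m n with h | h
  · obtain ⟨k, rfl⟩ := Int.le.dest h
    exact hypGForm_add_nat h₁ h₂ k hm' (by push_cast at hn; exact hn)
  · obtain ⟨k, hk⟩ := Int.le.dest h
    rw [← hk] at hm' ⊢
    exact (hypGForm_add_nat h₁ h₂ k hn (by push_cast at hm'; exact hm')).symm

theorem hypG_eq_gammaStrip {w₁ w₂ z : ℂ} (h₁ : 0 < w₁.re) (h₂ : 0 < w₂.re)
    (h : |z.im| < (w₁.re + w₂.re) / 2) : hypG w₁ w₂ z = gammaStrip w₁ w₂ z := by
  rw [hypG_eq_form h₁ h₂ (n := 0) (by simpa using h)]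
  simp [hypGForm]

/-- Oddness of `gInt` inverts the strip factor and the reflection exchanges the two products. No
exception is needed at zeros and poles, since the default value at a pole is `0 = 0⁻¹`. -/
theorem hypG_neg {w₁ w₂ : ℂ} (h₁ : 0 < w₁.re) (h₂ : 0 < w₂.re) (z : ℂ) :
    hypG w₁ w₂ (-z) = (hypG w₁ w₂ z)⁻¹ := by
  set n := round (z.im / w₁.re) with hn
  have hn' : |z.im - n * w₁.re| < (w₁.re + w₂.re) / 2 :=
    (abs_im_sub_round_le h₁).trans_lt (by linarith)
  have hm : |(-z).im - (-n : ℤ) * w₁.re| < (w₁.re + w₂.re) / 2 := by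
    rw [← abs_neg]
    convert hn' using 2
    push_cast
    rw [Complex.neg_im]
    ring
  rw [hypG_eq_form h₁ h₂ hn', hypG_eq_form h₁ h₂ hm, hypGForm, hypGForm, neg_neg,
    show -z - I * ((-n : ℤ) : ℂ) * w₁ = -(z - I * n * w₁) by push_cast; ring, gammaStrip_neg]
  have e1 : ∀ k : ℕ, Complex.cosh (Real.pi * (-(z - I * n * w₁) + I * (k + 1 / 2) * w₁) / w₂) =
      Complex.cosh (Real.pi * (z - I * n * w₁ - I * (k + 1 / 2) * w₁) / w₂) := fun k => by
    rw [← Complex.cosh_neg]; congr 1; ring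
  have e2 : ∀ k : ℕ, Complex.cosh (Real.pi * (-(z - I * n * w₁) - I * (k + 1 / 2) * w₁) / w₂) =
      Complex.cosh (Real.pi * (z - I * n * w₁ + I * (k + 1 / 2) * w₁) / w₂) := fun k => by
    rw [← Complex.cosh_neg]; congr 1; ring
  simp only [e1, e2]
  generalize (∏ k ∈ Finset.range n.toNat, _ : ℂ) = A
  generalize (∏ k ∈ Finset.range (-n).toNat, _ : ℂ) = B
  rw [inv_div, div_eq_mul_inv, div_eq_mul_inv, mul_inv]
  ring

variable {V : Type} [NormedAddCommGroup V] [NormedSpace ℂ V]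

theorem AnalyticAt.gammaStrip {a b c : V → ℂ} {p : V} (ha : AnalyticAt ℂ a p) (hb : AnalyticAt ℂ b p)
    (hc : AnalyticAt ℂ c p) (h₁ : 0 < (a p).re) (h₂ : 0 < (b p).re)
    (h : |(c p).im| < ((a p).re + (b p).re) / 2) :
    AnalyticAt ℂ (fun q => gammaStrip (a q) (b q) (c q)) p :=
  AnalyticAt.fun_comp (f := fun q => (a q, b q, c q)) (analyticAt_gammaStrip (mem_stripDomain h₁ h₂ h))
    (ha.prod (hb.prod hc))

theorem analyticAt_cosh_comp {f : V → ℂ} {p : V} (hf : AnalyticAt ℂ f p) :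
    AnalyticAt ℂ (fun q => Complex.cosh (f q)) p := by
  have : Differentiable ℂ Complex.cosh := Complex.differentiable_cosh
  exact AnalyticAt.fun_comp (this.analyticAt (f p)) hf

theorem im_sub_I_mul_int_mul (z w : ℂ) (n : ℤ) : (z - I * n * w).im = z.im - n * w.re := by
  rw [Complex.sub_im, mul_assoc, Complex.I_mul_im, ← Complex.ofReal_intCast, Complex.re_ofReal_mul]

omit [NormedSpace ℂ V] in
theorem eventually_hypG_eq_form {a b c : V → ℂ} {p : V} (ha : ContinuousAt a p)
    (hb : ContinuousAt b p) (hc : ContinuousAt c p) (h₁ : 0 < (a p).re) (h₂ : 0 < (b p).re) {n : ℤ}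
    (h : |(c p).im - n * (a p).re| < ((a p).re + (b p).re) / 2) :
    ∀ᶠ q in 𝓝 p, hypG (a q) (b q) (c q) = hypGForm n (a q) (b q) (c q) := by
  have ha' : ContinuousAt (fun q => (a q).re) p := Complex.continuous_re.continuousAt.comp ha
  have hb' : ContinuousAt (fun q => (b q).re) p := Complex.continuous_re.continuousAt.comp hb
  have hc' : ContinuousAt (fun q => (c q).im) p := Complex.continuous_im.continuousAt.comp hc
  have e : ∀ᶠ q in 𝓝 p, |(c q).im - n * (a q).re| < ((a q).re + (b q).re) / 2 :=
    ContinuousAt.eventually_lt (hc'.sub (ha'.const_mul _)).abs ((ha'.add hb').div_const 2) h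
  filter_upwards [ha'.eventually_const_lt h₁, hb'.eventually_const_lt h₂, e] with q h1 h2 h3
  exact hypG_eq_form h1 h2 h3

theorem analyticAt_cosh_factor {a b c : V → ℂ} {p : V} (ha : AnalyticAt ℂ a p)
    (hb : AnalyticAt ℂ b p) (hc : AnalyticAt ℂ c p) (h₂ : 0 < (b p).re) (n : ℤ) (s : ℂ) :
    AnalyticAt ℂ (fun q => 2 * Complex.cosh (Real.pi * (c q - I * n * a q + s * a q) / b q)) p := by
  refine analyticAt_const.mul (analyticAt_cosh_comp ?_)
  exact (analyticAt_const.mul ((hc.fun_sub (analyticAt_const.mul ha)).fun_add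
    (analyticAt_const.mul ha))).fun_div hb (ne_zero_of_re_pos h₂)

theorem meromAt_hypG {a b c : V → ℂ} {p : V} (ha : AnalyticAt ℂ a p) (hb : AnalyticAt ℂ b p)
    (hc : AnalyticAt ℂ c p) (h₁ : 0 < (a p).re) (h₂ : 0 < (b p).re) :
    MeromAt (fun q => hypG (a q) (b q) (c q)) p := by
  set n := round ((c p).im / (a p).re)
  have hn : |(c p).im - n * (a p).re| < ((a p).re + (b p).re) / 2 :=
    (abs_im_sub_round_le h₁).trans_lt (by linarith)
  have hev := eventually_hypG_eq_form ha.continuousAt hb.continuousAt hc.continuousAt h₁ h₂ hn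
  refine MeromAt.congr (f := fun q => hypGForm n (a q) (b q) (c q)) ?_ (hev.mono fun q hq => hq.symm)
  have hG : AnalyticAt ℂ (fun q => gammaStrip (a q) (b q) (c q - I * n * a q)) p :=
    AnalyticAt.gammaStrip ha hb (hc.fun_sub (analyticAt_const.mul ha)) h₁ h₂
      (by rw [im_sub_I_mul_int_mul]; exact hn)
  refine ((AnalyticAt.meromAt hG).mul (MeromAt.prod _ fun k _ => ?_)).div
    (MeromAt.prod _ fun k _ => ?_)
  · exact AnalyticAt.meromAt (analyticAt_cosh_factor ha hb hc h₂ n _)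
  · have := analyticAt_cosh_factor ha hb hc h₂ n (-(I * (k + 1 / 2)))
    refine AnalyticAt.meromAt ?_
    simpa only [neg_mul, ← sub_eq_add_neg] using this

/-- The reflection formula separates the poles of `1 / cosh` into those on the negative and those on
the positive imaginary axis, one Gamma factor for each. Finitely many poles of one kind can then be
removed by the functional equation. -/
theorem inv_two_cosh (u : ℂ) : (2 * Complex.cosh u)⁻¹ =
    Complex.Gamma (1 / 2 - I * u / Real.pi) * Complex.Gamma (1 / 2 + I * u / Real.pi) / (2 * Real.pi) := by
  have hpi : (Real.pi : ℂ) ≠ 0 := by exact_mod_cast Real.pi_ne_zero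
  have h := Complex.Gamma_mul_Gamma_one_sub (1 / 2 - I * u / Real.pi)
  have e1 : 1 - (1 / 2 - I * u / Real.pi) = 1 / 2 + I * u / Real.pi := by ring
  have e2 : Complex.sin (Real.pi * (1 / 2 - I * u / Real.pi)) = Complex.cosh u := by
    rw [← Complex.cos_mul_I, ← Complex.sin_pi_div_two_sub]
    congr 1
    field_simp
  rw [e1, e2] at h
  rw [h, div_div, mul_inv, div_eq_mul_inv, mul_inv, mul_inv]
  field_simp

theorem Gamma_mul_prod (s : ℂ) (M : ℕ) (h : ∀ l < M, s + l ≠ 0) :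
    Complex.Gamma s * ∏ l ∈ Finset.range M, (s + l) = Complex.Gamma (s + M) := by
  induction M with
  | zero => simp
  | succ M ih =>
    rw [Finset.prod_range_succ, ← mul_assoc, ih fun l hl => h l (by omega), mul_comm,
      ← Complex.Gamma_add_one _ (h M (by omega))]
    push_cast
    rw [add_assoc]

theorem analyticAt_Gamma {s : ℂ} (h : ∀ m : ℕ, s ≠ -m) : AnalyticAt ℂ Complex.Gamma s := by
  have h1 : AnalyticAt ℂ (fun s => (Complex.Gamma s)⁻¹) s :=
    Complex.differentiable_one_div_Gamma.analyticAt s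
  have h2 := h1.fun_inv (inv_ne_zero (Complex.Gamma_ne_zero h))
  simpa only [inv_inv] using h2

/-- The polynomial cancelling the first poles of the hyperbolic gamma function. -/
noncomputable def poleProd (M : ℕ) (q : ℂ × ℂ × ℂ) : ℂ :=
  ∏ k ∈ Finset.range M, ∏ l ∈ Finset.range M,
    (q.2.2 + I * wMean q.1 q.2.1 + I * k * q.1 + I * l * q.2.1)

/-- The set on which `hypG * poleProd M` is analytic. -/
def regDomain (M : ℕ) : Set (ℂ × ℂ × ℂ) :=
  {q | 0 < q.1.re ∧ 0 < q.2.1.re ∧ -(M : ℝ) * q.1.re < q.2.2.im ∧ -(M : ℝ) * q.2.1.re < q.2.2.im}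

theorem isOpen_regDomain (M : ℕ) : IsOpen (regDomain M) := by
  have h1 : Continuous fun q : ℂ × ℂ × ℂ => q.1.re := by fun_prop
  have h2 : Continuous fun q : ℂ × ℂ × ℂ => q.2.1.re := by fun_prop
  have h3 : Continuous fun q : ℂ × ℂ × ℂ => q.2.2.im := by fun_prop
  exact (isOpen_lt continuous_const h1).inter ((isOpen_lt continuous_const h2).inter
    ((isOpen_lt (h1.const_mul _) h3).inter (isOpen_lt (h2.const_mul _) h3)))

theorem frequently_prod_ne {ι : Type} (s : Finset ι) {f : ι → V → ℂ} {p : V}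
    (hf : ∀ i ∈ s, AnalyticAt ℂ (f i) p) (h : ∀ i ∈ s, ∃ᶠ q in 𝓝 p, f i q ≠ 0) :
    ∃ᶠ q in 𝓝 p, ∏ i ∈ s, f i q ≠ 0 := by
  classical
  induction s using Finset.induction_on with
  | empty => simp
  | insert i s hi ih =>
    simp only [Finset.prod_insert hi]
    exact frequently_mul_ne (hf i (by simp)) (Finset.analyticAt_fun_prod _ fun j hj => hf j (by simp [hj]))
      (h i (by simp)) (ih (fun j hj => hf j (by simp [hj])) fun j hj => h j (by simp [hj]))

theorem analyticAt_pole_factor (a b : ℂ) (q : ℂ × ℂ × ℂ) :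
    AnalyticAt ℂ (fun q : ℂ × ℂ × ℂ => q.2.2 + I * wMean q.1 q.2.1 + I * a * q.1 + I * b * q.2.1) q := by
  have hd : Differentiable ℂ
      (fun q : ℂ × ℂ × ℂ => q.2.2 + I * wMean q.1 q.2.1 + I * a * q.1 + I * b * q.2.1) := by
    unfold wMean
    fun_prop
  exact analyticAt_of_differentiableOn isOpen_univ hd.differentiableOn (Set.mem_univ _)

theorem frequently_poleProd_ne (M : ℕ) (q : ℂ × ℂ × ℂ) : ∃ᶠ x in 𝓝 q, poleProd M x ≠ 0 := by
  refine frequently_prod_ne _ (fun k _ => Finset.analyticAt_fun_prod _ fun l _ =>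
    analyticAt_pole_factor _ _ _) fun k _ => frequently_prod_ne _
    (fun l _ => analyticAt_pole_factor _ _ _) fun l _ h => ?_
  have h' : ∀ᶠ x in 𝓝 q, x.2.2 + I * wMean x.1 x.2.1 + I * k * x.1 + I * l * x.2.1 = 0 :=
    h.mono fun x hx => not_not.1 hx
  have hc : Tendsto (fun t : ℂ => (q.1, q.2.1, q.2.2 + t)) (𝓝 0) (𝓝 q) := by
    have : Continuous fun t : ℂ => (q.1, q.2.1, q.2.2 + t) := by fun_prop
    simpa using this.tendsto 0
  have h0 := h'.self_of_nhds
  have h1 : ∀ᶠ t in 𝓝[≠] (0 : ℂ), False := by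
    filter_upwards [nhdsWithin_le_nhds (hc.eventually h'), self_mem_nhdsWithin] with t ht hne
    refine hne ?_
    simp only [Set.mem_singleton_iff]
    linear_combination ht - h0
  exact h1.exists.elim fun _ h => h

theorem hypGForm_neg_nat (m : ℕ) (w₁ w₂ z : ℂ) : hypGForm (-(m : ℤ)) w₁ w₂ z =
    gammaStrip w₁ w₂ (z + I * m * w₁) *
      ∏ k ∈ Finset.range m, (2 * Complex.cosh (Real.pi * (z + I * (k + 1 / 2) * w₁) / w₂))⁻¹ := by
  have q1 : (-(m : ℤ)).toNat = 0 := Int.toNat_of_nonpos (by omega)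
  have q2 : (- -(m : ℤ)).toNat = m := by omega
  have e1 : z - I * ((-(m : ℤ) : ℤ) : ℂ) * w₁ = z + I * m * w₁ := by push_cast; ring
  rw [hypGForm]
  simp only [q1, q2, e1, Finset.prod_range_zero, mul_one]
  rw [Finset.prod_inv_distrib, div_eq_mul_inv, ← Finset.prod_range_reflect
    (fun k : ℕ => 2 * Complex.cosh (Real.pi * (z + I * (k + 1 / 2) * w₁) / w₂))]
  congr 2
  refine Finset.prod_congr rfl fun k hk => ?_
  have hk' : k + 1 ≤ m := Finset.mem_range.1 hk
  congr 4
  rw [Nat.sub_sub, Nat.cast_sub (by omega)]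
  push_cast
  ring

/-- With `s` the argument of the first Gamma factor, the linear factor of index `l` is `(s + l) i
w₂`, so the product raises `Γ(s)` to `Γ(s + M)`. -/
theorem inv_two_cosh_mul_prod {w₁ w₂ z : ℂ} (h₂ : w₂ ≠ 0) (k M : ℕ)
    (h : ∀ l < M, z + I * wMean w₁ w₂ + I * k * w₁ + I * l * w₂ ≠ 0) :
    (2 * Complex.cosh (Real.pi * (z + I * (k + 1 / 2) * w₁) / w₂))⁻¹ *
      ∏ l ∈ Finset.range M, (z + I * wMean w₁ w₂ + I * k * w₁ + I * l * w₂) =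
    Complex.Gamma (1 / 2 - I * (z + I * (k + 1 / 2) * w₁) / w₂ + M) *
      Complex.Gamma (1 / 2 + I * (z + I * (k + 1 / 2) * w₁) / w₂) * (I * w₂) ^ M / (2 * Real.pi) := by
  have hpi : (Real.pi : ℂ) ≠ 0 := by exact_mod_cast Real.pi_ne_zero
  have e : I * (Real.pi * (z + I * (k + 1 / 2) * w₁) / w₂) / Real.pi = I * (z + I * (k + 1 / 2) * w₁) / w₂ := by
    field_simp
  have hfac : ∀ l : ℕ, z + I * wMean w₁ w₂ + I * k * w₁ + I * l * w₂ =
      (1 / 2 - I * (z + I * (k + 1 / 2) * w₁) / w₂ + l) * (I * w₂) := by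
    intro l
    rw [wMean]
    field_simp
    linear_combination (2 * z + I * (2 * k + 1) * w₁) * Complex.I_sq
  rw [inv_two_cosh, e, ← Gamma_mul_prod _ M fun l hl h0 => h l hl (by rw [hfac, h0, zero_mul])]
  simp only [hfac, Finset.prod_mul_distrib, Finset.prod_const, Finset.card_range]
  ring

/-- For `n ≥ 0` the local expression has no denominator. For `n = -m < 0` the lower bound on `Im z`
against `Re w₁` gives `m ≤ M`; in each of the `m` factors `1 / (2 cosh)` the polynomial removes the
first `M` poles of one Gamma factor. By the bound against `Re w₂` the remaining ones lie out of
reach, and the other Gamma factor is regular because `Im z` is within `Re w₁ / 2` of `-m Re w₁`. The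
indices `k ≥ m` stay as polynomial factors. -/
theorem exists_regular_hypG (M : ℕ) : ∃ g : ℂ × ℂ × ℂ → ℂ, AnalyticOnNhd ℂ g (regDomain M) ∧
    ∀ q ∈ regDomain M, poleProd M q ≠ 0 → g q = hypG q.1 q.2.1 q.2.2 * poleProd M q := by
  refine exists_analytic_extension (A := {q | poleProd M q ≠ 0})
    (fun q _ => mem_closure_iff_frequently.2 (frequently_poleProd_ne M q)) ?_ (isOpen_regDomain M)
  rintro p ⟨h₁, h₂, h₃, h₄⟩
  have ha : AnalyticAt ℂ (fun q : ℂ × ℂ × ℂ => q.1) p := analyticAt_fst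
  have hb : AnalyticAt ℂ (fun q : ℂ × ℂ × ℂ => q.2.1) p := analyticAt_fst.fun_comp analyticAt_snd
  have hc : AnalyticAt ℂ (fun q : ℂ × ℂ × ℂ => q.2.2) p := analyticAt_snd.fun_comp analyticAt_snd
  have hpole : AnalyticAt ℂ (poleProd M) p := Finset.analyticAt_fun_prod _ fun k _ =>
    Finset.analyticAt_fun_prod _ fun l _ => analyticAt_pole_factor _ _ _
  obtain ⟨n, hn⟩ : ∃ n : ℤ, |p.2.2.im - n * p.1.re| ≤ p.1.re / 2 := ⟨_, abs_im_sub_round_le h₁⟩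
  have hev := eventually_hypG_eq_form (n := n) ha.continuousAt hb.continuousAt hc.continuousAt h₁ h₂
    (hn.trans_lt (by linarith))
  have hG : AnalyticAt ℂ (fun q : ℂ × ℂ × ℂ => gammaStrip q.1 q.2.1 (q.2.2 - I * n * q.1)) p :=
    AnalyticAt.gammaStrip ha hb (hc.fun_sub (analyticAt_const.mul ha)) h₁ h₂
      (by rw [im_sub_I_mul_int_mul]; exact hn.trans_lt (by linarith))
  rcases le_or_gt 0 n with h | h
  · have q1 : (-n).toNat = 0 := Int.toNat_of_nonpos (by omega)
    refine ⟨fun q => hypGForm n q.1 q.2.1 q.2.2 * poleProd M q, AnalyticAt.mul ?_ hpole, ?_⟩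
    · simp only [hypGForm, q1, Finset.prod_range_zero, div_one]
      exact hG.mul (Finset.analyticAt_fun_prod _ fun k _ => analyticAt_cosh_factor ha hb hc h₂ n _)
    · filter_upwards [hev] with q hq _
      rw [hq]
  · obtain ⟨m, rfl⟩ : ∃ m : ℕ, n = -(m : ℤ) := ⟨(-n).toNat, by omega⟩
    push_cast at hn
    rw [abs_le] at hn
    have hmM : m ≤ M := by
      have : (m : ℝ) < M + 1 := by
        by_contra hcon
        push Not at hcon
        nlinarith [hn.2]
      exact Nat.lt_succ_iff.1 (by exact_mod_cast this)
    refine ⟨fun q => gammaStrip q.1 q.2.1 (q.2.2 + I * m * q.1) * ((∏ k ∈ Finset.range m,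
      (Complex.Gamma (1 / 2 - I * (q.2.2 + I * (k + 1 / 2) * q.1) / q.2.1 + M) *
      Complex.Gamma (1 / 2 + I * (q.2.2 + I * (k + 1 / 2) * q.1) / q.2.1) * (I * q.2.1) ^ M /
        (2 * Real.pi))) * ∏ k ∈ Finset.Ico m M, ∏ l ∈ Finset.range M,
          (q.2.2 + I * wMean q.1 q.2.1 + I * k * q.1 + I * l * q.2.1)), ?_, ?_⟩
    · have hG' : AnalyticAt ℂ (fun q : ℂ × ℂ × ℂ => gammaStrip q.1 q.2.1 (q.2.2 + I * m * q.1)) p := by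
        simpa using hG
      refine hG'.mul (AnalyticAt.mul (Finset.analyticAt_fun_prod _ fun k hk => ?_)
        (Finset.analyticAt_fun_prod _ fun k _ => Finset.analyticAt_fun_prod _ fun l _ =>
          analyticAt_pole_factor _ _ _))
      have hk' : (k : ℝ) + 1 ≤ m := by exact_mod_cast Finset.mem_range.1 hk
      have hne := ne_zero_of_re_pos h₂
      set y : ℂ × ℂ × ℂ → ℂ := fun q => q.2.2 + I * (k + 1 / 2) * q.1 with hy
      have hyan : AnalyticAt ℂ y p := hc.fun_add (analyticAt_const.mul ha)
      have hyI : AnalyticAt ℂ (fun q : ℂ × ℂ × ℂ => I * y q / q.2.1) p :=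
        (analyticAt_const.mul hyan).fun_div hb hne
      have hyim : (y p).im = p.2.2.im + (k + 1 / 2) * p.1.re := by
        rw [hy]
        simp only
        rw [Complex.add_im, mul_assoc, Complex.I_mul_im,
          show ((k : ℂ) + 1 / 2) = (((k : ℝ) + 1 / 2 : ℝ) : ℂ) by push_cast; ring, Complex.re_ofReal_mul]
      have him : ∀ c : ℝ, I * y p = c * p.2.1 → (y p).im = -c * p.2.1.re := by
        intro c hcon
        have : y p = I * ((-c : ℝ) * p.2.1) := by
          push_cast
          linear_combination (-I) * hcon + y p * Complex.I_sq
        rw [this, Complex.I_mul_im, Complex.re_ofReal_mul]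
      have g1 : AnalyticAt ℂ (fun q : ℂ × ℂ × ℂ => Complex.Gamma (1 / 2 - I * y q / q.2.1 + M)) p := by
        refine AnalyticAt.fun_comp (g := Complex.Gamma) (analyticAt_Gamma fun j hj => ?_)
          ((analyticAt_const.fun_sub hyI).fun_add analyticAt_const)
        have h0 : I * y p = ((M + j + 1 / 2 : ℝ) : ℂ) * p.2.1 := by
          have : I * y p / p.2.1 = ((M + j + 1 / 2 : ℝ) : ℂ) := by
            push_cast; linear_combination -hj
          rwa [div_eq_iff hne] at this
        have h5 := him _ h0
        rw [hyim] at h5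
        have hk0 : (0 : ℝ) ≤ k * p.1.re := by positivity
        have hj0 : (0 : ℝ) ≤ j * p.2.1.re := by positivity
        nlinarith
      have g2 : AnalyticAt ℂ (fun q : ℂ × ℂ × ℂ => Complex.Gamma (1 / 2 + I * y q / q.2.1)) p := by
        refine AnalyticAt.fun_comp (g := Complex.Gamma) (analyticAt_Gamma fun j hj => ?_)
          (analyticAt_const.fun_add hyI)
        have h0 : I * y p = ((-(j + 1 / 2) : ℝ) : ℂ) * p.2.1 := by
          have : I * y p / p.2.1 = ((-(j + 1 / 2) : ℝ) : ℂ) := by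
            push_cast; linear_combination hj
          rwa [div_eq_iff hne] at this
        have h5 := him _ h0
        rw [hyim] at h5
        have hj0 : (0 : ℝ) ≤ j * p.2.1.re := by positivity
        nlinarith [hn.2]
      exact ((g1.mul g2).mul ((analyticAt_const.mul hb).fun_pow M)).fun_div analyticAt_const
        (by simp)
    · filter_upwards [hev, hb.continuousAt.eventually_ne (ne_zero_of_re_pos h₂)] with q hq hq2 hqA
      have hqA' : poleProd M q ≠ 0 := hqA
      rw [hq, hypGForm_neg_nat, mul_assoc, poleProd, ← Finset.prod_range_mul_prod_Ico _ hmM,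
        ← mul_assoc (∏ k ∈ Finset.range m, _), ← Finset.prod_mul_distrib]
      congr 2
      refine Finset.prod_congr rfl fun k hk => inv_two_cosh_mul_prod hq2 k M fun l hl => ?_
      rw [poleProd, Finset.prod_ne_zero_iff] at hqA'
      exact Finset.prod_ne_zero_iff.1 (hqA' k (Finset.mem_range.2
        ((Finset.mem_range.1 hk).trans_le hmM))) l (Finset.mem_range.2 hl)

end HypG

end AskeyWilson

namespace AskeyWilson

open MeasureTheory Filter Topology Metric
open Complex (I)

/-! ### Continuation of contour integrals with moving poles -/

section PoleContinuation

variable {V : Type} [NormedAddCommGroup V] [NormedSpace ℂ V]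

theorem exists_margin {X ι : Type} [TopologicalSpace X] (L : List ι) {f : ι → X → ℝ} {p : X}
    (hf : ∀ i ∈ L, ContinuousAt (f i) p) (h : ∀ i ∈ L, 0 < f i p) :
    ∃ ε > 0, ∀ᶠ q in 𝓝 p, ∀ i ∈ L, ε ≤ f i q := by
  induction L with
  | nil => exact ⟨1, one_pos, by simp⟩
  | cons a L ih =>
    obtain ⟨ε, hε, hev⟩ := ih (fun i hi => hf i (by simp [hi])) fun i hi => h i (by simp [hi])
    have ha := h a (by simp)
    refine ⟨min ε (f a p / 2), lt_min hε (by linarith), ?_⟩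
    filter_upwards [hev, (hf a (by simp)).eventually_const_lt (half_lt_self ha)] with q h1 h2 i hi
    rcases List.mem_cons.1 hi with rfl | hi
    · exact (min_le_right _ _).trans h2.le
    · exact (min_le_left _ _).trans (h1 i hi)

/-- The product of `z - γ p` over a list of moving points `γ`. -/
noncomputable def rootProd (L : List (V → ℂ)) (p : V) (z : ℂ) : ℂ := (L.map fun γ => z - γ p).prod

omit [NormedAddCommGroup V] [NormedSpace ℂ V] in
theorem norm_inv_rootProd_le {L : List (V → ℂ)} {p : V} {z : ℂ} {ε : ℝ} (hε : 0 < ε)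
    (h : ∀ γ ∈ L, ε ≤ ‖z - γ p‖) : ‖(rootProd L p z)⁻¹‖ ≤ (ε⁻¹) ^ L.length := by
  induction L with
  | nil => simp [rootProd]
  | cons a L ih =>
    have h1 := ih fun γ hγ => h γ (by simp [hγ])
    have h2 : ‖(z - a p)⁻¹‖ ≤ ε⁻¹ := by
      rw [norm_inv]; gcongr; exact h a (by simp)
    rw [rootProd, List.map_cons, List.prod_cons, mul_inv, norm_mul, List.length_cons, pow_succ']
    gcongr
    exact h1

omit [NormedAddCommGroup V] [NormedSpace ℂ V] in
theorem rootProd_ne_zero {L : List (V → ℂ)} {p : V} {z : ℂ} (h : ∀ γ ∈ L, z ≠ γ p) :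
    rootProd L p z ≠ 0 := by
  refine List.prod_ne_zero fun h0 => ?_
  obtain ⟨γ, hγ, h1⟩ := List.mem_map.1 h0
  exact h γ hγ (sub_eq_zero.1 h1)

theorem differentiableAt_rootProd {L : List (V → ℂ)} {q : V × ℂ}
    (h : ∀ γ ∈ L, DifferentiableAt ℂ γ q.1) :
    DifferentiableAt ℂ (fun q : V × ℂ => rootProd L q.1 q.2) q := by
  induction L with
  | nil => simp [rootProd]
  | cons a L ih =>
    simp only [rootProd, List.map_cons, List.prod_cons]
    refine DifferentiableAt.fun_mul (DifferentiableAt.fun_sub (by fun_prop) ?_)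
      (ih fun γ hγ => h γ (by simp [hγ]))
    exact DifferentiableAt.comp (g := a) (f := fun q : V × ℂ => q.1) q (h a (by simp)) (by fun_prop)

/-- Analytic families of functions on the closed strip `|Im z| ≤ T`, locally uniformly exponentially
decaying. -/
structure DecayingFamily (U : Set V) (T : ℝ) (h : V → ℂ → ℂ) : Prop where
  diff : ∀ p ∈ U, ∀ z : ℂ, |z.im| ≤ T → DifferentiableAt ℂ (fun q : V × ℂ => h q.1 q.2) (p, z)
  decay : ∀ p ∈ U, ∃ C c : ℝ, 0 < c ∧ ∀ᶠ q in 𝓝 p, ∀ z : ℂ, |z.im| ≤ T →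
    ‖h q z‖ ≤ C * Real.exp (-c * |z.re|)

variable {U : Set V} {T : ℝ} {h : V → ℂ → ℂ}

theorem DecayingFamily.differentiableAt_div (hh : DecayingFamily U T h) {L : List (V → ℂ)} {q : V × ℂ}
    (hq : q.1 ∈ U) (hz : |q.2.im| ≤ T) (hL : ∀ γ ∈ L, DifferentiableAt ℂ γ q.1)
    (hne : ∀ γ ∈ L, q.2 ≠ γ q.1) :
    DifferentiableAt ℂ (fun q : V × ℂ => h q.1 q.2 * (rootProd L q.1 q.2)⁻¹) q :=
  (hh.diff q.1 hq q.2 hz).fun_mul ((differentiableAt_rootProd hL).fun_inv (rootProd_ne_zero hne))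

theorem DecayingFamily.norm_div_le (hh : DecayingFamily U T h) {p : V} (hp : p ∈ U) (L : List (V → ℂ))
    {s : Set ℂ} (hs : ∀ z ∈ s, |z.im| ≤ T) {P : V → Prop} {ε : ℝ} (hε : 0 < ε)
    (hm : ∀ᶠ q in 𝓝 p, P q → ∀ z ∈ s, ∀ γ ∈ L, ε ≤ ‖z - γ q‖) :
    ∃ C c : ℝ, 0 < c ∧ ∀ᶠ q in 𝓝 p, P q → ∀ z ∈ s,
      ‖h q z * (rootProd L q z)⁻¹‖ ≤ C * Real.exp (-c * |z.re|) := by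
  obtain ⟨C, c, hc, hd⟩ := hh.decay p hp
  refine ⟨C * (ε⁻¹) ^ L.length, c, hc, ?_⟩
  filter_upwards [hd, hm] with q h1 h2 hP z hz
  have h3 := h1 z (hs z hz)
  rw [norm_mul]
  calc _ ≤ C * Real.exp (-c * |z.re|) * (ε⁻¹) ^ L.length :=
        mul_le_mul h3 (norm_inv_rootProd_le hε (h2 hP z hz)) (norm_nonneg _) ((norm_nonneg _).trans h3)
    _ = _ := by ring

variable [FiniteDimensional ℂ V]

theorem DecayingFamily.differentiableOn_line (hh : DecayingFamily U T h) (hU : IsOpen U)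
    {L : List (V → ℂ)} (hL : ∀ γ ∈ L, DifferentiableOn ℂ γ U) {s : ℝ} (hs : |s| ≤ T)
    (hne : ∀ p ∈ U, ∀ γ ∈ L, (γ p).im ≠ s) :
    DifferentiableOn ℂ (fun p => ∫ t : ℝ, h p (t + s * I) * (rootProd L p (t + s * I))⁻¹) U := by
  have him : ∀ t : ℝ, (t + s * I : ℂ).im = s := fun t => by simp
  have hre : ∀ t : ℝ, (t + s * I : ℂ).re = t := fun t => by simp
  have hLat : ∀ p ∈ U, ∀ γ ∈ L, DifferentiableAt ℂ γ p := fun p hp γ hγ =>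
    (hL γ hγ).differentiableAt (hU.mem_nhds hp)
  have hdiff : ∀ p ∈ U, ∀ t : ℝ, DifferentiableAt ℂ
      (fun q : V × ℂ => h q.1 q.2 * (rootProd L q.1 q.2)⁻¹) (p, (t + s * I : ℂ)) := fun p hp t =>
    hh.differentiableAt_div hp (by rwa [him]) (hLat p hp) fun γ hγ h0 => hne p hp γ hγ (by
      have := congrArg Complex.im h0
      rw [him] at this
      exact this.symm)
  refine differentiableOn_integral hU (fun p hp => ?_) fun p hp => ?_
  · refine Continuous.aestronglyMeasurable (continuous_iff_continuousAt.2 fun t => ?_)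
    exact ContinuousAt.comp (f := fun t : ℝ => ((p, (t + s * I : ℂ)) : V × ℂ))
      (hdiff p hp t).continuousAt (by fun_prop)
  · obtain ⟨ε, hε, hev⟩ := exists_margin L (f := fun γ p => |(γ p).im - s|) (p := p)
      (fun γ hγ => ((Complex.continuous_im.continuousAt.comp
        (hLat p hp γ hγ).continuousAt).sub continuousAt_const).abs)
      fun γ hγ => abs_pos.2 (sub_ne_zero.2 (hne p hp γ hγ))
    obtain ⟨C, c, hc, hb⟩ := hh.norm_div_le hp L (s := {z : ℂ | z.im = s}) (P := fun _ => True)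
      (fun z hz => by have hz' : z.im = s := hz; rwa [hz']) hε (by
        filter_upwards [hev] with q hq _ z hz γ hγ
        refine (hq γ hγ).trans ?_
        rw [← abs_neg, neg_sub, ← hz, ← Complex.sub_im]
        exact Complex.abs_im_le_norm _)
    obtain ⟨r, hr, hball⟩ := Metric.eventually_nhds_iff_ball.1 (hb.and (hU.mem_nhds hp))
    refine ⟨r, hr, fun t => C * Real.exp (-c * |t|), (integrable_exp_neg_mul_abs hc).const_mul _,
      Eventually.of_forall fun t => ⟨fun q hq => ?_, fun q hq => ?_⟩⟩
    · refine DifferentiableAt.differentiableWithinAt ?_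
      exact DifferentiableAt.comp (g := fun q : V × ℂ => h q.1 q.2 * (rootProd L q.1 q.2)⁻¹)
        (f := fun q : V => (q, (t + s * I : ℂ))) q (hdiff q (hball q hq).2 t) (by fun_prop)
    · have := (hball q hq).1 trivial (t + s * I) (him t)
      rwa [hre] at this

omit [FiniteDimensional ℂ V] in
-- No pole lies in the closed strip between the two lines, and the poles keep a positive distance
-- from it since they are finite in number; dividing by the linear factors therefore preserves the
-- exponential bound.
theorem DecayingFamily.integral_line_eq (hh : DecayingFamily U T h) {p : V} (hp : p ∈ U)
    {L : List (V → ℂ)} (hL : ∀ γ ∈ L, DifferentiableAt ℂ γ p) {s : ℝ} (hs : |s| ≤ T)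
    (hne : ∀ γ ∈ L, (γ p).im ∉ Set.uIcc 0 s) :
    ∫ t : ℝ, h p t * (rootProd L p t)⁻¹ =
      ∫ t : ℝ, h p (t + s * I) * (rootProd L p (t + s * I))⁻¹ := by
  have hsub : ∀ z : ℂ, z.im ∈ Set.uIcc 0 s → |z.im| ≤ T := fun z hz => by
    have := Set.abs_sub_left_of_mem_uIcc hz
    simp only [sub_zero] at this
    exact this.trans hs
  obtain ⟨ε, hε, hev⟩ := exists_margin L (f := fun γ _ => infDist (γ p).im (Set.uIcc 0 s)) (p := p)
    (fun γ _ => continuousAt_const)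
    fun γ hγ => (isCompact_uIcc.isClosed.notMem_iff_infDist_pos ⟨0, Set.left_mem_uIcc⟩).1 (hne γ hγ)
  obtain ⟨C, c, hc, hb⟩ := hh.norm_div_le hp L (s := {z : ℂ | z.im ∈ Set.uIcc 0 s}) (P := fun q => q = p)
    hsub hε (by
      filter_upwards [hev] with q hq hqp z hz γ hγ
      refine (hq γ hγ).trans ((infDist_le_dist_of_mem hz).trans ?_)
      rw [hqp, Real.dist_eq, ← abs_neg, neg_sub, ← Complex.sub_im]
      exact Complex.abs_im_le_norm _)
  have hb' := hb.self_of_nhds rfl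
  have := AskeyWilson.integral_line_eq (F := fun z => h p z * (rootProd L p z)⁻¹) (a := 0) (b := s) (C := C) hc
    (fun z hz => ?_) hb'
  · simpa using this
  · exact DifferentiableAt.comp (g := fun q : V × ℂ => h q.1 q.2 * (rootProd L q.1 q.2)⁻¹)
      (f := fun z : ℂ => (p, z)) z (hh.differentiableAt_div hp (hsub z hz) hL fun γ hγ h0 =>
        hne γ hγ (by simp only at h0; rwa [← h0])) (by fun_prop)

/-- The product of all differences `β - α`. -/
noncomputable def resultantProd (A B : List (V → ℂ)) (p : V) : ℂ :=
  (A.map fun α => (B.map fun β => β p - α p).prod).prod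

omit [FiniteDimensional ℂ V] [NormedSpace ℂ V] [NormedAddCommGroup V] in
theorem resultantProd_cons (α : V → ℂ) (A B : List (V → ℂ)) (p : V) :
    resultantProd (α :: A) B p = (B.map fun β => β p - α p).prod * resultantProd A B p := by
  simp [resultantProd]

omit [FiniteDimensional ℂ V] [NormedSpace ℂ V] [NormedAddCommGroup V] in
theorem resultantProd_cons_right (β : V → ℂ) (A B : List (V → ℂ)) (p : V) :
    resultantProd A (β :: B) p = (A.map fun α => β p - α p).prod * resultantProd A B p := by
  simp [resultantProd, List.prod_map_mul]

omit [FiniteDimensional ℂ V] [NormedSpace ℂ V] [NormedAddCommGroup V] in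
theorem resultantProd_ne_zero {A B : List (V → ℂ)} {p : V}
    (h : ∀ α ∈ A, ∀ β ∈ B, β p ≠ α p) : resultantProd A B p ≠ 0 := by
  refine List.prod_ne_zero fun h0 => ?_
  obtain ⟨α, hα, h1⟩ := List.mem_map.1 h0
  rw [List.prod_eq_zero_iff] at h1
  obtain ⟨β, hβ, h2⟩ := List.mem_map.1 h1
  exact h α hα β hβ (sub_eq_zero.1 h2)

omit [FiniteDimensional ℂ V] in
theorem differentiableOn_list_prod {ι : Type} (L : List ι) {f : ι → V → ℂ}
    (hf : ∀ i ∈ L, DifferentiableOn ℂ (f i) U) :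
    DifferentiableOn ℂ (fun p => (L.map fun i => f i p).prod) U := by
  induction L with
  | nil => simp
  | cons a L ih =>
    simp only [List.map_cons, List.prod_cons]
    exact (hf a (by simp)).fun_mul (ih fun i hi => hf i (by simp [hi]))

omit [FiniteDimensional ℂ V] in
theorem differentiableOn_resultantProd {A B : List (V → ℂ)} (hA : ∀ α ∈ A, DifferentiableOn ℂ α U)
    (hB : ∀ β ∈ B, DifferentiableOn ℂ β U) : DifferentiableOn ℂ (resultantProd A B) U :=
  differentiableOn_list_prod A fun α hα => differentiableOn_list_prod B fun β hβ =>
    (hB β hβ).fun_sub (hA α hα)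

omit [FiniteDimensional ℂ V] in
theorem DecayingFamily.integrable_real (hh : DecayingFamily U T h) (hU : IsOpen U) (hT : 0 ≤ T) {p : V}
    (hp : p ∈ U) {A B : List (V → ℂ)} (hA : ∀ α ∈ A, DifferentiableOn ℂ α U)
    (hB : ∀ β ∈ B, DifferentiableOn ℂ β U) (hpA : ∀ α ∈ A, (α p).im < 0)
    (hpB : ∀ β ∈ B, 0 < (β p).im) :
    Integrable fun t : ℝ => h p t * (rootProd A p t)⁻¹ * (rootProd B p t)⁻¹ := by
  have hdiv : ∀ t : ℂ, h p t * (rootProd A p t)⁻¹ * (rootProd B p t)⁻¹ =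
      h p t * (rootProd (A ++ B) p t)⁻¹ := fun t => by
    simp only [rootProd, List.map_append, List.prod_append, mul_inv]; ring
  simp only [hdiv]
  have hL : ∀ γ ∈ A ++ B, DifferentiableAt ℂ γ p := fun γ hγ => by
    rcases List.mem_append.1 hγ with h1 | h1
    · exact (hA γ h1).differentiableAt (hU.mem_nhds hp)
    · exact (hB γ h1).differentiableAt (hU.mem_nhds hp)
  have hne : ∀ γ ∈ A ++ B, (γ p).im ≠ 0 := fun γ hγ => by
    rcases List.mem_append.1 hγ with h1 | h1
    · exact (hpA γ h1).ne
    · exact (hpB γ h1).ne'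
  obtain ⟨ε, hε, hev⟩ := exists_margin (A ++ B) (f := fun γ (_ : V) => |(γ p).im|) (p := p)
    (fun γ _ => continuousAt_const) fun γ hγ => abs_pos.2 (hne γ hγ)
  obtain ⟨C, c, hc, hb⟩ := hh.norm_div_le hp (A ++ B) (s := {z : ℂ | z.im = 0}) (P := fun q => q = p)
    (fun z hz => by have hz' : z.im = 0 := hz; rw [hz']; simpa using hT) hε (by
      filter_upwards [hev] with q hq hqp z hz γ hγ
      have hz' : z.im = 0 := hz
      refine (hq γ hγ).trans ?_
      have := Complex.abs_im_le_norm (z - γ p)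
      rw [Complex.sub_im, hz', zero_sub, abs_neg] at this
      rwa [hqp])
  refine integrable_of_norm_le_exp (C := C) (continuous_iff_continuousAt.2 fun t => ?_) hc fun t => ?_
  · exact ContinuousAt.comp (f := fun t : ℝ => ((p, (t : ℂ)) : V × ℂ))
      (g := fun q : V × ℂ => h q.1 q.2 * (rootProd (A ++ B) q.1 q.2)⁻¹)
      (hh.differentiableAt_div hp (by simpa using hT) hL fun γ hγ h0 => hne γ hγ (by
        simp only at h0
        rw [← h0]; simp)).continuousAt (by fun_prop)
  · have := hb.self_of_nhds rfl t (by simp)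
    simpa using this

/-- Induction on both lists. The partial fraction identity expresses `β - α` times the integral as a
difference of two integrals, one without `α` and one without `β`; the remaining differences make up
the factor `resultantProd`. When one list is empty the contour moves to `Im z = -T` or `Im z = T`, a
line which the poles of the other list never reach on `U`, so the integral is analytic on all of
`U`. -/
theorem DecayingFamily.exists_continuation (hh : DecayingFamily U T h) (hU : IsOpen U) (hT : 0 ≤ T)
    (A B : List (V → ℂ)) (hA : ∀ α ∈ A, DifferentiableOn ℂ α U) (hB : ∀ β ∈ B, DifferentiableOn ℂ β U)
    (hAT : ∀ α ∈ A, ∀ p ∈ U, (α p).im < T) (hBT : ∀ β ∈ B, ∀ p ∈ U, -T < (β p).im) :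
    ∃ Ψ : V → ℂ, DifferentiableOn ℂ Ψ U ∧ ∀ p ∈ U, (∀ α ∈ A, (α p).im < 0) → (∀ β ∈ B, 0 < (β p).im) →
      Ψ p = resultantProd A B p *
        ∫ t : ℝ, h p t * (rootProd A p t)⁻¹ * (rootProd B p t)⁻¹ := by
  induction A generalizing B with
  | nil =>
    refine ⟨fun p => ∫ t : ℝ, h p (t + (-T : ℝ) * I) * (rootProd B p (t + (-T : ℝ) * I))⁻¹,
      hh.differentiableOn_line hU hB (by simp [abs_of_nonneg hT]) fun p hp β hβ => (hBT β hβ p hp).ne',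
      fun p hp _ hpB => ?_⟩
    simp only
    rw [← hh.integral_line_eq hp (fun β hβ => (hB β hβ).differentiableAt (hU.mem_nhds hp))
      (by simp [abs_of_nonneg hT]) fun β hβ hcon => ?_]
    · simp [resultantProd, rootProd]
    · rw [Set.uIcc_of_ge (by linarith)] at hcon
      linarith [hcon.2, hpB β hβ]
  | cons α A ihA =>
    induction B with
    | nil =>
      refine ⟨fun p => ∫ t : ℝ, h p (t + T * I) * (rootProd (α :: A) p (t + T * I))⁻¹,
        hh.differentiableOn_line hU hA (by simp [abs_of_nonneg hT]) fun p hp α hα => (hAT α hα p hp).ne,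
        fun p hp hpA _ => ?_⟩
      simp only
      rw [← hh.integral_line_eq hp (fun β hβ => (hA β hβ).differentiableAt (hU.mem_nhds hp))
        (by simp [abs_of_nonneg hT]) fun β hβ hcon => ?_]
      · simp [resultantProd, rootProd]
      · rw [Set.uIcc_of_le hT] at hcon
        linarith [hcon.1, hpA β hβ]
    | cons β B ihB =>
      have hA' : ∀ α ∈ A, DifferentiableOn ℂ α U := fun a ha => hA a (by simp [ha])
      have hB' : ∀ α ∈ B, DifferentiableOn ℂ α U := fun a ha => hB a (by simp [ha])
      obtain ⟨Ψ₁, h1, h1'⟩ := ihA (β :: B) hA' hB (fun a ha => hAT a (by simp [ha])) hBT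
      obtain ⟨Ψ₂, h2, h2'⟩ := ihB hB' fun a ha => hBT a (by simp [ha])
      refine ⟨fun p => (B.map fun β => β p - α p).prod * Ψ₁ p - (A.map fun α => β p - α p).prod * Ψ₂ p,
        ?_, ?_⟩
      · refine (DifferentiableOn.fun_mul ?_ h1).fun_sub (DifferentiableOn.fun_mul ?_ h2)
        · exact differentiableOn_list_prod B fun b hb => (hB' b hb).fun_sub (hA α (by simp))
        · exact differentiableOn_list_prod A fun a ha => (hB β (by simp)).fun_sub (hA' a ha)
      · intro p hp hpA hpB
        have hpA' : ∀ a ∈ A, (a p).im < 0 := fun a ha => hpA a (by simp [ha])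
        have hpB' : ∀ b ∈ B, 0 < (b p).im := fun b hb => hpB b (by simp [hb])
        have i1 := hh.integrable_real hU hT hp hA' hB hpA' hpB
        have i2 := hh.integrable_real hU hT hp hA hB' hpA hpB'
        simp only
        rw [h1' p hp hpA' hpB, h2' p hp hpA hpB', resultantProd_cons, resultantProd_cons,
          resultantProd_cons_right, List.map_cons, List.prod_cons]
        have hsplit : (β p - α p) * ∫ t : ℝ, h p t * (rootProd (α :: A) p t)⁻¹ * (rootProd (β :: B) p t)⁻¹ =
            (∫ t : ℝ, h p t * (rootProd A p t)⁻¹ * (rootProd (β :: B) p t)⁻¹) -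
            ∫ t : ℝ, h p t * (rootProd (α :: A) p t)⁻¹ * (rootProd B p t)⁻¹ := by
          rw [← integral_sub i1 i2, ← integral_const_mul]
          refine integral_congr_ae (Eventually.of_forall fun t => ?_)
          have n1 : (t : ℂ) - α p ≠ 0 := fun h0 => by
            have := congrArg Complex.im h0
            simp at this
            exact (hpA α (by simp)).ne this
          have n2 : (t : ℂ) - β p ≠ 0 := fun h0 => by
            have := congrArg Complex.im h0
            simp at this
            exact (hpB β (by simp)).ne' this
          simp only [rootProd, List.map_cons, List.prod_cons, mul_inv]
          have e1 := mul_inv_cancel₀ n1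
          have e2 := mul_inv_cancel₀ n2
          generalize (A.map fun γ => (t : ℂ) - γ p).prod⁻¹ = a
          generalize (B.map fun γ => (t : ℂ) - γ p).prod⁻¹ = b
          generalize ((t : ℂ) - α p)⁻¹ = c at *
          generalize ((t : ℂ) - β p)⁻¹ = d at *
          linear_combination (h p t * a * b * d) * e1 - (h p t * a * b * c) * e2
        linear_combination (-((B.map fun β => β p - α p).prod * (A.map fun α => β p - α p).prod *
          resultantProd A B p)) * hsplit

end PoleContinuation

end AskeyWilson

namespace AskeyWilson

open MeasureTheory Filter Topology Metric
open Complex (I)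

/-! ### Decay of products of hyperbolic gamma functions -/

section Decay

variable {V : Type} [TopologicalSpace V]

/-- The product `∏ G(z + a j) ∏ G(-z + b j)`. -/
noncomputable def gammaProd (w₁ w₂ : ℂ) (a b : Fin 4 → ℂ) (z : ℂ) : ℂ :=
  (∏ j, hypG w₁ w₂ (z + a j)) * ∏ j, hypG w₁ w₂ (-z + b j)

theorem gammaProd_neg (w₁ w₂ : ℂ) (a b : Fin 4 → ℂ) (z : ℂ) :
    gammaProd w₁ w₂ a b (-z) = gammaProd w₁ w₂ b a z := by
  rw [gammaProd, gammaProd, neg_neg, mul_comm]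

theorem norm_gauss (w₁ w₂ z : ℂ) : ‖gauss w₁ w₂ z‖ = Real.exp (I * Real.pi * z ^ 2 / (2 * w₁ * w₂)).re := by
  rw [gauss, Complex.norm_exp]

/-- The terms in `z²` cancel because there are equally many factors of both kinds; the condition on
the sum of the shifts determines the linear term and hence the decay rate. -/
theorem sum_gauss_exponent {w₁ w₂ : ℂ} (h₁ : w₁ ≠ 0) (h₂ : w₂ ≠ 0) {a b : Fin 4 → ℂ}
    (hsum : ∑ j, (a j + b j) = -4 * I * wMean w₁ w₂) (z : ℂ) :
    ∑ j, (I * Real.pi * (z - b j) ^ 2 / (2 * w₁ * w₂) - I * Real.pi * (z + a j) ^ 2 / (2 * w₁ * w₂)) =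
      -2 * Real.pi * (w₁⁻¹ + w₂⁻¹) * z +
        I * Real.pi / (2 * w₁ * w₂) * ∑ j, (b j ^ 2 - a j ^ 2) := by
  have h1 : ∀ j, I * Real.pi * (z - b j) ^ 2 / (2 * w₁ * w₂) - I * Real.pi * (z + a j) ^ 2 / (2 * w₁ * w₂) =
      I * Real.pi / (2 * w₁ * w₂) * (b j ^ 2 - a j ^ 2) - I * Real.pi / (2 * w₁ * w₂) * (2 * z) * (a j + b j) :=
    fun j => by ring
  simp only [h1, Finset.sum_sub_distrib, ← Finset.mul_sum]
  rw [hsum, wMean]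
  generalize ∑ x, b x ^ 2 = u
  generalize ∑ x, a x ^ 2 = v
  field_simp
  linear_combination (4 * z * (w₁ + w₂)) * Complex.I_sq

/-- Write `G(z + a_j) G(-z + b_j) = G(z + a_j) / G(z - b_j)`. The two arguments are a bounded
distance apart, so `exists_hypG_ratio` bounds each quotient by a quotient of Gaussians. -/
theorem exists_decay_right {w₁ w₂ : V → ℂ} {a b : Fin 4 → V → ℂ} {p : V} (hw₁ : ContinuousAt w₁ p)
    (hw₂ : ContinuousAt w₂ p) (ha : ∀ j, ContinuousAt (a j) p) (hb : ∀ j, ContinuousAt (b j) p)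
    (h₁ : 0 < (w₁ p).re) (h₂ : 0 < (w₂ p).re)
    (hsum : ∀ q, ∑ j, (a j q + b j q) = -4 * I * wMean (w₁ q) (w₂ q)) {T : ℝ} (hT : 0 ≤ T) {c : ℝ}
    (hc : c < 2 * Real.pi * ((w₁ p)⁻¹ + (w₂ p)⁻¹).re) :
    ∃ X C : ℝ, ∀ᶠ q in 𝓝 p, ∀ z : ℂ, X ≤ z.re → |z.im| ≤ T →
      ‖gammaProd (w₁ q) (w₂ q) (fun j => a j q) (fun j => b j q) z‖ ≤ C * Real.exp (-c * z.re) := by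
  have n1 := ne_zero_of_re_pos h₁
  have n2 := ne_zero_of_re_pos h₂
  set S := ∑ j, (‖a j p‖ + ‖b j p‖) + 1 with hS
  have hS0 : 0 ≤ S := by positivity
  have haS : ∀ j, ‖a j p‖ < S := fun j => by
    have := Finset.single_le_sum (f := fun j => ‖a j p‖ + ‖b j p‖) (fun i _ => by positivity) (Finset.mem_univ j)
    linarith [norm_nonneg (b j p)]
  have hbS : ∀ j, ‖b j p‖ < S := fun j => by
    have := Finset.single_le_sum (f := fun j => ‖a j p‖ + ‖b j p‖) (fun i _ => by positivity) (Finset.mem_univ j)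
    linarith [norm_nonneg (a j p)]
  obtain ⟨X, K, hK, hev⟩ := exists_hypG_ratio (w := (w₁ p, w₂ p)) h₁ h₂ (T := T + 2 * S) (by positivity)
  have hev' := (hw₁.prodMk hw₂).eventually hev
  set κ : V → ℂ := fun q => (w₁ q)⁻¹ + (w₂ q)⁻¹ with hκ
  have hκc : ContinuousAt κ p := (hw₁.inv₀ n1).add (hw₂.inv₀ n2)
  set E : V → ℂ := fun q => I * Real.pi / (2 * w₁ q * w₂ q) * ∑ j, (b j q ^ 2 - a j q ^ 2) with hE
  have hEc : ContinuousAt E p := by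
    refine ContinuousAt.mul (continuousAt_const.div ((continuousAt_const.mul hw₁).mul hw₂)
      (mul_ne_zero (mul_ne_zero two_ne_zero n1) n2)) ?_
    exact tendsto_finsetSum _ fun j _ => ((hb j).pow 2).sub ((ha j).pow 2)
  have e1 : ∀ᶠ q in 𝓝 p, c < 2 * Real.pi * (κ q).re :=
    ((Complex.continuous_re.continuousAt.comp hκc).const_mul _).eventually_const_lt hc
  have e2 : ∀ᶠ q in 𝓝 p, |(κ q).im| < |(κ p).im| + 1 :=
    (Complex.continuous_im.continuousAt.comp hκc).abs.eventually_lt_const (lt_add_one _)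
  have e3 : ∀ᶠ q in 𝓝 p, (E q).re < (E p).re + 1 :=
    (Complex.continuous_re.continuousAt.comp hEc).eventually_lt_const (lt_add_one _)
  have e4 : ∀ᶠ q in 𝓝 p, ∀ j, ‖a j q‖ < S := eventually_all.2 fun j => (ha j).norm.eventually_lt_const (haS j)
  have e5 : ∀ᶠ q in 𝓝 p, ∀ j, ‖b j q‖ < S := eventually_all.2 fun j => (hb j).norm.eventually_lt_const (hbS j)
  refine ⟨max (X + S) 0, K ^ 4 * Real.exp ((E p).re + 1 + 2 * Real.pi * (|(κ p).im| + 1) * T), ?_⟩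
  filter_upwards [hev', e1, e2, e3, e4, e5, hw₁.eventually_ne n1, hw₂.eventually_ne n2,
    (Complex.continuous_re.continuousAt.comp hw₁).eventually_const_lt h₁,
    (Complex.continuous_re.continuousAt.comp hw₂).eventually_const_lt h₂]
    with q hq q1 q2 q3 q4 q5 m1 m2 r1 r2 z hz hzT
  have hzX := (le_max_left _ _).trans hz
  have hz0 := (le_max_right _ _).trans hz
  have hpair : ∀ j, ‖hypG (w₁ q) (w₂ q) (z + a j q) * hypG (w₁ q) (w₂ q) (-z + b j q)‖ ≤
      K * Real.exp (I * Real.pi * (z - b j q) ^ 2 / (2 * w₁ q * w₂ q) -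
        I * Real.pi * (z + a j q) ^ 2 / (2 * w₁ q * w₂ q)).re := by
    intro j
    have b1 := abs_le.1 ((Complex.abs_re_le_norm (a j q)).trans (q4 j).le)
    have b2 := (Complex.abs_im_le_norm (a j q)).trans (q4 j).le
    have b3 := abs_le.1 ((Complex.abs_re_le_norm (b j q)).trans (q5 j).le)
    have b4 := (Complex.abs_im_le_norm (b j q)).trans (q5 j).le
    obtain ⟨g1, g2⟩ := hq (z + a j q) (z - b j q) (by rw [Complex.add_re]; linarith)
      (by rw [Complex.add_im]; exact (abs_add_le _ _).trans (by linarith))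
      (by rw [Complex.sub_re]; linarith)
      (by rw [Complex.sub_im]; exact (abs_sub _ _).trans (by linarith))
      (by
        rw [show z + a j q - (z - b j q) = a j q + b j q by ring]
        exact (norm_add_le _ _).trans (by linarith [q4 j, q5 j]))
    rw [show -z + b j q = -(z - b j q) by ring, hypG_neg r1 r2, Complex.sub_re, Real.exp_sub, norm_mul,
      norm_inv]
    rw [norm_mul, norm_mul, norm_gauss, norm_gauss] at g2
    have hpos : 0 < ‖hypG (w₁ q) (w₂ q) (z - b j q)‖ := norm_pos_iff.2 g1
    rw [mul_div_assoc', le_div_iff₀ (Real.exp_pos _), ← div_eq_mul_inv, div_mul_eq_mul_div, div_le_iff₀ hpos]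
    linarith
  rw [gammaProd, ← Finset.prod_mul_distrib, norm_prod]
  refine (Finset.prod_le_prod (fun _ _ => norm_nonneg _) fun j _ => hpair j).trans ?_
  rw [Finset.prod_mul_distrib, Finset.prod_const, Finset.card_univ, Fintype.card_fin, ← Real.exp_sum,
    ← Complex.re_sum, sum_gauss_exponent m1 m2 (hsum q), mul_assoc (K ^ 4), ← Real.exp_add]
  refine mul_le_mul_of_nonneg_left (Real.exp_le_exp.2 ?_) (by positivity)
  rw [Complex.add_re]
  have hre : (-2 * Real.pi * ((w₁ q)⁻¹ + (w₂ q)⁻¹) * z).re =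
      -(2 * Real.pi * (κ q).re) * z.re + 2 * Real.pi * ((κ q).im * z.im) := by
    rw [show (-2 * Real.pi * ((w₁ q)⁻¹ + (w₂ q)⁻¹) * z : ℂ) = ((-2 * Real.pi : ℝ) : ℂ) * (κ q * z) by
      rw [hκ]; push_cast; ring, Complex.re_ofReal_mul, Complex.mul_re]
    ring
  rw [hre]
  have h5 : (κ q).im * z.im ≤ (|(κ p).im| + 1) * T := by
    refine (le_abs_self _).trans ?_
    rw [abs_mul]
    gcongr
  have h6 : -(2 * Real.pi * (κ q).re) * z.re ≤ -c * z.re := by nlinarith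
  have h7 : 2 * Real.pi * ((κ q).im * z.im) ≤ 2 * Real.pi * ((|(κ p).im| + 1) * T) := by
    have := Real.pi_pos
    gcongr
  linarith

/-- The reflection `z ↦ -z` exchanges `a` and `b`, so the estimate on the left is the one on the
right with the two families exchanged. -/
theorem exists_decay {w₁ w₂ : V → ℂ} {a b : Fin 4 → V → ℂ} {p : V} (hw₁ : ContinuousAt w₁ p)
    (hw₂ : ContinuousAt w₂ p) (ha : ∀ j, ContinuousAt (a j) p) (hb : ∀ j, ContinuousAt (b j) p)
    (h₁ : 0 < (w₁ p).re) (h₂ : 0 < (w₂ p).re)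
    (hsum : ∀ q, ∑ j, (a j q + b j q) = -4 * I * wMean (w₁ q) (w₂ q)) {T : ℝ} (hT : 0 ≤ T) {c : ℝ}
    (hc : c < 2 * Real.pi * ((w₁ p)⁻¹ + (w₂ p)⁻¹).re) :
    ∃ X C : ℝ, ∀ᶠ q in 𝓝 p, ∀ z : ℂ, X ≤ |z.re| → |z.im| ≤ T →
      ‖gammaProd (w₁ q) (w₂ q) (fun j => a j q) (fun j => b j q) z‖ ≤ C * Real.exp (-c * |z.re|) := by
  obtain ⟨X, C, hev⟩ := exists_decay_right hw₁ hw₂ ha hb h₁ h₂ hsum hT hc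
  obtain ⟨X', C', hev'⟩ := exists_decay_right hw₁ hw₂ hb ha h₁ h₂
    (fun q => by rw [← hsum q]; exact Finset.sum_congr rfl fun j _ => add_comm _ _) hT hc
  refine ⟨max X X', max C C', ?_⟩
  filter_upwards [hev, hev'] with q hq hq' z hz hzT
  rcases le_total 0 z.re with h | h
  · rw [abs_of_nonneg h] at hz ⊢
    refine (hq z ((le_max_left _ _).trans hz) hzT).trans ?_
    gcongr
    exact le_max_left _ _
  · rw [abs_of_nonpos h] at hz ⊢
    have := hq' (-z) (by simpa using (le_max_right _ _).trans hz) (by simpa using hzT)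
    rw [gammaProd_neg, Complex.neg_re] at this
    refine this.trans ?_
    gcongr
    exact le_max_right _ _

theorem exists_pow_le_exp (D : ℕ) {R c : ℝ} (hR : 0 ≤ R) (hc : 0 < c) :
    ∃ C, 0 ≤ C ∧ ∀ t : ℝ, 0 ≤ t → (R + t) ^ D ≤ C * Real.exp (c * t) := by
  refine ⟨D.factorial / c ^ D * Real.exp (c * R), by positivity, fun t ht => ?_⟩
  have := Real.pow_div_factorial_le_exp (x := c * (R + t)) (by positivity) D
  rw [div_le_iff₀ (by positivity), mul_pow, mul_add, Real.exp_add] at this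
  rw [div_mul_eq_mul_div, div_mul_eq_mul_div, le_div_iff₀ (by positivity)]
  linarith

end Decay

end AskeyWilson

namespace AskeyWilson

open MeasureTheory Filter Topology Metric
open Complex (I)

/-! ### The continuation of the matrix coefficient -/

section Continuation

/-- The shifts in the factors `G(z + a)` of the integrand of the matrix coefficient. -/
noncomputable def upArg (j : Fin 4) (p : Param) : ℂ :=
  (![p.2.2.2.1 + p.2.2.2.2 / 2 + I * tau p.2.2.1, p.2.2.2.1 + p.2.2.2.2 / 2 - I * tau p.2.2.1,
    -(p.2.2.2.2 / 2) + I * sigma p.2.2.1, -(p.2.2.2.2 / 2) - I * sigma p.2.2.1] : Fin 4 → ℂ) j -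
    I * wMean p.1 p.2.1 / 2

/-- The shifts in the factors `G(-z + b)` of the integrand of the matrix coefficient. -/
noncomputable def loArg (j : Fin 4) (p : Param) : ℂ :=
  (![-(p.2.2.2.1 - p.2.2.2.2 / 2 + I * rho p.2.2.1), -(p.2.2.2.1 - p.2.2.2.2 / 2 - I * rho p.2.2.1),
    -(p.2.2.2.2 / 2 + I * upsilon p.2.2.1), -(p.2.2.2.2 / 2 - I * upsilon p.2.2.1)] : Fin 4 → ℂ) j -
    I * wMean p.1 p.2.1 / 2

theorem differentiable_upArg (j : Fin 4) : Differentiable ℂ (upArg j) := by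
  unfold upArg tau sigma wMean
  fin_cases j <;> simp <;> fun_prop

theorem differentiable_loArg (j : Fin 4) : Differentiable ℂ (loArg j) := by
  unfold loArg rho upsilon wMean
  fin_cases j <;> simp <;> fun_prop

theorem sum_upArg_add_loArg (p : Param) :
    ∑ j, (upArg j p + loArg j p) = -4 * I * wMean p.1 p.2.1 := by
  simp only [upArg, loArg, Fin.sum_univ_four, Matrix.cons_val]
  ring

/-- The integrand of the matrix coefficient. -/
noncomputable def coeffIntegrand (p : Param) (z : ℂ) : ℂ :=
  gammaProd p.1 p.2.1 (fun j => upArg j p) (fun j => loArg j p) z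

/-- The condition that the real line separates the poles of the integrand. -/
def Separated (p : Param) : Prop :=
  ∀ j, -(wMean p.1 p.2.1).re < (upArg j p).im ∧ -(wMean p.1 p.2.1).re < (loArg j p).im

/-- A convex exhaustion of the domain. -/
def exhaust (N : ℕ) : Set Param :=
  {p | ((N : ℝ) + 1)⁻¹ < p.1.re ∧ ((N : ℝ) + 1)⁻¹ < p.2.1.re ∧ ‖p‖ < N + 1}

theorem isOpen_exhaust (N : ℕ) : IsOpen (exhaust N) := by
  have h1 : Continuous fun p : Param => p.1.re := by fun_prop
  have h2 : Continuous fun p : Param => p.2.1.re := by fun_prop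
  exact (isOpen_lt continuous_const h1).inter ((isOpen_lt continuous_const h2).inter
    (isOpen_lt continuous_norm continuous_const))

theorem convex_exhaust (N : ℕ) : Convex ℝ (exhaust N) := by
  let l1 : Param →ₗ[ℝ] ℝ := Complex.reLm.comp (LinearMap.fst ℝ ℂ _)
  let l2 : Param →ₗ[ℝ] ℝ := Complex.reLm.comp ((LinearMap.fst ℝ ℂ _).comp (LinearMap.snd ℝ ℂ _))
  have c1 : Convex ℝ (l1 ⁻¹' Set.Ioi ((N : ℝ) + 1)⁻¹) := (convex_Ioi _).linear_preimage l1
  have c2 : Convex ℝ (l2 ⁻¹' Set.Ioi ((N : ℝ) + 1)⁻¹) := (convex_Ioi _).linear_preimage l2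
  have c3 := convex_ball (0 : Param) ((N : ℝ) + 1)
  have : exhaust N = l1 ⁻¹' Set.Ioi ((N : ℝ) + 1)⁻¹ ∩ (l2 ⁻¹' Set.Ioi ((N : ℝ) + 1)⁻¹ ∩ ball 0 ((N : ℝ) + 1)) := by
    ext p
    simp [exhaust, l1, l2]
  rw [this]
  exact c1.inter (c2.inter c3)

theorem exhaust_subset_domain (N : ℕ) : exhaust N ⊆ domain := fun p hp =>
  ⟨lt_trans (by positivity) hp.1, lt_trans (by positivity) hp.2.1⟩

theorem exhaust_mono {N N' : ℕ} (h : N ≤ N') : exhaust N ⊆ exhaust N' := by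
  rintro p ⟨h1, h2, h3⟩
  have h4 : (N : ℝ) ≤ N' := by exact_mod_cast h
  have h5 : ((N' : ℝ) + 1)⁻¹ ≤ ((N : ℝ) + 1)⁻¹ := by gcongr
  exact ⟨h5.trans_lt h1, h5.trans_lt h2, by linarith⟩

theorem exists_mem_exhaust {p : Param} (hp : p ∈ domain) : ∃ N, p ∈ exhaust N := by
  obtain ⟨h1, h2⟩ := hp
  obtain ⟨n1, hn1⟩ := exists_nat_one_div_lt h1
  obtain ⟨n2, hn2⟩ := exists_nat_one_div_lt h2
  obtain ⟨n3, hn3⟩ := exists_nat_gt ‖p‖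
  rw [one_div] at hn1 hn2
  have key : ∀ n : ℕ, n ≤ max n1 (max n2 n3) →
      ((max n1 (max n2 n3) : ℕ) + 1 : ℝ)⁻¹ ≤ ((n : ℝ) + 1)⁻¹ := by
    intro n hn
    have : (n : ℝ) ≤ (max n1 (max n2 n3) : ℕ) := by exact_mod_cast hn
    gcongr
  refine ⟨max n1 (max n2 n3), (key n1 (le_max_left _ _)).trans_lt hn1,
    (key n2 ((le_max_left _ _).trans (le_max_right _ _))).trans_lt hn2, ?_⟩
  have : (n3 : ℝ) ≤ (max n1 (max n2 n3) : ℕ) := by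
    exact_mod_cast (le_max_right n2 n3).trans (le_max_right _ _)
  linarith

theorem norm_components_le (p : Param) : ‖p.1‖ ≤ ‖p‖ ∧ ‖p.2.1‖ ≤ ‖p‖ ∧ (∀ i, ‖p.2.2.1 i‖ ≤ ‖p‖) ∧
    ‖p.2.2.2.1‖ ≤ ‖p‖ ∧ ‖p.2.2.2.2‖ ≤ ‖p‖ := by
  have h2 := norm_snd_le p
  have h3 := (norm_snd_le p.2).trans h2
  have h4 := (norm_snd_le p.2.2).trans h3
  exact ⟨norm_fst_le p, (norm_fst_le p.2).trans h2,
    fun i => (norm_le_pi_norm p.2.2.1 i).trans ((norm_fst_le p.2.2).trans h3),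
    (norm_fst_le p.2.2.2).trans h4, (norm_snd_le p.2.2.2).trans h4⟩

theorem norm_arg_le (p : Param) (j : Fin 4) : ‖upArg j p‖ ≤ 3 * ‖p‖ ∧ ‖loArg j p‖ ≤ 3 * ‖p‖ := by
  obtain ⟨h1, h2, h3, h4, h5⟩ := norm_components_le p
  have hw : ‖I * wMean p.1 p.2.1 / 2‖ ≤ ‖p‖ / 2 := by
    rw [norm_div, norm_mul, Complex.norm_I, one_mul, wMean, norm_div, Complex.norm_ofNat]
    have := norm_add_le p.1 p.2.1
    linarith
  have hhalf : ∀ u v : ℂ, ‖u‖ ≤ ‖p‖ → ‖v‖ ≤ ‖p‖ → ‖I * ((u + v) / 2)‖ ≤ ‖p‖ := fun u v hu hv => by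
    rw [norm_mul, Complex.norm_I, one_mul, norm_div, Complex.norm_ofNat]
    have := norm_add_le u v
    linarith
  have hl : ‖p.2.2.2.2 / 2‖ ≤ ‖p‖ / 2 := by
    rw [norm_div, Complex.norm_ofNat]; linarith
  have hn : ∀ i, ‖-p.2.2.1 i‖ ≤ ‖p‖ := fun i => by rw [norm_neg]; exact h3 i
  have ht : ‖I * tau p.2.2.1‖ ≤ ‖p‖ := by
    have := hhalf _ _ (h3 3) (hn 2); rwa [← sub_eq_add_neg] at this
  have hr : ‖I * rho p.2.2.1‖ ≤ ‖p‖ := by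
    have := hhalf _ _ (h3 1) (hn 0); rwa [← sub_eq_add_neg] at this
  have hs : ‖I * sigma p.2.2.1‖ ≤ ‖p‖ := hhalf _ _ (h3 0) (h3 1)
  have hu : ‖I * upsilon p.2.2.1‖ ≤ ‖p‖ := by
    have := hhalf _ _ (hn 2) (hn 3); rwa [← neg_add] at this
  have sub : ∀ {u v : ℂ} {a b : ℝ}, ‖u‖ ≤ a → ‖v‖ ≤ b → ‖u - v‖ ≤ a + b := fun ha hb =>
    (norm_sub_le _ _).trans (add_le_add ha hb)
  have add : ∀ {u v : ℂ} {a b : ℝ}, ‖u‖ ≤ a → ‖v‖ ≤ b → ‖u + v‖ ≤ a + b := fun ha hb =>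
    (norm_add_le _ _).trans (add_le_add ha hb)
  have neg : ∀ {u : ℂ} {a : ℝ}, ‖u‖ ≤ a → ‖-u‖ ≤ a := fun ha => by rwa [norm_neg]
  have hp := norm_nonneg p
  constructor
  · fin_cases j <;> simp only [upArg]
    · exact (sub (add (add h4 hl) ht) hw).trans (by linarith)
    · exact (sub (sub (add h4 hl) ht) hw).trans (by linarith)
    · exact (sub (add (neg hl) hs) hw).trans (by linarith)
    · exact (sub (sub (neg hl) hs) hw).trans (by linarith)
  · fin_cases j <;> simp only [loArg]
    · exact (sub (neg (add (sub h4 hl) hr)) hw).trans (by linarith)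
    · exact (sub (neg (sub (sub h4 hl) hr)) hw).trans (by linarith)
    · exact (sub (neg (add hl hu)) hw).trans (by linarith)
    · exact (sub (neg (sub hl hu)) hw).trans (by linarith)

/-- The poles of the integrand on one side of the contour. -/
noncomputable def poleArg (a : Fin 4 → Param → ℂ) (i : Fin 4 × ℕ × ℕ) (p : Param) : ℂ :=
  a i.1 p + I * wMean p.1 p.2.1 + I * i.2.1 * p.1 + I * i.2.2 * p.2.1

/-- Indices of the poles that are taken into account. -/
def poleIndex (M : ℕ) : Finset (Fin 4 × ℕ × ℕ) :=
  Finset.univ ×ˢ Finset.range M ×ˢ Finset.range M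

theorem differentiable_poleArg {a : Fin 4 → Param → ℂ} (ha : ∀ j, Differentiable ℂ (a j))
    (i : Fin 4 × ℕ × ℕ) : Differentiable ℂ (poleArg a i) := by
  have := ha i.1
  unfold poleArg wMean
  fun_prop

theorem poleArg_im (a : Fin 4 → Param → ℂ) (i : Fin 4 × ℕ × ℕ) (p : Param) :
    (poleArg a i p).im = (a i.1 p).im + (wMean p.1 p.2.1).re + i.2.1 * p.1.re + i.2.2 * p.2.1.re := by
  simp only [poleArg, Complex.add_im, mul_assoc, Complex.I_mul_im]
  rw [← Complex.ofReal_natCast, ← Complex.ofReal_natCast, Complex.re_ofReal_mul, Complex.re_ofReal_mul]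

theorem rootProd_toList {ι : Type} (s : Finset ι) (f : ι → Param → ℂ) (p : Param) (z : ℂ) :
    rootProd (s.toList.map f) p z = ∏ i ∈ s, (z - f i p) := by
  rw [rootProd, List.map_map, ← Finset.prod_map_toList]
  rfl

theorem prod_poleProd (a : Fin 4 → Param → ℂ) (M : ℕ) (p : Param) (z : ℂ) :
    ∏ j, poleProd M (p.1, p.2.1, z + a j p) = ∏ i ∈ poleIndex M, (z + poleArg a i p) := by
  rw [poleIndex, Finset.prod_product]
  refine Finset.prod_congr rfl fun j _ => ?_
  rw [Finset.prod_product, poleProd]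
  refine Finset.prod_congr rfl fun k _ => Finset.prod_congr rfl fun l _ => ?_
  simp only [poleArg]
  ring

theorem rootProd_neg_poleArg (a : Fin 4 → Param → ℂ) (M : ℕ) (p : Param) (z : ℂ) :
    rootProd ((poleIndex M).toList.map fun i p => -poleArg a i p) p z =
      ∏ j, poleProd M (p.1, p.2.1, z + a j p) := by
  rw [rootProd_toList, prod_poleProd]
  simp only [sub_neg_eq_add]

theorem rootProd_poleArg (a : Fin 4 → Param → ℂ) (M : ℕ) (p : Param) (z : ℂ) :
    rootProd ((poleIndex M).toList.map (poleArg a)) p z =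
      ∏ j, poleProd M (p.1, p.2.1, -z + a j p) := by
  -- Each of the `4 M²` linear factors changes sign, an even number of times.
  have hcard : Even (poleIndex M).card := by
    rw [poleIndex, Finset.card_product, Finset.card_univ, Fintype.card_fin]
    exact (by decide : Even 4).mul_right _
  rw [rootProd_toList, prod_poleProd,
    Finset.prod_congr rfl (fun i _ => show z - poleArg a i p = -1 * (-z + poleArg a i p) by ring),
    Finset.prod_mul_distrib, Finset.prod_const, hcard.neg_one_pow, one_mul]

/-- On `exhaust N` the real parts of the periods exceed `1/(N + 1)`, so with this number of poles `M
Re wᵢ > 6(N + 1) + 1`. That is the bound for the imaginary parts of all arguments when `|Im z| ≤ 3(N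
+ 1) + 1`, since each shift has norm below `3(N + 1)`. -/
theorem mem_regDomain_of_exhaust {N : ℕ} {p : Param} (hp : p ∈ exhaust N) {ζ : ℂ}
    (h : |ζ.im| ≤ 6 * ((N : ℝ) + 1) + 1) :
    ((p.1, p.2.1, ζ) : ℂ × ℂ × ℂ) ∈ regDomain ((N + 1) * (6 * (N + 1) + 1)) := by
  obtain ⟨h1, h2, -⟩ := hp
  have hd : (0 : ℝ) < (N : ℝ) + 1 := by positivity
  have hone : ∀ w : ℂ, ((N : ℝ) + 1)⁻¹ < w.re →
      -(((N + 1) * (6 * (N + 1) + 1) : ℕ) : ℝ) * w.re < ζ.im := by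
    intro w hw
    rw [inv_lt_iff_one_lt_mul₀' hd] at hw
    push_cast
    rw [abs_le] at h
    nlinarith [h.1]
  exact ⟨lt_trans (by positivity) h1, lt_trans (by positivity) h2, hone _ h1, hone _ h2⟩

end Continuation

end AskeyWilson

namespace AskeyWilson

open MeasureTheory Filter Topology Metric
open Complex (I)

/-! ### Continuation on one set of the exhaustion. -/

section Continuation

/-- The points below the real line that are poles of the integrand. -/
noncomputable def lowerPoles (M : ℕ) : List (Param → ℂ) :=
  (poleIndex M).toList.map fun i p => -poleArg upArg i p

/-- The points above the real line that are poles of the integrand. -/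
noncomputable def upperPoles (M : ℕ) : List (Param → ℂ) :=
  (poleIndex M).toList.map (poleArg loArg)

/-- A product of eight functions of the shape of the integrand. -/
noncomputable def regIntegrand (g : ℂ × ℂ × ℂ → ℂ) (p : Param) (z : ℂ) : ℂ :=
  (∏ j, g (p.1, p.2.1, z + upArg j p)) * ∏ j, g (p.1, p.2.1, -z + loArg j p)

theorem abs_im_add_arg_le {N : ℕ} {p : Param} (hp : p ∈ exhaust N) {z : ℂ}
    (hz : |z.im| ≤ 3 * ((N : ℝ) + 1) + 1) (j : Fin 4) :
    |(z + upArg j p).im| ≤ 6 * ((N : ℝ) + 1) + 1 ∧ |(-z + loArg j p).im| ≤ 6 * ((N : ℝ) + 1) + 1 := by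
  obtain ⟨h1, h2⟩ := norm_arg_le p j
  have h3 := hp.2.2
  have h4 := Complex.abs_im_le_norm (upArg j p)
  have h5 := Complex.abs_im_le_norm (loArg j p)
  constructor
  · rw [Complex.add_im]
    have := abs_add_le z.im (upArg j p).im
    linarith
  · rw [Complex.add_im, Complex.neg_im]
    have := abs_add_le (-z.im) (loArg j p).im
    rw [abs_neg] at this
    linarith

theorem regIntegrand_eq {N M : ℕ} (hM : M = (N + 1) * (6 * (N + 1) + 1)) {g : ℂ × ℂ × ℂ → ℂ}
    (hg : ∀ q ∈ regDomain M, poleProd M q ≠ 0 → g q = hypG q.1 q.2.1 q.2.2 * poleProd M q)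
    {p : Param} (hp : p ∈ exhaust N) {z : ℂ} (hz : |z.im| ≤ 3 * ((N : ℝ) + 1) + 1)
    (hA : rootProd (lowerPoles M) p z ≠ 0) (hB : rootProd (upperPoles M) p z ≠ 0) :
    regIntegrand g p z = coeffIntegrand p z * rootProd (lowerPoles M) p z * rootProd (upperPoles M) p z := by
  subst hM
  rw [lowerPoles, rootProd_neg_poleArg] at hA ⊢
  rw [upperPoles, rootProd_poleArg] at hB ⊢
  rw [regIntegrand, coeffIntegrand, gammaProd,
    Finset.prod_congr rfl fun j _ => hg _ (mem_regDomain_of_exhaust hp (abs_im_add_arg_le hp hz j).1)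
      (Finset.prod_ne_zero_iff.1 hA j (Finset.mem_univ j)),
    Finset.prod_congr rfl fun j _ => hg _ (mem_regDomain_of_exhaust hp (abs_im_add_arg_le hp hz j).2)
      (Finset.prod_ne_zero_iff.1 hB j (Finset.mem_univ j)), Finset.prod_mul_distrib,
    Finset.prod_mul_distrib]
  ring

theorem norm_rootProd_le {V : Type} {L : List (V → ℂ)} {p : V} {z : ℂ} {R : ℝ}
    (h : ∀ γ ∈ L, ‖z - γ p‖ ≤ R) : ‖rootProd L p z‖ ≤ R ^ L.length := by
  induction L with
  | nil => simp [rootProd]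
  | cons a L ih =>
    have h1 := ih fun γ hγ => h γ (by simp [hγ])
    have h2 := h a (by simp)
    rw [rootProd, List.map_cons, List.prod_cons, norm_mul, List.length_cons, pow_succ']
    exact mul_le_mul h2 h1 (norm_nonneg _) ((norm_nonneg _).trans h2)

theorem differentiable_poles {M : ℕ} {γ : Param → ℂ} (h : γ ∈ lowerPoles M ∨ γ ∈ upperPoles M) :
    Differentiable ℂ γ := by
  rcases h with h | h
  · obtain ⟨i, -, rfl⟩ := List.mem_map.1 h
    exact (differentiable_poleArg differentiable_upArg i).neg
  · obtain ⟨i, -, rfl⟩ := List.mem_map.1 h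
    exact differentiable_poleArg differentiable_loArg i

theorem exists_norm_poles_le (M : ℕ) (p : Param) :
    ∃ R : ℝ, ∀ᶠ q in 𝓝 p, ∀ γ ∈ lowerPoles M ++ upperPoles M, ‖γ q‖ ≤ R := by
  have key : ∀ L : List (Param → ℂ), (∀ γ ∈ L, Continuous γ) → ∃ R : ℝ, ∀ᶠ q in 𝓝 p, ∀ γ ∈ L, ‖γ q‖ ≤ R := by
    intro L hL
    induction L with
    | nil => exact ⟨0, by simp⟩
    | cons a L ih =>
      obtain ⟨R, hR⟩ := ih fun γ hγ => hL γ (by simp [hγ])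
      have ha : Continuous a := hL a (by simp)
      refine ⟨max R (‖a p‖ + 1), ?_⟩
      filter_upwards [hR, ha.norm.continuousAt.eventually_lt_const (lt_add_one ‖a p‖)] with q h1 h2 γ hγ
      rcases List.mem_cons.1 hγ with rfl | hγ
      · exact h2.le.trans (le_max_right _ _)
      · exact (h1 γ hγ).trans (le_max_left _ _)
  exact key _ fun γ hγ => (differentiable_poles (List.mem_append.1 hγ)).continuous

theorem inv_re_pos {w : ℂ} (h : 0 < w.re) : 0 < (w⁻¹).re := by
  rw [Complex.inv_re]
  exact div_pos h (Complex.normSq_pos.2 (ne_zero_of_re_pos h))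

theorem differentiableAt_regIntegrand {N M : ℕ} (hM : M = (N + 1) * (6 * (N + 1) + 1))
    {g : ℂ × ℂ × ℂ → ℂ} (hg : AnalyticOnNhd ℂ g (regDomain M)) {p : Param} (hp : p ∈ exhaust N) {z : ℂ}
    (hz : |z.im| ≤ 3 * ((N : ℝ) + 1) + 1) :
    DifferentiableAt ℂ (fun q : Param × ℂ => regIntegrand g q.1 q.2) (p, z) := by
  subst hM
  have hup : ∀ j, DifferentiableAt ℂ (fun q : Param × ℂ => upArg j q.1) (p, z) := fun j =>
    (differentiable_upArg j _).comp (p, z) differentiableAt_fst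
  have hlo : ∀ j, DifferentiableAt ℂ (fun q : Param × ℂ => loArg j q.1) (p, z) := fun j =>
    (differentiable_loArg j _).comp (p, z) differentiableAt_fst
  have hu : ∀ j, DifferentiableAt ℂ (fun q : Param × ℂ => g (q.1.1, q.1.2.1, q.2 + upArg j q.1)) (p, z) := fun j => by
    have h := (hg _ (mem_regDomain_of_exhaust hp (abs_im_add_arg_le hp hz j).1)).differentiableAt
    have := hup j
    exact DifferentiableAt.comp (g := g) (f := fun q : Param × ℂ => (q.1.1, q.1.2.1, q.2 + upArg j q.1))
      (p, z) h (by fun_prop)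
  have hl : ∀ j, DifferentiableAt ℂ (fun q : Param × ℂ => g (q.1.1, q.1.2.1, -q.2 + loArg j q.1)) (p, z) := fun j => by
    have h := (hg _ (mem_regDomain_of_exhaust hp (abs_im_add_arg_le hp hz j).2)).differentiableAt
    have := hlo j
    exact DifferentiableAt.comp (g := g) (f := fun q : Param × ℂ => (q.1.1, q.1.2.1, -q.2 + loArg j q.1))
      (p, z) h (by fun_prop)
  simp only [regIntegrand, Fin.prod_univ_four]
  exact ((((hu 0).fun_mul (hu 1)).fun_mul (hu 2)).fun_mul (hu 3)).fun_mul
    ((((hl 0).fun_mul (hl 1)).fun_mul (hl 2)).fun_mul (hl 3))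

/-- Of the available rate `2πκ` the gamma product uses `πκ`; half of this pays for the polynomial
growth of the linear factors. On the remaining compact rectangle the bound is continuity. -/
theorem exists_decay_regIntegrand {N M : ℕ} (hM : M = (N + 1) * (6 * (N + 1) + 1))
    {g : ℂ × ℂ × ℂ → ℂ} (hg : AnalyticOnNhd ℂ g (regDomain M))
    (hg' : ∀ q ∈ regDomain M, poleProd M q ≠ 0 → g q = hypG q.1 q.2.1 q.2.2 * poleProd M q)
    {p : Param} (hp : p ∈ exhaust N) :
    ∃ C c : ℝ, 0 < c ∧ ∀ᶠ q in 𝓝 p, ∀ z : ℂ, |z.im| ≤ 3 * ((N : ℝ) + 1) + 1 →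
      ‖regIntegrand g q z‖ ≤ C * Real.exp (-c * |z.re|) := by
  set T : ℝ := 3 * ((N : ℝ) + 1) + 1 with hTdef
  have hT : 0 ≤ T := by positivity
  obtain ⟨h1, h2⟩ := exhaust_subset_domain N hp
  set κ := ((p.1)⁻¹ + (p.2.1)⁻¹).re with hκ
  have hκpos : 0 < κ := by
    rw [hκ, Complex.add_re]; exact add_pos (inv_re_pos h1) (inv_re_pos h2)
  have hc0 : 0 < Real.pi * κ := mul_pos Real.pi_pos hκpos
  obtain ⟨X, C₁, hX⟩ := exists_decay (w₁ := fun p : Param => p.1) (w₂ := fun p : Param => p.2.1)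
    (a := upArg) (b := loArg) (p := p) (T := T) (c := Real.pi * κ) (by fun_prop) (by fun_prop)
    (fun j => (differentiable_upArg j).continuous.continuousAt)
    (fun j => (differentiable_loArg j).continuous.continuousAt) h1 h2 sum_upArg_add_loArg hT (by
      rw [mul_assoc]; linarith)
  obtain ⟨R, hR⟩ := exists_norm_poles_le M p
  set R' := max R 0
  obtain ⟨C₂, hC₂, hpow⟩ := exists_pow_le_exp ((lowerPoles M).length + (upperPoles M).length)
    (R := R' + T) (c := Real.pi * κ / 2) (add_nonneg (le_max_right _ _) hT) (by positivity)
  set X' := max X (R' + 1)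
  have hK : IsCompact (Set.Icc (-X') X' ×ℂ Set.Icc (-T) T) := isCompact_Icc.reProdIm isCompact_Icc
  obtain ⟨C₃, hC₃⟩ := eventually_bounded_of_isCompact (f := fun q : Param × ℂ => regIntegrand g q.1 q.2)
    (x := p) hK fun z hz =>
      (differentiableAt_regIntegrand hM hg hp (abs_le.2 hz.2)).continuousAt
  refine ⟨max (|C₁| * C₂) (|C₃| * Real.exp (Real.pi * κ / 2 * X')), Real.pi * κ / 2, by positivity, ?_⟩
  filter_upwards [hX, hR, hC₃, (isOpen_exhaust N).mem_nhds hp] with q q1 q2 q3 q4 z hz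
  rcases le_or_gt X' |z.re| with hzX | hzX
  · have hsmall : ∀ γ ∈ lowerPoles M ++ upperPoles M, z ≠ γ q := by
      rintro γ hγ rfl
      have := (Complex.abs_re_le_norm _).trans (q2 γ hγ)
      have h5 := (le_max_right X (R' + 1)).trans hzX
      have h6 := le_max_left R 0
      linarith
    have hbd : ∀ γ ∈ lowerPoles M ++ upperPoles M, ‖z - γ q‖ ≤ R' + T + |z.re| := fun γ hγ => by
      have h5 := (norm_sub_le z (γ q)).trans (add_le_add (Complex.norm_le_abs_re_add_abs_im z) (q2 γ hγ))
      have h6 := le_max_left R 0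
      linarith
    rw [regIntegrand_eq hM hg' q4 hz
      (rootProd_ne_zero fun γ hγ => hsmall γ (List.mem_append.2 (.inl hγ)))
      (rootProd_ne_zero fun γ hγ => hsmall γ (List.mem_append.2 (.inr hγ))), mul_assoc, norm_mul, norm_mul]
    have n1 := q1 z ((le_max_left _ _).trans hzX) hz
    have n2 := norm_rootProd_le fun γ hγ => hbd γ (List.mem_append.2 (.inl hγ))
    have n3 := norm_rootProd_le fun γ hγ => hbd γ (List.mem_append.2 (.inr hγ))
    have n0 : 0 ≤ R' + T + |z.re| := add_nonneg (add_nonneg (le_max_right _ _) hT) (abs_nonneg _)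
    have n4 := (mul_le_mul n2 n3 (norm_nonneg _) (pow_nonneg n0 _)).trans
      ((pow_add _ _ _).symm.le.trans (hpow _ (abs_nonneg _)))
    have n5 : ‖coeffIntegrand q z‖ ≤ |C₁| * Real.exp (-(Real.pi * κ) * |z.re|) :=
      n1.trans (mul_le_mul_of_nonneg_right (le_abs_self _) (Real.exp_pos _).le)
    refine (mul_le_mul n5 n4 (by positivity) (by positivity)).trans ?_
    have : |C₁| * Real.exp (-(Real.pi * κ) * |z.re|) * (C₂ * Real.exp (Real.pi * κ / 2 * |z.re|)) =
        |C₁| * C₂ * Real.exp (-(Real.pi * κ / 2) * |z.re|) := by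
      rw [mul_mul_mul_comm, ← Real.exp_add]
      congr 2
      ring
    rw [this]
    exact mul_le_mul_of_nonneg_right (le_max_left _ _) (Real.exp_pos _).le
  · have n1 := q3 z ⟨abs_le.1 hzX.le, abs_le.1 hz⟩
    refine (n1.trans (le_abs_self _)).trans ?_
    refine le_trans ?_ (mul_le_mul_of_nonneg_right (le_max_right _ _) (Real.exp_pos _).le)
    rw [mul_assoc, ← Real.exp_add]
    refine le_mul_of_one_le_right (abs_nonneg _) (Real.one_le_exp ?_)
    have := mul_le_mul_of_nonneg_left hzX.le (by positivity : 0 ≤ Real.pi * κ / 2)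
    linarith

/-- The height `3(N + 1) + 1` exceeds the norm of every shift, so no lower pole rises to it and no
upper pole sinks below its negative. At separated parameters the lower poles have negative and the
upper poles positive imaginary part; the denominator, the product of their differences, is then
nonzero. -/
theorem exists_local_continuation (N : ℕ) : ∃ Ψ R : Param → ℂ, DifferentiableOn ℂ Ψ (exhaust N) ∧
    DifferentiableOn ℂ R (exhaust N) ∧ ∀ p ∈ exhaust N, Separated p →
      R p ≠ 0 ∧ Ψ p = R p * ∫ t : ℝ, coeffIntegrand p t := by
  obtain ⟨M, hM⟩ : ∃ M, M = (N + 1) * (6 * (N + 1) + 1) := ⟨_, rfl⟩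
  obtain ⟨g, hg, hg'⟩ := exists_regular_hypG M
  have hfam : DecayingFamily (exhaust N) (3 * ((N : ℝ) + 1) + 1) (regIntegrand g) :=
    ⟨fun p hp z hz => differentiableAt_regIntegrand hM hg hp hz,
      fun p hp => exists_decay_regIntegrand hM hg hg' hp⟩
  have hpos : ∀ p ∈ exhaust N, ∀ i : Fin 4 × ℕ × ℕ, 0 ≤ (wMean p.1 p.2.1).re ∧
      0 ≤ (i.2.1 : ℝ) * p.1.re ∧ 0 ≤ (i.2.2 : ℝ) * p.2.1.re := fun p hp i => by
    obtain ⟨h1, h2⟩ := exhaust_subset_domain N hp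
    rw [wMean_re]
    exact ⟨by linarith, by positivity, by positivity⟩
  obtain ⟨Ψ, hΨ, hint⟩ := hfam.exists_continuation (isOpen_exhaust N) (by positivity) (lowerPoles M)
    (upperPoles M) (fun α hα => (differentiable_poles (.inl hα)).differentiableOn)
    (fun β hβ => (differentiable_poles (.inr hβ)).differentiableOn) (fun α hα p hp => by
      obtain ⟨i, -, rfl⟩ := List.mem_map.1 hα
      obtain ⟨h1, h2, h3⟩ := hpos p hp i
      have h4 := abs_le.1 ((Complex.abs_im_le_norm _).trans (norm_arg_le p i.1).1)
      have h5 := hp.2.2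
      simp only [Complex.neg_im, poleArg_im]
      linarith [h4.1]) (fun β hβ p hp => by
      obtain ⟨i, -, rfl⟩ := List.mem_map.1 hβ
      obtain ⟨h1, h2, h3⟩ := hpos p hp i
      have h4 := abs_le.1 ((Complex.abs_im_le_norm _).trans (norm_arg_le p i.1).2)
      have h5 := hp.2.2
      rw [poleArg_im]
      linarith [h4.1])
  refine ⟨Ψ, resultantProd (lowerPoles M) (upperPoles M), hΨ, differentiableOn_resultantProd
    (fun α hα => (differentiable_poles (.inl hα)).differentiableOn)
    (fun β hβ => (differentiable_poles (.inr hβ)).differentiableOn), fun p hp hs => ?_⟩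
  have hα : ∀ α ∈ lowerPoles M, (α p).im < 0 := fun α hα => by
    obtain ⟨i, -, rfl⟩ := List.mem_map.1 hα
    obtain ⟨h1, h2, h3⟩ := hpos p hp i
    simp only [Complex.neg_im, poleArg_im]
    linarith [(hs i.1).1]
  have hβ : ∀ β ∈ upperPoles M, 0 < (β p).im := fun β hβ => by
    obtain ⟨i, -, rfl⟩ := List.mem_map.1 hβ
    obtain ⟨h1, h2, h3⟩ := hpos p hp i
    rw [poleArg_im]
    linarith [(hs i.1).2]
  refine ⟨resultantProd_ne_zero fun α h1 β h2 h3 => ?_, ?_⟩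
  · have := hα α h1
    have := hβ β h2
    rw [h3] at this
    linarith
  · rw [hint p hp hα hβ]
    congr 1
    refine integral_congr_ae (Eventually.of_forall fun t => ?_)
    have hA : rootProd (lowerPoles M) p t ≠ 0 := rootProd_ne_zero fun γ hγ h0 => by
      have := hα γ hγ
      rw [← h0, Complex.ofReal_im] at this
      exact lt_irrefl _ this
    have hB : rootProd (upperPoles M) p t ≠ 0 := rootProd_ne_zero fun γ hγ h0 => by
      have := hβ γ hγ
      rw [← h0, Complex.ofReal_im] at this
      exact lt_irrefl _ this
    simp only
    rw [regIntegrand_eq hM hg' hp (by simp; positivity) hA hB]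
    field_simp

end Continuation

end AskeyWilson

namespace AskeyWilson

open MeasureTheory Filter Topology Metric
open Complex (I)
open scoped ComplexConjugate

/-! ### Gluing the continuations and identifying the matrix coefficient. -/

section Continuation

theorem isOpen_separated : IsOpen {p : Param | Separated p} := by
  simp only [Separated, Set.ofPred_forall]
  refine isOpen_iInter_of_finite fun j => ?_
  have h1 : Continuous fun p : Param => -(wMean p.1 p.2.1).re := by unfold wMean; fun_prop
  have h2 := (Complex.continuous_im).comp (differentiable_upArg j).continuous
  have h3 := (Complex.continuous_im).comp (differentiable_loArg j).continuous
  exact (isOpen_lt h1 h2).inter (isOpen_lt h1 h3)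

theorem exists_separated (N : ℕ) {p : Param} (hp : p ∈ exhaust N) : ∃ q ∈ exhaust N, Separated q := by
  have hd := exhaust_subset_domain N hp
  refine ⟨(p.1, p.2.1, 0, 0, 0), ⟨hp.1, hp.2.1, lt_of_le_of_lt ?_ hp.2.2⟩, fun j => ?_⟩
  · obtain ⟨h1, h2, -⟩ := norm_components_le p
    simp [Prod.norm_def] at h1 h2 ⊢
    exact (le_total _ _).imp id .inl
  · have h : 0 < (wMean p.1 p.2.1).re := by
      rw [wMean_re]; linarith [hd.1, hd.2]
    have h2 : (I * wMean p.1 p.2.1 / 2).im = (wMean p.1 p.2.1).re / 2 := by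
      rw [mul_div_assoc, Complex.I_mul_im, Complex.div_ofNat_re]
    fin_cases j <;> simp [upArg, loArg, tau, rho, sigma, upsilon, h2] <;> linarith

theorem preconnected_exhaust (N : ℕ) : IsPreconnected (exhaust N) := (convex_exhaust N).isPreconnected

theorem analyticOnNhd_exhaust {N : ℕ} {f : Param → ℂ} (hf : DifferentiableOn ℂ f (exhaust N)) :
    AnalyticOnNhd ℂ f (exhaust N) := fun _ hp => analyticAt_of_differentiableOn (isOpen_exhaust N) hf hp

/-- The cross products `Ψ N * R N'` and `Ψ N' * R N` agree near a separated point, where both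
quotients are the integral, hence on the whole convex set `exhaust N` for `N ≤ N'`. So the quotient
may be taken from any `N` whose denominator does not vanish at the point; the value is `0` if there
is none. -/
theorem exists_global_continuation : ∃ ψ : Param → ℂ, (∀ p ∈ domain, MeromAt ψ p) ∧
    ∀ p ∈ domain, Separated p → AnalyticAt ℂ ψ p ∧ ψ p = ∫ t : ℝ, coeffIntegrand p t := by
  classical
  choose Ψ R hΨ hR hint using exists_local_continuation
  have hfreq : ∀ N, ∀ p ∈ exhaust N, ∃ᶠ q in 𝓝 p, R N q ≠ 0 := by
    intro N p hp h0
    obtain ⟨q, hq, hs⟩ := exists_separated N hp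
    have := (analyticOnNhd_exhaust (hR N)).eqOn_zero_of_preconnected_of_eventuallyEq_zero
      (preconnected_exhaust N) hp (h0.mono fun x hx => not_not.1 hx) hq
    exact (hint N q hq hs).1 this
  have hcons' : ∀ N N', N ≤ N' → ∀ p ∈ exhaust N, Ψ N p * R N' p = Ψ N' p * R N p := by
    intro N N' hN p hp
    obtain ⟨q, hq, hs⟩ := exists_separated N hp
    have hsub := exhaust_mono hN
    have h1 := analyticOnNhd_exhaust ((hΨ N).fun_mul ((hR N').mono hsub))
    have h2 := analyticOnNhd_exhaust (((hΨ N').mono hsub).fun_mul (hR N))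
    refine h1.eqOn_of_preconnected_of_eventuallyEq h2 (preconnected_exhaust N) hq ?_ hp
    filter_upwards [(isOpen_exhaust N).mem_nhds hq, isOpen_separated.mem_nhds hs] with x hx hxs
    rw [(hint N x hx hxs).2, (hint N' x (hsub hx) hxs).2]
    ring
  have hcons : ∀ N N', ∀ p ∈ exhaust N, p ∈ exhaust N' → R N p ≠ 0 → R N' p ≠ 0 →
      Ψ N p / R N p = Ψ N' p / R N' p := by
    intro N N' p hp hp' h1 h2
    rw [div_eq_div_iff h1 h2]
    rcases le_total N N' with h | h
    · exact hcons' N N' h p hp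
    · exact (hcons' N' N h p hp').symm
  let ψ : Param → ℂ := fun p => if h : ∃ N, p ∈ exhaust N ∧ R N p ≠ 0 then
    Ψ h.choose p / R h.choose p else 0
  have hψ : ∀ N, ∀ p ∈ exhaust N, R N p ≠ 0 → ψ p = Ψ N p / R N p := by
    intro N p hp hne
    have h : ∃ N, p ∈ exhaust N ∧ R N p ≠ 0 := ⟨N, hp, hne⟩
    have : ψ p = Ψ h.choose p / R h.choose p := dif_pos h
    rw [this]
    exact hcons _ _ p h.choose_spec.1 hp h.choose_spec.2 hne
  refine ⟨ψ, fun p hp => ?_, fun p hp hs => ?_⟩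
  · obtain ⟨N, hN⟩ := exists_mem_exhaust hp
    refine ⟨Ψ N, R N, analyticOnNhd_exhaust (hΨ N) p hN, analyticOnNhd_exhaust (hR N) p hN,
      hfreq N p hN, ?_⟩
    filter_upwards [(isOpen_exhaust N).mem_nhds hN] with q hq hne
    exact hψ N q hq hne
  · obtain ⟨N, hN⟩ := exists_mem_exhaust hp
    obtain ⟨h1, h2⟩ := hint N p hN hs
    refine ⟨((analyticOnNhd_exhaust (hΨ N) p hN).div (analyticOnNhd_exhaust (hR N) p hN) h1).congr ?_, by
      rw [hψ N p hN h1, h2, mul_div_cancel_left₀ _ h1]⟩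
    filter_upwards [(isOpen_exhaust N).mem_nhds hN,
      (analyticOnNhd_exhaust (hR N) p hN).continuousAt.eventually_ne h1] with q hq hne
    exact (hψ N q hq hne).symm

theorem xi_bounds (γ : Fin 4 → ℂ) : |(rho γ).re| ≤ xi γ ∧ |(sigma γ).re| ≤ xi γ ∧
    |(tau γ).re| ≤ xi γ ∧ |(upsilon γ).re| ≤ xi γ := by
  unfold xi
  exact ⟨(le_max_left _ _).trans (le_max_left _ _), (le_max_right _ _).trans (le_max_left _ _),
    (le_max_left _ _).trans (le_max_right _ _), (le_max_right _ _).trans (le_max_right _ _)⟩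

theorem separated_of_zeta {w₁ w₂ : ℝ} {γ : Fin 4 → ℂ} {x lam : ℂ}
    (h : |x.im| < zeta w₁ w₂ γ lam) : Separated (w₁, w₂, γ, x, lam) := by
  obtain ⟨h1, h2, h3, h4⟩ := xi_bounds γ
  rw [zeta] at h
  have hw : (wMean w₁ w₂).re = (w₁ + w₂) / 2 := by rw [wMean_re]; simp
  have h5 : (I * wMean w₁ w₂ / 2).im = (w₁ + w₂) / 2 / 2 := by
    rw [mul_div_assoc, Complex.I_mul_im, Complex.div_ofNat_re, hw]
  have := abs_nonneg x.im
  have e1 := abs_le.1 h1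
  have e2 := abs_le.1 h2
  have e3 := abs_le.1 h3
  have e4 := abs_le.1 h4
  have e5 := abs_le.1 (le_refl |x.im|)
  have e6 := abs_le.1 (le_refl |(lam / 2).im|)
  intro j
  fin_cases j <;> simp only [upArg, loArg, Fin.zero_eta, Fin.mk_one, Fin.reduceFinMk, Matrix.cons_val,
    Complex.sub_im, Complex.add_im, Complex.neg_im, Complex.I_mul_im, h5, hw] <;>
    constructor <;> linarith [e1.1, e2.1, e3.1, e4.1, e5.1, e6.1, e1.2, e2.2, e3.2, e4.2, e5.2, e6.2]

theorem conj_hypG {w₁ w₂ : ℝ} (h₁ : 0 < w₁) (h₂ : 0 < w₂) {z : ℂ} (hz : |z.im| < (w₁ + w₂) / 2) :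
    conj (hypG w₁ w₂ z) = hypG w₁ w₂ (-conj z) := by
  have h₁' : 0 < (w₁ : ℂ).re := h₁
  have h₂' : 0 < (w₂ : ℂ).re := h₂
  rw [hypG_neg h₁' h₂', hypG_eq_gammaStrip h₁' h₂' hz, hypG_eq_gammaStrip h₁' h₂' (by simpa using hz),
    gammaStrip_conj]

/-- Denominators become numerators by `G(-z) = 1/G(z)`, and conjugation of `F` undoes the
conjugations of `λ`, `υ`, `σ` in its definition. The condition `|Im x| < ζ` is used to place the
arguments of `F` on the real line inside the strip, where the conjugation rule holds. -/
theorem matrixCoeff_eq {w₁ w₂ : ℝ} (h₁ : 0 < w₁) (h₂ : 0 < w₂) {γ : Fin 4 → ℂ} {x lam : ℂ}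
    (h : |x.im| < zeta w₁ w₂ γ lam) :
    matrixCoeff w₁ w₂ γ x lam = ∫ t : ℝ, coeffIntegrand (w₁, w₂, γ, x, lam) t := by
  have h₁' : 0 < (w₁ : ℂ).re := h₁
  have h₂' : 0 < (w₂ : ℂ).re := h₂
  obtain ⟨b1, b2, b3, b4⟩ := xi_bounds γ
  rw [zeta] at h
  have hw : (wMean w₁ w₂).re = (w₁ + w₂) / 2 := by rw [wMean_re]; simp
  have hwc : conj (wMean w₁ w₂) = wMean w₁ w₂ := by
    rw [wMean, map_div₀, map_add, Complex.conj_ofReal, Complex.conj_ofReal, Complex.conj_ofNat]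
  have hw2 : (I * wMean w₁ w₂ / 2).im = (w₁ + w₂) / 2 / 2 := by
    rw [mul_div_assoc, Complex.I_mul_im, Complex.div_ofNat_re, hw]
  have hbound : ∀ (t : ℝ) (s κ u : ℂ), (s = 1 ∨ s = -1) → (κ = 1 ∨ κ = -1) → |u.re| ≤ xi γ →
      |(t + s * (conj lam / 2) + κ * (I * wMean w₁ w₂ / 2) + I * conj u).im| < (w₁ + w₂) / 2 ∧
      |(t + s * (conj lam / 2) + κ * (I * wMean w₁ w₂ / 2) - I * conj u).im| < (w₁ + w₂) / 2 := by
    intro t s κ u hs hκ hu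
    have e0 := abs_nonneg x.im
    have e1 := abs_le.1 hu
    have e2 := abs_le.1 (le_refl |(lam / 2).im|)
    have e3 : (conj lam / 2).im = -(lam / 2).im := by
      rw [Complex.div_ofNat_im, Complex.div_ofNat_im, Complex.conj_im, neg_div]
    rcases hs with rfl | rfl <;> rcases hκ with rfl | rfl <;>
    simp only [one_mul, neg_mul, Complex.add_im, Complex.sub_im, Complex.neg_im, Complex.ofReal_im, hw2, e3,
      Complex.I_mul_im, Complex.conj_re, abs_lt] <;> refine ⟨⟨?_, ?_⟩, ⟨?_, ?_⟩⟩ <;> linarith [e1.1, e2.1, e1.2, e2.2]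
  refine integral_congr_ae (Eventually.of_forall fun t => ?_)
  obtain ⟨c1, c2⟩ := hbound t 1 (-1) (upsilon γ) (.inl rfl) (.inr rfl) b4
  obtain ⟨c3, c4⟩ := hbound t (-1) 1 (sigma γ) (.inr rfl) (.inl rfl) b2
  have d1 := conj_hypG h₁ h₂ c1
  have d2 := conj_hypG h₁ h₂ c2
  have d3 := conj_hypG h₁ h₂ c3
  have d4 := conj_hypG h₁ h₂ c4
  have hci : conj (I * wMean w₁ w₂ / 2) = -(I * wMean w₁ w₂ / 2) := by
    rw [map_div₀, map_mul, hwc, Complex.conj_I, Complex.conj_ofNat]; ring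
  simp only [map_add, map_sub, map_mul, map_neg, map_one, hci, Complex.conj_ofReal, Complex.conj_I,
    Complex.conj_conj, map_div₀, Complex.conj_ofNat] at d1 d2 d3 d4
  have hinv := hypG_neg h₁' h₂'
  simp only [hatAct, H, F, hypGpm, coeffIntegrand, gammaProd, Fin.prod_univ_four, upArg, loArg,
    Matrix.cons_val, map_div₀, map_mul]
  rw [show (t : ℂ) + conj lam / 2 - I * wMean w₁ w₂ / 2 + I * conj (upsilon γ) =
      t + 1 * (conj lam / 2) + -1 * (I * wMean w₁ w₂ / 2) + I * conj (upsilon γ) by ring,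
    show (t : ℂ) + conj lam / 2 - I * wMean w₁ w₂ / 2 - I * conj (upsilon γ) =
      t + 1 * (conj lam / 2) + -1 * (I * wMean w₁ w₂ / 2) - I * conj (upsilon γ) by ring,
    show (t : ℂ) - conj lam / 2 + I * wMean w₁ w₂ / 2 + I * conj (sigma γ) =
      t + -1 * (conj lam / 2) + 1 * (I * wMean w₁ w₂ / 2) + I * conj (sigma γ) by ring,
    show (t : ℂ) - conj lam / 2 + I * wMean w₁ w₂ / 2 - I * conj (sigma γ) =
      t + -1 * (conj lam / 2) + 1 * (I * wMean w₁ w₂ / 2) - I * conj (sigma γ) by ring, d1, d2, d3, d4]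
  simp only [div_eq_mul_inv _ (_ * _), mul_inv, ← hinv]
  ring_nf

end Continuation

end AskeyWilson

namespace AskeyWilson

open MeasureTheory Filter Topology Metric
open Complex (I)

/-! ### Shift equations and exponential variables. -/

section Contiguous

theorem hypG_add_period {w₁ w₂ z : ℂ} (h₁ : 0 < w₁.re) (h₂ : 0 < w₂.re)
    (h : |(z + I * w₁ / 2).im| < w₂.re / 2) :
    hypG w₁ w₂ (z + I * w₁) = 2 * Complex.cosh (Real.pi * (z + I * w₁ / 2) / w₂) * hypG w₁ w₂ z := by
  have him : (I * w₁ / 2).im = w₁.re / 2 := by rw [mul_div_assoc, Complex.I_mul_im, Complex.div_ofNat_re]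
  rw [Complex.add_im, him, abs_lt] at h
  rw [hypG_eq_gammaStrip h₁ h₂ (by rw [Complex.add_im, Complex.I_mul_im, abs_lt]; constructor <;> linarith),
    hypG_eq_gammaStrip h₁ h₂ (by rw [abs_lt]; constructor <;> linarith)]
  have := gammaStrip_shift (z := z + I * w₁ / 2) h₁ h₂
    (by rw [Complex.add_im, him, abs_lt]; constructor <;> linarith)
  rwa [show z + I * w₁ / 2 + I * w₁ / 2 = z + I * w₁ by ring, add_sub_cancel_right] at this

theorem hypG_sub_period {w₁ w₂ z : ℂ} (h₁ : 0 < w₁.re) (h₂ : 0 < w₂.re)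
    (h : |(z - I * w₁ / 2).im| < w₂.re / 2) :
    hypG w₁ w₂ z = 2 * Complex.cosh (Real.pi * (z - I * w₁ / 2) / w₂) * hypG w₁ w₂ (z - I * w₁) := by
  have := hypG_add_period (z := z - I * w₁) h₁ h₂
    (by rwa [show z - I * w₁ + I * w₁ / 2 = z - I * w₁ / 2 by ring])
  rwa [show z - I * w₁ + I * w₁ / 2 = z - I * w₁ / 2 by ring, sub_add_cancel] at this

/-- Products of gamma functions in the strip decay exponentially. -/
theorem differentiableAt_gammaProd {w₁ w₂ : ℂ} {a b : Fin 4 → ℂ} (h₁ : 0 < w₁.re) (h₂ : 0 < w₂.re)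
    {T : ℝ} (ha : ∀ j, |(a j).im| + T < (w₁.re + w₂.re) / 2)
    (hb : ∀ j, |(b j).im| + T < (w₁.re + w₂.re) / 2) {z : ℂ} (hz : |z.im| ≤ T) :
    DifferentiableAt ℂ (gammaProd w₁ w₂ a b) z := by
  have key : ∀ f : ℂ → ℂ, DifferentiableAt ℂ f z → |(f z).im| < (w₁.re + w₂.re) / 2 →
      DifferentiableAt ℂ (fun z => hypG w₁ w₂ (f z)) z := by
    intro f hf hlt
    have hd : AnalyticAt ℂ (fun u : ℂ => gammaStrip w₁ w₂ u) (f z) :=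
      AnalyticAt.gammaStrip analyticAt_const analyticAt_const analyticAt_id h₁ h₂ hlt
    have hG : DifferentiableAt ℂ (hypG w₁ w₂) (f z) := by
      refine hd.differentiableAt.congr_of_eventuallyEq ?_
      have hc : Continuous fun u : ℂ => |u.im| := by fun_prop
      filter_upwards [hc.continuousAt.eventually_lt_const hlt] with u hu
      exact hypG_eq_gammaStrip h₁ h₂ hu
    exact DifferentiableAt.comp (g := hypG w₁ w₂) (f := f) z hG hf
  have hu : ∀ j, DifferentiableAt ℂ (fun z => hypG w₁ w₂ (z + a j)) z := fun j =>
    key _ (by fun_prop) (by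
      have := abs_add_le z.im (a j).im
      have := ha j
      rw [Complex.add_im]; linarith)
  have hl : ∀ j, DifferentiableAt ℂ (fun z => hypG w₁ w₂ (-z + b j)) z := fun j =>
    key _ (by fun_prop) (by
      have := abs_add_le (-z.im) (b j).im
      have := hb j
      rw [abs_neg] at *
      rw [Complex.add_im, Complex.neg_im]; linarith)
  unfold gammaProd
  simp only [Fin.prod_univ_four]
  exact ((((hu 0).fun_mul (hu 1)).fun_mul (hu 2)).fun_mul (hu 3)).fun_mul
    ((((hl 0).fun_mul (hl 1)).fun_mul (hl 2)).fun_mul (hl 3))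

theorem exists_gammaProd_le {w₁ w₂ : ℂ} {a b : Fin 4 → ℂ} (h₁ : 0 < w₁.re) (h₂ : 0 < w₂.re)
    (hsum : ∑ j, (a j + b j) = -4 * I * wMean w₁ w₂) {T : ℝ} (hT : 0 ≤ T)
    (ha : ∀ j, |(a j).im| + T < (w₁.re + w₂.re) / 2)
    (hb : ∀ j, |(b j).im| + T < (w₁.re + w₂.re) / 2) {c : ℝ} (hc0 : 0 ≤ c)
    (hc : c < 2 * Real.pi * (w₁⁻¹ + w₂⁻¹).re) :
    ∃ C, ∀ z : ℂ, |z.im| ≤ T → ‖gammaProd w₁ w₂ a b z‖ ≤ C * Real.exp (-c * |z.re|) := by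
  obtain ⟨X, C₁, h⟩ := exists_decay (V := ℂ) (p := 0) (w₁ := fun _ => w₁) (w₂ := fun _ => w₂)
    (a := fun j _ => a j) (b := fun j _ => b j) continuousAt_const continuousAt_const
    (fun _ => continuousAt_const) (fun _ => continuousAt_const) h₁ h₂ (fun _ => hsum) hT hc
  have h := h.self_of_nhds
  have hK : IsCompact (Set.Icc (-X) X ×ℂ Set.Icc (-T) T) := isCompact_Icc.reProdIm isCompact_Icc
  obtain ⟨C₂, hC₂⟩ := hK.exists_bound_of_continuousOn (f := gammaProd w₁ w₂ a b) fun z hz =>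
    (differentiableAt_gammaProd h₁ h₂ ha hb (abs_le.2 hz.2)).continuousAt.continuousWithinAt
  refine ⟨max C₁ (|C₂| * Real.exp (c * X)), fun z hz => ?_⟩
  rcases le_or_gt X |z.re| with hX | hX
  · exact (h z hX hz).trans (mul_le_mul_of_nonneg_right (le_max_left _ _) (Real.exp_pos _).le)
  · refine ((hC₂ z ⟨abs_le.1 hX.le, abs_le.1 hz⟩).trans (le_abs_self _)).trans ?_
    refine le_trans ?_ (mul_le_mul_of_nonneg_right (le_max_right _ _) (Real.exp_pos _).le)
    rw [mul_assoc, ← Real.exp_add]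
    refine le_mul_of_one_le_right (abs_nonneg _) (Real.one_le_exp ?_)
    have := mul_le_mul_of_nonneg_left hX.le hc0
    linarith

/-- The exponential `e(y) = exp(2πy / w)`. -/
noncomputable def expPer (w y : ℂ) : ℂ := Complex.exp (2 * Real.pi * y / w)

theorem expPer_add (w y y' : ℂ) : expPer w (y + y') = expPer w y * expPer w y' := by
  rw [expPer, expPer, expPer, ← Complex.exp_add]; congr 1; ring

theorem expPer_neg (w y : ℂ) : expPer w (-y) = (expPer w y)⁻¹ := by
  rw [expPer, expPer, ← Complex.exp_neg]; congr 1; ring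

theorem expPer_sub (w y y' : ℂ) : expPer w (y - y') = expPer w y / expPer w y' := by
  rw [sub_eq_add_neg, expPer_add, expPer_neg, div_eq_mul_inv]

theorem expPer_ne_zero (w y : ℂ) : expPer w y ≠ 0 := Complex.exp_ne_zero _

theorem expPer_quarter {w : ℂ} (hw : w ≠ 0) : expPer w (I * w / 4) = I := by
  rw [expPer, show 2 * Real.pi * (I * w / 4) / w = Real.pi / 2 * I by field_simp; ring, Complex.exp_pi_div_two_mul_I]

theorem two_cosh_mul_two_cosh (w y y' : ℂ) :
    2 * Complex.cosh (Real.pi * y / w) * (2 * Complex.cosh (Real.pi * y' / w)) =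
      expPer w (-(y + y') / 2) * ((1 + expPer w y) * (1 + expPer w y')) := by
  have h : ∀ y, 2 * Complex.cosh (Real.pi * y / w) = expPer w (-y / 2) * (1 + expPer w y) := by
    intro y
    rw [Complex.two_cosh, mul_add, mul_one, ← expPer_add, expPer, expPer, add_comm]
    congr 2 <;> ring
  rw [h, h, neg_add, add_div, expPer_add]
  ring

theorem two_cosh_add_mul_two_cosh_add (w y y' v : ℂ) :
    2 * Complex.cosh (Real.pi * (y + v) / w) * (2 * Complex.cosh (Real.pi * (y' + v) / w)) =
      expPer w (-(y + y') / 2 - v) *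
        (1 + (expPer w y + expPer w y') * expPer w v + expPer w y * expPer w y' * expPer w v ^ 2) := by
  rw [two_cosh_mul_two_cosh, expPer_add w y v, expPer_add w y' v,
    show -(y + v + (y' + v)) / 2 = -(y + y') / 2 - v by ring]
  ring

/-! ### The rational certificate -/

/-- The common denominator of the coefficients. -/
def certDenom (p X : ℂ) : ℂ := (X ^ 2 - 1) * (X ^ 2 - p ^ 2) * (1 - p ^ 2 * X ^ 2)

/-- The coefficient of the forward shift. -/
noncomputable def certForward (p X R s u : ℂ) : ℂ :=
  -(s / u) * (X ^ 2 - p ^ 2) * (1 + p * X * s * R + p ^ 2 * X ^ 2 * s ^ 2) *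
    (1 + p * X * R / s + p ^ 2 * X ^ 2 / s ^ 2) / certDenom p X

/-- The coefficient of the backward shift. -/
noncomputable def certBackward (p X T s u : ℂ) : ℂ :=
  s * u * (1 - p ^ 2 * X ^ 2) * X ^ 2 * p ^ 2 * (1 + X * T / (p * u) + X ^ 2 / (p ^ 2 * u ^ 2)) *
    (1 + p * T / (X * u) + p ^ 2 / (u ^ 2 * X ^ 2)) / certDenom p X

/-- The coefficient `A(x)` in exponential variables. -/
noncomputable def certPlus (p X R T s u : ℂ) : ℂ :=
  -(X ^ 2 - p ^ 2) * (1 + p * X * s * R + p ^ 2 * X ^ 2 * s ^ 2) *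
    (1 + p * X * T / u + p ^ 2 * X ^ 2 / u ^ 2) / certDenom p X

/-- The coefficient `A(-x)` in exponential variables. -/
noncomputable def certMinus (p X R T s u : ℂ) : ℂ :=
  (1 - p ^ 2 * X ^ 2) * (X ^ 2 + p * X * s * R + p ^ 2 * s ^ 2) *
    (X ^ 2 + p * X * T / u + p ^ 2 / u ^ 2) / certDenom p X

/-- The eigenvalue in exponential variables. -/
noncomputable def certEigen (p L s u : ℂ) : ℂ :=
  -(p * s / u * (L ^ 2 + (L ^ 2)⁻¹) + (p * s / u) ^ 2 + 1)

theorem exists_certificate {p X L T R s u : ℂ} (hp : p ≠ 0) (hX : X ≠ 0) (hL : L ≠ 0) (hs : s ≠ 0)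
    (hu : u ≠ 0) (hD : certDenom p X ≠ 0) : ∃ n₁ n₂ n₃ : ℂ, ∀ Z : ℂ, Z ≠ 0 →
    certForward p X R s u * (-(p / L ^ 2)) * ((1 - X * L * T * Z + X ^ 2 * L ^ 2 * Z ^ 2) *
        (1 - X * L * T / p ^ 2 * Z + X ^ 2 * L ^ 2 / p ^ 4 * Z ^ 2)) -
      (certPlus p X R T s u + certMinus p X R T s u + certEigen p L s u) *
        ((1 + p * X * R / L * Z + p ^ 2 * X ^ 2 / L ^ 2 * Z ^ 2) *
          (1 - X * L * T / p ^ 2 * Z + X ^ 2 * L ^ 2 / p ^ 4 * Z ^ 2)) +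
      certBackward p X T s u * (-(L ^ 2 / p)) *
        ((1 + X * R / (L * p) * Z + X ^ 2 / (L ^ 2 * p ^ 2) * Z ^ 2) *
          (1 + p * X * R / L * Z + p ^ 2 * X ^ 2 / L ^ 2 * Z ^ 2)) =
    p ^ 2 * (1 - (s + s⁻¹) / L * Z + Z ^ 2 / L ^ 2) *
        (1 - X * L * T / p ^ 2 * Z + X ^ 2 * L ^ 2 / p ^ 4 * Z ^ 2) *
        (n₁ / (p ^ 2 * Z) + n₂ + n₃ * (p ^ 2 * Z)) -
      (1 + L * (u + u⁻¹) / p * Z + L ^ 2 / p ^ 2 * Z ^ 2) *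
        (1 + p * X * R / L * Z + p ^ 2 * X ^ 2 / L ^ 2 * Z ^ 2) * (n₁ / Z + n₂ + n₃ * Z) := by
  let a := X ^ 2 * (s + s⁻¹) / L
  let b := X ^ 4 / L ^ 2
  let c := X * L * T / p ^ 2
  let d := X ^ 2 * L ^ 2 / p ^ 4
  let e := X ^ 2 * L * (u + u⁻¹) / p
  let f := L ^ 2 * X ^ 4 / p ^ 4
  let g := X * R / (L * p)
  let h := X ^ 2 / (L ^ 2 * p ^ 2)
  let k := p ^ 3 * s / u / certDenom p X
  -- `n₁ Z + n₂ Z² + n₃ Z³` is `k` times `(X² - p²)(1 - aZ + bZ²)(1 - cZ + dZ²) + (1 - p²X²)(p² + eZ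
  -- + fZ²)(1 + gZ + hZ²) - X²(1 - p⁴)(1 + gZ + hZ²)(1 - cZ + dZ²)`. The constant and quartic terms
  -- of this polynomial cancel, which is why three coefficients suffice.
  refine ⟨k * ((X ^ 2 - p ^ 2) * (-a - c) + (1 - p ^ 2 * X ^ 2) * (e + p ^ 2 * g) -
      X ^ 2 * (1 - p ^ 4) * (g - c)),
    k * ((X ^ 2 - p ^ 2) * (b + d + a * c) + (1 - p ^ 2 * X ^ 2) * (f + p ^ 2 * h + e * g) -
      X ^ 2 * (1 - p ^ 4) * (d + h - c * g)),
    k * ((X ^ 2 - p ^ 2) * (-a * d - b * c) + (1 - p ^ 2 * X ^ 2) * (e * h + f * g) -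
      X ^ 2 * (1 - p ^ 4) * (g * d - c * h)), fun Z hZ => ?_⟩
  simp only [a, b, c, d, e, f, g, h, k, certForward, certBackward, certPlus, certMinus, certEigen]
  -- The denominator stays an atom while fractions are cleared and is expanded only in the final
  -- polynomial identity.
  obtain ⟨D, hDn⟩ : ∃ D, D = certDenom p X := ⟨_, rfl⟩
  rw [← hDn] at hD ⊢
  field_simp
  rw [hDn, certDenom]
  ring

end Contiguous

end AskeyWilson

namespace AskeyWilson

open MeasureTheory Filter Topology Metric
open Complex (I)

/-! ### The telescoping identity for the integrands. -/

section Contiguous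

theorem coeffIntegrand_add {w₁ w₂ : ℂ} {γ : Fin 4 → ℂ} {x lam z : ℂ} (d : ℂ) :
    coeffIntegrand (w₁, w₂, γ, x + d, lam) z =
      gammaProd w₁ w₂ (fun j => upArg j (w₁, w₂, γ, x, lam) + ![d, d, 0, 0] j)
        (fun j => loArg j (w₁, w₂, γ, x, lam) - ![d, d, 0, 0] j) z := by
  simp only [coeffIntegrand, gammaProd, Fin.prod_univ_four, upArg, loArg, Matrix.cons_val]
  ring_nf

/-- The common shift `-iw/2` contributes the factor `-i e(-iw₁/4)`. This is why `Z = i e(iw₁/4)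
e(z)` is the natural variable of the certificate. -/
theorem expPer_upArg {w₁ w₂ : ℂ} (h₂ : w₂ ≠ 0) (γ : Fin 4 → ℂ) (x lam z : ℂ) (j : Fin 4) :
    expPer w₂ (z + upArg j (w₁, w₂, γ, x, lam)) =
      -(![expPer w₂ x * expPer w₂ (lam / 2) * expPer w₂ (I * tau γ),
        expPer w₂ x * expPer w₂ (lam / 2) / expPer w₂ (I * tau γ),
        expPer w₂ (I * sigma γ) / expPer w₂ (lam / 2),
        1 / (expPer w₂ (lam / 2) * expPer w₂ (I * sigma γ))] j * (I * expPer w₂ (I * w₁ / 4) * expPer w₂ z)) /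
          expPer w₂ (I * w₁ / 4) ^ 2 := by
  have hq := expPer_quarter h₂
  have hI : (-I : ℂ) = I⁻¹ := by simp
  have h0 := expPer_ne_zero w₂ (I * w₁ / 4)
  have h1 := expPer_ne_zero w₂ (lam / 2)
  have h2 := expPer_ne_zero w₂ (I * sigma γ)
  have h3 := expPer_ne_zero w₂ (I * tau γ)
  have hm : ∀ y, expPer w₂ (z + (y - I * wMean w₁ w₂ / 2)) =
      -(expPer w₂ y * (I * expPer w₂ (I * w₁ / 4) * expPer w₂ z)) / expPer w₂ (I * w₁ / 4) ^ 2 := by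
    intro y
    rw [show z + (y - I * wMean w₁ w₂ / 2) = z + y - I * w₁ / 4 - I * w₂ / 4 by rw [wMean]; ring,
      expPer_sub, expPer_sub, expPer_add, hq, div_eq_mul_inv _ I, ← hI]
    field_simp
  rw [upArg, hm]
  congr 2
  fin_cases j <;> simp only [Fin.zero_eta, Fin.mk_one, Fin.reduceFinMk, Matrix.cons_val, expPer_add,
    expPer_sub, expPer_neg] <;> field_simp

theorem expPer_loArg {w₁ w₂ : ℂ} (h₂ : w₂ ≠ 0) (γ : Fin 4 → ℂ) (x lam z : ℂ) (j : Fin 4) :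
    expPer w₂ (z - loArg j (w₁, w₂, γ, x, lam)) =
      ![expPer w₂ x * expPer w₂ (I * rho γ) / expPer w₂ (lam / 2),
        expPer w₂ x / (expPer w₂ (lam / 2) * expPer w₂ (I * rho γ)),
        expPer w₂ (lam / 2) * expPer w₂ (I * upsilon γ),
        expPer w₂ (lam / 2) / expPer w₂ (I * upsilon γ)] j *
          (I * expPer w₂ (I * w₁ / 4) * expPer w₂ z) := by
  have hq := expPer_quarter h₂
  have h0 := expPer_ne_zero w₂ (I * w₁ / 4)
  have h1 := expPer_ne_zero w₂ (lam / 2)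
  have h2 := expPer_ne_zero w₂ (I * rho γ)
  have h3 := expPer_ne_zero w₂ (I * upsilon γ)
  have hm : ∀ y, expPer w₂ (z - (-y - I * wMean w₁ w₂ / 2)) =
      expPer w₂ y * (I * expPer w₂ (I * w₁ / 4) * expPer w₂ z) := by
    intro y
    rw [show z - (-y - I * wMean w₁ w₂ / 2) = z + y + I * w₁ / 4 + I * w₂ / 4 by rw [wMean]; ring,
      expPer_add, expPer_add, expPer_add, hq]
    ring
  fin_cases j <;> simp only [loArg, Fin.zero_eta, Fin.mk_one, Fin.reduceFinMk, Matrix.cons_val] <;> rw [hm] <;>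
    simp only [expPer_add, expPer_sub] <;> field_simp

variable {w₁ w₂ : ℝ} {γ : Fin 4 → ℂ} {x lam : ℂ}

/-- The telescoping function. -/
noncomputable def telescoper (w₁ w₂ : ℂ) (γ : Fin 4 → ℂ) (x lam n₁ n₂ n₃ z : ℂ) : ℂ :=
  gammaProd w₁ w₂ (fun j => upArg j (w₁, w₂, γ, x, lam) - ![I * w₁, I * w₁, 0, 0] j)
    (fun j => loArg j (w₁, w₂, γ, x, lam) + ![0, 0, I * w₁, I * w₁] j) z *
  (n₁ / (I * expPer w₂ (I * w₁ / 4) * expPer w₂ z) + n₂ +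
    n₃ * (I * expPer w₂ (I * w₁ / 4) * expPer w₂ z))

theorem expPer_period {w₁ w₂ : ℂ} : expPer w₂ (I * w₁) = expPer w₂ (I * w₁ / 4) ^ 4 := by
  rw [show I * w₁ = I * w₁ / 4 + I * w₁ / 4 + (I * w₁ / 4 + I * w₁ / 4) by ring, expPer_add, expPer_add]
  ring_nf

theorem expPer_half_period {w₁ w₂ : ℂ} : expPer w₂ (I * w₁ / 2) = expPer w₂ (I * w₁ / 4) ^ 2 := by
  rw [show I * w₁ / 2 = I * w₁ / 4 + I * w₁ / 4 by ring, expPer_add]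
  ring_nf

/-- The parameters for which all the arguments that occur in the derivation of the difference
equation lie in the strip. -/
structure Moderate (w₁ w₂ : ℝ) (p : Param) : Prop where
  pos : 0 < w₁
  large : 16 * w₁ ≤ w₂
  up : ∀ j, |(upArg j p).im + (w₁ + w₂) / 4| ≤ w₁ / 2
  lo : ∀ j, |(loArg j p).im + (w₁ + w₂) / 4| ≤ w₁ / 2

/-- The coefficients of the contiguous relation, as a linear form in three unknowns. -/
noncomputable def contiguousForm (w₁ w₂ : ℂ) (γ : Fin 4 → ℂ) (x lam f₁ f₀ f₂ : ℂ) : ℂ :=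
  certForward (expPer w₂ (I * w₁ / 2)) (expPer w₂ x)
      (expPer w₂ (I * rho γ) + (expPer w₂ (I * rho γ))⁻¹)
      (expPer w₂ (I * sigma γ)) (expPer w₂ (I * upsilon γ)) * f₁ -
  (certPlus (expPer w₂ (I * w₁ / 2)) (expPer w₂ x)
        (expPer w₂ (I * rho γ) + (expPer w₂ (I * rho γ))⁻¹)
        (expPer w₂ (I * tau γ) + (expPer w₂ (I * tau γ))⁻¹)
        (expPer w₂ (I * sigma γ)) (expPer w₂ (I * upsilon γ)) +
      certMinus (expPer w₂ (I * w₁ / 2)) (expPer w₂ x)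
        (expPer w₂ (I * rho γ) + (expPer w₂ (I * rho γ))⁻¹)
        (expPer w₂ (I * tau γ) + (expPer w₂ (I * tau γ))⁻¹)
        (expPer w₂ (I * sigma γ)) (expPer w₂ (I * upsilon γ)) +
      certEigen (expPer w₂ (I * w₁ / 2)) (expPer w₂ (lam / 2))
        (expPer w₂ (I * sigma γ)) (expPer w₂ (I * upsilon γ))) * f₀ +
  certBackward (expPer w₂ (I * w₁ / 2)) (expPer w₂ x)
      (expPer w₂ (I * tau γ) + (expPer w₂ (I * tau γ))⁻¹)
      (expPer w₂ (I * sigma γ)) (expPer w₂ (I * upsilon γ)) * f₂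

/-- By the difference equation all gamma factors in the three integrands and in the two values of
the telescoper reduce to the same eight values. The factors `2 cosh` that appear come in pairs, and
each pair is an exponential times a quadratic polynomial in `Z`; after removal of the exponentials
the claim is the rational certificate. -/
theorem exists_telescoper (h : Moderate w₁ w₂ (w₁, w₂, γ, x, lam))
    (hD : certDenom (expPer w₂ (I * w₁ / 2)) (expPer w₂ x) ≠ 0) :
    ∃ n₁ n₂ n₃ κ : ℂ, ∀ z : ℝ,
      contiguousForm w₁ w₂ γ x lam (coeffIntegrand (w₁, w₂, γ, x + I * w₁, lam) z)
        (coeffIntegrand (w₁, w₂, γ, x, lam) z) (coeffIntegrand (w₁, w₂, γ, x - I * w₁, lam) z) =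
      κ * (telescoper w₁ w₂ γ x lam n₁ n₂ n₃ (z + I * w₁) - telescoper w₁ w₂ γ x lam n₁ n₂ n₃ z) := by
  obtain ⟨hpos, hlarge, hup, hlo⟩ := h
  have h₁ : 0 < (w₁ : ℂ).re := hpos
  have h₂ : 0 < (w₂ : ℂ).re := by rw [Complex.ofReal_re]; linarith
  have hw₂ := ne_zero_of_re_pos h₂
  have im1 : (I * (w₁ : ℂ)).im = w₁ := by rw [Complex.I_mul_im, Complex.ofReal_re]
  have im2 : (I * (w₁ : ℂ) / 2).im = w₁ / 2 := by rw [Complex.div_ofNat_im, im1]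
  -- shifting a factor down by one period
  have shift : ∀ y : ℂ, |y.im + (w₁ + w₂) / 4| ≤ 3 / 2 * w₁ →
      hypG w₁ w₂ y = 2 * Complex.cosh (Real.pi * (y - I * w₁ / 2) / w₂) * hypG w₁ w₂ (y - I * w₁) := by
    intro y hy
    refine hypG_sub_period h₁ h₂ ?_
    rw [abs_le] at hy
    rw [Complex.sub_im, im2, Complex.ofReal_re, abs_lt]
    constructor <;> linarith [hy.1, hy.2]
  have sup : ∀ (z : ℝ) (j : Fin 4), |((z : ℂ) + upArg j (w₁, w₂, γ, x, lam)).im + (w₁ + w₂) / 4| ≤ w₁ / 2 := by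
    intro z j
    rw [Complex.add_im, Complex.ofReal_im, zero_add]
    exact hup j
  have slo : ∀ (z : ℝ) (j : Fin 4), |(-(z : ℂ) + loArg j (w₁, w₂, γ, x, lam)).im + (w₁ + w₂) / 4| ≤ w₁ / 2 := by
    intro z j
    rw [Complex.add_im, Complex.neg_im, Complex.ofReal_im, neg_zero, zero_add]
    exact hlo j
  have shift0 : ∀ y : ℂ, |y.im + (w₁ + w₂) / 4| ≤ w₁ / 2 →
      hypG w₁ w₂ y = 2 * Complex.cosh (Real.pi * (y - I * w₁ / 2) / w₂) * hypG w₁ w₂ (y - I * w₁) :=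
    fun y hy => shift y (by linarith)
  have shift1 : ∀ y : ℂ, |y.im + (w₁ + w₂) / 4| ≤ w₁ / 2 →
      hypG w₁ w₂ (y + I * w₁) = 2 * Complex.cosh (Real.pi * (y + I * w₁ / 2) / w₂) * hypG w₁ w₂ y := by
    intro y hy
    have := shift (y + I * w₁) (by
      rw [Complex.add_im, im1]; rw [abs_le] at hy ⊢; constructor <;> linarith [hy.1, hy.2])
    rwa [show y + I * w₁ - I * w₁ / 2 = y + I * w₁ / 2 by ring, add_sub_cancel_right] at this
  have shiftL0 : ∀ y : ℂ, |(-y).im + (w₁ + w₂) / 4| ≤ w₁ / 2 →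
      hypG w₁ w₂ (-y) = 2 * Complex.cosh (Real.pi * (y + I * w₁ / 2) / w₂) * hypG w₁ w₂ (-y - I * w₁) := by
    intro y hy
    rw [shift0 _ hy, ← Complex.cosh_neg]
    congr 3
    ring
  have shiftL1 : ∀ y : ℂ, |(-y).im + (w₁ + w₂) / 4| ≤ w₁ / 2 →
      hypG w₁ w₂ (-y + I * w₁) = 2 * Complex.cosh (Real.pi * (y + -(I * w₁ / 2)) / w₂) * hypG w₁ w₂ (-y) := by
    intro y hy
    rw [shift1 _ hy, ← Complex.cosh_neg]
    congr 3
    ring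
  obtain ⟨θ, hθ⟩ : ∃ θ, θ = expPer w₂ (I * w₁ / 4) := ⟨_, rfl⟩
  have hhalf := expPer_half_period (w₁ := w₁) (w₂ := w₂)
  have hper := expPer_period (w₁ := w₁) (w₂ := w₂)
  have eup := fun z j => expPer_upArg (w₁ := w₁) hw₂ γ x lam z j
  have elo := fun z j => expPer_loArg (w₁ := w₁) hw₂ γ x lam z j
  have hlam : expPer w₂ lam = expPer w₂ (lam / 2) ^ 2 := by
    rw [sq, ← expPer_add]; congr 1; ring
  have hquart := expPer_quarter hw₂
  have hθ0 : θ ≠ 0 := hθ ▸ expPer_ne_zero _ _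
  have hX0 := expPer_ne_zero w₂ x
  have hL0 := expPer_ne_zero w₂ (lam / 2)
  have ht0 := expPer_ne_zero w₂ (I * tau γ)
  have hr0 := expPer_ne_zero w₂ (I * rho γ)
  have hs0 := expPer_ne_zero w₂ (I * sigma γ)
  have hu0 := expPer_ne_zero w₂ (I * upsilon γ)
  unfold contiguousForm
  rw [hhalf] at hD ⊢
  rw [← hθ] at hD ⊢ hhalf hper eup elo
  obtain ⟨n₁, n₂, n₃, hcert⟩ := exists_certificate (T := expPer w₂ (I * tau γ) + (expPer w₂ (I * tau γ))⁻¹)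
    (R := expPer w₂ (I * rho γ) + (expPer w₂ (I * rho γ))⁻¹) (pow_ne_zero 2 hθ0) hX0 hL0 hs0 hu0 hD
  obtain ⟨a, ha⟩ : ∃ a : Fin 4 → ℂ, a = fun j => upArg j (w₁, w₂, γ, x, lam) := ⟨_, rfl⟩
  obtain ⟨b, hb⟩ : ∃ b : Fin 4 → ℂ, b = fun j => loArg j (w₁, w₂, γ, x, lam) := ⟨_, rfl⟩
  -- This `κ` brings the exponential prefactors of the pairs belonging to `a 2`, `a 3` and to `b 2`,
  -- `b 3` to those of the pairs belonging to `b 0`, `b 1` and to `a 0`, `a 1`, up to a power of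
  -- `θ`; see `r3` and `r4`.
  refine ⟨n₁, n₂, n₃, expPer w₂ (-(a 0 + a 1 + b 2 + b 3) / 2), fun z => ?_⟩
  have hcert := hcert (I * θ * expPer w₂ z)
    (mul_ne_zero (mul_ne_zero Complex.I_ne_zero hθ0) (expPer_ne_zero _ _))
  -- the exponential prefactors
  have r1 : expPer w₂ (-(z + a 0 + (z + a 1)) / 2 - I * w₁ / 2) =
      expPer w₂ (-(z - b 0 + (z - b 1)) / 2 - I * w₁ / 2) * -(θ ^ 2 / expPer w₂ (lam / 2) ^ 2) := by
    rw [show -(z + a 0 + (z + a 1)) / 2 - I * w₁ / 2 = -(z - b 0 + (z - b 1)) / 2 - I * w₁ / 2 +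
      (I * w₁ / 2 + (I * w₂ / 4 + I * w₂ / 4) - lam) by
        simp only [ha, hb, upArg, loArg, wMean, Matrix.cons_val]; ring,
      expPer_add _ _ (_ - lam), expPer_sub _ _ lam, expPer_add _ (I * w₁ / 2), expPer_add _ (I * w₂ / 4), hquart, hhalf, hlam, Complex.I_mul_I]
    ring
  have r2 : expPer w₂ (-(z - b 0 + (z - b 1)) / 2 - -(I * w₁ / 2)) =
      expPer w₂ (-(z + a 0 + (z + a 1)) / 2 - -(I * w₁ / 2)) * -(expPer w₂ (lam / 2) ^ 2 / θ ^ 2) := by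
    rw [show -(z - b 0 + (z - b 1)) / 2 - -(I * w₁ / 2) = -(z + a 0 + (z + a 1)) / 2 - -(I * w₁ / 2) +
      (lam - I * w₁ / 2 + -(I * w₂ / 4 + I * w₂ / 4)) by
        simp only [ha, hb, upArg, loArg, wMean, Matrix.cons_val]; ring,
      expPer_add _ _ (_ + -(I * w₂ / 4 + I * w₂ / 4)), expPer_add _ _ (-(I * w₂ / 4 + I * w₂ / 4)), expPer_sub _ lam,
      expPer_neg _ (_ + _), expPer_add _ (I * w₂ / 4), hquart, hhalf, hlam, Complex.I_mul_I]
    ring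
  have r3 : expPer w₂ (-(a 0 + a 1 + b 2 + b 3) / 2) * expPer w₂ (-(z - b 2 + (z - b 3)) / 2 - -(I * w₁ / 2)) =
      expPer w₂ (-(z + a 0 + (z + a 1)) / 2 - -(I * w₁ / 2)) := by
    rw [← expPer_add]; congr 1; ring
  have r4 : expPer w₂ (-(a 0 + a 1 + b 2 + b 3) / 2) * expPer w₂ (-(z + a 2 + (z + a 3)) / 2 - I * w₁ / 2) =
      θ ^ 4 * expPer w₂ (-(z - b 0 + (z - b 1)) / 2 - I * w₁ / 2) := by
    have : expPer w₂ (I * w₂) = 1 := by rw [expPer_period, hquart, Complex.I_pow_four]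
    rw [← expPer_add, show -(a 0 + a 1 + b 2 + b 3) / 2 + (-(z + a 2 + (z + a 3)) / 2 - I * w₁ / 2) =
      I * w₁ + (-(z - b 0 + (z - b 1)) / 2 - I * w₁ / 2) + I * w₂ by
        simp only [ha, hb, upArg, loArg, wMean, Matrix.cons_val]; ring,
      expPer_add _ _ (I * w₂), this, mul_one, expPer_add, hper]
  have hneg : expPer w₂ (-(I * w₁ / 2)) = (θ ^ 2)⁻¹ := by rw [expPer_neg, hhalf]
  have ea : ∀ j, expPer w₂ (z + a j) = _ := fun j => (by rw [ha] : expPer w₂ (z + a j) = _).trans (eup z j)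
  have eb : ∀ j, expPer w₂ (z - b j) = _ := fun j => (by rw [hb] : expPer w₂ (z - b j) = _).trans (elo z j)
  have q1 := two_cosh_add_mul_two_cosh_add w₂ (z + a 0) (z + a 1) (-(I * w₁ / 2))
  have q2 := two_cosh_add_mul_two_cosh_add w₂ (z + a 0) (z + a 1) (I * w₁ / 2)
  have q3 := two_cosh_add_mul_two_cosh_add w₂ (z + a 2) (z + a 3) (I * w₁ / 2)
  have q4 := two_cosh_add_mul_two_cosh_add w₂ (z - b 0) (z - b 1) (I * w₁ / 2)
  have q5 := two_cosh_add_mul_two_cosh_add w₂ (z - b 0) (z - b 1) (-(I * w₁ / 2))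
  have q6 := two_cosh_add_mul_two_cosh_add w₂ (z - b 2) (z - b 3) (-(I * w₁ / 2))
  simp only [ea, eb, hneg, hhalf, Matrix.cons_val] at q1 q2 q3 q4 q5 q6
  rw [r1] at q2
  rw [r2] at q5
  have sa : ∀ j, |((z : ℂ) + a j).im + (w₁ + w₂) / 4| ≤ w₁ / 2 := fun j => by rw [ha]; exact sup z j
  have sb : ∀ j, |(-((z : ℂ) - b j)).im + (w₁ + w₂) / 4| ≤ w₁ / 2 := fun j => by
    rw [hb, neg_sub, sub_eq_neg_add]; exact slo z j
  have u := fun j => shift0 _ (sa j)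
  have U := fun j => shift1 _ (sa j)
  have l := fun j => shiftL0 _ (sb j)
  have m := fun j => shiftL1 _ (sb j)
  simp only [sub_eq_add_neg _ (I * (w₁ : ℂ) / 2)] at u
  have e0 : coeffIntegrand (w₁, w₂, γ, x, lam) z =
      hypG w₁ w₂ (z + a 0) * hypG w₁ w₂ (z + a 1) * hypG w₁ w₂ (z + a 2) * hypG w₁ w₂ (z + a 3) *
        (hypG w₁ w₂ (-(z - b 0)) * hypG w₁ w₂ (-(z - b 1)) * hypG w₁ w₂ (-(z - b 2)) *
          hypG w₁ w₂ (-(z - b 3))) := by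
    simp only [coeffIntegrand, gammaProd, Fin.prod_univ_four, ha, hb, neg_sub, neg_add_eq_sub]
  have e1 : coeffIntegrand (w₁, w₂, γ, x + I * w₁, lam) z =
      hypG w₁ w₂ (z + a 0 + I * w₁) * hypG w₁ w₂ (z + a 1 + I * w₁) * hypG w₁ w₂ (z + a 2) *
        hypG w₁ w₂ (z + a 3) *
        (hypG w₁ w₂ (-(z - b 0) - I * w₁) * hypG w₁ w₂ (-(z - b 1) - I * w₁) * hypG w₁ w₂ (-(z - b 2)) *
          hypG w₁ w₂ (-(z - b 3))) := by
    rw [coeffIntegrand_add]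
    simp only [gammaProd, Fin.prod_univ_four, ha, hb, Matrix.cons_val]
    ring_nf
  have e2 : coeffIntegrand (w₁, w₂, γ, x - I * w₁, lam) z =
      hypG w₁ w₂ (z + a 0 - I * w₁) * hypG w₁ w₂ (z + a 1 - I * w₁) * hypG w₁ w₂ (z + a 2) *
        hypG w₁ w₂ (z + a 3) *
        (hypG w₁ w₂ (-(z - b 0) + I * w₁) * hypG w₁ w₂ (-(z - b 1) + I * w₁) * hypG w₁ w₂ (-(z - b 2)) *
          hypG w₁ w₂ (-(z - b 3))) := by
    rw [sub_eq_add_neg x, coeffIntegrand_add]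
    simp only [gammaProd, Fin.prod_univ_four, ha, hb, Matrix.cons_val]
    ring_nf
  have e3 : telescoper w₁ w₂ γ x lam n₁ n₂ n₃ z =
      hypG w₁ w₂ (z + a 0 - I * w₁) * hypG w₁ w₂ (z + a 1 - I * w₁) * hypG w₁ w₂ (z + a 2) *
        hypG w₁ w₂ (z + a 3) *
        (hypG w₁ w₂ (-(z - b 0)) * hypG w₁ w₂ (-(z - b 1)) * hypG w₁ w₂ (-(z - b 2) + I * w₁) *
          hypG w₁ w₂ (-(z - b 3) + I * w₁)) *
        (n₁ / (I * θ * expPer w₂ z) + n₂ + n₃ * (I * θ * expPer w₂ z)) := by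
    rw [telescoper, ← hθ]
    refine congrArg (· * _) ?_
    simp only [gammaProd, Fin.prod_univ_four, ha, hb, Matrix.cons_val]
    ring_nf
  have e4 : telescoper w₁ w₂ γ x lam n₁ n₂ n₃ (z + I * w₁) =
      hypG w₁ w₂ (z + a 0) * hypG w₁ w₂ (z + a 1) * hypG w₁ w₂ (z + a 2 + I * w₁) *
        hypG w₁ w₂ (z + a 3 + I * w₁) *
        (hypG w₁ w₂ (-(z - b 0) - I * w₁) * hypG w₁ w₂ (-(z - b 1) - I * w₁) * hypG w₁ w₂ (-(z - b 2)) *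
          hypG w₁ w₂ (-(z - b 3))) *
        (n₁ / ((θ ^ 2) ^ 2 * (I * θ * expPer w₂ z)) + n₂ + n₃ * ((θ ^ 2) ^ 2 * (I * θ * expPer w₂ z))) := by
    rw [telescoper, ← hθ, expPer_add, hper,
      show I * θ * (expPer w₂ z * θ ^ 4) = (θ ^ 2) ^ 2 * (I * θ * expPer w₂ z) by ring]
    refine congrArg (· * _) ?_
    simp only [gammaProd, Fin.prod_univ_four, ha, hb, Matrix.cons_val]
    ring_nf
  rw [e0, e1, e2, e3, e4, U 0, U 1, U 2, U 3, u 0, u 1, m 0, m 1, m 2, m 3, l 0, l 1]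
  generalize hypG w₁ w₂ (z + a 0 - I * w₁) = g₀
  generalize hypG w₁ w₂ (z + a 1 - I * w₁) = g₁
  generalize hypG w₁ w₂ (z + a 2) = g₂
  generalize hypG w₁ w₂ (z + a 3) = g₃
  generalize hypG w₁ w₂ (-(z - b 0) - I * w₁) = k₀
  generalize hypG w₁ w₂ (-(z - b 1) - I * w₁) = k₁
  generalize hypG w₁ w₂ (-(z - b 2)) = k₂
  generalize hypG w₁ w₂ (-(z - b 3)) = k₃
  obtain ⟨Z, hZ⟩ : ∃ Z, Z = I * θ * expPer w₂ z := ⟨_, rfl⟩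
  simp only [← hZ] at q1 q2 q3 q4 q5 q6 hcert ⊢
  generalize 2 * Complex.cosh (Real.pi * (z + a 0 + -(I * w₁ / 2)) / w₂) = u₀ at q1 ⊢
  generalize 2 * Complex.cosh (Real.pi * (z + a 1 + -(I * w₁ / 2)) / w₂) = u₁ at q1 ⊢
  generalize 2 * Complex.cosh (Real.pi * (z + a 0 + I * w₁ / 2) / w₂) = U₀ at q2 ⊢
  generalize 2 * Complex.cosh (Real.pi * (z + a 1 + I * w₁ / 2) / w₂) = U₁ at q2 ⊢
  generalize 2 * Complex.cosh (Real.pi * (z + a 2 + I * w₁ / 2) / w₂) = U₂ at q3 ⊢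
  generalize 2 * Complex.cosh (Real.pi * (z + a 3 + I * w₁ / 2) / w₂) = U₃ at q3 ⊢
  generalize 2 * Complex.cosh (Real.pi * (z - b 0 + I * w₁ / 2) / w₂) = l₀ at q4 ⊢
  generalize 2 * Complex.cosh (Real.pi * (z - b 1 + I * w₁ / 2) / w₂) = l₁ at q4 ⊢
  generalize 2 * Complex.cosh (Real.pi * (z - b 0 + -(I * w₁ / 2)) / w₂) = m₀ at q5 ⊢
  generalize 2 * Complex.cosh (Real.pi * (z - b 1 + -(I * w₁ / 2)) / w₂) = m₁ at q5 ⊢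
  generalize 2 * Complex.cosh (Real.pi * (z - b 2 + -(I * w₁ / 2)) / w₂) = m₂ at q6 ⊢
  generalize 2 * Complex.cosh (Real.pi * (z - b 3 + -(I * w₁ / 2)) / w₂) = m₃ at q6 ⊢
  have q3' := congrArg (expPer w₂ (-(a 0 + a 1 + b 2 + b 3) / 2) * ·) q3
  have q6' := congrArg (expPer w₂ (-(a 0 + a 1 + b 2 + b 3) / 2) * ·) q6
  simp only [← mul_assoc] at q3' q6'
  rw [mul_assoc _ U₂ U₃, r4] at q3'
  rw [mul_assoc _ m₂ m₃, r3] at q6'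
  clear r1 r2 r3 r4 q3 q6 e0 e1 e2 e3 e4 u U l m
  generalize expPer w₂ (-(z + a 0 + (z + a 1)) / 2 - -(I * w₁ / 2)) = h at *
  generalize expPer w₂ (-(z - b 0 + (z - b 1)) / 2 - I * w₁ / 2) = k at *
  generalize expPer w₂ (-(a 0 + a 1 + b 2 + b 3) / 2) = κ at *
  generalize expPer w₂ x = X at *
  generalize expPer w₂ (lam / 2) = L at *
  generalize expPer w₂ (I * tau γ) = t at *
  generalize expPer w₂ (I * rho γ) = r at *
  generalize expPer w₂ (I * sigma γ) = s at *
  generalize expPer w₂ (I * upsilon γ) = υ at *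
  generalize certForward (θ ^ 2) X (r + r⁻¹) s υ = α at *
  generalize certPlus (θ ^ 2) X (r + r⁻¹) (t + t⁻¹) s υ + certMinus (θ ^ 2) X (r + r⁻¹) (t + t⁻¹) s υ +
    certEigen (θ ^ 2) L s υ = β at *
  generalize certBackward (θ ^ 2) X (t + t⁻¹) s υ = δ at *
  have q1 : u₀ * u₁ = h * ((1 - X * L * (t + t⁻¹) / (θ ^ 2) ^ 2 * Z + X ^ 2 * L ^ 2 / (θ ^ 2) ^ 4 * Z ^ 2)) := by
    rw [q1]; field_simp; ring
  have q2 : U₀ * U₁ = k * -(θ ^ 2 / L ^ 2) * (1 - X * L * (t + t⁻¹) * Z + X ^ 2 * L ^ 2 * Z ^ 2) := by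
    rw [q2]; field_simp; ring
  have q4 : l₀ * l₁ = k * (1 + θ ^ 2 * X * (r + r⁻¹) / L * Z + (θ ^ 2) ^ 2 * X ^ 2 / L ^ 2 * Z ^ 2) := by
    rw [q4]; field_simp
  have q5 : m₀ * m₁ = h * -(L ^ 2 / θ ^ 2) *
      (1 + X * (r + r⁻¹) / (L * θ ^ 2) * Z + X ^ 2 / (L ^ 2 * (θ ^ 2) ^ 2) * Z ^ 2) := by
    rw [q5]; field_simp
  have q3 : κ * (U₂ * U₃) = (θ ^ 2) ^ 2 * k * (1 - (s + s⁻¹) / L * Z + Z ^ 2 / L ^ 2) := by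
    rw [q3']; field_simp; ring
  have q6 : κ * (m₂ * m₃) = h * (1 + L * (υ + υ⁻¹) / θ ^ 2 * Z + L ^ 2 / (θ ^ 2) ^ 2 * Z ^ 2) := by
    rw [q6']; field_simp
  clear q3' q6'
  generalize (1 - X * L * (t + t⁻¹) / (θ ^ 2) ^ 2 * Z + X ^ 2 * L ^ 2 / (θ ^ 2) ^ 4 * Z ^ 2) = Q₁ at *
  generalize (1 - X * L * (t + t⁻¹) * Z + X ^ 2 * L ^ 2 * Z ^ 2) = Q₂ at *
  generalize (1 + θ ^ 2 * X * (r + r⁻¹) / L * Z + (θ ^ 2) ^ 2 * X ^ 2 / L ^ 2 * Z ^ 2) = Q₄ at *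
  generalize (1 + X * (r + r⁻¹) / (L * θ ^ 2) * Z + X ^ 2 / (L ^ 2 * (θ ^ 2) ^ 2) * Z ^ 2) = Q₅ at *
  generalize (1 - (s + s⁻¹) / L * Z + Z ^ 2 / L ^ 2) = Q₃ at *
  generalize (1 + L * (υ + υ⁻¹) / θ ^ 2 * Z + L ^ 2 / (θ ^ 2) ^ 2 * Z ^ 2) = Q₆ at *
  generalize n₁ / Z + n₂ + n₃ * Z = N₀ at *
  generalize n₁ / ((θ ^ 2) ^ 2 * Z) + n₂ + n₃ * ((θ ^ 2) ^ 2 * Z) = N₁ at *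
  -- Every term carries the same exponential `h * k`, so this is `h * k` times the certificate.
  have key : α * ((u₀ * u₁) * (U₀ * U₁)) - β * ((u₀ * u₁) * (l₀ * l₁)) + δ * ((m₀ * m₁) * (l₀ * l₁)) =
      κ * (U₂ * U₃) * (u₀ * u₁) * N₁ - κ * (m₂ * m₃) * (l₀ * l₁) * N₀ := by
    rw [q1, q2, q4, q5, q3, q6]
    linear_combination h * k * hcert
  linear_combination g₀ * g₁ * g₂ * g₃ * (k₀ * k₁ * k₂ * k₃) * key


end Contiguous

end AskeyWilson

namespace AskeyWilson

open MeasureTheory Filter Topology Metric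
open Complex (I)

/-! ### Integration of the telescoping identity. -/

section Contiguous

variable {w₁ w₂ : ℝ} {γ : Fin 4 → ℂ} {x lam : ℂ}

theorem norm_expPer (w : ℝ) (y : ℂ) : ‖expPer w y‖ = Real.exp (2 * Real.pi * y.re / w) := by
  rw [expPer, Complex.norm_exp]
  congr 1
  rw [Complex.div_ofReal_re, ← Complex.ofReal_ofNat, ← Complex.ofReal_mul, Complex.re_ofReal_mul]

/-- `-(w₁ + w₂)/4` is half-way between the real line and the lower edge of the strip. A displacement
of `3w₁/2` together with a contour shift of `w₁` stays inside as soon as `w₂ > 9w₁`. -/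
theorem abs_im_add_lt (hpos : 0 < w₁) (hlarge : 16 * w₁ ≤ w₂) {a : ℂ}
    (ha : |a.im + (w₁ + w₂) / 4| ≤ 3 / 2 * w₁) :
    |a.im| + w₁ < ((w₁ : ℂ).re + (w₂ : ℂ).re) / 2 := by
  rw [abs_le] at ha
  rw [Complex.ofReal_re, Complex.ofReal_re, ← lt_sub_iff_add_lt, abs_lt]
  constructor <;> linarith [ha.1, ha.2]

theorem Moderate.shift (h : Moderate w₁ w₂ (w₁, w₂, γ, x, lam)) {d e : Fin 4 → ℂ}
    (hd : ∀ j, |(d j).im| ≤ w₁) (he : ∀ j, |(e j).im| ≤ w₁) :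
    (∀ j, |(upArg j (w₁, w₂, γ, x, lam) + d j).im| + w₁ < ((w₁ : ℂ).re + (w₂ : ℂ).re) / 2) ∧
    (∀ j, |(loArg j (w₁, w₂, γ, x, lam) + e j).im| + w₁ < ((w₁ : ℂ).re + (w₂ : ℂ).re) / 2) := by
  constructor <;> intro j <;> refine abs_im_add_lt h.pos h.large ?_ <;> rw [Complex.add_im]
  · have h1 := abs_le.1 (h.up j)
    have h2 := abs_le.1 (hd j)
    rw [abs_le]; constructor <;> linarith [h1.1, h1.2, h2.1, h2.2]
  · have h1 := abs_le.1 (h.lo j)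
    have h2 := abs_le.1 (he j)
    rw [abs_le]; constructor <;> linarith [h1.1, h1.2, h2.1, h2.2]

/-- The rate `2π/w₂ + π/w₁` is below the critical `2π(1/w₁ + 1/w₂)`, but above the growth rate
`2π/w₂` of `e(z)` and its inverse in the telescoper, which therefore still decays at rate `π/w₁`.
Since the increments sum to zero, the sum of the shifts is preserved. -/
theorem Moderate.exists_le (h : Moderate w₁ w₂ (w₁, w₂, γ, x, lam)) {d e : Fin 4 → ℂ}
    (hd : ∀ j, |(d j).im| ≤ w₁) (he : ∀ j, |(e j).im| ≤ w₁) (hsum : ∑ j, (d j + e j) = 0) :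
    ∃ C, 0 ≤ C ∧ ∀ z : ℂ, |z.im| ≤ w₁ →
      ‖gammaProd w₁ w₂ (fun j => upArg j (w₁, w₂, γ, x, lam) + d j)
        (fun j => loArg j (w₁, w₂, γ, x, lam) + e j) z‖ ≤
          C * Real.exp (-(2 * Real.pi / w₂ + Real.pi / w₁) * |z.re|) := by
  have h₁ : 0 < (w₁ : ℂ).re := h.pos
  have hw₂ : 0 < w₂ := by linarith [h.pos, h.large]
  have h₂ : 0 < (w₂ : ℂ).re := hw₂
  have hpos := h.pos
  obtain ⟨C, hC⟩ := exists_gammaProd_le (T := w₁) (c := 2 * Real.pi / w₂ + Real.pi / w₁) h₁ h₂ (by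
      have h1 := sum_upArg_add_loArg (w₁, w₂, γ, x, lam)
      rw [← h1, ← add_zero (∑ j, (upArg j _ + loArg j _)), ← hsum, ← Finset.sum_add_distrib]
      exact Finset.sum_congr rfl fun j _ => by ring) h.pos.le (h.shift hd he).1 (h.shift hd he).2
    (by positivity) (by
      rw [Complex.add_re, ← Complex.ofReal_inv, ← Complex.ofReal_inv, Complex.ofReal_re, Complex.ofReal_re]
      have : 0 < Real.pi / w₁ := by positivity
      have e : 2 * Real.pi * (w₁⁻¹ + w₂⁻¹) = 2 * Real.pi / w₂ + Real.pi / w₁ + Real.pi / w₁ := by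
        field_simp; ring
      linarith)
  refine ⟨C, ?_, hC⟩
  have := (norm_nonneg _).trans (hC 0 (by simpa using h.pos.le))
  simpa using this

theorem Moderate.integrable (h : Moderate w₁ w₂ (w₁, w₂, γ, x, lam)) {d : ℂ} (hd : |d.im| ≤ w₁) :
    Integrable fun t : ℝ => coeffIntegrand (w₁, w₂, γ, x + d, lam) t := by
  have hpos := h.pos
  have hw₂ : 0 < w₂ := by linarith [h.pos, h.large]
  have hd1 : ∀ j, |((![d, d, 0, 0] : Fin 4 → ℂ) j).im| ≤ w₁ := fun j => by
    fin_cases j <;> simp [hd, h.pos.le]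
  have hd2 : ∀ j, |(-(![d, d, 0, 0] : Fin 4 → ℂ) j).im| ≤ w₁ := fun j => by
    rw [Complex.neg_im, abs_neg]; exact hd1 j
  obtain ⟨C, -, hC⟩ := h.exists_le hd1 hd2 (by simp)
  have hdiff := h.shift hd1 hd2
  simp only [coeffIntegrand_add, sub_eq_add_neg]
  refine integrable_of_norm_le_exp (C := C) (c := 2 * Real.pi / w₂ + Real.pi / w₁) ?_ (by positivity)
    fun t => ?_
  · refine continuous_iff_continuousAt.2 fun t => ?_
    exact ContinuousAt.comp (f := fun t : ℝ => (t : ℂ)) (differentiableAt_gammaProd (T := w₁) h.pos hw₂ hdiff.1 hdiff.2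
      (by simpa using h.pos.le)).continuousAt (by fun_prop)
  · have := hC t (by simpa using h.pos.le)
    rwa [Complex.ofReal_re] at this

theorem Moderate.telescoper_bounds (h : Moderate w₁ w₂ (w₁, w₂, γ, x, lam)) (n₁ n₂ n₃ : ℂ) :
    (∀ z : ℂ, |z.im| ≤ w₁ → DifferentiableAt ℂ (telescoper w₁ w₂ γ x lam n₁ n₂ n₃) z) ∧
    ∃ C, ∀ z : ℂ, |z.im| ≤ w₁ →
      ‖telescoper w₁ w₂ γ x lam n₁ n₂ n₃ z‖ ≤ C * Real.exp (-(Real.pi / w₁) * |z.re|) := by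
  have hpos := h.pos
  have hw₂ : 0 < w₂ := by linarith [h.pos, h.large]
  have him : (I * (w₁ : ℂ)).im = w₁ := by rw [Complex.I_mul_im, Complex.ofReal_re]
  have hd : ∀ j, |(-(![I * w₁, I * w₁, 0, 0] : Fin 4 → ℂ) j).im| ≤ w₁ := fun j => by
    fin_cases j <;> simp [abs_of_pos h.pos, h.pos.le]
  have he : ∀ j, |((![0, 0, I * w₁, I * w₁] : Fin 4 → ℂ) j).im| ≤ w₁ := fun j => by
    fin_cases j <;> simp [abs_of_pos h.pos, h.pos.le]
  obtain ⟨C, hC0, hC⟩ := h.exists_le hd he (by simp [Fin.sum_univ_four])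
  have hdiff := h.shift hd he
  have hne := expPer_ne_zero (w₂ : ℂ)
  obtain ⟨θ, hθ⟩ : ∃ θ, θ = I * expPer w₂ (I * w₁ / 4) := ⟨_, rfl⟩
  have hθ0 : θ ≠ 0 := hθ ▸ mul_ne_zero Complex.I_ne_zero (hne _)
  have heq : telescoper w₁ w₂ γ x lam n₁ n₂ n₃ = fun z =>
      gammaProd w₁ w₂ (fun j => upArg j (w₁, w₂, γ, x, lam) + -![I * w₁, I * w₁, 0, 0] j)
        (fun j => loArg j (w₁, w₂, γ, x, lam) + ![0, 0, I * w₁, I * w₁] j) z *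
      (n₁ / (θ * expPer w₂ z) + n₂ + n₃ * (θ * expPer w₂ z)) := by
    funext z
    rw [telescoper, hθ]
    rfl
  have hexp : Differentiable ℂ (expPer (w₂ : ℂ)) := by unfold expPer; fun_prop
  rw [heq]
  refine ⟨fun z hz => (differentiableAt_gammaProd (T := w₁) h.pos hw₂ hdiff.1 hdiff.2 hz).fun_mul ?_,
    C * (‖n₁‖ / ‖θ‖ + ‖n₂‖ + ‖n₃‖ * ‖θ‖), fun z hz => ?_⟩
  · have := hexp z
    have h0 : θ * expPer w₂ z ≠ 0 := mul_ne_zero hθ0 (hne z)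
    fun_prop (disch := assumption)
  · have h1 := hC z hz
    set A := 2 * Real.pi * |z.re| / w₂ with hA
    have hA0 : 0 ≤ A := by positivity
    have e1 : ‖expPer w₂ z‖ ≤ Real.exp A := by
      rw [norm_expPer, hA]
      have := le_abs_self z.re
      gcongr
    have e2 : ‖(expPer w₂ z)⁻¹‖ ≤ Real.exp A := by
      rw [← expPer_neg, norm_expPer, hA, Complex.neg_re]
      have := neg_le_abs z.re
      gcongr
    have e3 : ‖n₁ / (θ * expPer w₂ z) + n₂ + n₃ * (θ * expPer w₂ z)‖ ≤
        (‖n₁‖ / ‖θ‖ + ‖n₂‖ + ‖n₃‖ * ‖θ‖) * Real.exp A := by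
      refine (norm_add₃_le).trans ?_
      rw [div_eq_mul_inv, mul_inv, ← mul_assoc, ← mul_assoc, norm_mul, norm_mul, norm_mul, norm_mul, norm_inv θ]
      have i1 := mul_le_mul_of_nonneg_left e2 (by positivity : 0 ≤ ‖n₁‖ * ‖θ‖⁻¹)
      have i2 := mul_le_mul_of_nonneg_left e1 (by positivity : 0 ≤ ‖n₃‖ * ‖θ‖)
      have i3 := mul_le_mul_of_nonneg_left (Real.one_le_exp hA0) (norm_nonneg n₂)
      rw [div_eq_mul_inv]
      linarith
    rw [norm_mul]
    refine (mul_le_mul h1 e3 (norm_nonneg _) (by positivity)).trans (le_of_eq ?_)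
    rw [mul_mul_mul_comm, ← Real.exp_add]
    congr 2
    rw [hA]
    ring

/-- The telescoper is analytic and decaying on the closed strip between the real line and its
translate by `iw₁`, so its integrals over the two lines agree. -/
theorem Moderate.contiguousForm_integral (h : Moderate w₁ w₂ (w₁, w₂, γ, x, lam))
    (hD : certDenom (expPer w₂ (I * w₁ / 2)) (expPer w₂ x) ≠ 0) :
    contiguousForm w₁ w₂ γ x lam (∫ t : ℝ, coeffIntegrand (w₁, w₂, γ, x + I * w₁, lam) t)
      (∫ t : ℝ, coeffIntegrand (w₁, w₂, γ, x, lam) t)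
      (∫ t : ℝ, coeffIntegrand (w₁, w₂, γ, x - I * w₁, lam) t) = 0 := by
  obtain ⟨n₁, n₂, n₃, κ, htel⟩ := exists_telescoper h hD
  obtain ⟨hdiff, C, hC⟩ := h.telescoper_bounds n₁ n₂ n₃
  have hpos := h.pos
  have hc : 0 < Real.pi / w₁ := by positivity
  have him : (I * (w₁ : ℂ)).im = w₁ := by rw [Complex.I_mul_im, Complex.ofReal_re]
  have i1 := h.integrable (d := I * w₁) (by rw [him, abs_of_pos hpos])
  have i0 := h.integrable (d := 0) (by simpa using hpos.le)
  have i2 := h.integrable (d := -(I * w₁)) (by rw [Complex.neg_im, him, abs_neg, abs_of_pos hpos])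
  rw [add_zero] at i0
  rw [← sub_eq_add_neg] at i2
  have hshift := integral_line_eq (F := telescoper w₁ w₂ γ x lam n₁ n₂ n₃) (a := 0) (b := w₁) hc
    (fun z hz => hdiff z ?_) (fun z hz => hC z ?_)
  rotate_left
  · rw [Set.uIcc_of_le hpos.le] at hz; rw [abs_of_nonneg hz.1]; exact hz.2
  · rw [Set.uIcc_of_le hpos.le] at hz; rw [abs_of_nonneg hz.1]; exact hz.2
  have line : ∀ s : ℝ, |s| ≤ w₁ → Integrable fun t : ℝ => telescoper w₁ w₂ γ x lam n₁ n₂ n₃ (t + I * s) := by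
    intro s hs
    have him : ∀ t : ℝ, (t + I * s : ℂ).im = s := fun t => by simp
    refine integrable_of_norm_le_exp (C := C) (continuous_iff_continuousAt.2 fun t => ?_) hc fun t => ?_
    · exact ContinuousAt.comp (f := fun t : ℝ => (t + I * s : ℂ)) (hdiff _ (by rwa [him])).continuousAt (by fun_prop)
    · have := hC (t + I * s) (by rwa [him])
      simpa using this
  have l1 := line w₁ (abs_of_pos hpos).le
  have l0 := line 0 (by simpa using hpos.le)
  simp only [Complex.ofReal_zero, mul_zero, add_zero, mul_comm _ I] at l0 hshift
  have := integral_congr_ae (μ := volume) (Eventually.of_forall htel)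
  rw [integral_const_mul, integral_sub l1 l0, ← hshift, sub_self, mul_zero] at this
  rw [← this]
  have key : ∀ (α β δ : ℂ) {f₁ f₀ f₂ : ℝ → ℂ}, Integrable f₁ → Integrable f₀ → Integrable f₂ →
      α * (∫ t, f₁ t) - β * (∫ t, f₀ t) + δ * (∫ t, f₂ t) = ∫ t, (α * f₁ t - β * f₀ t + δ * f₂ t) := by
    intro α β δ f₁ f₀ f₂ h₁ h₀ h₂
    rw [integral_add _ (h₂.const_mul _), integral_sub (h₁.const_mul _) (h₀.const_mul _), integral_const_mul,
      integral_const_mul, integral_const_mul]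
    exact (h₁.const_mul _).sub (h₀.const_mul _)
  exact key _ _ _ i1 i0 i2

end Contiguous

end AskeyWilson

namespace AskeyWilson

open MeasureTheory Filter Topology Metric
open Complex (I)

/-! ### From the contiguous relation to the Askey–Wilson operator. -/

section DifferenceEquation

theorem expPer_half {w y : ℂ} : expPer w (y / 2) ^ 2 = expPer w y := by
  rw [sq, ← expPer_add, add_halves]

theorem expPer_mean {w₁ w₂ : ℂ} (h₂ : w₂ ≠ 0) : expPer w₂ (I * wMean w₁ w₂) = -expPer w₂ (I * w₁ / 2) := by
  rw [show I * wMean w₁ w₂ = I * w₁ / 2 + (I * w₂ / 4 + I * w₂ / 4) by rw [wMean]; ring, expPer_add,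
    expPer_add, expPer_quarter h₂, Complex.I_mul_I, mul_neg_one]

theorem coeffDenom_eq {w₁ w₂ : ℂ} (h₂ : w₂ ≠ 0) (x : ℂ) :
    coeffDenom w₁ w₂ x = (1 - expPer w₂ x ^ 2) * (1 - expPer w₂ (I * w₁ / 2) ^ 2 * expPer w₂ x ^ 2) := by
  have h : ∀ y, Complex.exp (4 * Real.pi * y / w₂) = expPer w₂ y ^ 2 := fun y => by
    rw [sq, ← expPer_add, expPer]; congr 1; ring
  rw [coeffDenom, h, h, expPer_add, expPer_mean h₂]
  ring

/-- The coefficient denominators at `x` and `-x` share the condition `X² ≠ 1` and contribute `1 -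
p²X²` and `X² - p²` respectively. -/
theorem certDenom_ne_zero {w₁ w₂ x : ℂ} (h₂ : w₂ ≠ 0) (h : coeffDenom w₁ w₂ x ≠ 0)
    (h' : coeffDenom w₁ w₂ (-x) ≠ 0) : certDenom (expPer w₂ (I * w₁ / 2)) (expPer w₂ x) ≠ 0 := by
  rw [coeffDenom_eq h₂] at h h'
  rw [expPer_neg] at h'
  have hX := expPer_ne_zero w₂ x
  have e : certDenom (expPer w₂ (I * w₁ / 2)) (expPer w₂ x) = expPer w₂ x ^ 4 *
      ((1 - (expPer w₂ x)⁻¹ ^ 2) * (1 - expPer w₂ (I * w₁ / 2) ^ 2 * (expPer w₂ x)⁻¹ ^ 2)) *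
        (1 - expPer w₂ (I * w₁ / 2) ^ 2 * expPer w₂ x ^ 2) := by
    rw [certDenom]; field_simp
  rw [e]
  exact mul_ne_zero (mul_ne_zero (pow_ne_zero _ hX) h') (right_ne_zero_of_mul h)

theorem expPer_gamma (w : ℂ) (γ : Fin 4 → ℂ) :
    expPer w (I * γ 0) = expPer w (I * sigma γ) / expPer w (I * rho γ) ∧
    expPer w (I * γ 1) = expPer w (I * sigma γ) * expPer w (I * rho γ) ∧
    expPer w (I * γ 2) = 1 / (expPer w (I * tau γ) * expPer w (I * upsilon γ)) ∧
    expPer w (I * γ 3) = expPer w (I * tau γ) / expPer w (I * upsilon γ) := by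
  refine ⟨?_, ?_, ?_, ?_⟩
  · rw [← expPer_sub]; congr 1; rw [sigma, rho]; ring
  · rw [← expPer_add]; congr 1; rw [sigma, rho]; ring
  · rw [← expPer_add, one_div, ← expPer_neg]; congr 1; rw [tau, upsilon]; ring
  · rw [← expPer_sub]; congr 1; rw [tau, upsilon]; ring

theorem coeffA_eq {w₁ w₂ : ℂ} (h₂ : w₂ ≠ 0) (γ : Fin 4 → ℂ) (x : ℂ) :
    coeffA w₁ w₂ γ x = (∏ j, (1 + expPer w₂ (I * w₁ / 2) * expPer w₂ (I * γ j) * expPer w₂ x)) /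
      ((1 - expPer w₂ x ^ 2) * (1 - expPer w₂ (I * w₁ / 2) ^ 2 * expPer w₂ x ^ 2)) := by
  rw [coeffA, coeffDenom_eq h₂]
  congr 1
  refine Finset.prod_congr rfl fun j _ => ?_
  change 1 - expPer w₂ _ = _
  rw [expPer_add, expPer_add, expPer_mean h₂]
  ring

theorem eigenvalue_eq {w₁ w₂ : ℂ} (γ : Fin 4 → ℂ) (lam : ℂ) :
    eigenvalue w₁ w₂ γ lam = certEigen (expPer w₂ (I * w₁ / 2)) (expPer w₂ (lam / 2))
      (expPer w₂ (I * sigma γ)) (expPer w₂ (I * upsilon γ)) := by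
  have e : Complex.exp (Real.pi * I * w₁ / w₂ + 2 * Real.pi * I * dual γ 0 / w₂) =
      expPer w₂ (I * w₁ / 2) * expPer w₂ (I * sigma γ) / expPer w₂ (I * upsilon γ) := by
    rw [← expPer_add, ← expPer_sub, expPer]
    congr 1
    simp only [dual, Matrix.cons_val, sigma, upsilon]
    ring
  have e2 : Complex.exp (2 * Real.pi * lam / w₂) = expPer w₂ (lam / 2) ^ 2 := by rw [expPer_half, expPer]
  rw [eigenvalue, Complex.cosh, Complex.cosh, Complex.exp_neg, Complex.exp_neg, e, e2, certEigen]
  have h0 := expPer_ne_zero w₂ (I * w₁ / 2)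
  have h1 := expPer_ne_zero w₂ (lam / 2)
  have h2 := expPer_ne_zero w₂ (I * sigma γ)
  have h3 := expPer_ne_zero w₂ (I * upsilon γ)
  field_simp
  ring

theorem hypG_ne_zero {w₁ w₂ z : ℂ} (h₁ : 0 < w₁.re) (h₂ : 0 < w₂.re) (h : |z.im| < (w₁.re + w₂.re) / 2) :
    hypG w₁ w₂ z ≠ 0 := by
  rw [hypG_eq_gammaStrip h₁ h₂ h]
  exact gammaStrip_ne_zero _ _ _

/-- The condition that `x` and its two translates lie well inside the strip. -/
structure DeltaModerate (w₁ w₂ : ℝ) (γ : Fin 4 → ℂ) (x : ℂ) : Prop where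
  zero : |(x - I * γ 0).im| ≤ w₁
  one : |(x - I * γ 1).im| ≤ w₁
  two : |(x + I * γ 2).im| ≤ w₁
  three : |(x + I * γ 3).im| ≤ w₁

variable {w₁ w₂ : ℝ} {γ : Fin 4 → ℂ} {x lam : ℂ}

theorem DeltaModerate.hypG_ne_zero (hpos : 0 < w₁) (hlarge : 16 * w₁ ≤ w₂) {y d : ℂ} (hd : |d.im| ≤ w₁)
    (hy : |y.im| ≤ w₁) : hypG w₁ w₂ (y + d) ≠ 0 := by
  have h := abs_add_le y.im d.im
  refine AskeyWilson.hypG_ne_zero (w₁ := w₁) (w₂ := w₂) hpos ?_ ?_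
  · rw [Complex.ofReal_re]; linarith
  · rw [Complex.add_im, Complex.ofReal_re, Complex.ofReal_re]; linarith

theorem Delta_add (w₁ w₂ : ℂ) (γ : Fin 4 → ℂ) (x d : ℂ) : Delta w₁ w₂ γ (x + d) =
    hypG w₁ w₂ (x + I * γ 2 + d) * hypG w₁ w₂ (x + I * γ 3 + d) /
      (hypG w₁ w₂ (x - I * γ 0 + d) * hypG w₁ w₂ (x - I * γ 1 + d)) := by
  rw [Delta, add_right_comm x d, add_right_comm x d, add_sub_right_comm x d, add_sub_right_comm x d]

theorem DeltaModerate.ne_zero (h : DeltaModerate w₁ w₂ γ x) (hpos : 0 < w₁) (hlarge : 16 * w₁ ≤ w₂) {d : ℂ}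
    (hd : |d.im| ≤ w₁) : Delta w₁ w₂ γ (x + d) ≠ 0 := by
  rw [Delta_add]
  exact div_ne_zero (mul_ne_zero (DeltaModerate.hypG_ne_zero hpos hlarge hd h.two)
    (DeltaModerate.hypG_ne_zero hpos hlarge hd h.three))
    (mul_ne_zero (DeltaModerate.hypG_ne_zero hpos hlarge hd h.zero)
    (DeltaModerate.hypG_ne_zero hpos hlarge hd h.one))

/-- The quadratic factor `(1 + e(y + v)) (1 + e(y' + v))`. -/
noncomputable def pairFactor (w y y' v : ℂ) : ℂ :=
  1 + (expPer w y + expPer w y') * expPer w v + expPer w y * expPer w y' * expPer w v ^ 2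

/-- The quotient of the two values of `Δ` is a quotient of products of two factors `2 cosh`. The
case `ε = 0` serves the forward and `ε = -iw₁` the backward shift. `pairFactor` does not vanish
because it is a nonzero multiple of factors `2 cosh` that relate nonzero values of `G`. -/
theorem DeltaModerate.add_period (h : DeltaModerate w₁ w₂ γ x) (hpos : 0 < w₁) (hlarge : 16 * w₁ ≤ w₂)
    {ε : ℂ} (hε : ε = 0 ∨ ε = -(I * w₁)) :
    pairFactor w₂ (x - I * γ 0) (x - I * γ 1) (ε + I * w₁ / 2) ≠ 0 ∧
    expPer w₂ (I * sigma γ) * pairFactor w₂ (x - I * γ 0) (x - I * γ 1) (ε + I * w₁ / 2) *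
        Delta w₁ w₂ γ (x + (ε + I * w₁)) =
      expPer w₂ (I * upsilon γ) * pairFactor w₂ (x + I * γ 2) (x + I * γ 3) (ε + I * w₁ / 2) *
        Delta w₁ w₂ γ (x + ε) := by
  have h₁ : 0 < (w₁ : ℂ).re := hpos
  have h₂ : 0 < (w₂ : ℂ).re := by rw [Complex.ofReal_re]; linarith
  have im1 : (I * (w₁ : ℂ)).im = w₁ := by rw [Complex.I_mul_im, Complex.ofReal_re]
  have im2 : (I * (w₁ : ℂ) / 2).im = w₁ / 2 := by rw [Complex.div_ofNat_im, im1]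
  have hε1 : |ε.im| ≤ w₁ := by
    rcases hε with rfl | rfl
    · simpa using hpos.le
    · rw [Complex.neg_im, im1, abs_neg, abs_of_pos hpos]
  have hε2 : |(ε + I * w₁).im| ≤ w₁ := by
    rcases hε with rfl | rfl
    · rw [zero_add, im1, abs_of_pos hpos]
    · simpa using hpos.le
  have hε3 : |(ε + I * w₁ / 2).im| ≤ w₁ := by
    rw [Complex.add_im, im2]
    rcases hε with rfl | rfl
    · rw [Complex.zero_im, abs_le]; constructor <;> linarith
    · rw [Complex.neg_im, im1, abs_le]; constructor <;> linarith
  have shift : ∀ y : ℂ, |y.im| ≤ w₁ → hypG w₁ w₂ (y + (ε + I * w₁)) =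
      2 * Complex.cosh (Real.pi * (y + (ε + I * w₁ / 2)) / w₂) * hypG w₁ w₂ (y + ε) := by
    intro y hy
    have := abs_add_le y.im (ε + I * w₁ / 2).im
    have := hypG_add_period (w₁ := w₁) (w₂ := w₂) (z := y + ε) h₁ h₂ (by
      rw [add_assoc, Complex.add_im, Complex.ofReal_re]; linarith)
    rwa [add_assoc, add_assoc] at this
  have p1 := two_cosh_add_mul_two_cosh_add w₂ (x - I * γ 0) (x - I * γ 1) (ε + I * w₁ / 2)
  have p2 := two_cosh_add_mul_two_cosh_add w₂ (x + I * γ 2) (x + I * γ 3) (ε + I * w₁ / 2)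
  rw [← pairFactor] at p1 p2
  rw [show -(x - I * γ 0 + (x - I * γ 1)) / 2 - (ε + I * w₁ / 2) = -x - (ε + I * w₁ / 2) + I * sigma γ by
    rw [sigma]; ring, expPer_add] at p1
  rw [show -(x + I * γ 2 + (x + I * γ 3)) / 2 - (ε + I * w₁ / 2) = -x - (ε + I * w₁ / 2) + I * upsilon γ by
    rw [upsilon]; ring, expPer_add] at p2
  have s0 := shift _ h.zero
  have s1 := shift _ h.one
  have s2 := shift _ h.two
  have s3 := shift _ h.three
  have n0 := DeltaModerate.hypG_ne_zero hpos hlarge hε2 h.zero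
  have n1 := DeltaModerate.hypG_ne_zero hpos hlarge hε2 h.one
  have n2 := DeltaModerate.hypG_ne_zero hpos hlarge hε1 h.zero
  have n3 := DeltaModerate.hypG_ne_zero hpos hlarge hε1 h.one
  have hE := expPer_ne_zero w₂ (-x - (ε + I * w₁ / 2))
  have hs := expPer_ne_zero w₂ (I * sigma γ)
  rw [s0] at n0
  rw [s1] at n1
  rw [Delta_add, Delta_add, s0, s1, s2, s3]
  generalize 2 * Complex.cosh (Real.pi * (x - I * γ 0 + (ε + I * w₁ / 2)) / w₂) = c₀ at *
  generalize 2 * Complex.cosh (Real.pi * (x - I * γ 1 + (ε + I * w₁ / 2)) / w₂) = c₁ at *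
  generalize 2 * Complex.cosh (Real.pi * (x + I * γ 2 + (ε + I * w₁ / 2)) / w₂) = c₂ at *
  generalize 2 * Complex.cosh (Real.pi * (x + I * γ 3 + (ε + I * w₁ / 2)) / w₂) = c₃ at *
  generalize pairFactor w₂ (x - I * γ 0) (x - I * γ 1) (ε + I * w₁ / 2) = K at *
  generalize pairFactor w₂ (x + I * γ 2) (x + I * γ 3) (ε + I * w₁ / 2) = K' at *
  generalize expPer w₂ (-x - (ε + I * w₁ / 2)) = E at *
  generalize expPer w₂ (I * sigma γ) = s at *
  generalize expPer w₂ (I * upsilon γ) = u at *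
  generalize hypG w₁ w₂ (x - I * γ 0 + ε) = g₀ at *
  generalize hypG w₁ w₂ (x - I * γ 1 + ε) = g₁ at *
  generalize hypG w₁ w₂ (x + I * γ 2 + ε) = g₂ at *
  generalize hypG w₁ w₂ (x + I * γ 3 + ε) = g₃ at *
  have hc₀ := left_ne_zero_of_mul n0
  have hc₁ := left_ne_zero_of_mul n1
  have hK : K ≠ 0 := by
    rintro rfl
    rw [mul_zero] at p1
    exact mul_ne_zero hc₀ hc₁ p1
  refine ⟨hK, ?_⟩
  have e1 : c₂ * g₂ * (c₃ * g₃) / (c₀ * g₀ * (c₁ * g₁)) = (c₂ * c₃) * (g₂ * g₃) / ((c₀ * c₁) * (g₀ * g₁)) := by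
    congr 1 <;> ring
  rw [e1, p1, p2]
  field_simp

/-- In `A(x)` and `A(-x)` two of the four linear factors cancel against the quotient of neighbouring
values of `Δ`. Division by `Δ` thus converts the coefficients of the contiguous relation into those
of the Askey–Wilson operator. -/
theorem coeffA_mul_Delta (h : DeltaModerate w₁ w₂ γ x) (hpos : 0 < w₁) (hlarge : 16 * w₁ ≤ w₂)
    (hD : certDenom (expPer w₂ (I * w₁ / 2)) (expPer w₂ x) ≠ 0) :
    coeffA w₁ w₂ γ x * Delta w₁ w₂ γ x = certForward (expPer w₂ (I * w₁ / 2)) (expPer w₂ x)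
      (expPer w₂ (I * rho γ) + (expPer w₂ (I * rho γ))⁻¹)
      (expPer w₂ (I * sigma γ)) (expPer w₂ (I * upsilon γ)) * Delta w₁ w₂ γ (x + I * w₁) ∧
    coeffA w₁ w₂ γ (-x) * Delta w₁ w₂ γ x = certBackward (expPer w₂ (I * w₁ / 2)) (expPer w₂ x)
      (expPer w₂ (I * tau γ) + (expPer w₂ (I * tau γ))⁻¹)
      (expPer w₂ (I * sigma γ)) (expPer w₂ (I * upsilon γ)) * Delta w₁ w₂ γ (x - I * w₁) ∧
    coeffA w₁ w₂ γ x = certPlus (expPer w₂ (I * w₁ / 2)) (expPer w₂ x)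
      (expPer w₂ (I * rho γ) + (expPer w₂ (I * rho γ))⁻¹)
      (expPer w₂ (I * tau γ) + (expPer w₂ (I * tau γ))⁻¹)
      (expPer w₂ (I * sigma γ)) (expPer w₂ (I * upsilon γ)) ∧
    coeffA w₁ w₂ γ (-x) = certMinus (expPer w₂ (I * w₁ / 2)) (expPer w₂ x)
      (expPer w₂ (I * rho γ) + (expPer w₂ (I * rho γ))⁻¹)
      (expPer w₂ (I * tau γ) + (expPer w₂ (I * tau γ))⁻¹)
      (expPer w₂ (I * sigma γ)) (expPer w₂ (I * upsilon γ)) := by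
  have h₂ : 0 < (w₂ : ℂ).re := by rw [Complex.ofReal_re]; linarith
  have hw₂ := ne_zero_of_re_pos h₂
  obtain ⟨hK, hf⟩ := h.add_period hpos hlarge (.inl rfl)
  obtain ⟨hK', hb⟩ := h.add_period hpos hlarge (.inr rfl)
  obtain ⟨g0, g1, g2, g3⟩ := expPer_gamma w₂ γ
  rw [zero_add, zero_add, add_zero] at hf
  rw [zero_add] at hK
  rw [neg_add_cancel, add_zero, ← sub_eq_add_neg] at hb
  have ev : expPer w₂ (-(I * w₁) + I * w₁ / 2) = (expPer w₂ (I * w₁ / 2))⁻¹ := by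
    rw [← expPer_neg]; congr 1; ring
  simp only [pairFactor, expPer_sub, expPer_add _ x, ev, g0, g1, g2, g3] at hf hb hK hK'
  rw [coeffA_eq hw₂, coeffA_eq hw₂, Fin.prod_univ_four, Fin.prod_univ_four, expPer_neg, g0, g1, g2, g3]
  have hp0 := expPer_ne_zero w₂ (I * w₁ / 2)
  have hX0 := expPer_ne_zero w₂ x
  have ht0 := expPer_ne_zero w₂ (I * tau γ)
  have hr0 := expPer_ne_zero w₂ (I * rho γ)
  have hs0 := expPer_ne_zero w₂ (I * sigma γ)
  have hu0 := expPer_ne_zero w₂ (I * upsilon γ)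
  generalize Delta w₁ w₂ γ x = D₀ at *
  generalize Delta w₁ w₂ γ (x + I * w₁) = D₁ at *
  generalize Delta w₁ w₂ γ (x - I * w₁) = D₂ at *
  generalize expPer w₂ x = X at *
  generalize expPer w₂ (I * w₁ / 2) = p at *
  generalize expPer w₂ (I * tau γ) = t at *
  generalize expPer w₂ (I * rho γ) = r at *
  generalize expPer w₂ (I * sigma γ) = s at *
  generalize expPer w₂ (I * upsilon γ) = u at *
  have d1 : X ^ 2 - 1 ≠ 0 := left_ne_zero_of_mul (left_ne_zero_of_mul hD)
  have d2 : X ^ 2 - p ^ 2 ≠ 0 := right_ne_zero_of_mul (left_ne_zero_of_mul hD)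
  have d3 : 1 - p ^ 2 * X ^ 2 ≠ 0 := right_ne_zero_of_mul hD
  have d1' : 1 - X ^ 2 ≠ 0 := by rw [← neg_sub]; exact neg_ne_zero.2 d1
  simp only [certForward, certBackward, certPlus, certMinus, certDenom]
  refine ⟨?_, ?_, ?_, ?_⟩
  · have e : s * (1 + (X / (s / r) + X / (s * r)) * p + X / (s / r) * (X / (s * r)) * p ^ 2) *
        ((1 + p * (s / r) * X) * (1 + p * (s * r) * X) * (1 + p * (1 / (t * u)) * X) *
          (1 + p * (t / u) * X) / ((1 - X ^ 2) * (1 - p ^ 2 * X ^ 2))) =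
        -(s / u) * (X ^ 2 - p ^ 2) * (1 + p * X * s * (r + r⁻¹) + p ^ 2 * X ^ 2 * s ^ 2) *
          (1 + p * X * (r + r⁻¹) / s + p ^ 2 * X ^ 2 / s ^ 2) /
            ((X ^ 2 - 1) * (X ^ 2 - p ^ 2) * (1 - p ^ 2 * X ^ 2)) *
          (u * (1 + (X * (1 / (t * u)) + X * (t / u)) * p + X * (1 / (t * u)) * (X * (t / u)) * p ^ 2)) := by
      rw [← neg_sub (X ^ 2) 1]
      generalize hd : X ^ 2 - 1 = d at *
      generalize hd' : X ^ 2 - p ^ 2 = d' at *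
      generalize hd'' : 1 - p ^ 2 * X ^ 2 = d'' at *
      field_simp
      ring
    refine mul_left_cancel₀ (mul_ne_zero hs0 hK) ?_
    linear_combination D₀ * e - (-(s / u) * (X ^ 2 - p ^ 2) * (1 + p * X * s * (r + r⁻¹) + p ^ 2 * X ^ 2 * s ^ 2) *
          (1 + p * X * (r + r⁻¹) / s + p ^ 2 * X ^ 2 / s ^ 2) /
            ((X ^ 2 - 1) * (X ^ 2 - p ^ 2) * (1 - p ^ 2 * X ^ 2))) * hf
  · have e : (1 + p * (s / r) * X⁻¹) * (1 + p * (s * r) * X⁻¹) * (1 + p * (1 / (t * u)) * X⁻¹) *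
          (1 + p * (t / u) * X⁻¹) / ((1 - X⁻¹ ^ 2) * (1 - p ^ 2 * X⁻¹ ^ 2)) *
        (u * (1 + (X * (1 / (t * u)) + X * (t / u)) * p⁻¹ + X * (1 / (t * u)) * (X * (t / u)) * p⁻¹ ^ 2)) =
        s * u * (1 - p ^ 2 * X ^ 2) * X ^ 2 * p ^ 2 * (1 + X * (t + t⁻¹) / (p * u) + X ^ 2 / (p ^ 2 * u ^ 2)) *
          (1 + p * (t + t⁻¹) / (X * u) + p ^ 2 / (u ^ 2 * X ^ 2)) /
            ((X ^ 2 - 1) * (X ^ 2 - p ^ 2) * (1 - p ^ 2 * X ^ 2)) *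
          (s * (1 + (X / (s / r) + X / (s * r)) * p⁻¹ + X / (s / r) * (X / (s * r)) * p⁻¹ ^ 2)) := by
      rw [show 1 - X⁻¹ ^ 2 = (X ^ 2 - 1) / X ^ 2 by field_simp,
        show 1 - p ^ 2 * X⁻¹ ^ 2 = (X ^ 2 - p ^ 2) / X ^ 2 by field_simp]
      generalize hd : X ^ 2 - 1 = d at *
      generalize hd' : X ^ 2 - p ^ 2 = d' at *
      generalize hd'' : 1 - p ^ 2 * X ^ 2 = d'' at *
      field_simp
      ring
    refine mul_left_cancel₀ (mul_ne_zero hs0 hK') ?_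
    linear_combination D₂ * e + ((1 + p * (s / r) * X⁻¹) * (1 + p * (s * r) * X⁻¹) * (1 + p * (1 / (t * u)) * X⁻¹) *
          (1 + p * (t / u) * X⁻¹) / ((1 - X⁻¹ ^ 2) * (1 - p ^ 2 * X⁻¹ ^ 2))) * hb
  · rw [← neg_sub (X ^ 2) 1]
    generalize hd : X ^ 2 - 1 = d at *
    generalize hd' : X ^ 2 - p ^ 2 = d' at *
    generalize hd'' : 1 - p ^ 2 * X ^ 2 = d'' at *
    field_simp
    ring
  · rw [show 1 - X⁻¹ ^ 2 = (X ^ 2 - 1) / X ^ 2 by field_simp,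
      show 1 - p ^ 2 * X⁻¹ ^ 2 = (X ^ 2 - p ^ 2) / X ^ 2 by field_simp]
    generalize hd : X ^ 2 - 1 = d at *
    generalize hd' : X ^ 2 - p ^ 2 = d' at *
    generalize hd'' : 1 - p ^ 2 * X ^ 2 = d'' at *
    field_simp
    ring

/-- The difference equation for the normalized integral. -/
theorem Moderate.awOp_eq (hm : Moderate w₁ w₂ (w₁, w₂, γ, x, lam)) (h : DeltaModerate w₁ w₂ γ x)
    (hD : coeffDenom w₁ w₂ x ≠ 0) (hD' : coeffDenom w₁ w₂ (-x) ≠ 0) (c : ℂ) {f : ℂ → ℂ}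
    (hf : ∀ d ∈ ({0, I * (w₁ : ℂ), -(I * w₁)} : Set ℂ), f (x + d) =
      c * (∫ t : ℝ, coeffIntegrand (w₁, w₂, γ, x + d, lam) t) / Delta w₁ w₂ γ (x + d)) :
    awOp w₁ w₂ γ f x = eigenvalue w₁ w₂ γ lam * f x := by
  have hpos := hm.pos
  have hlarge := hm.large
  have h₂ : 0 < (w₂ : ℂ).re := by rw [Complex.ofReal_re]; linarith
  have im1 : (I * (w₁ : ℂ)).im = w₁ := by rw [Complex.I_mul_im, Complex.ofReal_re]
  have hD := certDenom_ne_zero (ne_zero_of_re_pos h₂) hD hD'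
  have hint := hm.contiguousForm_integral hD
  obtain ⟨a1, a2, a3, a4⟩ := coeffA_mul_Delta h hpos hlarge hD
  have n0 := h.ne_zero hpos hlarge (d := 0) (by simpa using hpos.le)
  have n1 := h.ne_zero hpos hlarge (d := I * w₁) (by rw [im1, abs_of_pos hpos])
  have n2 := h.ne_zero hpos hlarge (d := -(I * w₁)) (by rw [Complex.neg_im, im1, abs_neg, abs_of_pos hpos])
  have f0 := hf 0 (by simp)
  have f1 := hf (I * w₁) (by simp)
  have f2 := hf (-(I * w₁)) (by simp)
  rw [add_zero] at f0 n0
  rw [← sub_eq_add_neg] at f2 n2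
  rw [contiguousForm, ← a3, ← a4, ← eigenvalue_eq] at hint
  rw [awOp, f0, f1, f2]
  generalize certForward _ _ _ _ _ = α at *
  generalize certBackward _ _ _ _ _ = β at *
  generalize coeffA w₁ w₂ γ x = A at *
  generalize coeffA w₁ w₂ γ (-x) = A' at *
  generalize eigenvalue w₁ w₂ γ lam = v at *
  generalize (∫ t : ℝ, coeffIntegrand (w₁, w₂, γ, x, lam) t) = I₀ at *
  generalize (∫ t : ℝ, coeffIntegrand (w₁, w₂, γ, x + I * w₁, lam) t) = I₁ at *
  generalize (∫ t : ℝ, coeffIntegrand (w₁, w₂, γ, x - I * w₁, lam) t) = I₂ at *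
  generalize Delta w₁ w₂ γ x = D₀ at *
  generalize Delta w₁ w₂ γ (x + I * w₁) = D₁ at *
  generalize Delta w₁ w₂ γ (x - I * w₁) = D₂ at *
  have b1 : A * (c * I₁ / D₁) = c * α * I₁ / D₀ := by
    rw [mul_div_assoc', div_eq_div_iff n1 n0]
    linear_combination c * I₁ * a1
  have b2 : A' * (c * I₂ / D₂) = c * β * I₂ / D₀ := by
    rw [mul_div_assoc', div_eq_div_iff n2 n0]
    linear_combination c * I₂ * a2
  rw [mul_sub, mul_sub, b1, b2]
  field_simp
  linear_combination c * hint

end DifferenceEquation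

end AskeyWilson

namespace AskeyWilson

open MeasureTheory Filter Topology Metric
open Complex (I)

/-! ### Symmetries of the integral and the four equations for real periods. -/

section RealPeriods

variable {w₁ w₂ : ℝ} {γ : Fin 4 → ℂ} {x lam : ℂ}

theorem wMean_comm (w₁ w₂ : ℂ) : wMean w₁ w₂ = wMean w₂ w₁ := by rw [wMean, add_comm, wMean]

/-- Only the integral is visibly symmetric; the continuation used in `hypG` treats the two periods
differently. Symmetry in the strip is enough, because the equations are verified where all arguments
lie there. -/
theorem hypG_comm {w₁ w₂ z : ℂ} (h₁ : 0 < w₁.re) (h₂ : 0 < w₂.re) (h : |z.im| < (w₁.re + w₂.re) / 2) :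
    hypG w₁ w₂ z = hypG w₂ w₁ z := by
  rw [hypG_eq_gammaStrip h₁ h₂ h, hypG_eq_gammaStrip h₂ h₁ (by rwa [add_comm]), gammaStrip_comm]

theorem Moderate.pos₂ {p : Param} (h : Moderate w₁ w₂ p) : 0 < w₂ := by linarith [h.pos, h.large]

theorem abs_im_vec_le {d : ℂ} {r : ℝ} (hd : |d.im| ≤ r) (j : Fin 4) :
    |((![d, d, 0, 0] : Fin 4 → ℂ) j).im| ≤ r := by
  have := (abs_nonneg _).trans hd
  fin_cases j <;> simp [hd, this]

theorem Moderate.coeffIntegrand_comm (h : Moderate w₁ w₂ (w₁, w₂, γ, x, lam)) {d : ℂ} (hd : |d.im| ≤ w₁)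
    {z : ℂ} (hz : |z.im| ≤ w₁) :
    coeffIntegrand (w₂, w₁, γ, x + d, lam) z = coeffIntegrand (w₁, w₂, γ, x + d, lam) z := by
  have h₁ : 0 < (w₁ : ℂ).re := h.pos
  have h₂ : 0 < (w₂ : ℂ).re := h.pos₂
  have hup : ∀ j, upArg j (w₂, w₁, γ, x, lam) = upArg j (w₁, w₂, γ, x, lam) := fun j => by
    simp only [upArg, wMean_comm (w₂ : ℂ) w₁]
  have hlo : ∀ j, loArg j (w₂, w₁, γ, x, lam) = loArg j (w₁, w₂, γ, x, lam) := fun j => by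
    simp only [loArg, wMean_comm (w₂ : ℂ) w₁]
  obtain ⟨h1, h2⟩ := h.shift (abs_im_vec_le hd) (e := fun j => -![d, d, 0, 0] j)
    (fun j => by rw [Complex.neg_im, abs_neg]; exact abs_im_vec_le hd j)
  have key : ∀ y y' : ℂ, |y'.im| + w₁ < ((w₁ : ℂ).re + (w₂ : ℂ).re) / 2 → |y.im| ≤ w₁ →
      hypG w₂ w₁ (y + y') = hypG w₁ w₂ (y + y') := fun y y' h3 h4 =>
    (hypG_comm h₁ h₂ (by
      rw [Complex.add_im]
      have := abs_add_le y.im y'.im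
      linarith)).symm
  have hz' : |(-z).im| ≤ w₁ := by rwa [Complex.neg_im, abs_neg]
  have e1 := fun j => key z _ (h1 j) hz
  have e2 := fun j => key (-z) _ (h2 j) hz'
  simp only [coeffIntegrand_add, gammaProd, hup, hlo, sub_eq_add_neg, e1, e2]

theorem DeltaModerate.comm (h : DeltaModerate w₁ w₂ γ x) (hpos : 0 < w₁) (hlarge : 16 * w₁ ≤ w₂) {d : ℂ}
    (hd : |d.im| ≤ w₁) : Delta w₂ w₁ γ (x + d) = Delta w₁ w₂ γ (x + d) := by
  have h₁ : 0 < (w₁ : ℂ).re := hpos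
  have h₂ : 0 < (w₂ : ℂ).re := by rw [Complex.ofReal_re]; linarith
  have key : ∀ y : ℂ, |y.im| ≤ w₁ → hypG w₂ w₁ (y + d) = hypG w₁ w₂ (y + d) := fun y hy =>
    (hypG_comm h₁ h₂ (by
      rw [Complex.add_im, Complex.ofReal_re, Complex.ofReal_re]
      have := abs_add_le y.im d.im
      linarith)).symm
  rw [Delta_add, Delta_add, key _ h.zero, key _ h.one, key _ h.two, key _ h.three]

/-- Cauchy's theorem for the imaginary part of `s`, translation invariance of Lebesgue measure for
the real part. -/
theorem Moderate.integral_add (h : Moderate w₁ w₂ (w₁, w₂, γ, x, lam)) {d s : ℂ} (hd : |d.im| ≤ w₁)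
    (hs : |s.im| ≤ w₁) :
    ∫ t : ℝ, coeffIntegrand (w₁, w₂, γ, x + d, lam) (t + s) =
      ∫ t : ℝ, coeffIntegrand (w₁, w₂, γ, x + d, lam) t := by
  have hpos := h.pos
  have hw₂ := h.pos₂
  have hd2 : ∀ j, |(-(![d, d, 0, 0] : Fin 4 → ℂ) j).im| ≤ w₁ := fun j => by
    rw [Complex.neg_im, abs_neg]; exact abs_im_vec_le hd j
  obtain ⟨C, -, hC⟩ := h.exists_le (abs_im_vec_le hd) hd2 (by simp)
  obtain ⟨h1, h2⟩ := h.shift (abs_im_vec_le hd) hd2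
  simp only [coeffIntegrand_add, sub_eq_add_neg]
  have hz : ∀ z : ℂ, z.im ∈ Set.uIcc 0 s.im → |z.im| ≤ w₁ := fun z hz => by
    have := Set.abs_sub_left_of_mem_uIcc hz
    simp only [sub_zero] at this
    exact this.trans hs
  have hshift := integral_line_eq (a := 0) (b := s.im) (c := 2 * Real.pi / w₂ + Real.pi / w₁)
    (F := gammaProd w₁ w₂ (fun j => upArg j (w₁, w₂, γ, x, lam) + ![d, d, 0, 0] j)
      fun j => loArg j (w₁, w₂, γ, x, lam) + -![d, d, 0, 0] j) (by positivity)
    (fun z h3 => differentiableAt_gammaProd (T := w₁) hpos hw₂ h1 h2 (hz z h3)) fun z h3 => hC z (hz z h3)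
  simp only [Complex.ofReal_zero, zero_mul, add_zero] at hshift
  rw [hshift]
  refine Eq.trans ?_ (integral_add_right_eq_self (fun t : ℝ =>
    gammaProd w₁ w₂ (fun j => upArg j (w₁, w₂, γ, x, lam) + ![d, d, 0, 0] j)
      (fun j => loArg j (w₁, w₂, γ, x, lam) + -![d, d, 0, 0] j) (t + s.im * I)) s.re)
  refine integral_congr_ae (Eventually.of_forall fun t => ?_)
  have e : ((t + s.re : ℝ) : ℂ) + s.im * I = t + s := by
    rw [Complex.ofReal_add, add_assoc, Complex.re_add_im]
  simp only [e]

theorem dual_params (γ : Fin 4 → ℂ) : rho (dual γ) = upsilon γ ∧ sigma (dual γ) = sigma γ ∧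
    tau (dual γ) = tau γ ∧ upsilon (dual γ) = rho γ := by
  refine ⟨?_, ?_, ?_, ?_⟩ <;> simp only [rho, sigma, tau, upsilon, dual, Matrix.cons_val] <;> ring

/-- Passing to the dual parameters exchanges `ρ` with `υ` and fixes `σ` and `τ`. With `x` and `λ`
also exchanged, the translation by `(x - λ)/2` merely permutes the gamma factors. -/
theorem coeffIntegrand_dual (w₁ w₂ : ℂ) (γ : Fin 4 → ℂ) (x lam z : ℂ) :
    coeffIntegrand (w₁, w₂, γ, x, lam) z =
      coeffIntegrand (w₁, w₂, dual γ, lam, x) (z + (x - lam) / 2) := by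
  obtain ⟨h1, h2, h3, h4⟩ := dual_params γ
  simp only [coeffIntegrand, gammaProd, Fin.prod_univ_four, upArg, loArg, Matrix.cons_val, h1, h2, h3, h4]
  ring_nf

theorem abs_im_diff_le {d : ℂ} (hd : |d.im| ≤ w₁) (hs : |((x - lam) / 2).im| ≤ w₁ / 2) :
    |((x - (lam + d)) / 2).im| ≤ w₁ := by
  rw [show (x - (lam + d)) / 2 = (x - lam) / 2 + -(d / 2) by ring, Complex.add_im, Complex.neg_im,
    Complex.div_ofNat_im d]
  have := abs_add_le ((x - lam) / 2).im (-(d.im / 2))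
  rw [abs_neg, abs_div, abs_two] at this
  linarith

theorem Moderate.integral_dual (h : Moderate w₁ w₂ (w₁, w₂, dual γ, lam, x)) {d : ℂ} (hd : |d.im| ≤ w₁)
    (hs : |((x - lam) / 2).im| ≤ w₁ / 2) :
    ∫ t : ℝ, coeffIntegrand (w₁, w₂, γ, x, lam + d) t =
      ∫ t : ℝ, coeffIntegrand (w₁, w₂, dual γ, lam + d, x) t := by
  rw [← h.integral_add hd (s := (x - (lam + d)) / 2)]
  · simp only [← coeffIntegrand_dual]
  · exact abs_im_diff_le hd hs

/-- Conditions on the parameters that hold near a base point and imply all four difference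
equations. -/
structure NearBase (w₁ w₂ : ℝ) (γ : Fin 4 → ℂ) (x lam : ℂ) : Prop where
  moderate : Moderate w₁ w₂ (w₁, w₂, γ, x, lam)
  moderate_dual : Moderate w₁ w₂ (w₁, w₂, dual γ, lam, x)
  delta : DeltaModerate w₁ w₂ γ x
  delta_dual : DeltaModerate w₁ w₂ (dual γ) lam
  strip : |x.im| + w₁ < zeta w₁ w₂ γ lam
  diff : |((x - lam) / 2).im| ≤ w₁ / 2
  denom : coeffDenom w₁ w₂ x ≠ 0
  denom_neg : coeffDenom w₁ w₂ (-x) ≠ 0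
  denom_dual : coeffDenom w₁ w₂ lam ≠ 0
  denom_dual_neg : coeffDenom w₁ w₂ (-lam) ≠ 0

theorem abs_im_of_mem {w₁ : ℝ} (hpos : 0 < w₁) {d : ℂ} (hd : d ∈ ({0, I * (w₁ : ℂ), -(I * w₁)} : Set ℂ)) :
    |d.im| ≤ w₁ := by
  rcases hd with rfl | rfl | rfl
  · simpa using hpos.le
  · simp [abs_of_pos hpos]
  · simp [abs_of_pos hpos]

variable {ψ : ℂ → ℂ → (Fin 4 → ℂ) → ℂ → ℂ → ℂ}

/-- The reserve `w₁` in `NearBase.strip` keeps the translates of `x` or `λ` by `±iw₁` in the region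
`|Im x| < ζ`, where the value of `ψ` is prescribed. -/
theorem NearBase.psi_eq (h : NearBase w₁ w₂ γ x lam) (hψ : IsContinuation ψ) {d e : ℂ}
    (hd : |d.im| + |e.im| ≤ w₁) :
    ψ w₁ w₂ γ (x + d) (lam + e) = ∫ t : ℝ, coeffIntegrand (w₁, w₂, γ, x + d, lam + e) t := by
  have hx : |(x + d).im| < zeta w₁ w₂ γ (lam + e) := by
    have h1 := h.strip
    rw [zeta] at h1 ⊢
    rw [show (lam + e) / 2 = lam / 2 + e / 2 by ring, Complex.add_im, Complex.add_im, Complex.div_ofNat_im e]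
    have h2 := abs_add_le x.im d.im
    have h3 := abs_add_le (lam / 2).im (e.im / 2)
    rw [abs_div, abs_two] at h3
    have := abs_nonneg e.im
    linarith
  have hpos := h.moderate.pos
  have hpos₂ := h.moderate.pos₂
  rw [hψ.2 w₁ w₂ γ _ _ hpos hpos₂ hx, matrixCoeff_eq hpos hpos₂ hx]

theorem NearBase.psi_swap_eq (h : NearBase w₁ w₂ γ x lam) (hψ : IsContinuation ψ) {d e : ℂ}
    (hd : |d.im| + |e.im| ≤ w₁) :
    ψ w₂ w₁ γ (x + d) (lam + e) = ∫ t : ℝ, coeffIntegrand (w₂, w₁, γ, x + d, lam + e) t := by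
  have hx : |(x + d).im| < zeta w₂ w₁ γ (lam + e) := by
    have h1 := h.strip
    rw [zeta] at h1 ⊢
    rw [show (lam + e) / 2 = lam / 2 + e / 2 by ring, Complex.add_im, Complex.add_im, Complex.div_ofNat_im e]
    have h2 := abs_add_le x.im d.im
    have h3 := abs_add_le (lam / 2).im (e.im / 2)
    rw [abs_div, abs_two] at h3
    have := abs_nonneg e.im
    linarith
  have hpos := h.moderate.pos
  have hpos₂ := h.moderate.pos₂
  rw [hψ.2 w₂ w₁ γ _ _ hpos₂ hpos hx, matrixCoeff_eq hpos₂ hpos hx]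

theorem NearBase.awOp_S (h : NearBase w₁ w₂ γ x lam) (hψ : IsContinuation ψ) :
    awOp w₁ w₂ γ (fun y => S ψ w₁ w₂ γ y lam) x = eigenvalue w₁ w₂ γ lam * S ψ w₁ w₂ γ x lam :=
  h.moderate.awOp_eq h.delta h.denom h.denom_neg
    (normConst w₁ w₂ γ / (((w₁ : ℂ) * w₂) ^ (1 / 2 : ℂ) * Delta w₁ w₂ (dual γ) lam)) (f := fun y => S ψ w₁ w₂ γ y lam)
    fun d hd => by
      have := h.psi_eq hψ (d := d) (e := 0) (by simpa using abs_im_of_mem h.moderate.pos hd)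
      rw [add_zero] at this
      simp only [S, this]
      ring

/-- The operator steps in the short period, while `S` is taken with the periods in the opposite
order. The integral and `Δ(γ; x)` are symmetric in the periods; the other factors of `S` do not
depend on `x` and go into the constant. -/
theorem NearBase.awOp_S_swap (h : NearBase w₁ w₂ γ x lam) (hψ : IsContinuation ψ) :
    awOp w₁ w₂ γ (fun y => S ψ w₂ w₁ γ y lam) x = eigenvalue w₁ w₂ γ lam * S ψ w₂ w₁ γ x lam :=
  h.moderate.awOp_eq h.delta h.denom h.denom_neg
    (normConst w₂ w₁ γ / (((w₂ : ℂ) * w₁) ^ (1 / 2 : ℂ) * Delta w₂ w₁ (dual γ) lam)) (f := fun y => S ψ w₂ w₁ γ y lam)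
    fun d hd => by
      have hd' := abs_im_of_mem h.moderate.pos hd
      have := h.psi_swap_eq hψ (d := d) (e := 0) (by simpa using hd')
      rw [add_zero] at this
      have hi : (∫ t : ℝ, coeffIntegrand (w₂, w₁, γ, x + d, lam) t) =
          ∫ t : ℝ, coeffIntegrand (w₁, w₂, γ, x + d, lam) t :=
        integral_congr_ae (Eventually.of_forall fun t => h.moderate.coeffIntegrand_comm hd'
          (by simpa using h.moderate.pos.le))
      simp only [S, this, h.delta.comm h.moderate.pos h.moderate.large hd', hi]
      ring

/-- The equation in `λ` is the equation in the first variable for the dual parameters with `x` and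
`λ` exchanged; the two integrals agree, and `Δ(γ; x)` is now a constant. -/
theorem NearBase.awOp_S_dual (h : NearBase w₁ w₂ γ x lam) (hψ : IsContinuation ψ) :
    awOp w₁ w₂ (dual γ) (fun y => S ψ w₁ w₂ γ x y) lam = eigenvalue w₁ w₂ (dual γ) x * S ψ w₁ w₂ γ x lam :=
  h.moderate_dual.awOp_eq h.delta_dual h.denom_dual h.denom_dual_neg
    (normConst w₁ w₂ γ / (((w₁ : ℂ) * w₂) ^ (1 / 2 : ℂ) * Delta w₁ w₂ γ x)) (f := fun y => S ψ w₁ w₂ γ x y)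
    fun d hd => by
      have hd' := abs_im_of_mem h.moderate.pos hd
      have := h.psi_eq hψ (d := 0) (e := d) (by simpa using hd')
      rw [add_zero] at this
      simp only [S, this, h.moderate_dual.integral_dual hd' h.diff]
      ring

theorem NearBase.awOp_S_dual_swap (h : NearBase w₁ w₂ γ x lam) (hψ : IsContinuation ψ) :
    awOp w₁ w₂ (dual γ) (fun y => S ψ w₂ w₁ γ x y) lam = eigenvalue w₁ w₂ (dual γ) x * S ψ w₂ w₁ γ x lam :=
  h.moderate_dual.awOp_eq h.delta_dual h.denom_dual h.denom_dual_neg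
    (normConst w₂ w₁ γ / (((w₂ : ℂ) * w₁) ^ (1 / 2 : ℂ) * Delta w₂ w₁ γ x)) (f := fun y => S ψ w₂ w₁ γ x y)
    fun d hd => by
      have hd' := abs_im_of_mem h.moderate.pos hd
      have := h.psi_swap_eq hψ (d := 0) (e := d) (by simpa using hd')
      rw [add_zero] at this
      have hs := abs_im_diff_le hd' h.diff
      have hi : (∫ t : ℝ, coeffIntegrand (w₂, w₁, γ, x, lam + d) t) =
          ∫ t : ℝ, coeffIntegrand (w₁, w₂, dual γ, lam + d, x) t := by
        rw [← h.moderate_dual.integral_add hd' (s := (x - (lam + d)) / 2)]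
        · refine integral_congr_ae (Eventually.of_forall fun t => ?_)
          simp only
          rw [coeffIntegrand_dual, h.moderate_dual.coeffIntegrand_comm hd']
          rwa [Complex.add_im, Complex.ofReal_im, zero_add]
        · exact hs
      simp only [S, this, h.delta_dual.comm h.moderate.pos h.moderate.large hd', hi]
      ring

end RealPeriods

end AskeyWilson

namespace AskeyWilson

open MeasureTheory Filter Topology Metric
open Complex (I)

/-! ### A base point near which all conditions hold. -/

section BasePoint

/-- `|e(iw₁/2)| = 1` for real periods, whereas `|e(y)| ≠ 1` for real `y ≠ 0`. -/
theorem coeffDenom_ne_zero_of_real {w₁ w₂ y : ℝ} (h₂ : w₂ ≠ 0) (hy : y ≠ 0) : coeffDenom w₁ w₂ y ≠ 0 := by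
  have hp : ‖expPer w₂ (I * w₁ / 2)‖ = 1 := by
    rw [norm_expPer, Complex.div_ofNat_re, Complex.I_mul_re, Complex.ofReal_im]
    simp
  have hX : ‖expPer w₂ y‖ ≠ 1 := by
    rw [norm_expPer, Complex.ofReal_re, Ne, Real.exp_eq_one_iff]
    have := Real.pi_ne_zero
    positivity
  have hX2 : ‖expPer w₂ y‖ ^ 2 ≠ 1 := fun h => hX ((pow_eq_one_iff_of_nonneg (norm_nonneg _) two_ne_zero).1 h)
  rw [coeffDenom_eq (by exact_mod_cast h₂)]
  refine mul_ne_zero (sub_ne_zero.2 fun h => hX2 ?_) (sub_ne_zero.2 fun h => hX2 ?_)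
  · rw [← norm_pow, ← h, norm_one]
  · have := congrArg norm h
    rw [norm_mul, norm_pow, norm_pow, hp, norm_one, one_pow, one_mul] at this
    exact this.symm

theorem differentiable_dual (j : Fin 4) : Differentiable ℂ fun p : Param => dual p.2.2.1 j := by
  unfold dual
  fin_cases j <;> simp <;> fun_prop

theorem continuous_dual : Continuous fun p : Param => dual p.2.2.1 :=
  continuous_pi fun j => (differentiable_dual j).continuous

/-- A point with real periods at which the difference equations can be verified on integrals. -/
def basePoint (a b : ℝ) : Param := ((a : ℂ), (b : ℂ), 0, 1, 1)

/-- At `γ = 0` and real `x`, `λ` every shift has imaginary part exactly `-(w₁ + w₂)/4`, and all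
conditions are strict, hence open. The values `x = λ = 1` avoid the zeros of the coefficient
denominators. Real parts of the periods are taken so that the statement makes sense on a full
complex neighbourhood. -/
theorem eventually_nearBase : ∀ᶠ q : Param in 𝓝 (basePoint 1 20),
    NearBase q.1.re q.2.1.re q.2.2.1 q.2.2.2.1 q.2.2.2.2 := by
  have hlt : ∀ f g : Param → ℝ, Continuous f → Continuous g → f (basePoint 1 20) < g (basePoint 1 20) →
      ∀ᶠ q in 𝓝 (basePoint 1 20), f q < g q := fun f g hf hg h => (isOpen_lt hf hg).mem_nhds h
  let R : Param → Param := fun q => ((q.1.re : ℂ), (q.2.1.re : ℂ), q.2.2.1, q.2.2.2.1, q.2.2.2.2)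
  let R' : Param → Param := fun q => ((q.1.re : ℂ), (q.2.1.re : ℂ), dual q.2.2.1, q.2.2.2.2, q.2.2.2.1)
  have hR : Continuous R := by fun_prop
  have hdual := continuous_dual
  have hR' : Continuous R' := by fun_prop
  have d0 : dual 0 = 0 := by funext j; fin_cases j <;> simp [dual]
  have hw : (I * wMean 1 20 / 2).im = 21 / 4 := by
    rw [wMean, mul_div_assoc, Complex.I_mul_im]; norm_num
  have hw' : (wMean 1 20).re = 21 / 2 := by rw [wMean]; norm_num
  have hmod : ∀ r : Param → Param, Continuous r → r (basePoint 1 20) = basePoint 1 20 →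
      ∀ᶠ q in 𝓝 (basePoint 1 20), ∀ j, |(upArg j (r q)).im + (q.1.re + q.2.1.re) / 4| < q.1.re / 2 ∧
        |(loArg j (r q)).im + (q.1.re + q.2.1.re) / 4| < q.1.re / 2 := by
    intro r hr h0
    rw [eventually_all]
    intro j
    have h1 := (differentiable_upArg j).continuous.comp hr
    have h2 := (differentiable_loArg j).continuous.comp hr
    refine (hlt _ _ ((Complex.continuous_im.comp h1).add (by fun_prop)).abs (by fun_prop) ?_).and
      (hlt _ _ ((Complex.continuous_im.comp h2).add (by fun_prop)).abs (by fun_prop) ?_)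
    · change |(upArg j (r (basePoint 1 20))).im + ((1 : ℂ).re + (20 : ℝ)) / 4| < (1 : ℝ) / 2
      rw [h0]
      fin_cases j <;> simp [basePoint, upArg, tau, sigma, hw', abs_lt] <;> norm_num
    · change |(loArg j (r (basePoint 1 20))).im + ((1 : ℂ).re + (20 : ℝ)) / 4| < (1 : ℝ) / 2
      rw [h0]
      fin_cases j <;> simp [basePoint, loArg, rho, upsilon, hw', abs_lt] <;> norm_num
  have hden : ∀ y : Param → ℂ, Continuous y → ∀ y₀ : ℝ, y₀ ≠ 0 → y (basePoint 1 20) = y₀ →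
      ∀ᶠ q in 𝓝 (basePoint 1 20), coeffDenom q.1.re q.2.1.re (y q) ≠ 0 := by
    intro y hy y₀ hy₀ h0
    have hc : ContinuousAt (fun q : Param => coeffDenom q.1.re q.2.1.re (y q)) (basePoint 1 20) := by
      have hne : (((basePoint 1 20).2.1.re : ℝ) : ℂ) ≠ 0 := by simp [basePoint]
      unfold coeffDenom wMean
      fun_prop (disch := assumption)
    refine hc.eventually_ne ?_
    simp only [h0]
    exact coeffDenom_ne_zero_of_real (by simp [basePoint]) hy₀
  have hm := hmod R hR (by simp [R, basePoint])
  have hm' := hmod R' hR' (by simp [R', basePoint, d0])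
  have hpos := hlt (fun _ => 0) (fun q => q.1.re) (by fun_prop) (by fun_prop) (by simp [basePoint])
  have hlarge := hlt (fun q => 16 * q.1.re) (fun q => q.2.1.re) (by fun_prop) (by fun_prop)
    (by simp [basePoint]; norm_num)
  have hdel : ∀ y : Param → ℂ, Continuous y → (y (basePoint 1 20)).im = 0 →
      ∀ᶠ q in 𝓝 (basePoint 1 20), |(y q).im| < q.1.re := fun y hy h0 =>
    hlt _ _ (by fun_prop) (by fun_prop) (by rw [h0]; simp [basePoint])
  have hγ : ∀ j, Continuous fun q : Param => dual q.2.2.1 j := fun j => (differentiable_dual j).continuous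
  have b0 := hdel (fun q => q.2.2.2.1 - I * q.2.2.1 0) (by fun_prop) (by simp [basePoint])
  have b1 := hdel (fun q => q.2.2.2.1 - I * q.2.2.1 1) (by fun_prop) (by simp [basePoint])
  have b2 := hdel (fun q => q.2.2.2.1 + I * q.2.2.1 2) (by fun_prop) (by simp [basePoint])
  have b3 := hdel (fun q => q.2.2.2.1 + I * q.2.2.1 3) (by fun_prop) (by simp [basePoint])
  have c0 := hdel (fun q => q.2.2.2.2 - I * dual q.2.2.1 0) (by fun_prop) (by simp [basePoint, d0])
  have c1 := hdel (fun q => q.2.2.2.2 - I * dual q.2.2.1 1) (by fun_prop) (by simp [basePoint, d0])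
  have c2 := hdel (fun q => q.2.2.2.2 + I * dual q.2.2.1 2) (by fun_prop) (by simp [basePoint, d0])
  have c3 := hdel (fun q => q.2.2.2.2 + I * dual q.2.2.1 3) (by fun_prop) (by simp [basePoint, d0])
  have hstrip := hlt (fun q => |q.2.2.2.1.im| + q.1.re) (fun q => zeta q.1.re q.2.1.re q.2.2.1 q.2.2.2.2)
    (by fun_prop) (by unfold zeta xi rho sigma tau upsilon; fun_prop)
    (by simp [basePoint, zeta, xi, rho, sigma, tau, upsilon]; norm_num)
  have hdiff := hlt (fun q => |((q.2.2.2.1 - q.2.2.2.2) / 2).im|) (fun q => q.1.re / 2) (by fun_prop) (by fun_prop)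
    (by simp [basePoint])
  filter_upwards [hm, hm', hpos, hlarge, b0, b1, b2, b3, c0, c1, c2, c3, hstrip, hdiff,
    hden (fun q => q.2.2.2.1) (by fun_prop) 1 (by simp) (by simp [basePoint]),
    hden (fun q => -q.2.2.2.1) (by fun_prop) (-1) (by simp) (by simp [basePoint]),
    hden (fun q => q.2.2.2.2) (by fun_prop) 1 (by simp) (by simp [basePoint]),
    hden (fun q => -q.2.2.2.2) (by fun_prop) (-1) (by simp) (by simp [basePoint])]
    with q q1 q2 q3 q4 q5 q6 q7 q8 q9 q10 q11 q12 q13 q14 q15 q16 q17 q18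
  exact ⟨⟨q3, q4.le, fun j => (q1 j).1.le, fun j => (q1 j).2.le⟩,
    ⟨q3, q4.le, fun j => (q2 j).1.le, fun j => (q2 j).2.le⟩,
    ⟨q5.le, q6.le, q7.le, q8.le⟩, ⟨q9.le, q10.le, q11.le, q12.le⟩, q13, q14.le, q15, q16, q17, q18⟩

theorem eventually_nearBase_swap : ∀ᶠ q : Param in 𝓝 (basePoint 20 1),
    NearBase q.2.1.re q.1.re q.2.2.1 q.2.2.2.1 q.2.2.2.2 := by
  have h : Continuous fun q : Param => ((q.2.1, q.1, q.2.2) : Param) := by fun_prop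
  exact (h.tendsto (basePoint 20 1)).eventually eventually_nearBase

end BasePoint

end AskeyWilson

namespace AskeyWilson

open MeasureTheory Filter Topology Metric
open Complex (I)

/-! ### The identity theorem on the whole parameter domain. -/

section Identity

theorem isOpen_domain : IsOpen domain := by
  have h1 : Continuous fun p : Param => p.1.re := by fun_prop
  have h2 : Continuous fun p : Param => p.2.1.re := by fun_prop
  exact (isOpen_lt continuous_const h1).inter (isOpen_lt continuous_const h2)

theorem isPreconnected_domain : IsPreconnected domain := by
  have h1 : IsLinearMap ℝ fun p : Param => p.1.re := ⟨fun _ _ => rfl, fun c p => by simp⟩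
  have h2 : IsLinearMap ℝ fun p : Param => p.2.1.re := ⟨fun _ _ => rfl, fun c p => by simp⟩
  exact ((convex_halfSpace_gt h1 0).inter (convex_halfSpace_gt h2 0)).isPreconnected

theorem analyticAt_of_differentiable {E : Type} [NormedAddCommGroup E] [NormedSpace ℂ E] [FiniteDimensional ℂ E]
    {F : Type} [NormedAddCommGroup F] [NormedSpace ℂ F] [CompleteSpace F] {f : E → F}
    (hf : Differentiable ℂ f) (p : E) : AnalyticAt ℂ f p :=
  analyticAt_of_differentiableOn isOpen_univ hf.differentiableOn (Set.mem_univ p)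

variable {u₁ u₂ y l : Param → ℂ} {g : Param → Fin 4 → ℂ} {p : Param}

theorem analyticAt_coeffDenom (h₁ : AnalyticAt ℂ u₁ p) (h₂ : AnalyticAt ℂ u₂ p) (hy : AnalyticAt ℂ y p)
    (hne : u₂ p ≠ 0) : AnalyticAt ℂ (fun q => coeffDenom (u₁ q) (u₂ q) (y q)) p := by
  unfold coeffDenom wMean
  fun_prop (disch := assumption)

theorem analyticAt_coeffA_num (h₁ : AnalyticAt ℂ u₁ p) (h₂ : AnalyticAt ℂ u₂ p) (hy : AnalyticAt ℂ y p)
    (hg : ∀ j, AnalyticAt ℂ (fun q => g q j) p) (hne : u₂ p ≠ 0) :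
    AnalyticAt ℂ (fun q => ∏ j : Fin 4,
      (1 - Complex.exp (2 * Real.pi * (I * wMean (u₁ q) (u₂ q) + I * g q j + y q) / u₂ q))) p := by
  refine Finset.analyticAt_fun_prod _ fun j _ => ?_
  have := hg j
  unfold wMean
  fun_prop (disch := assumption)

theorem meromAt_coeffA (h₁ : AnalyticAt ℂ u₁ p) (h₂ : AnalyticAt ℂ u₂ p) (hy : AnalyticAt ℂ y p)
    (hg : ∀ j, AnalyticAt ℂ (fun q => g q j) p) (hne : u₂ p ≠ 0) :
    MeromAt (fun q => coeffA (u₁ q) (u₂ q) (g q) (y q)) p :=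
  (AnalyticAt.meromAt (analyticAt_coeffA_num h₁ h₂ hy hg hne)).div
    (AnalyticAt.meromAt (analyticAt_coeffDenom h₁ h₂ hy hne))

theorem continuousAt_coeffA (h₁ : AnalyticAt ℂ u₁ p) (h₂ : AnalyticAt ℂ u₂ p) (hy : AnalyticAt ℂ y p)
    (hg : ∀ j, AnalyticAt ℂ (fun q => g q j) p) (hne : u₂ p ≠ 0) (hd : coeffDenom (u₁ p) (u₂ p) (y p) ≠ 0) :
    ContinuousAt (fun q => coeffA (u₁ q) (u₂ q) (g q) (y q)) p :=
  (analyticAt_coeffA_num h₁ h₂ hy hg hne).continuousAt.div (analyticAt_coeffDenom h₁ h₂ hy hne).continuousAt hd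

theorem analyticAt_eigenvalue (h₁ : AnalyticAt ℂ u₁ p) (h₂ : AnalyticAt ℂ u₂ p) (hl : AnalyticAt ℂ l p)
    (hg : ∀ j, AnalyticAt ℂ (fun q => g q j) p) (hne : u₂ p ≠ 0) :
    AnalyticAt ℂ (fun q => eigenvalue (u₁ q) (u₂ q) (g q) (l q)) p := by
  have g0 := hg 0
  have g1 := hg 1
  have g2 := hg 2
  have g3 := hg 3
  have hd : AnalyticAt ℂ (fun q => dual (g q) 0) p := by
    change AnalyticAt ℂ (fun q => (g q 0 + g q 1 + g q 2 + g q 3) / 2) p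
    fun_prop (disch := norm_num)
  have he : AnalyticAt ℂ (fun q => Real.pi * I * u₁ q / u₂ q + 2 * Real.pi * I * dual (g q) 0 / u₂ q) p := by
    have : ∀ d : Param → ℂ, AnalyticAt ℂ d p →
        AnalyticAt ℂ (fun q => Real.pi * I * u₁ q / u₂ q + 2 * Real.pi * I * d q / u₂ q) p := fun d hd => by
      fun_prop (disch := assumption)
    exact this _ hd
  refine (analyticAt_const.mul he.cexp).mul (AnalyticAt.add ?_ (analyticAt_cosh_comp he))
  exact analyticAt_cosh_comp (by fun_prop (disch := assumption))

/-- A second order difference equation between meromorphic functions holds on all of the domain once it holds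
for real periods near one point. -/
theorem eigen_identity {F : Param → ℂ} (hF : ∀ p ∈ domain, MeromAt F p)
    (h₁ : Differentiable ℂ u₁) (h₂ : Differentiable ℂ u₂) (hy : Differentiable ℂ y) (hl : Differentiable ℂ l)
    (hg : ∀ j, Differentiable ℂ fun q => g q j) (hne : ∀ p ∈ domain, u₂ p ≠ 0)
    (φ : Param ≃ₜ Param) (hφ : Differentiable ℂ φ) (hφ' : Differentiable ℂ φ.symm)
    (hd : ∀ p ∈ domain, φ p ∈ domain) (hd' : ∀ p ∈ domain, φ.symm p ∈ domain)
    {a b : ℝ} (ha : 0 < a) (hb : 0 < b)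
    (h : ∀ᶠ q in 𝓝 (basePoint a b), q.1.im = 0 → q.2.1.im = 0 →
      coeffA (u₁ q) (u₂ q) (g q) (y q) * (F (φ q) - F q) +
        coeffA (u₁ q) (u₂ q) (g q) (-y q) * (F (φ.symm q) - F q) = eigenvalue (u₁ q) (u₂ q) (g q) (l q) * F q)
    (hp : p ∈ domain) (hc : coeffDenom (u₁ p) (u₂ p) (y p) ≠ 0) (hc' : coeffDenom (u₁ p) (u₂ p) (-y p) ≠ 0)
    (hF₀ : ContinuousAt F p) (hF₁ : ContinuousAt F (φ p)) (hF₂ : ContinuousAt F (φ.symm p)) :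
    coeffA (u₁ p) (u₂ p) (g p) (y p) * (F (φ p) - F p) +
      coeffA (u₁ p) (u₂ p) (g p) (-y p) * (F (φ.symm p) - F p) = eigenvalue (u₁ p) (u₂ p) (g p) (l p) * F p := by
  have a₁ := analyticAt_of_differentiable h₁
  have a₂ := analyticAt_of_differentiable h₂
  have ay := analyticAt_of_differentiable hy
  have ay' := fun q => (ay q).fun_neg
  have al := analyticAt_of_differentiable hl
  have ag := fun q j => analyticAt_of_differentiable (hg j) q
  have hmer : ∀ q ∈ domain, MeromAt (fun q => coeffA (u₁ q) (u₂ q) (g q) (y q) * (F (φ q) - F q) +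
      coeffA (u₁ q) (u₂ q) (g q) (-y q) * (F (φ.symm q) - F q) -
        eigenvalue (u₁ q) (u₂ q) (g q) (l q) * F q) q := fun q hq =>
    (((meromAt_coeffA (a₁ q) (a₂ q) (ay q) (ag q) (hne q hq)).mul
      (((hF _ (hd q hq)).comp (analyticAt_of_differentiable hφ q) (φ.map_nhds_eq q)).sub (hF q hq))).add
      ((meromAt_coeffA (a₁ q) (a₂ q) (ay' q) (ag q) (hne q hq)).mul
      (((hF _ (hd' q hq)).comp (analyticAt_of_differentiable hφ' q) (φ.symm.map_nhds_eq q)).sub (hF q hq)))).sub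
      ((AnalyticAt.meromAt (analyticAt_eigenvalue (a₁ q) (a₂ q) (al q) (ag q) (hne q hq))).mul (hF q hq))
  have hbase : basePoint a b ∈ domain := ⟨ha, hb⟩
  -- The difference of the two sides vanishes for real periods near the base point, hence off an
  -- analytic set near every point of the convex domain. Continuity at `p` then gives the value at
  -- `p` itself.
  have hv := VanishesAt.of_preconnected isPreconnected_domain hmer hbase
    (VanishesAt.of_real (hmer _ hbase) (h.mono fun q hq h1 h2 => sub_eq_zero.2 (hq h1 h2))) p hp
  have hcF : ContinuousAt (fun q => F (φ q)) p :=
    ContinuousAt.comp (f := φ) (g := F) hF₁ φ.continuous.continuousAt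
  have hcF' : ContinuousAt (fun q => F (φ.symm q)) p :=
    ContinuousAt.comp (f := φ.symm) (g := F) hF₂ φ.symm.continuous.continuousAt
  exact sub_eq_zero.1 (hv.eq_zero ((((continuousAt_coeffA (a₁ p) (a₂ p) (ay p) (ag p) (hne p hp) hc).mul
    (hcF.sub hF₀)).add ((continuousAt_coeffA (a₁ p) (a₂ p) (ay' p) (ag p) (hne p hp) hc').mul
    (hcF'.sub hF₀))).sub
    ((analyticAt_eigenvalue (a₁ p) (a₂ p) (al p) (ag p) (hne p hp)).continuousAt.mul hF₀)))

/-- Translation of the variable `x` by a function of the periods. -/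
noncomputable def shiftX (c : ℂ × ℂ → ℂ) (hc : Continuous c) : Param ≃ₜ Param where
  toFun p := (p.1, p.2.1, p.2.2.1, p.2.2.2.1 + I * c (p.1, p.2.1), p.2.2.2.2)
  invFun p := (p.1, p.2.1, p.2.2.1, p.2.2.2.1 - I * c (p.1, p.2.1), p.2.2.2.2)
  left_inv p := by simp
  right_inv p := by simp
  continuous_toFun := by fun_prop
  continuous_invFun := by fun_prop

/-- Translation of the variable `λ` by a function of the periods. -/
noncomputable def shiftLam (c : ℂ × ℂ → ℂ) (hc : Continuous c) : Param ≃ₜ Param where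
  toFun p := (p.1, p.2.1, p.2.2.1, p.2.2.2.1, p.2.2.2.2 + I * c (p.1, p.2.1))
  invFun p := (p.1, p.2.1, p.2.2.1, p.2.2.2.1, p.2.2.2.2 - I * c (p.1, p.2.1))
  left_inv p := by simp
  right_inv p := by simp
  continuous_toFun := by fun_prop
  continuous_invFun := by fun_prop

/-- The principal branch is analytic because `w₁ w₂` avoids the negative axis and `0`: from `w₁ w₂ =
r ≤ 0` it would follow that `w₂ = r / w₁` has nonpositive real part. -/
theorem analyticAt_sqrt_periods (hp : p ∈ domain) :
    AnalyticAt ℂ (fun q : Param => (q.1 * q.2.1) ^ (1 / 2 : ℂ)) p := by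
  refine AnalyticAt.cpow (analyticAt_of_differentiable (by fun_prop) p) analyticAt_const ?_
  rw [Complex.mem_slitPlane_iff_not_le_zero]
  intro h
  obtain ⟨r, hr, h⟩ : ∃ r : ℝ, r ≤ 0 ∧ p.1 * p.2.1 = r := by
    rw [Complex.le_def] at h
    exact ⟨(p.1 * p.2.1).re, h.1, Complex.ext rfl (by simpa using h.2)⟩
  have hne := ne_zero_of_re_pos hp.1
  have h2 : p.2.1 = r * p.1⁻¹ := by rw [← h]; field_simp
  have h3 := hp.2
  rw [h2, Complex.re_ofReal_mul] at h3
  exact h3.not_ge (mul_nonpos_of_nonpos_of_nonneg hr (inv_re_pos hp.1).le)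

theorem meromAt_Delta {y : Param → ℂ} {g : Param → Fin 4 → ℂ} (hy : AnalyticAt ℂ y p)
    (hg : ∀ j, AnalyticAt ℂ (fun q => g q j) p) (hp : p ∈ domain) :
    MeromAt (fun q => Delta q.1 q.2.1 (g q) (y q)) p := by
  have g0 := hg 0
  have g1 := hg 1
  have g2 := hg 2
  have g3 := hg 3
  have H : ∀ c : Param → ℂ, AnalyticAt ℂ c p → MeromAt (fun q => hypG q.1 q.2.1 (c q)) p := fun c hc =>
    meromAt_hypG (analyticAt_of_differentiable (by fun_prop) p) (analyticAt_of_differentiable (by fun_prop) p) hc hp.1 hp.2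
  exact ((H _ (by fun_prop)).mul (H _ (by fun_prop))).div ((H _ (by fun_prop)).mul (H _ (by fun_prop)))

theorem meromAt_normConst (hp : p ∈ domain) : MeromAt (fun q : Param => normConst q.1 q.2.1 q.2.2.1) p := by
  have H : ∀ c : Param → ℂ, Differentiable ℂ c → MeromAt (fun q => hypG q.1 q.2.1 (c q)) p := fun c hc =>
    meromAt_hypG (analyticAt_of_differentiable (by fun_prop) p) (analyticAt_of_differentiable (by fun_prop) p) (analyticAt_of_differentiable hc p) hp.1 hp.2
  unfold normConst wMean
  exact ((H _ (by fun_prop)).mul (H _ (by fun_prop))).mul (H _ (by fun_prop))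

theorem meromAt_S {ψ : ℂ → ℂ → (Fin 4 → ℂ) → ℂ → ℂ → ℂ} (hψ : ∀ p ∈ domain, MeromAt (joint ψ) p) :
    ∀ p ∈ domain, MeromAt (joint (S ψ)) p := fun p hp =>
  ((meromAt_normConst hp).mul (hψ p hp)).div
    (((AnalyticAt.meromAt (analyticAt_sqrt_periods hp)).mul
      (meromAt_Delta (y := fun q => q.2.2.2.1) (g := fun q => q.2.2.1)
        (analyticAt_of_differentiable (by fun_prop) p)
        (fun j => analyticAt_of_differentiable (by fun_prop) p) hp)).mul
      (meromAt_Delta (y := fun q => q.2.2.2.2) (g := fun q => dual q.2.2.1)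
        (analyticAt_of_differentiable (by fun_prop) p)
        (fun j => analyticAt_of_differentiable (differentiable_dual j) p) hp))

end Identity

end AskeyWilson

namespace AskeyWilson

open MeasureTheory Filter Topology Metric
open Complex (I)
open scoped ComplexConjugate

/-! ### The four eigenvalue equations. -/

section Main

variable {ψ : ℂ → ℂ → (Fin 4 → ℂ) → ℂ → ℂ → ℂ} {w₁ w₂ : ℂ} {γ : Fin 4 → ℂ} {x lam : ℂ}

theorem eq_ofReal_re {z : ℂ} (h : z.im = 0) : (z.re : ℂ) = z := Complex.ext rfl (by simpa using h.symm)

theorem differentiable_gamma (j : Fin 4) : Differentiable ℂ fun q : Param => q.2.2.1 j := by fun_prop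

theorem eigenX (hψ : IsContinuation ψ) (h₁ : 0 < w₁.re) (h₂ : 0 < w₂.re) :
    EigenX (S ψ) w₁ w₂ w₁ w₂ γ x lam := by
  intro hc hc' f₀ f₁ f₂
  refine eigen_identity (F := joint (S ψ)) (u₁ := fun q => q.1) (u₂ := fun q => q.2.1)
    (y := fun q => q.2.2.2.1) (l := fun q => q.2.2.2.2) (g := fun q => q.2.2.1) (meromAt_S hψ.1)
    (by fun_prop) (by fun_prop) (by fun_prop) (by fun_prop) differentiable_gamma
    (fun p hp => ne_zero_of_re_pos hp.2) (shiftX Prod.fst continuous_fst)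
    (by unfold shiftX; dsimp; fun_prop) (by unfold shiftX; dsimp; fun_prop) (fun p hp => hp) (fun p hp => hp)
    (a := 1) (b := 20) one_pos (by norm_num) ?_ (p := (w₁, w₂, γ, x, lam)) ⟨h₁, h₂⟩ hc hc' f₀.continuousAt
    f₁.continuousAt f₂.continuousAt
  filter_upwards [eventually_nearBase] with q hq e₁ e₂
  have := hq.awOp_S hψ
  rw [eq_ofReal_re e₁, eq_ofReal_re e₂] at this
  exact this

/-- The base point has periods `(20, 1)`, so that the step of the operator, now `w₂`, is again the
short period. -/
theorem eigenX_swap (hψ : IsContinuation ψ) (h₁ : 0 < w₁.re) (h₂ : 0 < w₂.re) :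
    EigenX (S ψ) w₂ w₁ w₁ w₂ γ x lam := by
  intro hc hc' f₀ f₁ f₂
  refine eigen_identity (F := joint (S ψ)) (u₁ := fun q => q.2.1) (u₂ := fun q => q.1)
    (y := fun q => q.2.2.2.1) (l := fun q => q.2.2.2.2) (g := fun q => q.2.2.1) (meromAt_S hψ.1)
    (by fun_prop) (by fun_prop) (by fun_prop) (by fun_prop) differentiable_gamma
    (fun p hp => ne_zero_of_re_pos hp.1) (shiftX Prod.snd continuous_snd)
    (by unfold shiftX; dsimp; fun_prop) (by unfold shiftX; dsimp; fun_prop) (fun p hp => hp) (fun p hp => hp)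
    (a := 20) (b := 1) (by norm_num) one_pos ?_ (p := (w₁, w₂, γ, x, lam)) ⟨h₁, h₂⟩ hc hc' f₀.continuousAt
    f₁.continuousAt f₂.continuousAt
  filter_upwards [eventually_nearBase_swap] with q hq e₁ e₂
  have := hq.awOp_S_swap hψ
  rw [eq_ofReal_re e₁, eq_ofReal_re e₂] at this
  exact this

theorem eigenLam (hψ : IsContinuation ψ) (h₁ : 0 < w₁.re) (h₂ : 0 < w₂.re) :
    EigenLam (S ψ) w₁ w₂ w₁ w₂ γ x lam := by
  intro hc hc' f₀ f₁ f₂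
  refine eigen_identity (F := joint (S ψ)) (u₁ := fun q => q.1) (u₂ := fun q => q.2.1)
    (y := fun q => q.2.2.2.2) (l := fun q => q.2.2.2.1) (g := fun q => dual q.2.2.1) (meromAt_S hψ.1)
    (by fun_prop) (by fun_prop) (by fun_prop) (by fun_prop) differentiable_dual
    (fun p hp => ne_zero_of_re_pos hp.2) (shiftLam Prod.fst continuous_fst)
    (by unfold shiftLam; dsimp; fun_prop) (by unfold shiftLam; dsimp; fun_prop) (fun p hp => hp) (fun p hp => hp)
    (a := 1) (b := 20) one_pos (by norm_num) ?_ (p := (w₁, w₂, γ, x, lam)) ⟨h₁, h₂⟩ hc hc' f₀.continuousAt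
    f₁.continuousAt f₂.continuousAt
  filter_upwards [eventually_nearBase] with q hq e₁ e₂
  have := hq.awOp_S_dual hψ
  rw [eq_ofReal_re e₁, eq_ofReal_re e₂] at this
  exact this

theorem eigenLam_swap (hψ : IsContinuation ψ) (h₁ : 0 < w₁.re) (h₂ : 0 < w₂.re) :
    EigenLam (S ψ) w₂ w₁ w₁ w₂ γ x lam := by
  intro hc hc' f₀ f₁ f₂
  refine eigen_identity (F := joint (S ψ)) (u₁ := fun q => q.2.1) (u₂ := fun q => q.1)
    (y := fun q => q.2.2.2.2) (l := fun q => q.2.2.2.1) (g := fun q => dual q.2.2.1) (meromAt_S hψ.1)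
    (by fun_prop) (by fun_prop) (by fun_prop) (by fun_prop) differentiable_dual
    (fun p hp => ne_zero_of_re_pos hp.1) (shiftLam Prod.snd continuous_snd)
    (by unfold shiftLam; dsimp; fun_prop) (by unfold shiftLam; dsimp; fun_prop) (fun p hp => hp) (fun p hp => hp)
    (a := 20) (b := 1) (by norm_num) one_pos ?_ (p := (w₁, w₂, γ, x, lam)) ⟨h₁, h₂⟩ hc hc' f₀.continuousAt
    f₁.continuousAt f₂.continuousAt
  filter_upwards [eventually_nearBase_swap] with q hq e₁ e₂
  have := hq.awOp_S_dual_swap hψ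
  rw [eq_ofReal_re e₁, eq_ofReal_re e₂] at this
  exact this

end Main

end AskeyWilson

namespace AskeyWilson

open MeasureTheory Filter Topology Metric
open Complex (I)
open scoped ComplexConjugate

/-! ### Nonvanishing of `S`. -/

section Nonvanishing

/-- A curve of parameters on which the renormalized matrix coefficient is nonzero near the origin. -/
noncomputable def testPoint (t : ℝ) : Param := (1, 1, ![(t : ℂ), 0, 0, 0], 0, 0)

theorem testPoint_mem (t : ℝ) : testPoint t ∈ domain := by simp [testPoint, domain]

theorem continuous_testPoint : Continuous testPoint := by
  have h : Continuous fun t : ℝ => (![(t : ℂ), 0, 0, 0] : Fin 4 → ℂ) :=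
    continuous_pi fun j => by fin_cases j <;> simp <;> fun_prop
  unfold testPoint
  fun_prop

theorem zeta_testPoint (t : ℝ) : zeta 1 1 (testPoint t).2.2.1 (testPoint t).2.2.2.2 = 1 / 2 - |t| / 2 := by
  have h : |-(t : ℝ) / 2| = |t| / 2 := by rw [abs_div, abs_neg, abs_two]
  have h' : |t / 2| = |t| / 2 := by rw [abs_div, abs_two]
  have h0 : 0 ≤ |t| / 2 := by positivity
  simp [zeta, xi, testPoint, rho, sigma, tau, upsilon, h, h', h0]

theorem continuous_zeta : Continuous fun q : Param => zeta q.1.re q.2.1.re q.2.2.1 q.2.2.2.2 := by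
  unfold zeta xi rho sigma tau upsilon
  fun_prop

/-- All eight shifts equal `-i/2`, and `conj G(z) = G(-conj z)`, so the integrand at real `t` is
`|G(t - i/2)|⁸`, which is positive. -/
theorem integral_coeffIntegrand_testPoint_ne_zero : ∫ t : ℝ, coeffIntegrand (testPoint 0) t ≠ 0 := by
  set g : ℝ → ℝ := fun t => Complex.normSq (hypG 1 1 (t - I / 2)) ^ 4 with hg
  have h1 : 0 < (1 : ℂ).re := by simp
  have hup : ∀ j, upArg j (testPoint 0) = -(I / 2) := fun j => by
    fin_cases j <;> simp [upArg, testPoint, tau, sigma, wMean]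
  have hlo : ∀ j, loArg j (testPoint 0) = -(I / 2) := fun j => by
    fin_cases j <;> simp [loArg, testPoint, rho, upsilon, wMean]
  have him : ∀ t : ℝ, |((t : ℂ) - I / 2).im| < (1 + 1) / 2 := fun t => by
    simp; norm_num
  have heq : ∀ t : ℝ, coeffIntegrand (testPoint 0) t = (g t : ℂ) := by
    intro t
    have hc := conj_hypG (w₁ := 1) (w₂ := 1) one_pos one_pos (him t)
    have e1 : -conj ((t : ℂ) - I / 2) = -t + -(I / 2) := by
      rw [map_sub, map_div₀, Complex.conj_ofReal, Complex.conj_I, Complex.conj_ofNat]; ring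
    rw [e1, Complex.ofReal_one] at hc
    rw [hg, coeffIntegrand, gammaProd]
    simp only [hup, hlo, Fin.prod_const]
    change hypG 1 1 (t + -(I / 2)) ^ 4 * hypG 1 1 (-t + -(I / 2)) ^ 4 = _
    rw [← hc, ← mul_pow, ← sub_eq_add_neg, Complex.mul_conj, Complex.ofReal_pow]
  have hpos : ∀ t, 0 < g t := fun t => pow_pos (Complex.normSq_pos.2
    (hypG_ne_zero h1 h1 (by simpa only [Complex.one_re] using him t))) 4
  have hint : Integrable fun t : ℝ => coeffIntegrand (testPoint 0) t := by
    have hU : ∀ j, |(upArg j (testPoint 0)).im| + 0 < ((1 : ℂ).re + (1 : ℂ).re) / 2 := fun j => by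
      rw [hup]; simp; norm_num
    have hL : ∀ j, |(loArg j (testPoint 0)).im| + 0 < ((1 : ℂ).re + (1 : ℂ).re) / 2 := fun j => by
      rw [hlo]; simp; norm_num
    obtain ⟨C, hC⟩ := exists_gammaProd_le h1 h1 (sum_upArg_add_loArg (testPoint 0)) le_rfl hU hL (c := 1)
      zero_le_one (by simp; linarith [Real.pi_gt_three])
    refine integrable_of_norm_le_exp (C := C) (c := 1) (continuous_iff_continuousAt.2 fun t => ?_) one_pos
      fun t => ?_
    · exact ContinuousAt.comp (f := fun t : ℝ => (t : ℂ))
        (differentiableAt_gammaProd h1 h1 hU hL (by simp)).continuousAt (by fun_prop)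
    · have := hC t (by simp)
      rwa [Complex.ofReal_re] at this
  simp only [heq] at hint ⊢
  have hint' : Integrable g := by simpa using hint.re
  rw [integral_complex_ofReal]
  refine Complex.ofReal_ne_zero.2 (ne_of_gt ((integral_pos_iff_support_of_nonneg (fun t => (hpos t).le) hint').2 ?_))
  have : Function.support g = Set.univ := Set.eq_univ_of_forall fun t => (hpos t).ne'
  rw [this]
  simp

variable {p : Param}

theorem analyticAt_hypG_of_strip {c : Param → ℂ} (hc : AnalyticAt ℂ c p) (hp : p ∈ domain)
    (h : |(c p).im| < (p.1.re + p.2.1.re) / 2) : AnalyticAt ℂ (fun q => hypG q.1 q.2.1 (c q)) p := by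
  have hg := AnalyticAt.gammaStrip (analyticAt_of_differentiable (f := fun q : Param => q.1) (by fun_prop) p)
    (analyticAt_of_differentiable (f := fun q : Param => q.2.1) (by fun_prop) p) hc hp.1 hp.2 h
  refine hg.congr ?_
  have hcc := hc.continuousAt
  have h1 : ContinuousAt (fun q : Param => |(c q).im|) p := (Complex.continuous_im.continuousAt.comp hcc).abs
  have h2 : ContinuousAt (fun q : Param => (q.1.re + q.2.1.re) / 2) p := by fun_prop
  filter_upwards [h1.eventually_lt h2 h, isOpen_domain.mem_nhds hp] with q hq hqd
  exact (hypG_eq_gammaStrip hqd.1 hqd.2 hq).symm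

theorem analyticAt_Delta {y : Param → ℂ} {g : Param → Fin 4 → ℂ} (hy : Differentiable ℂ y)
    (hg : ∀ j, Differentiable ℂ fun q => g q j) (hp : p ∈ domain)
    (h : ∀ j, |(y p).im| + |(g p j).re| < (p.1.re + p.2.1.re) / 2) :
    AnalyticAt ℂ (fun q => Delta q.1 q.2.1 (g q) (y q)) p ∧ Delta p.1 p.2.1 (g p) (y p) ≠ 0 := by
  have g0 := hg 0
  have g1 := hg 1
  have g2 := hg 2
  have g3 := hg 3
  have hadd : ∀ j, |(y p + I * g p j).im| < (p.1.re + p.2.1.re) / 2 := fun j => by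
    rw [Complex.add_im, Complex.I_mul_im]; exact (abs_add_le _ _).trans_lt (h j)
  have hsub : ∀ j, |(y p - I * g p j).im| < (p.1.re + p.2.1.re) / 2 := fun j => by
    rw [Complex.sub_im, Complex.I_mul_im]; exact (abs_sub _ _).trans_lt (h j)
  have H : ∀ c : Param → ℂ, Differentiable ℂ c → |(c p).im| < (p.1.re + p.2.1.re) / 2 →
      AnalyticAt ℂ (fun q => hypG q.1 q.2.1 (c q)) p := fun c hc hcp =>
    analyticAt_hypG_of_strip (analyticAt_of_differentiable hc p) hp hcp
  have H' : ∀ c : ℂ, |c.im| < (p.1.re + p.2.1.re) / 2 → hypG p.1 p.2.1 c ≠ 0 := fun c hc =>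
    hypG_ne_zero hp.1 hp.2 hc
  refine ⟨?_, div_ne_zero (mul_ne_zero (H' _ (hadd 2)) (H' _ (hadd 3)))
    (mul_ne_zero (H' _ (hsub 0)) (H' _ (hsub 1)))⟩
  exact ((H (fun q => y q + I * g q 2) (by fun_prop) (hadd 2)).mul
    (H (fun q => y q + I * g q 3) (by fun_prop) (hadd 3))).div
    ((H (fun q => y q - I * g q 0) (by fun_prop) (hsub 0)).mul
    (H (fun q => y q - I * g q 1) (by fun_prop) (hsub 1)))
    (mul_ne_zero (H' _ (hsub 0)) (H' _ (hsub 1)))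

theorem analyticAt_normConst (hp : p ∈ domain)
    (h : ∀ j : Fin 4, j ≠ 0 → |(I * p.2.2.1 0 + I * p.2.2.1 j + I * wMean p.1 p.2.1).im| <
      (p.1.re + p.2.1.re) / 2) :
    AnalyticAt ℂ (fun q : Param => normConst q.1 q.2.1 q.2.2.1) p ∧ normConst p.1 p.2.1 p.2.2.1 ≠ 0 := by
  have H : ∀ j : Fin 4, j ≠ 0 → AnalyticAt ℂ
      (fun q : Param => hypG q.1 q.2.1 (I * q.2.2.1 0 + I * q.2.2.1 j + I * wMean q.1 q.2.1)) p := fun j hj =>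
    analyticAt_hypG_of_strip (analyticAt_of_differentiable (by unfold wMean; fun_prop) p) hp (h j hj)
  have H' : ∀ j : Fin 4, j ≠ 0 →
      hypG p.1 p.2.1 (I * p.2.2.1 0 + I * p.2.2.1 j + I * wMean p.1 p.2.1) ≠ 0 := fun j hj =>
    hypG_ne_zero hp.1 hp.2 (h j hj)
  exact ⟨((H 1 (by decide)).mul (H 2 (by decide))).mul (H 3 (by decide)),
    mul_ne_zero (mul_ne_zero (H' 1 (by decide)) (H' 2 (by decide))) (H' 3 (by decide))⟩

/-- At `t = 0` the factors of `N` would be `G(iw) = 0`, on the edge of the strip. For `-1 < t < 0`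
all gamma functions in `N` and in the two `Δ` have their arguments inside the strip, where `G` is
analytic and nonzero. -/
theorem analyticAt_S_testPoint {ψ : ℂ → ℂ → (Fin 4 → ℂ) → ℂ → ℂ → ℂ} {t : ℝ} (ht : t < 0) (ht' : -1 < t)
    (hψ : AnalyticAt ℂ (joint ψ) (testPoint t)) (hne : joint ψ (testPoint t) ≠ 0) :
    AnalyticAt ℂ (joint (S ψ)) (testPoint t) ∧ joint (S ψ) (testPoint t) ≠ 0 := by
  have hp := testPoint_mem t
  obtain ⟨n1, n2⟩ := analyticAt_normConst hp (fun j hj => by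
    fin_cases j
    · exact absurd rfl hj
    all_goals simp [testPoint, wMean, abs_lt]; constructor <;> linarith)
  obtain ⟨a1, a2⟩ := analyticAt_Delta (y := fun q => q.2.2.2.1) (g := fun q => q.2.2.1) (by fun_prop)
    differentiable_gamma hp (fun j => by
      fin_cases j <;> simp [testPoint, abs_lt]; constructor <;> linarith)
  obtain ⟨b1, b2⟩ := analyticAt_Delta (y := fun q => q.2.2.2.2) (g := fun q => dual q.2.2.1) (by fun_prop)
    differentiable_dual hp (fun j => by
      fin_cases j <;> simp [testPoint, dual, abs_lt] <;> constructor <;> linarith)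
  have c1 := analyticAt_sqrt_periods hp
  have c2 : ((testPoint t).1 * (testPoint t).2.1) ^ (1 / 2 : ℂ) ≠ 0 := by simp [testPoint]
  have d2 := mul_ne_zero (mul_ne_zero c2 a2) b2
  exact ⟨(n1.mul hψ).div ((c1.mul a1).mul b1) d2, div_ne_zero (mul_ne_zero n2 hne) d2⟩

theorem exists_continuation : ∃ ψ : ℂ → ℂ → (Fin 4 → ℂ) → ℂ → ℂ → ℂ, IsContinuation ψ ∧
    ∀ p ∈ domain, Separated p → AnalyticAt ℂ (joint ψ) p ∧ joint ψ p = ∫ t : ℝ, coeffIntegrand p t := by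
  obtain ⟨ψ, h1, h2⟩ := exists_global_continuation
  refine ⟨fun w₁ w₂ γ x lam => ψ (w₁, w₂, γ, x, lam), ⟨h1, fun w₁ w₂ γ x lam hw₁ hw₂ hx => ?_⟩, h2⟩
  rw [matrixCoeff_eq hw₁ hw₂ hx]
  exact (h2 (w₁, w₂, γ, x, lam) ⟨hw₁, hw₂⟩ (separated_of_zeta hx)).2

/-- Two continuations need agree only off an analytic set: their values are prescribed for real
periods alone, and elsewhere the meromorphic structure leaves them free on the zeros of local
denominators. -/
theorem IsContinuation.vanishesAt_sub {ψ ψ' : ℂ → ℂ → (Fin 4 → ℂ) → ℂ → ℂ → ℂ} (h : IsContinuation ψ)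
    (h' : IsContinuation ψ') {t : ℝ} (ht : |t| < 1) :
    VanishesAt (fun q => joint ψ q - joint ψ' q) (testPoint t) := by
  have hp := testPoint_mem t
  have hm : MeromAt (fun q => joint ψ q - joint ψ' q) (testPoint t) :=
    MeromAt.sub (h.1 _ hp) (h'.1 _ hp)
  have he : testPoint t = (((1 : ℝ) : ℂ), ((1 : ℝ) : ℂ), (testPoint t).2.2) := by simp [testPoint]
  rw [he] at hm ⊢
  refine VanishesAt.of_real hm ?_
  rw [← he]
  have hz : ∀ᶠ q : Param in 𝓝 (testPoint t), |q.2.2.2.1.im| < zeta q.1.re q.2.1.re q.2.2.1 q.2.2.2.2 := by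
    refine (isOpen_lt (by fun_prop) continuous_zeta).mem_nhds ?_
    change |(0 : ℂ).im| < zeta 1 1 (testPoint t).2.2.1 (testPoint t).2.2.2.2
    rw [zeta_testPoint]
    simp; linarith
  filter_upwards [hz, isOpen_domain.mem_nhds hp] with q hq hqd e₁ e₂
  have key : ∀ φ, IsContinuation φ → joint φ q = matrixCoeff q.1.re q.2.1.re q.2.2.1 q.2.2.2.1 q.2.2.2.2 := by
    intro φ hφ
    have := hφ.2 q.1.re q.2.1.re q.2.2.1 q.2.2.2.1 q.2.2.2.2 hqd.1 hqd.2 hq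
    rw [eq_ofReal_re e₁, eq_ofReal_re e₂] at this
    exact this
  rw [key ψ h, key ψ' h', sub_self]

/-- Nonvanishing is first obtained for a particular continuation `φ`, which is analytic at separated
parameters: by continuity the integral stays nonzero for small `t < 0`. The given `ψ` agrees with
`φ` near a point `q` close to `testPoint t` and off the exceptional set, and there `S` is analytic
and nonzero for both. -/
theorem exists_S_ne_zero {ψ : ℂ → ℂ → (Fin 4 → ℂ) → ℂ → ℂ → ℂ} (hψ : IsContinuation ψ) :
    ∃ p ∈ domain, AnalyticAt ℂ (joint (S ψ)) p ∧ joint (S ψ) p ≠ 0 := by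
  obtain ⟨φ, hφ, hint⟩ := exists_continuation
  have hsep : ∀ t : ℝ, |t| < 1 → Separated (testPoint t) := fun t ht => by
    have : |(0 : ℂ).im| < zeta 1 1 (testPoint t).2.2.1 (testPoint t).2.2.2.2 := by
      rw [zeta_testPoint]; simp; linarith
    simpa [testPoint] using separated_of_zeta this
  obtain ⟨f1, f2⟩ := hint _ (testPoint_mem 0) (hsep 0 (by simp))
  have hev : ∀ᶠ t : ℝ in 𝓝[<] 0, joint φ (testPoint t) ≠ 0 := by
    refine ((f1.continuousAt.comp continuous_testPoint.continuousAt).eventually_ne ?_).filter_mono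
      nhdsWithin_le_nhds
    simpa only [Function.comp_apply, f2] using integral_coeffIntegrand_testPoint_ne_zero
  obtain ⟨t, h1, h2, h3⟩ := (hev.and ((Ioo_mem_nhdsLT (show (-1 : ℝ) < 0 by norm_num)))).exists
  have ht : |t| < 1 := abs_lt.2 ⟨h2, by linarith⟩
  obtain ⟨s1, s2⟩ := analyticAt_S_testPoint h3 h2 (hint _ (testPoint_mem t) (hsep t ht)).1 h1
  obtain ⟨c, hc, hc', hv⟩ := hψ.vanishesAt_sub hφ ht
  obtain ⟨q, q1, q2, q3, q4, q5, q6⟩ := (hc'.and_eventually (hc.eventually_analyticAt.and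
    (hv.eventually_nhds.and (s1.eventually_analyticAt.and ((s1.continuousAt.eventually_ne s2).and
    (isOpen_domain.mem_nhds (testPoint_mem t))))))).exists
  have heq : ∀ᶠ r in 𝓝 q, joint (S φ) r = joint (S ψ) r := by
    filter_upwards [q3, q2.continuousAt.eventually_ne q1] with r hr hr'
    have : joint ψ r = joint φ r := sub_eq_zero.1 (hr hr')
    simp only [joint] at this
    simp only [joint, S, this]
  exact ⟨q, q6, q4.congr heq, heq.self_of_nhds ▸ q5⟩

end Nonvanishing

end AskeyWilson

theorem corollary6p6 :
    (∃ ψ : ℂ → ℂ → (Fin 4 → ℂ) → ℂ → ℂ → ℂ, AskeyWilson.IsContinuation ψ) ∧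
    ∀ ψ : ℂ → ℂ → (Fin 4 → ℂ) → ℂ → ℂ → ℂ, AskeyWilson.IsContinuation ψ →
      AskeyWilson.IsMeromorphicOn (AskeyWilson.joint (AskeyWilson.S ψ)) AskeyWilson.domain ∧
      (∃ p ∈ AskeyWilson.domain, AnalyticAt ℂ (AskeyWilson.joint (AskeyWilson.S ψ)) p ∧
        AskeyWilson.joint (AskeyWilson.S ψ) p ≠ 0) ∧
      ∀ (w₁ w₂ : ℂ) (γ : Fin 4 → ℂ) (x lam : ℂ), 0 < w₁.re → 0 < w₂.re →
        AskeyWilson.EigenX (AskeyWilson.S ψ) w₁ w₂ w₁ w₂ γ x lam ∧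
        AskeyWilson.EigenX (AskeyWilson.S ψ) w₂ w₁ w₁ w₂ γ x lam ∧
        AskeyWilson.EigenLam (AskeyWilson.S ψ) w₁ w₂ w₁ w₂ γ x lam ∧
        AskeyWilson.EigenLam (AskeyWilson.S ψ) w₂ w₁ w₁ w₂ γ x lam := by
  refine ⟨AskeyWilson.exists_continuation.imp fun ψ h => h.1, fun ψ hψ => ⟨AskeyWilson.meromAt_S hψ.1,
    AskeyWilson.exists_S_ne_zero hψ, fun w₁ w₂ γ x lam h₁ h₂ => ⟨?_, ?_, ?_, ?_⟩⟩⟩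
  · exact AskeyWilson.eigenX hψ h₁ h₂
  · exact AskeyWilson.eigenX_swap hψ h₁ h₂
  · exact AskeyWilson.eigenLam hψ h₁ h₂
  · exact AskeyWilson.eigenLam_swap hψ h₁ h₂
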